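/- **Setting (graph).** Let $S\in\mathbb C^{m\times m}$ be Hermitian, $T\in\mathbb C^{m\times p}$ with columns indexed by $m+1,\dots,n$, $n=m+p$. Let $G$ be the graph on $\{1,\dots,n\}$ in which $j\neq k$ are adjacent iff $j\le m<k$ and $T_{jk}\ne0$ (or vice versa), or $j,k\le m$ and ($S_{jk}\neq0$ or $T_{jl}\ne0\ne T_{kl}$ for some $l>m$). For $0<d\le1$ the metric graph $\Gamma=\Gamma^{S,T}(d)$ has vertices $v_1,\dots,v_n$, an outer edge $I_j=[0,\infty)$ attached at $0$ to each $v_j$, and for each edge $\{j,k\}$, $j<k$, of $G$ an inner edge $e$ with $I_e=[-d,d]$ running from $v_j$ to $v_k$. Let $L^2(\Gamma)=\bigoplus_eL^2(I_e)$ and let $H^1(\Gamma)$ be the set of $f\in\bigoplus_eH^1(I_e)$ that are continuous at the vertices. For real $A_e,w_e$ ($e$ inner) and $w_v$ ($v$ a vertex) put, on $H^1(\Gamma)$, $$\mathfrak h(f)=\sum_{e\text{ outer}}\int_0^\infty|f_e'|^2+\sum_{e\text{ inner}}\Bigl(\int_{-d}^d|f_e'+\mathrm iA_ef_e|^2+w_e|f_e(0)|^2\Bigr)+\sum_vw_v|f(v)|^2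 .$$ **Setting (manifold).** Let $k\ge1$; let each $Y_e$ ($e$ any edge) be a compact connected Riemannian $k$-manifold without boundary, of volume $1$, and each $X_v$ a compact connected Riemannian $(k+1)$-manifold whose boundary is the disjoint union of isometric copies of the $Y_e$, one for each end of an edge $e$ at $v$, such that $X_v$ is isometric to a product $[0,\ell)\times Y_e$ near each of them. For $0<\varepsilon\le d$ let $X_\varepsilon$ be the Riemannian manifold obtained by gluing $I_e\times\varepsilon Y_e$ (metric $ds^2+\varepsilon^2h_e$) and $\varepsilon X_v$ (metric $\varepsilon^2g_v$) along these boundary components, and let $H^1(X_\varepsilon)\subset L^2(X_\varepsilon)$ be the completion of $C_c^\infty(X_\varepsilon)$ for $\|u\|^2+\|du\|^2$. On $H^1(X_\varepsilon)$ put $$\mathfrak h_\varepsilon(u)=\sum_{e\text{ outer}}\int_0^\infty\bigl(\|u_e'\|^2+\|d_{Y_e}u_e\|^2\bigr)ds+\sum_{e\text{ inner}}\Bigl(\int_{-d}^d\bigl(\|u_e'+\mathrm iA_eu_e\|^2+\|d_{Y_e}u_e\|^2\bigr)ds+\frac{w_e}{2\varepsilon}\int_{-\varepsilon}^\varepsilon\|u_e\|^2ds\Bigr)+\sum_v\Bigl(\|du_v\|^2+\frac{w_v}{\varepsilon\operatorname{vol}X_v}\|u_v\|^2\Bigr),$$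 with norms in $L^2(\varepsilon Y_e)$ and $L^2(\varepsilon X_v)$. Let $\overline w=3\max_{e,v}\{|w_e|,|w_v|\}$. Forms without magnetic and electric potentials define the norms of $H^1(\Gamma)$, $H^1(X_\varepsilon)$: $\|\cdot\|_1^2=\|\cdot\|^2+{}$(form with $A=0$, $w=0$). **Quasi-unitary equivalence.** Let $\mathfrak h$, $\tilde{\mathfrak h}$ be closed semibounded forms in Hilbert spaces $\mathcal H,\tilde{\mathcal H}$ whose domains $\mathcal H^1,\tilde{\mathcal H}^1$ are dense and are Hilbert spaces with norms $\|\cdot\|_1\ge\|\cdot\|$. They are $\delta$-quasi-unitarily equivalent if there are operators $J:\mathcal H\to\tilde{\mathcal H}$ (bounded), $J^1:\mathcal H^1\to\tilde{\mathcal H}^1$, $J'^1:\tilde{\mathcal H}^1\to\mathcal H^1$ with, for all $f\in\mathcal H^1$, $u\in\tilde{\mathcal H}^1$: $\|Jf-J^1f\|\le\delta\|f\|_1$, $\|J^*u-J'^1u\|\le\delta\|u\|_1$, $\|J^*Jf-f\|\le\delta\|f\|_1$, $\|JJ^*u-u\|\le\delta\|u\|_1$, $|\mathfrak h(J'^1u,f)-\tilde{\mathfrak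 h}(u,J^1f)|\le\delta\|u\|_1\|f\|_1$. **Proposition.** For every $a_0$ and all $(X_v)_v$, $(Y_e)_e$ there is a constant $C>0$, depending only on $a_0$, $(X_v)_v$, $(Y_e)_e$, such that for all $S,T$ as above (with the given combinatorial graph), all $0<d\le1$, $0<\varepsilon\le d$, all real $w_e,w_v$ and all real $A_e$ with $|A_e|\le a_0/d$, the forms $\mathfrak h$ and $\mathfrak h_\varepsilon$ are (closed, semibounded and) $\delta_\varepsilon$-quasi-unitarily equivalent with $$\delta_\varepsilon=C\Bigl(\frac{\varepsilon}{d}\Bigr)^{1/2}(\overline w+1)+C\,\frac{\varepsilon^{1/2}}d .$$ More precisely, with this $\delta_\varepsilon$ one may use the identification operators $$Jf=\bigoplus_e\varepsilon^{-k/2}f_e\otimes\mathbf 1_{Y_e}\oplus0,\qquad J^1f=\bigoplus_e\varepsilon^{-k/2}f_e\otimes\mathbf 1_{Y_e}\oplus\bigoplus_v\varepsilon^{-k/2}f(v)\mathbf 1_{X_v},$$ and, with $g=J^*u$ (that is, $g_e(s)=\varepsilon^{k/2}\int_{Y_e}u_e(s,y)\,dy$) and the average $c_v=\frac1{\operatorname{vol}X_v}\int_{X_v}u$,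 $$(J'^1u)_e=g_e+\chi_-\bigl(\varepsilon^{k/2}c_{v_j}-g_e(-d)\bigr)+\chi_+\bigl(\varepsilon^{k/2}c_{v_k}-g_e(d)\bigr)$$ on an inner edge $e=\{j,k\}$, $j<k$, and $(J'^1u)_e=g_e+\chi\bigl(\varepsilon^{k/2}c_{v_j}-g_e(0)\bigr)$ on the outer edge $e=j$. Here $\chi_\pm,\chi$ are any smooth real functions with $\chi_\pm(\pm d)=1$, $|\chi_\pm'|\le2/d$ on $[-d,d]$, $\chi_\pm(s)=0$ for $\pm s\in[-d,0]$, and $\chi(0)=1$, $|\chi'|\le2$ on $[0,\infty)$, $\chi(s)=0$ for $s\ge1$. -/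

import Mathlib

open Set Filter Topology MeasureTheory
open scoped Manifold ContDiff ENNReal ComplexConjugate

universe u

noncomputable section

namespace MagneticGraph

/-! ## Quasi-unitary equivalence of quadratic forms -/

section Abstract

variable {H : Type*} [NormedAddCommGroup H] [InnerProductSpace ℂ H]
variable {H' : Type*} [NormedAddCommGroup H'] [InnerProductSpace ℂ H']

/-- A form domain `dom` in a Hilbert space, a "free" form, which defines the norm of the
form domain, and the form of interest.  Sesquilinear forms are linear in the first argument; only
the values of the forms on `dom` matter. -/
structure FormSpace (H : Type*) [NormedAddCommGroup H] [InnerProductSpace ℂ H] where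
  dom : Set H
  free : H → H → ℂ
  form : H → H → ℂ

/-- The square of the norm of the form domain, `‖f‖₁² = ‖f‖² + 𝔡(f)`. -/
def FormSpace.normSq (𝔥 : FormSpace H) (f : H) : ℝ := ‖f‖ ^ 2 + (𝔥.free f f).re

/-- `q` is a Hermitian sesquilinear form on `dom`, semibounded from below and closed. -/
structure IsClosedForm (dom : Set H) (q : H → H → ℂ) : Prop where
  add_left : ∀ f ∈ dom, ∀ g ∈ dom, ∀ h ∈ dom, q (f + g) h = q f h + q g h
  smul_left : ∀ c : ℂ, ∀ f ∈ dom, ∀ g ∈ dom, q (c • f) g = c * q f g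
  symm : ∀ f ∈ dom, ∀ g ∈ dom, q g f = conj (q f g)
  semibounded : ∃ c : ℝ, ∀ f ∈ dom, c * ‖f‖ ^ 2 ≤ (q f f).re
  closed : ∀ (x : ℕ → H) (f : H), (∀ k, x k ∈ dom) → Tendsto x atTop (𝓝 f) →
    Tendsto (fun l : ℕ × ℕ => (q (x l.1 - x l.2) (x l.1 - x l.2)).re) atTop (𝓝 0) →
    f ∈ dom ∧ Tendsto (fun k => (q (x k - f) (x k - f)).re) atTop (𝓝 0)

/-- The form domain is a dense subspace, a Hilbert space for the norm `‖·‖₁ ≥ ‖·‖` (that is, the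
free form is nonnegative and closed), and the form is closed and semibounded from below. -/
structure FormSpace.IsAdmissible (𝔥 : FormSpace H) : Prop where
  subspace : ∃ V : Submodule ℂ H, (V : Set H) = 𝔥.dom
  dense : Dense 𝔥.dom
  free_nonneg : ∀ f ∈ 𝔥.dom, 0 ≤ (𝔥.free f f).re
  free_closed : IsClosedForm 𝔥.dom 𝔥.free
  form_closed : IsClosedForm 𝔥.dom 𝔥.form

variable [CompleteSpace H] [CompleteSpace H']

/-- The operators `J : H → H'`, `J₁ : H¹ → H'¹`, `J₁' : H'¹ → H¹` are `δ`-quasi-unitary for the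
forms `𝔥` and `𝔥'`. -/
structure IsQuasiUnitary (𝔥 : FormSpace H) (𝔥' : FormSpace H') (δ : ℝ)
    (J : H →L[ℂ] H') (J₁ : H →ₗ.[ℂ] H') (J₁' : H' →ₗ.[ℂ] H) : Prop where
  dom_eq : (J₁.domain : Set H) = 𝔥.dom
  map_dom : ∀ f : J₁.domain, J₁ f ∈ 𝔥'.dom
  dom_eq' : (J₁'.domain : Set H') = 𝔥'.dom
  map_dom' : ∀ x : J₁'.domain, J₁' x ∈ 𝔥.dom
  close : ∀ f : J₁.domain, ‖J f - J₁ f‖ ^ 2 ≤ δ ^ 2 * 𝔥.normSq f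
  close' : ∀ x : J₁'.domain,
    ‖ContinuousLinearMap.adjoint J x - J₁' x‖ ^ 2 ≤ δ ^ 2 * 𝔥'.normSq x
  inv : ∀ f ∈ 𝔥.dom, ‖ContinuousLinearMap.adjoint J (J f) - f‖ ^ 2 ≤ δ ^ 2 * 𝔥.normSq f
  inv' : ∀ x ∈ 𝔥'.dom, ‖J (ContinuousLinearMap.adjoint J x) - x‖ ^ 2 ≤ δ ^ 2 * 𝔥'.normSq x
  form_close : ∀ (f : J₁.domain) (x : J₁'.domain),
    ‖𝔥.form (J₁' x) f - 𝔥'.form x (J₁ f)‖ ≤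
      δ * √(𝔥'.normSq x) * √(𝔥.normSq f)

/-- `δ`-quasi-unitary equivalence of two closed semibounded forms. -/
def QuasiUnitarilyEquivalent (𝔥 : FormSpace H) (𝔥' : FormSpace H') (δ : ℝ) : Prop :=
  𝔥.IsAdmissible ∧ 𝔥'.IsAdmissible ∧
    ∃ (J : H →L[ℂ] H') (J₁ : H →ₗ.[ℂ] H') (J₁' : H' →ₗ.[ℂ] H), IsQuasiUnitary 𝔥 𝔥' δ J J₁ J₁'

end Abstract

/-! ## The graph -/

/-- The combinatorial graph of the vertices `v_j` and the inner edges `{j,k}` determined by the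
matrices `S` (Hermitian) and `T`.  The first `m` vertices are the ones that index the rows of `T`,
the last `p` vertices index its columns. -/
def stGraph {m p : ℕ} (S : Matrix (Fin m) (Fin m) ℂ) (T : Matrix (Fin m) (Fin p) ℂ) :
    SimpleGraph (Fin (m + p)) :=
  SimpleGraph.fromRel fun a b =>
    (∃ j l, a = Fin.castAdd p j ∧ b = Fin.natAdd m l ∧ T j l ≠ 0) ∨
    (∃ j k, a = Fin.castAdd p j ∧ b = Fin.castAdd p k ∧
      ((∃ l, T j l ≠ 0 ∧ T k l ≠ 0) ∨ S j k ≠ 0))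

/-- An inner edge `{j,k}` with `j < k`. -/
structure InnerEdge {n : ℕ} (G : SimpleGraph (Fin n)) where
  fst : Fin n
  snd : Fin n
  lt : fst < snd
  adj : G.Adj fst snd

instance {n : ℕ} (G : SimpleGraph (Fin n)) : Finite (InnerEdge G) :=
  Finite.of_injective (fun e : InnerEdge G => (e.fst, e.snd)) (by
    rintro ⟨a, b, _, _⟩ ⟨a', b', _, _⟩ h
    simp only [Prod.mk.injEq] at h
    obtain ⟨rfl, rfl⟩ := h
    rfl)

instance {n : ℕ} (G : SimpleGraph (Fin n)) : Fintype (InnerEdge G) := Fintype.ofFinite _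

/-- The edges: one outer edge at each vertex, and the inner edges. -/
abbrev Edge {n : ℕ} (G : SimpleGraph (Fin n)) := Fin n ⊕ InnerEdge G

/-- The pairs of an edge and one of its end points: the end point of an outer edge, the initial
and the final point of an inner edge. -/
inductive EdgeEnd {n : ℕ} (G : SimpleGraph (Fin n))
  | outer (j : Fin n)
  | left (e : InnerEdge G)
  | right (e : InnerEdge G)

namespace EdgeEnd

variable {n : ℕ} {G : SimpleGraph (Fin n)}

def edge : EdgeEnd G → Edge G
  | outer j => Sum.inl j
  | left e => Sum.inr e
  | right e => Sum.inr e

def vertex : EdgeEnd G → Fin n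
  | outer j => j
  | left e => e.fst
  | right e => e.snd

/-- The parameter of the end point in the interval of its edge. -/
def pos (d : ℝ) : EdgeEnd G → ℝ
  | outer _ => 0
  | left _ => -d
  | right _ => d

end EdgeEnd

section MetricGraph

variable {n : ℕ} (G : SimpleGraph (Fin n)) (d : ℝ)

variable {G} in
/-- `[0,∞)` for an outer edge, `[-d,d]` for an inner edge. -/
def edgeInterval : Edge G → Set ℝ
  | Sum.inl _ => Ici 0
  | Sum.inr _ => Icc (-d) d

/-- Length measure on the disjoint union of the edges. -/
def graphMeasure : Measure (Σ _ : Edge G, ℝ) :=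
  Measure.sum fun e => (volume.restrict (edgeInterval d e)).map (Sigma.mk e)

/-- `L²(Γ) = ⨁ₑ L²(Iₑ)`. -/
abbrev GraphL2 := Lp ℂ 2 (graphMeasure G d)

variable {G} {d}

/-- On each edge, `F` is an absolutely continuous representative of `f` with derivative
`F' ∈ L²(Iₑ)`; thus `f` is an element of `⨁ₑ H¹(Iₑ)` with weak derivative `F'`. -/
structure IsEdgeRep (f : GraphL2 G d) (F F' : Edge G → ℝ → ℂ) : Prop where
  ae_eq : ∀ e, ∀ᵐ s ∂volume.restrict (edgeInterval d e), f ⟨e, s⟩ = F e s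
  memLp : ∀ e, MemLp (F' e) 2 (volume.restrict (edgeInterval d e))
  ftc : ∀ e, ∀ s ∈ edgeInterval d e, ∀ t ∈ edgeInterval d e,
    F e t - F e s = ∫ x in s..t, F' e x

open Classical in
/-- The representative `(F, F')` of `f ∈ ⨁ₑ H¹(Iₑ)` and of its derivative. -/
def edgeRep (f : GraphL2 G d) : (Edge G → ℝ → ℂ) × (Edge G → ℝ → ℂ) :=
  if h : ∃ P : (Edge G → ℝ → ℂ) × (Edge G → ℝ → ℂ), IsEdgeRep f P.1 P.2 then h.choose else 0

/-- The value of `f ∈ ⨁ₑ H¹(Iₑ)` at an end of an edge. -/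
def endValue (f : GraphL2 G d) (a : EdgeEnd G) : ℂ := (edgeRep f).1 a.edge (a.pos d)

/-- The value `f(v)` of `f ∈ H¹(Γ)` at a vertex (read off on the outer edge at `v`). -/
def vertexValue (f : GraphL2 G d) (v : Fin n) : ℂ := endValue f (EdgeEnd.outer v)

variable (G) (d)

/-- `H¹(Γ)`: the functions in `⨁ₑ H¹(Iₑ)` that are continuous at the vertices. -/
def graphH1 : Set (GraphL2 G d) :=
  {f | ∃ F F' : Edge G → ℝ → ℂ, IsEdgeRep f F F' ∧
    ∃ c : Fin n → ℂ, ∀ a : EdgeEnd G, F a.edge (a.pos d) = c a.vertex}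

/-- The (sesquilinear form of the) quadratic form `𝔥` on the graph, with the vector potential `A`
on the inner edges, `δ` interactions of strength `wE` at the midpoints of the inner edges, and of
strength `wV` at the vertices. -/
def graphSesq (A wE : InnerEdge G → ℝ) (wV : Fin n → ℝ) (f g : GraphL2 G d) : ℂ :=
  let F := (edgeRep f).1
  let F' := (edgeRep f).2
  let K := (edgeRep g).1
  let K' := (edgeRep g).2
  (∑ j : Fin n, ∫ s in Ioi (0 : ℝ), F' (Sum.inl j) s * conj (K' (Sum.inl j) s)) +
  (∑ e : InnerEdge G,
    ((∫ s in (-d)..d,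
        (F' (Sum.inr e) s + Complex.I * A e * F (Sum.inr e) s) *
          conj (K' (Sum.inr e) s + Complex.I * A e * K (Sum.inr e) s)) +
      wE e * (F (Sum.inr e) 0 * conj (K (Sum.inr e) 0)))) +
  ∑ v : Fin n, wV v * (vertexValue f v * conj (vertexValue g v))

/-- `L²(Γ)` with the form domain `H¹(Γ)`, the free form `𝔡` and the form `𝔥`. -/
def graphForm (A wE : InnerEdge G → ℝ) (wV : Fin n → ℝ) : FormSpace (GraphL2 G d) where
  dom := graphH1 G d
  free := graphSesq G d 0 0 0
  form := graphSesq G d A wE wV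

end MetricGraph

/-! ## Riemannian manifolds -/

section Riemannian

variable {N : ℕ} {Hm : Type*} [TopologicalSpace Hm]
  (I : ModelWithCorners ℝ (EuclideanSpace ℝ (Fin N)) Hm)
  {M : Type*} [TopologicalSpace M] [ChartedSpace Hm M]

/-- A field of bilinear forms on the tangent spaces. -/
abbrev MetricField (M : Type*) [TopologicalSpace M] [ChartedSpace Hm M] :=
  ∀ x : M, TangentSpace I x →L[ℝ] TangentSpace I x →L[ℝ] ℝ

/-- The metric `ε² g`. -/
def scaleMetric (ε : ℝ) (g : MetricField I M) : MetricField I M := fun x => (ε ^ 2) • g x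

/-- The standard basis of the model space, as a basis of the tangent space at `x`. -/
def tangentBasis (x : M) (i : Fin N) : TangentSpace I x :=
  (EuclideanSpace.single i (1 : ℝ) : EuclideanSpace ℝ (Fin N))

/-- The coordinate vector fields of the chart at `x₀`, at the point with coordinates `z`. -/
def coordVector (x₀ : M) (z : EuclideanSpace ℝ (Fin N)) (i : Fin N) :
    TangentSpace I ((extChartAt I x₀).symm z) :=
  mfderivWithin 𝓘(ℝ, EuclideanSpace ℝ (Fin N)) I (extChartAt I x₀).symm (range I) z
    (EuclideanSpace.single i (1 : ℝ) : EuclideanSpace ℝ (Fin N))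

/-- `√(det g_{ij})` in the coordinates of the chart at `x₀`. -/
def chartDensity (g : MetricField I M) (x₀ : M) (z : EuclideanSpace ℝ (Fin N)) : ℝ :=
  √(Matrix.of fun i j : Fin N =>
    g ((extChartAt I x₀).symm z) (coordVector I x₀ z i) (coordVector I x₀ z j)).det

/-- The Riemannian measure on the domain of the chart at `x₀`, extended by zero. -/
def chartVol [MeasurableSpace M] (g : MetricField I M) (x₀ : M) : Measure M :=
  ((volume.restrict (extChartAt I x₀).target).withDensity
    fun z => ENNReal.ofReal (chartDensity I g x₀ z)).map (extChartAt I x₀).symm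

/-- The Riemannian measure: it restricts to `√(det g_{ij}) dz` on the domain of each chart.  As
the chart measures agree on the overlaps, it is their least upper bound. -/
def riemVol [MeasurableSpace M] (g : MetricField I M) : Measure M := ⨆ x₀ : M, chartVol I g x₀

/-- The Hermitian product `∑ g^{ij} αᵢ conj βⱼ` of two complex covectors. -/
def cometric (g : MetricField I M) (x : M) (α β : TangentSpace I x →L[ℝ] ℂ) : ℂ :=
  ∑ i : Fin N, ∑ j : Fin N,
    (((Matrix.of fun i j : Fin N => g x (tangentBasis I x i) (tangentBasis I x j))⁻¹ i j : ℝ) : ℂ) *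
      (α (tangentBasis I x i) * conj (β (tangentBasis I x j)))

/-- `⟨dφ, dψ⟩_g` at the point `x`. -/
def gradProd (g : MetricField I M) (φ ψ : M → ℂ) (x : M) : ℂ :=
  cometric I g x (mfderiv I 𝓘(ℝ, ℂ) φ x) (mfderiv I 𝓘(ℝ, ℂ) ψ x)

end Riemannian

/-- A compact connected smooth Riemannian manifold modelled on `I`. -/
structure RiemMfd {N : ℕ} {Hm : Type} [TopologicalSpace Hm]
    (I : ModelWithCorners ℝ (EuclideanSpace ℝ (Fin N)) Hm) where
  carrier : Type u
  [top : TopologicalSpace carrier]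
  [charted : ChartedSpace Hm carrier]
  [mfd : IsManifold I ∞ carrier]
  [compact : CompactSpace carrier]
  [connected : ConnectedSpace carrier]
  [t2 : T2Space carrier]
  metric : Bundle.ContMDiffRiemannianMetric I ∞ (EuclideanSpace ℝ (Fin N))
    (fun x : carrier => TangentSpace I x)

namespace RiemMfd

variable {N : ℕ} {Hm : Type} [TopologicalSpace Hm]
  {I : ModelWithCorners ℝ (EuclideanSpace ℝ (Fin N)) Hm}

instance : CoeSort (RiemMfd.{u} I) (Type u) := ⟨carrier⟩

instance (M : RiemMfd.{u} I) : TopologicalSpace M := M.top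
instance (M : RiemMfd.{u} I) : ChartedSpace Hm M := M.charted
instance (M : RiemMfd.{u} I) : IsManifold I ∞ M := M.mfd
instance (M : RiemMfd.{u} I) : CompactSpace M := M.compact
instance (M : RiemMfd.{u} I) : ConnectedSpace M := M.connected
instance (M : RiemMfd.{u} I) : T2Space M := M.t2
instance (M : RiemMfd.{u} I) : MeasurableSpace M := borel M
instance (M : RiemMfd.{u} I) : BorelSpace M := ⟨rfl⟩

/-- The metric tensor of `M`. -/
def g (M : RiemMfd.{u} I) : MetricField I M := M.metric.inner

end RiemMfd

/-! ## The manifold `X_ε` -/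

/-- The building blocks of the manifolds `X_ε`: closed transverse manifolds `Yₑ` of dimension `k`
and volume `1`, and compact vertex manifolds `X_v` of dimension `k + 1`, whose boundary is the
disjoint union of copies of the `Yₑ`, over the ends of edges at `v`.  Near each of these boundary
components `X_v` is isometric to a cylinder `[0, ℓ) × Yₑ`. -/
structure BuildingBlocks {n : ℕ} (G : SimpleGraph (Fin n)) (k : ℕ) where
  Y : Edge G → RiemMfd.{u} (𝓡 k)
  X : Fin n → RiemMfd.{u} (𝓡∂ (k + 1))
  vol_Y : ∀ e, riemVol (𝓡 k) (Y e).g univ = 1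
  /-- The length of the cylindrical ends. -/
  ℓ : ℝ
  ℓ_pos : 0 < ℓ
  /-- The cylindrical ends (only the values on `[0, ℓ) × Yₑ` matter). -/
  collar : ∀ a : EdgeEnd G, ℝ × Y a.edge → X a.vertex
  collar_smooth : ∀ a, ContMDiffOn (𝓘(ℝ, ℝ).prod (𝓡 k)) (𝓡∂ (k + 1)) ∞ (collar a)
    (Ico 0 ℓ ×ˢ univ)
  collar_inj : ∀ a, InjOn (collar a) (Ico 0 ℓ ×ˢ univ)
  collar_open : ∀ a, IsOpen (collar a '' (Ico 0 ℓ ×ˢ univ))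
  collar_isometry : ∀ a, ∀ t ∈ Ico 0 ℓ, ∀ (y : Y a.edge) (τ τ' : ℝ)
    (ξ ξ' : TangentSpace (𝓡 k) y),
    (X a.vertex).g (collar a (t, y))
      (mfderivWithin (𝓘(ℝ, ℝ).prod (𝓡 k)) (𝓡∂ (k + 1)) (collar a) (Ico 0 ℓ ×ˢ univ) (t, y)
        ((τ, ξ) : ℝ × EuclideanSpace ℝ (Fin k)))
      (mfderivWithin (𝓘(ℝ, ℝ).prod (𝓡 k)) (𝓡∂ (k + 1)) (collar a) (Ico 0 ℓ ×ˢ univ) (t, y)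
        ((τ', ξ') : ℝ × EuclideanSpace ℝ (Fin k))) =
      τ * τ' + (Y a.edge).g y ξ ξ'
  boundary_inj : Function.Injective fun q : (Σ a : EdgeEnd G, Y a.edge) =>
    (⟨q.1.vertex, collar q.1 (0, q.2)⟩ : Σ v, X v)
  boundary_eq : (range fun q : (Σ a : EdgeEnd G, Y a.edge) =>
    (⟨q.1.vertex, collar q.1 (0, q.2)⟩ : Σ v, X v)) =
      {x | x.2 ∈ (𝓡∂ (k + 1)).boundary (X x.1)}

namespace BuildingBlocks

variable {n k : ℕ} {G : SimpleGraph (Fin n)} (B : BuildingBlocks.{u} G k) (d ε : ℝ)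

/-- The disjoint union of the pieces of `X_ε`: the edge neighbourhoods `Iₑ × Yₑ` (here with
`ℝ` instead of `Iₑ`; the measure lives on `Iₑ`), and the vertex neighbourhoods `X_v`. -/
abbrev Point := (Σ e : Edge G, ℝ × B.Y e) ⊕ (Σ v : Fin n, B.X v)

variable {B} in
abbrev edgePt (e : Edge G) (q : ℝ × B.Y e) : B.Point := Sum.inl ⟨e, q⟩

variable {B} in
abbrev vertexPt (v : Fin n) (x : B.X v) : B.Point := Sum.inr ⟨v, x⟩

/-- The Riemannian measure of the scaled transverse manifold `ε Yₑ`, with the metric `ε² hₑ`. -/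
def volY (e : Edge G) : Measure (B.Y e) := riemVol (𝓡 k) (scaleMetric (𝓡 k) ε (B.Y e).g)

/-- The Riemannian measure of the scaled vertex manifold `ε X_v`, with the metric `ε² g_v`. -/
def volX (v : Fin n) : Measure (B.X v) :=
  riemVol (𝓡∂ (k + 1)) (scaleMetric (𝓡∂ (k + 1)) ε (B.X v).g)

/-- The Riemannian measure of `X_ε`. -/
def mfdMeasure : Measure B.Point :=
  (Measure.sum fun e : Edge G =>
    ((volume.restrict (edgeInterval d e)).prod (B.volY ε e)).map (edgePt e)) +
  Measure.sum fun v : Fin n => (B.volX ε v).map (vertexPt v)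

/-- `L²(X_ε) = ⨁ₑ L²(Iₑ × ε Yₑ) ⊕ ⨁ᵥ L²(ε X_v)`. -/
abbrev MfdL2 := Lp ℂ 2 (B.mfdMeasure d ε)

/-- A function on `X_ε` near the edge neighbourhood of `e`: the edge coordinate `s` is extended
beyond the ends of `e` by length `ε ℓ`, into the cylindrical ends of the adjacent `ε X_v`. -/
def extend (φ : B.Point → ℂ) : ∀ e : Edge G, ℝ × B.Y e → ℂ
  | Sum.inl j, (s, y) =>
      if s < 0 then φ (vertexPt j (B.collar (EdgeEnd.outer j) (-s / ε, y)))
      else φ (edgePt (Sum.inl j) (s, y))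
  | Sum.inr e, (s, y) =>
      if s < -d then φ (vertexPt e.fst (B.collar (EdgeEnd.left e) ((-d - s) / ε, y)))
      else if d < s then φ (vertexPt e.snd (B.collar (EdgeEnd.right e) ((s - d) / ε, y)))
      else φ (edgePt (Sum.inr e) (s, y))

/-- The range of the extended edge coordinate. -/
def extInterval : Edge G → Set ℝ
  | Sum.inl _ => Ioi (-(ε * B.ℓ))
  | Sum.inr _ => Ioo (-d - ε * B.ℓ) (d + ε * B.ℓ)

/-- Smooth functions with compact support on the manifold `X_ε`, which is obtained by gluing the
pieces along the boundary components: they are smooth on the `X_v` and in the product coordinates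
on the edge neighbourhoods enlarged by the cylindrical ends (these sets form an open cover of
`X_ε`, up to the boundary of the `X_v`). -/
structure IsTestFunction (φ : B.Point → ℂ) : Prop where
  smooth_vertex : ∀ v, ContMDiff (𝓡∂ (k + 1)) 𝓘(ℝ, ℂ) ∞ fun x : B.X v => φ (vertexPt v x)
  smooth_edge : ∀ e, ContMDiffOn (𝓘(ℝ, ℝ).prod (𝓡 k)) 𝓘(ℝ, ℂ) ∞ (B.extend d ε φ e)
    (B.extInterval d ε e ×ˢ univ)
  compact_support : ∃ R : ℝ, ∀ (j : Fin n) (s : ℝ) (y : B.Y (Sum.inl j)), R < s →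
    φ (edgePt (Sum.inl j) (s, y)) = 0

/-- The longitudinal derivative on an edge neighbourhood. -/
def longDeriv (φ : B.Point → ℂ) (e : Edge G) (s : ℝ) (y : B.Y e) : ℂ :=
  deriv (fun t => φ (edgePt e (t, y))) s

/-- The product of the transverse derivatives on an edge neighbourhood, in the metric `ε² hₑ`. -/
def transProd (φ ψ : B.Point → ℂ) (e : Edge G) (s : ℝ) (y : B.Y e) : ℂ :=
  gradProd (𝓡 k) (scaleMetric (𝓡 k) ε (B.Y e).g)
    (fun y' => φ (edgePt e (s, y'))) (fun y' => ψ (edgePt e (s, y'))) y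

/-- The volume of the unscaled vertex manifold `X_v`. -/
def vertexVol (v : Fin n) : ℝ := (riemVol (𝓡∂ (k + 1)) (B.X v).g univ).toReal

/-- The (sesquilinear form of the) quadratic form `𝔥_ε` on test functions: vector potential `A`
on the inner edges, potential `wE / (2ε)` on `[-ε, ε] × ε Yₑ` in the middle of each inner edge, and
potential `wV / (ε vol X_v)` on the vertex neighbourhoods. -/
def mfdSesq (A wE : InnerEdge G → ℝ) (wV : Fin n → ℝ) (φ ψ : B.Point → ℂ) : ℂ :=
  (∑ j : Fin n, ∫ s in Ioi (0 : ℝ), ∫ y,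
    (B.longDeriv φ (Sum.inl j) s y * conj (B.longDeriv ψ (Sum.inl j) s y) +
      B.transProd ε φ ψ (Sum.inl j) s y) ∂B.volY ε (Sum.inl j)) +
  (∑ e : InnerEdge G,
    ((∫ s in (-d)..d, ∫ y,
      ((B.longDeriv φ (Sum.inr e) s y + Complex.I * A e * φ (edgePt (Sum.inr e) (s, y))) *
          conj (B.longDeriv ψ (Sum.inr e) s y + Complex.I * A e * ψ (edgePt (Sum.inr e) (s, y))) +
        B.transProd ε φ ψ (Sum.inr e) s y) ∂B.volY ε (Sum.inr e)) +
    (wE e / (2 * ε) : ℝ) *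
      ∫ s in (-ε)..ε, ∫ y, φ (edgePt (Sum.inr e) (s, y)) * conj (ψ (edgePt (Sum.inr e) (s, y)))
        ∂B.volY ε (Sum.inr e))) +
  ∑ v : Fin n,
    ((∫ x, gradProd (𝓡∂ (k + 1)) (scaleMetric (𝓡∂ (k + 1)) ε (B.X v).g)
        (fun x' => φ (vertexPt v x')) (fun x' => ψ (vertexPt v x')) x ∂B.volX ε v) +
    (wV v / (ε * B.vertexVol v) : ℝ) *
      ∫ x, φ (vertexPt v x) * conj (ψ (vertexPt v x)) ∂B.volX ε v)

/-- `φ` is a sequence of test functions that converges to `x` in `L²(X_ε)` and is a Cauchy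
sequence for the `H¹` norm, whose square is `‖φ‖² + ‖dφ‖²`. -/
structure IsApprox (x : B.MfdL2 d ε) (φ : ℕ → B.Point → ℂ) : Prop where
  test : ∀ i, B.IsTestFunction d ε (φ i)
  tendsto : Tendsto (fun i => eLpNorm (φ i - ⇑x) 2 (B.mfdMeasure d ε)) atTop (𝓝 0)
  cauchy : Tendsto (fun l : ℕ × ℕ =>
    (B.mfdSesq d ε 0 0 0 (φ l.1 - φ l.2) (φ l.1 - φ l.2)).re) atTop (𝓝 0)

/-- `H¹(X_ε)`, the completion of the test functions for the `H¹` norm, as a subspace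
of `L²(X_ε)`. -/
def mfdH1 : Set (B.MfdL2 d ε) := {x | ∃ φ, B.IsApprox d ε x φ}

open Classical in
/-- A sequence of test functions that converges to `x` in `H¹(X_ε)`. -/
def approx (x : B.MfdL2 d ε) : ℕ → B.Point → ℂ :=
  if h : ∃ φ, B.IsApprox d ε x φ then h.choose else 0

/-- The form `𝔥_ε` on `H¹(X_ε)`, the continuous extension of the form on test functions. -/
def mfdSesqH1 (A wE : InnerEdge G → ℝ) (wV : Fin n → ℝ) (x y : B.MfdL2 d ε) : ℂ :=
  limUnder atTop fun i => B.mfdSesq d ε A wE wV (B.approx d ε x i) (B.approx d ε y i)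

/-- `L²(X_ε)` with the form domain `H¹(X_ε)`, the free form `𝔡_ε` and the form `𝔥_ε`. -/
def mfdForm (A wE : InnerEdge G → ℝ) (wV : Fin n → ℝ) : FormSpace (B.MfdL2 d ε) where
  dom := B.mfdH1 d ε
  free := B.mfdSesqH1 d ε 0 0 0
  form := B.mfdSesqH1 d ε A wE wV

/-! ### The identification operators -/

/-- The average of a function over the vertex manifold `X_v`. -/
def vertexAvg (x : B.Point → ℂ) (v : Fin n) : ℂ :=
  ((B.vertexVol v)⁻¹ : ℝ) * ∫ z, x (vertexPt v z) ∂riemVol (𝓡∂ (k + 1)) (B.X v).g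

/-- `J f = ⨁ₑ fₑ ⊗ ε^{-k/2} ⊕ 0`. -/
def IsLift (J : GraphL2 G d →L[ℂ] B.MfdL2 d ε) : Prop :=
  ∀ f, J f =ᵐ[B.mfdMeasure d ε] fun z => match z with
    | Sum.inl ⟨e, (s, _)⟩ => ((ε ^ (-(k : ℝ) / 2) : ℝ) : ℂ) * f ⟨e, s⟩
    | Sum.inr _ => 0

/-- `J₁ f = ⨁ₑ fₑ ⊗ ε^{-k/2} ⊕ ⨁ᵥ ε^{-k/2} f(v)` on `H¹(Γ)`. -/
def IsLift₁ (J₁ : GraphL2 G d →ₗ.[ℂ] B.MfdL2 d ε) : Prop :=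
  (J₁.domain : Set (GraphL2 G d)) = graphH1 G d ∧
  ∀ f : J₁.domain, J₁ f =ᵐ[B.mfdMeasure d ε] fun z => match z with
    | Sum.inl ⟨e, (s, _)⟩ => ((ε ^ (-(k : ℝ) / 2) : ℝ) : ℂ) * (f : GraphL2 G d) ⟨e, s⟩
    | Sum.inr ⟨v, _⟩ => ((ε ^ (-(k : ℝ) / 2) : ℝ) : ℂ) * vertexValue (f : GraphL2 G d) v

/-- `J₁'` on `H¹(X_ε)`: the adjoint `J*` of `J`, corrected by means of the cut-off functions in
such a way that the value at the vertex `v` becomes `ε^{k/2}` times the average over `X_v`. -/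
def IsProj₁ (χm χp χo : ℝ → ℝ) (J : GraphL2 G d →L[ℂ] B.MfdL2 d ε)
    (J₁' : B.MfdL2 d ε →ₗ.[ℂ] GraphL2 G d) : Prop :=
  (J₁'.domain : Set (B.MfdL2 d ε)) = B.mfdH1 d ε ∧
  ∀ x : J₁'.domain,
    let f := ContinuousLinearMap.adjoint J x
    let corr : EdgeEnd G → ℂ := fun a =>
      ((ε ^ ((k : ℝ) / 2) : ℝ) : ℂ) * B.vertexAvg (x : B.MfdL2 d ε) a.vertex - endValue f a
    J₁' x =ᵐ[graphMeasure G d] fun q => match q with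
      | ⟨Sum.inl j, s⟩ => f ⟨Sum.inl j, s⟩ + χo s * corr (EdgeEnd.outer j)
      | ⟨Sum.inr e, s⟩ => f ⟨Sum.inr e, s⟩ + χm s * corr (EdgeEnd.left e) +
          χp s * corr (EdgeEnd.right e)

end BuildingBlocks

/-- The cut-off functions: `χm`, `χp` live on the inner edges, at the left and at the right end,
and `χo` on the outer edges. -/
structure IsCutoff (d : ℝ) (χm χp χo : ℝ → ℝ) : Prop where
  smooth_m : ContDiff ℝ ∞ χm
  smooth_p : ContDiff ℝ ∞ χp
  smooth_o : ContDiff ℝ ∞ χo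
  one_m : χm (-d) = 1
  one_p : χp d = 1
  one_o : χo 0 = 1
  deriv_m : ∀ s ∈ Icc (-d) d, |deriv χm s| ≤ 2 / d
  deriv_p : ∀ s ∈ Icc (-d) d, |deriv χp s| ≤ 2 / d
  deriv_o : ∀ s, 0 ≤ s → |deriv χo s| ≤ 2
  zero_m : ∀ s ∈ Icc 0 d, χm s = 0
  zero_p : ∀ s ∈ Icc (-d) 0, χp s = 0
  zero_o : ∀ s, 1 ≤ s → χo s = 0

/-- `3 max {|w_e|, |w_v|}`. -/
def maxW {n : ℕ} {G : SimpleGraph (Fin n)} (wE : InnerEdge G → ℝ) (wV : Fin n → ℝ) : ℝ :=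
  3 * max (⨆ e, |wE e|) (⨆ v, |wV v|)

end MagneticGraph

end

open MagneticGraph

noncomputable section

namespace MagneticGraph

open ENNReal (ofReal ofReal_ne_top ofReal_mul ofReal_pow toReal_ofReal ofReal_le_ofReal ofReal_lt_top)
open Finset (sum_congr sum_nonneg mul_sum sum_le_sum single_le_sum sum_mul sum_eq_zero
  sum_add_distrib sum_const card_univ)
open Complex (norm_real real_smul conj_ofReal normSq_eq_norm_sq mul_conj)
open Real (norm_eq_abs sqrt_nonneg le_sqrt_of_sq_le norm_of_nonneg)

notation "𝔼" N:max => EuclideanSpace ℝ (Fin N)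

notation "𝓑" k:max => modelWithCornersEuclideanHalfSpace (k + 1)

notation:max "dV" M:max => riemVol _ (RiemMfd.g M)

notation "ContMDiffProd" I:max O:max Φ:max =>
  ContMDiffOn (ModelWithCorners.prod (modelWithCornersSelf ℝ ℝ) I) (modelWithCornersSelf ℝ ℂ) ∞ Φ
    (SProd.sprod O univ)

section MatrixForms

variable {N : ℕ}

/-- The Hermitian form on complex covectors that is dual to a real Gram matrix. -/
def dualForm (G : Matrix (Fin N) (Fin N) ℝ) (a b : Fin N → ℂ) : ℂ :=
  ∑ i, ∑ j, ((G⁻¹ i j : ℝ) : ℂ) * (a i * conj (b j))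

open Matrix in
lemma dualForm_eq (G : Matrix (Fin N) (Fin N) ℝ) (a b : Fin N → ℂ) :
    dualForm G a b = a ⬝ᵥ (G⁻¹.map Complex.ofReal) *ᵥ (star b) := by
  simp only [dualForm, dotProduct, mulVec, mul_sum, Matrix.map_apply, Pi.star_apply,
    RCLike.star_def]
  refine sum_congr rfl fun i _ => sum_congr rfl fun j _ => ?_
  ring

open Matrix in
lemma dualForm_change (P G : Matrix (Fin N) (Fin N) ℝ) (hP : IsUnit P.det) (a b : Fin N → ℂ) :
    dualForm (P * G * Pᵀ) (fun i => ∑ k, (P i k : ℂ) * a k) (fun i => ∑ k, (P i k : ℂ) * b k) =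
      dualForm G a b := by
  have e1 : ∀ a : Fin N → ℂ,
      (fun i => ∑ k, (P i k : ℂ) * a k) = (P.map Complex.ofReal) *ᵥ a := fun a => rfl
  have e2 : star ((P.map Complex.ofReal) *ᵥ b) = (P.map Complex.ofReal) *ᵥ star b := by
    ext i
    simp [mulVec, dotProduct]
  have hmap : ∀ A B : Matrix (Fin N) (Fin N) ℝ,
      (A * B).map Complex.ofReal = A.map Complex.ofReal * B.map Complex.ofReal := fun A B => by
    ext i j; simp [Matrix.mul_apply]
  have e3 : ∀ (A : Matrix (Fin N) (Fin N) ℂ) (v w : Fin N → ℂ),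
      (A *ᵥ v) ⬝ᵥ w = v ⬝ᵥ (Aᵀ *ᵥ w) := fun A v w => by
    rw [← vecMul_transpose, ← dotProduct_mulVec]
  have e4 : Pᵀ * ((P * G * Pᵀ)⁻¹ * P) = G⁻¹ := by
    have hP' : IsUnit Pᵀ.det := by rwa [det_transpose]
    rw [Matrix.mul_inv_rev, Matrix.mul_inv_rev, Matrix.mul_assoc, Matrix.mul_assoc,
      Matrix.nonsing_inv_mul _ hP, Matrix.mul_one, ← Matrix.mul_assoc,
      Matrix.mul_nonsing_inv _ hP', Matrix.one_mul]
  rw [dualForm_eq, dualForm_eq, e1, e1, e2, e3, mulVec_mulVec, mulVec_mulVec, ← transpose_map,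
    Matrix.mul_assoc, ← hmap, ← hmap, e4]

open Matrix in
open scoped MatrixOrder in
lemma exists_dualForm_factor {G : Matrix (Fin N) (Fin N) ℝ} (hG : G.PosDef) :
    ∃ Q : Matrix (Fin N) (Fin N) ℝ, G⁻¹ = Qᵀ * Q := by
  obtain ⟨B, hB⟩ := CStarAlgebra.nonneg_iff_eq_star_mul_self.mp hG.inv.posSemidef.nonneg
  exact ⟨B, by simpa [Matrix.star_eq_conjTranspose, Matrix.conjTranspose_eq_transpose_of_trivial] using hB⟩

lemma dualForm_of_factor {G Q : Matrix (Fin N) (Fin N) ℝ} (hQ : G⁻¹ = Q.transpose * Q)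
    (a b : Fin N → ℂ) :
    dualForm G a b = ∑ m, (∑ i, (Q m i : ℂ) * a i) * conj (∑ i, (Q m i : ℂ) * b i) := by
  have e : ∀ m, (∑ i, (Q m i : ℂ) * a i) * conj (∑ i, (Q m i : ℂ) * b i) =
      ∑ i, ∑ j, ((Q m i : ℂ) * a i) * ((Q m j : ℂ) * conj (b j)) := fun m => by
    rw [map_sum, Finset.sum_mul_sum]
    simp only [map_mul, conj_ofReal]
  simp only [dualForm, hQ, Matrix.mul_apply, Matrix.transpose_apply, Complex.ofReal_sum,
    Complex.ofReal_mul, sum_mul, e]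
  rw [Finset.sum_comm (s := Finset.univ) (t := Finset.univ)
    (f := fun m i => ∑ j, ((Q m i : ℂ) * a i) * ((Q m j : ℂ) * conj (b j)))]
  refine sum_congr rfl fun i _ => ?_
  rw [Finset.sum_comm (s := Finset.univ) (t := Finset.univ)
    (f := fun m j => ((Q m i : ℂ) * a i) * ((Q m j : ℂ) * conj (b j)))]
  refine sum_congr rfl fun j _ => sum_congr rfl fun m _ => ?_
  ring

lemma dualForm_conj_symm {G : Matrix (Fin N) (Fin N) ℝ} (hG : G.PosDef) (a b : Fin N → ℂ) :
    dualForm G b a = conj (dualForm G a b) := by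
  obtain ⟨Q, hQ⟩ := exists_dualForm_factor hG
  simp only [dualForm_of_factor hQ, map_sum, map_mul, Complex.conj_conj]
  exact sum_congr rfl fun _ _ => mul_comm _ _

lemma dualForm_self_nonneg {G : Matrix (Fin N) (Fin N) ℝ} (hG : G.PosDef) (a : Fin N → ℂ) :
    0 ≤ (dualForm G a a).re := by
  obtain ⟨Q, hQ⟩ := exists_dualForm_factor hG
  rw [dualForm_of_factor hQ, Complex.re_sum]
  refine sum_nonneg fun m _ => ?_
  rw [mul_conj]
  exact_mod_cast Complex.normSq_nonneg _

/-- The Cauchy-Schwarz inequality `|a(ξ)|² ≤ |a|² |ξ|²`. -/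
lemma norm_sum_mul_sq_le {G : Matrix (Fin N) (Fin N) ℝ} (hG : G.PosDef) (a : Fin N → ℂ)
    (ξ : Fin N → ℝ) :
    ‖∑ i, a i * (ξ i : ℂ)‖ ^ 2 ≤ (dualForm G a a).re * ∑ i, ∑ j, ξ i * ξ j * G i j := by
  obtain ⟨Q, hQ⟩ := exists_dualForm_factor hG
  have hdet : IsUnit G.det := isUnit_iff_ne_zero.mpr hG.det_pos.ne'
  set η : Fin N → ℝ := Q.mulVec (G.mulVec ξ) with hη
  have h1 : Q.transpose.mulVec η = ξ := by
    rw [hη, Matrix.mulVec_mulVec, Matrix.mulVec_mulVec, ← hQ, Matrix.nonsing_inv_mul _ hdet,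
      Matrix.one_mulVec]
  have h2 : ∑ i, a i * (ξ i : ℂ) = ∑ m, (∑ i, (Q m i : ℂ) * a i) * (η m : ℂ) := by
    conv_lhs => rw [← h1]
    simp only [Matrix.mulVec, dotProduct, Matrix.transpose_apply, Complex.ofReal_sum,
      Complex.ofReal_mul, mul_sum, sum_mul]
    rw [Finset.sum_comm]
    refine sum_congr rfl fun i _ => sum_congr rfl fun j _ => ?_
    simp only [hη]
    ring
  have h3 : ∑ i, ∑ j, ξ i * ξ j * G i j = ∑ m, η m ^ 2 := by
    have : ∑ m, η m ^ 2 = dotProduct η η := by simp [dotProduct, sq]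
    rw [this]
    conv_rhs => enter [2]; rw [hη]
    rw [Matrix.dotProduct_mulVec, ← Matrix.mulVec_transpose, h1]
    simp only [dotProduct, Matrix.mulVec, mul_sum]
    exact sum_congr rfl fun i _ => sum_congr rfl fun j _ => by ring
  have h4 : (dualForm G a a).re = ∑ m, ‖∑ i, (Q m i : ℂ) * a i‖ ^ 2 := by
    rw [dualForm_of_factor hQ, Complex.re_sum]
    refine sum_congr rfl fun m _ => ?_
    rw [mul_conj, normSq_eq_norm_sq, Complex.ofReal_re]
  rw [h2, h3, h4]
  calc ‖∑ m, (∑ i, (Q m i : ℂ) * a i) * (η m : ℂ)‖ ^ 2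
      ≤ (∑ m, ‖∑ i, (Q m i : ℂ) * a i‖ * |η m|) ^ 2 := by
        gcongr
        refine (norm_sum_le _ _).trans_eq (sum_congr rfl fun m _ => ?_)
        rw [norm_mul, norm_real, norm_eq_abs]
    _ ≤ _ := by
        refine (Finset.sum_mul_sq_le_sq_mul_sq _ _ _).trans_eq ?_
        simp only [sq_abs]

lemma dualForm_add_left (G : Matrix (Fin N) (Fin N) ℝ) (a b c : Fin N → ℂ) :
    dualForm G (a + b) c = dualForm G a c + dualForm G b c := by
  simp only [dualForm, Pi.add_apply, ← sum_add_distrib]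
  exact sum_congr rfl fun i _ => sum_congr rfl fun j _ => by ring

lemma dualForm_smul_left (G : Matrix (Fin N) (Fin N) ℝ) (z : ℂ) (a c : Fin N → ℂ) :
    dualForm G (z • a) c = z * dualForm G a c := by
  simp only [dualForm, Pi.smul_apply, smul_eq_mul, mul_sum]
  exact sum_congr rfl fun i _ => sum_congr rfl fun j _ => by ring

lemma dualForm_smul_gram (G : Matrix (Fin N) (Fin N) ℝ) (hG : G.PosDef) {t : ℝ} (ht : t ≠ 0)
    (a b : Fin N → ℂ) : dualForm (t • G) a b = (t⁻¹ : ℝ) * dualForm G a b := by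
  have : (t • G)⁻¹ = t⁻¹ • G⁻¹ := by
    refine Matrix.inv_eq_left_inv ?_
    rw [Matrix.smul_mul, Matrix.mul_smul, smul_smul, inv_mul_cancel₀ ht, one_smul,
      Matrix.nonsing_inv_mul _ (isUnit_iff_ne_zero.mpr hG.det_pos.ne')]
  simp only [dualForm, this, Matrix.smul_apply, smul_eq_mul, mul_sum, Complex.ofReal_mul]
  exact sum_congr rfl fun i _ => sum_congr rfl fun j _ => by ring

end MatrixForms

section Coordinates

variable {N : ℕ} {Hm : Type} [TopologicalSpace Hm]
  {I : ModelWithCorners ℝ (𝔼 N) Hm} {M : RiemMfd.{u} I} (x₀ : M)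

local notation "Ξ" => extChartAt I

/-- The matrix of a bilinear form on a tangent space. -/
def gramOf {x : M} (v : Fin N → TangentSpace I x) : Matrix (Fin N) (Fin N) ℝ :=
  Matrix.of fun i j => M.g x (v i) (v j)

/-- The Gram matrix of the coordinate vector fields. -/
def gram (z : 𝔼 N) : Matrix (Fin N) (Fin N) ℝ :=
  gramOf (coordVector I x₀ z)

lemma gramOf_apply_sum {x : M} (v : Fin N → TangentSpace I x) (ξ : Fin N → ℝ) :
    ∑ i, ∑ j, ξ i * ξ j * gramOf v i j = M.g x (∑ i, ξ i • v i) (∑ i, ξ i • v i) := by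
  simp only [map_sum, map_smul, FunLike.coe_sum, Finset.sum_apply, 
    _root_.smul_apply, smul_eq_mul, gramOf, Matrix.of_apply]
  rw [Finset.sum_comm]
  refine sum_congr rfl fun i _ => ?_
  rw [mul_sum]
  refine sum_congr rfl fun j _ => ?_
  ring

lemma gramOf_posDef {x : M} {v : Fin N → TangentSpace I x} (hv : LinearIndependent ℝ v) :
    (gramOf v).PosDef := by
  refine Matrix.PosDef.of_dotProduct_mulVec_pos ?_ fun ξ hξ => ?_
  · ext i j
    exact M.metric.symm x _ _
  · have h := gramOf_apply_sum v ξ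
    have : star ξ ⬝ᵥ (gramOf v).mulVec ξ = ∑ i, ∑ j, ξ i * ξ j * gramOf v i j := by
      simp only [dotProduct, Matrix.mulVec, mul_sum, star_trivial]
      exact sum_congr rfl fun i _ => sum_congr rfl fun j _ => by ring
    rw [this, h]
    refine M.metric.pos x _ fun h0 => hξ ?_
    ext i
    exact Fintype.linearIndependent_iff.mp hv ξ h0 i

lemma coordVector_eq {z : 𝔼 N} (hz : z ∈ (Ξ x₀).target)
    (i : Fin N) :
    coordVector I x₀ z i =
      (trivializationAt (𝔼 N) (TangentSpace I) x₀).symmL ℝ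
        ((Ξ x₀).symm z) (EuclideanSpace.single i (1 : ℝ)) := by
  have hs : (Ξ x₀).symm z ∈ (chartAt Hm x₀).source := by
    rw [← extChartAt_source I]; exact (Ξ x₀).map_target hz
  have := TangentBundle.symmL_trivializationAt (I := I) hs
  rw [(Ξ x₀).right_inv hz] at this
  rw [this]
  rfl

lemma linearIndependent_coordVector {z : 𝔼 N}
    (hz : z ∈ (Ξ x₀).target) : LinearIndependent ℝ (coordVector I x₀ z) := by
  have hs : (Ξ x₀).symm z ∈ (trivializationAt (𝔼 N) (TangentSpace I) x₀).baseSet := by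
    rw [TangentBundle.trivializationAt_baseSet, ← extChartAt_source I]
    exact (Ξ x₀).map_target hz
  refine LinearIndependent.of_comp ((trivializationAt (𝔼 N)
    (TangentSpace I) x₀).continuousLinearMapAt ℝ ((Ξ x₀).symm z)).toLinearMap ?_
  have h2 := (EuclideanSpace.basisFun (Fin N) ℝ).toBasis.linearIndependent
  have h3 : (((trivializationAt (𝔼 N)
    (TangentSpace I) x₀).continuousLinearMapAt ℝ ((Ξ x₀).symm z)).toLinearMap ∘
      coordVector I x₀ z) = (EuclideanSpace.basisFun (Fin N) ℝ).toBasis := by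
    funext i
    rw [Function.comp_apply, coordVector_eq x₀ hz i]
    refine ((trivializationAt (𝔼 N) (TangentSpace I)
        x₀).continuousLinearMapAt_symmL hs _).trans ?_
    simp
  rw [h3]
  exact h2

lemma gram_posDef {z : 𝔼 N} (hz : z ∈ (Ξ x₀).target) :
    (gram x₀ z).PosDef := gramOf_posDef (linearIndependent_coordVector x₀ hz)

lemma continuousOn_gram (i j : Fin N) :
    ContinuousOn (fun z => gram x₀ z i j) (Ξ x₀).target := by
  set e := trivializationAt (𝔼 N) (TangentSpace I : M → Type _) x₀ with he
  have hv : ∀ i, ContMDiffOn I (I.prod 𝓘(ℝ, 𝔼 N)) ∞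
      (fun m : M => Bundle.TotalSpace.mk' (𝔼 N) m
        (e.symmL ℝ m (EuclideanSpace.single i (1 : ℝ)))) e.baseSet := fun i => by
    rw [e.contMDiffOn_section_baseSet_iff]
    refine (contMDiffOn_const (c := EuclideanSpace.single i (1 : ℝ))).congr fun m hm => ?_
    simp [hm]
  have h1 := ContMDiffOn.clm_bundle_apply₂ (M.metric.contMDiff.contMDiffOn (s := e.baseSet)) (hv i) (hv j)
  have h2 : ContinuousOn (fun m : M => M.metric.inner m (e.symmL ℝ m (EuclideanSpace.single i (1 : ℝ))) (e.symmL ℝ m (EuclideanSpace.single j (1 : ℝ)))) e.baseSet := by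
    intro m hm
    have := h1 m hm
    rw [Bundle.contMDiffWithinAt_totalSpace] at this
    exact this.2.continuousWithinAt
  have hmaps : MapsTo (Ξ x₀).symm (Ξ x₀).target e.baseSet := by
    rw [TangentBundle.trivializationAt_baseSet, ← extChartAt_source I]
    exact fun z hz => (Ξ x₀).map_target hz
  refine (h2.comp (continuousOn_extChartAt_symm x₀) hmaps).congr fun z hz => ?_
  simp only [gram, gramOf, Matrix.of_apply, coordVector_eq x₀ hz]
  rfl

end Coordinates

section Coordinates

variable {N : ℕ} {Hm : Type} [TopologicalSpace Hm]
  {I : ModelWithCorners ℝ (𝔼 N) Hm} {M : RiemMfd.{u} I}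

local notation "Ξ" => extChartAt I

lemma tangentBasis_sum {x : M} (v : TangentSpace I x) :
    v = ∑ k, (show 𝔼 N from v) k • tangentBasis I x k := by
  have := ((EuclideanSpace.basisFun (Fin N) ℝ).sum_repr (show 𝔼 N from v)).symm
  simp only [EuclideanSpace.basisFun_apply] at this
  exact this

lemma linearIndependent_tangentBasis (x : M) : LinearIndependent ℝ (tangentBasis I x) := by
  have h2 := (EuclideanSpace.basisFun (Fin N) ℝ).toBasis.linearIndependent
  have : (⇑(EuclideanSpace.basisFun (Fin N) ℝ).toBasis : Fin N → 𝔼 N) =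
      tangentBasis I x := by
    funext i
    simp [tangentBasis]
  rw [this] at h2
  exact h2

lemma cometric_eq_dualForm {x : M} {v : Fin N → TangentSpace I x} (hv : LinearIndependent ℝ v)
    (α β : TangentSpace I x →L[ℝ] ℂ) :
    cometric I M.g x α β = dualForm (gramOf v) (fun i => α (v i)) (fun i => β (v i)) := by
  set P : Matrix (Fin N) (Fin N) ℝ :=
    Matrix.of fun i k => (show 𝔼 N from v i) k with hP
  have hvP : ∀ i, v i = ∑ k, P i k • tangentBasis I x k := fun i => tangentBasis_sum (v i)
  have hG : gramOf v = P * gramOf (tangentBasis I x) * P.transpose := by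
    ext i j
    simp only [gramOf, Matrix.of_apply, Matrix.mul_apply, Matrix.transpose_apply]
    rw [hvP i, hvP j]
    simp only [map_sum, map_smul, FunLike.coe_sum, Finset.sum_apply,
      _root_.smul_apply, smul_eq_mul, sum_mul]
    refine sum_congr rfl fun k _ => ?_
    rw [mul_sum]
    refine sum_congr rfl fun l _ => ?_
    ring
  have hdet : IsUnit P.det := by
    have h1 := (gramOf_posDef hv).det_pos.ne'
    rw [hG, Matrix.det_mul, Matrix.det_mul] at h1
    exact isUnit_iff_ne_zero.mpr (left_ne_zero_of_mul (left_ne_zero_of_mul h1))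
  have hα : ∀ α : TangentSpace I x →L[ℝ] ℂ, (fun i => α (v i)) =
      fun i => ∑ k, (P i k : ℂ) * α (tangentBasis I x k) := fun α => by
    funext i
    rw [hvP i, map_sum]
    simp only [map_smul, real_smul]
  rw [hα α, hα β, hG, dualForm_change _ _ hdet]
  rfl

lemma cometric_conj_symm (x : M) (α β : TangentSpace I x →L[ℝ] ℂ) :
    cometric I M.g x β α = conj (cometric I M.g x α β) := by
  rw [cometric_eq_dualForm (linearIndependent_tangentBasis x),
    cometric_eq_dualForm (linearIndependent_tangentBasis x)]
  exact dualForm_conj_symm (gramOf_posDef (linearIndependent_tangentBasis x)) _ _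

lemma cometric_self_nonneg (x : M) (α : TangentSpace I x →L[ℝ] ℂ) :
    0 ≤ (cometric I M.g x α α).re := by
  rw [cometric_eq_dualForm (linearIndependent_tangentBasis x)]
  exact dualForm_self_nonneg (gramOf_posDef (linearIndependent_tangentBasis x)) _

lemma cometric_add_left (g : MetricField I M) (x : M) (α β γ : TangentSpace I x →L[ℝ] ℂ) :
    cometric I g x (α + β) γ = cometric I g x α γ + cometric I g x β γ :=
  dualForm_add_left _ _ _ _

lemma cometric_smul_left (g : MetricField I M) (x : M) (c : ℂ) (α γ : TangentSpace I x →L[ℝ] ℂ) :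
    cometric I g x (c • α) γ = c * cometric I g x α γ :=
  dualForm_smul_left _ _ _ _

lemma cometric_scaleMetric {ε : ℝ} (hε : ε ≠ 0) (x : M) (α β : TangentSpace I x →L[ℝ] ℂ) :
    cometric I (scaleMetric I ε M.g) x α β = ((ε ^ 2)⁻¹ : ℝ) * cometric I M.g x α β :=
  dualForm_smul_gram (gramOf (M := M) (tangentBasis I x))
    (gramOf_posDef (linearIndependent_tangentBasis x)) (pow_ne_zero 2 hε) _ _

/-- The Cauchy-Schwarz inequality for the pairing of covectors and vectors. -/
lemma norm_apply_sq_le_cometric (x : M) (α : TangentSpace I x →L[ℝ] ℂ) (ξ : TangentSpace I x) :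
    ‖α ξ‖ ^ 2 ≤ (cometric I M.g x α α).re * M.g x ξ ξ := by
  have h := norm_sum_mul_sq_le (gramOf_posDef (linearIndependent_tangentBasis x))
    (fun i => α (tangentBasis I x i)) (fun i => (show 𝔼 N from ξ) i)
  rw [gramOf_apply_sum, ← tangentBasis_sum,
    ← cometric_eq_dualForm (linearIndependent_tangentBasis x)] at h
  convert h using 3
  conv_lhs => rw [tangentBasis_sum ξ]
  rw [map_sum]
  refine sum_congr rfl fun i _ => ?_
  rw [map_smul, real_smul, mul_comm]

variable (x₀ : M)

/-- The `i`-th partial derivative in the chart at `x₀`. -/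
def chartDeriv (φ : M → ℂ) (z : 𝔼 N) (i : Fin N) : ℂ :=
  fderivWithin ℝ (φ ∘ (Ξ x₀).symm) (range I) z (EuclideanSpace.single i (1 : ℝ))

lemma mfderiv_coordVector {φ : M → ℂ} {z : 𝔼 N}
    (hz : z ∈ (Ξ x₀).target)
    (hφ : MDifferentiableAt I 𝓘(ℝ, ℂ) φ ((Ξ x₀).symm z)) (i : Fin N) :
    mfderiv I 𝓘(ℝ, ℂ) φ ((Ξ x₀).symm z) (coordVector I x₀ z i) =
      chartDeriv x₀ φ z i := by
  have hr : z ∈ range I := extChartAt_target_subset_range x₀ hz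
  have h1 : MDifferentiableWithinAt 𝓘(ℝ, 𝔼 N) I (Ξ x₀).symm
      (range I) z := mdifferentiableWithinAt_extChartAt_symm hz
  have hu : UniqueMDiffWithinAt 𝓘(ℝ, 𝔼 N) (range I) z :=
    (I.uniqueDiffOn z hr).uniqueMDiffWithinAt
  have h2 := mfderiv_comp_mfderivWithin z hφ h1 hu
  have h3 : chartDeriv x₀ φ z i = mfderivWithin 𝓘(ℝ, 𝔼 N) 𝓘(ℝ, ℂ)
      (φ ∘ (Ξ x₀).symm) (range I) z (EuclideanSpace.single i (1 : ℝ)) := by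
    rw [mfderivWithin_eq_fderivWithin]; rfl
  rw [h3, h2]
  rfl

lemma gradProd_chart {φ ψ : M → ℂ} {z : 𝔼 N}
    (hz : z ∈ (Ξ x₀).target)
    (hφ : MDifferentiableAt I 𝓘(ℝ, ℂ) φ ((Ξ x₀).symm z))
    (hψ : MDifferentiableAt I 𝓘(ℝ, ℂ) ψ ((Ξ x₀).symm z)) :
    gradProd I M.g φ ψ ((Ξ x₀).symm z) =
      dualForm (gram x₀ z) (chartDeriv x₀ φ z) (chartDeriv x₀ ψ z) := by
  refine (cometric_eq_dualForm (linearIndependent_coordVector x₀ hz) _ _).trans ?_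
  have e : ∀ {φ : M → ℂ}, MDifferentiableAt I 𝓘(ℝ, ℂ) φ ((Ξ x₀).symm z) →
      (fun i => mfderiv I 𝓘(ℝ, ℂ) φ ((Ξ x₀).symm z) (coordVector I x₀ z i)) =
      chartDeriv x₀ φ z := fun h => funext fun i => mfderiv_coordVector x₀ hz h i
  exact congrArg₂ (dualForm (gram x₀ z)) (e hφ) (e hψ)

lemma continuousOn_gram_inv (i j : Fin N) :
    ContinuousOn (fun z => (gram x₀ z)⁻¹ i j) (Ξ x₀).target := by
  have h : ContinuousOn (gram x₀) (Ξ x₀).target :=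
    continuousOn_pi.mpr fun i => continuousOn_pi.mpr fun j => continuousOn_gram x₀ i j
  have hd : ContinuousOn (fun z => (gram x₀ z).det) (Ξ x₀).target :=
    (continuous_id.matrix_det).comp_continuousOn h
  have ha : ContinuousOn (fun z => (gram x₀ z).adjugate i j) (Ξ x₀).target :=
    ((continuous_id.matrix_adjugate).matrix_elem i j).comp_continuousOn h
  refine ((hd.inv₀ fun z hz => (gram_posDef x₀ hz).det_pos.ne').mul ha).congr fun z hz => ?_
  simp [Matrix.inv_def, Ring.inverse_eq_inv']

lemma continuousOn_dualForm_gram {T : Type*} [TopologicalSpace T] {s : Set T}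
    {ζ : T → 𝔼 N} (hζ : ContinuousOn ζ s)
    (hm : MapsTo ζ s (Ξ x₀).target) {a b : T → Fin N → ℂ}
    (ha : ∀ i, ContinuousOn (fun t => a t i) s) (hb : ∀ i, ContinuousOn (fun t => b t i) s) :
    ContinuousOn (fun t => dualForm (gram x₀ (ζ t)) (a t) (b t)) s := by
  unfold dualForm
  refine continuousOn_finsetSum _ fun i _ => continuousOn_finsetSum _ fun j _ => ?_
  refine ContinuousOn.mul ?_ ((ha i).mul (Complex.continuous_conj.comp_continuousOn (hb j)))
  exact Complex.continuous_ofReal.comp_continuousOn ((continuousOn_gram_inv x₀ i j).comp hζ hm)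

section Param

variable {O : Set ℝ} {Φ Ψ : ℝ × M → ℂ}

lemma contDiffOn_chart (hΦ : ContMDiffProd I O Φ) :
    ContDiffOn ℝ ∞ (fun p : ℝ × 𝔼 N => Φ (p.1, (Ξ x₀).symm p.2))
      (O ×ˢ (Ξ x₀).target) := by
  rw [← contMDiffOn_iff_contDiffOn]
  have h1 : ContMDiffOn 𝓘(ℝ, ℝ × 𝔼 N) (𝓘(ℝ, ℝ).prod I) ∞
      (fun p : ℝ × 𝔼 N => (p.1, (Ξ x₀).symm p.2))
      (O ×ˢ (Ξ x₀).target) :=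
    contDiff_fst.contMDiff.contMDiffOn.prodMk
      ((contMDiffOn_extChartAt_symm x₀).comp contDiff_snd.contMDiff.contMDiffOn fun p hp => hp.2)
  exact hΦ.comp h1 (fun p hp => ⟨hp.1, mem_univ _⟩)

lemma uniqueDiffOn_prod_target (hO : IsOpen O) :
    UniqueDiffOn ℝ (O ×ˢ (Ξ x₀).target) :=
  hO.uniqueDiffOn.prod (uniqueDiffOn_extChartAt_target x₀)

lemma continuousOn_chart_fderivWithin (hO : IsOpen O)
    (hΦ : ContMDiffProd I O Φ)
    (v : ℝ × 𝔼 N) :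
    ContinuousOn (fun p => fderivWithin ℝ
      (fun p : ℝ × 𝔼 N => Φ (p.1, (Ξ x₀).symm p.2))
      (O ×ˢ (Ξ x₀).target) p v) (O ×ˢ (Ξ x₀).target) :=
  ((contDiffOn_chart x₀ hΦ).continuousOn_fderivWithin (uniqueDiffOn_prod_target x₀ hO)
    (by simp)).clm_apply continuousOn_const

lemma chartDeriv_slice
    (hΦ : ContMDiffProd I O Φ) {s : ℝ} (hs : s ∈ O)
    {z : 𝔼 N} (hz : z ∈ (Ξ x₀).target) (i : Fin N) :
    chartDeriv x₀ (fun x => Φ (s, x)) z i = fderivWithin ℝ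
      (fun p : ℝ × 𝔼 N => Φ (p.1, (Ξ x₀).symm p.2))
      (O ×ˢ (Ξ x₀).target) (s, z) (0, EuclideanSpace.single i (1 : ℝ)) := by
  have h1 := (((contDiffOn_chart x₀ hΦ).differentiableOn (by simp)) (s, z)
    ⟨hs, hz⟩).hasFDerivWithinAt
  have h2 : HasFDerivWithinAt (fun z : 𝔼 N => (s, z))
    (ContinuousLinearMap.inr ℝ ℝ (𝔼 N)) (Ξ x₀).target z :=
    (hasFDerivAt_prodMk_right s z).hasFDerivWithinAt
  have h3 := h1.comp z h2 (fun y hy => ⟨hs, hy⟩)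
  have hn : (Ξ x₀).target ∈ 𝓝[range I] z := extChartAt_target_mem_nhdsWithin_of_mem hz
  have h4 := h3.mono_of_mem_nhdsWithin hn
  have hr : z ∈ range I := extChartAt_target_subset_range x₀ hz
  rw [chartDeriv]
  have h5 := h4.fderivWithin (I.uniqueDiffOn z hr)
  erw [h5]
  simp

lemma mdifferentiableAt_slice (hO : IsOpen O)
    (hΦ : ContMDiffProd I O Φ) {s : ℝ} (hs : s ∈ O) (x : M) :
    MDifferentiableAt I 𝓘(ℝ, ℂ) (fun x => Φ (s, x)) x := by
  have h1 : ContMDiffAt (𝓘(ℝ, ℝ).prod I) 𝓘(ℝ, ℂ) ∞ Φ (s, x) :=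
    hΦ.contMDiffAt ((hO.prod isOpen_univ).mem_nhds ⟨hs, mem_univ _⟩)
  have h2 : ContMDiffAt I (𝓘(ℝ, ℝ).prod I) ∞ (fun x : M => (s, x)) x :=
    contMDiffAt_const.prodMk contMDiffAt_id
  exact (h1.comp x h2).mdifferentiableAt (by simp)

lemma continuousOn_gradProd (hO : IsOpen O)
    (hΦ : ContMDiffProd I O Φ)
    (hΨ : ContMDiffProd I O Ψ) :
    ContinuousOn (fun p : ℝ × M => gradProd I M.g (fun x => Φ (p.1, x)) (fun x => Ψ (p.1, x)) p.2)
      (O ×ˢ univ) := by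
  rintro ⟨s, x₀⟩ ⟨hs, -⟩
  have hU : O ×ˢ (Ξ x₀).source ∈ 𝓝 (s, x₀) :=
    (hO.prod (isOpen_extChartAt_source x₀)).mem_nhds ⟨hs, mem_extChartAt_source x₀⟩
  refine ContinuousAt.continuousWithinAt ?_
  refine ContinuousOn.continuousAt ?_ hU
  have hm : MapsTo (fun p : ℝ × M => (p.1, Ξ x₀ p.2)) (O ×ˢ (Ξ x₀).source)
      (O ×ˢ (Ξ x₀).target) := fun p hp => ⟨hp.1, (Ξ x₀).map_source hp.2⟩
  have hc : ContinuousOn (fun p : ℝ × M => (p.1, Ξ x₀ p.2))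
      (O ×ˢ (Ξ x₀).source) :=
    continuousOn_fst.prodMk ((continuousOn_extChartAt x₀).comp continuousOn_snd fun p hp => hp.2)
  have hcont := continuousOn_dualForm_gram x₀
    (ζ := fun p : ℝ × M => Ξ x₀ p.2) (s := O ×ˢ (Ξ x₀).source)
    (continuousOn_snd.comp hc (mapsTo_univ _ _ )) (fun p hp => (hm hp).2)
    (fun i => (continuousOn_chart_fderivWithin x₀ hO hΦ (0, EuclideanSpace.single i 1)).comp hc hm)
    (fun i => (continuousOn_chart_fderivWithin x₀ hO hΨ (0, EuclideanSpace.single i 1)).comp hc hm)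
  refine hcont.congr fun p hp => ?_
  have hz := (hm hp).2
  have hl : (Ξ x₀).symm (Ξ x₀ p.2) = p.2 := (Ξ x₀).left_inv hp.2
  have h := gradProd_chart x₀ hz (φ := fun x => Φ (p.1, x)) (ψ := fun x => Ψ (p.1, x))
    (mdifferentiableAt_slice hO hΦ hp.1 _) (mdifferentiableAt_slice hO hΨ hp.1 _)
  simp only at h hz
  rw [hl] at h
  rw [h]
  congr 1 <;> funext i
  · exact chartDeriv_slice x₀ hΦ hp.1 hz i
  · exact chartDeriv_slice x₀ hΨ hp.1 hz i

lemma hasDerivAt_slice_chart (hO : IsOpen O)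
    (hΦ : ContMDiffProd I O Φ) {s : ℝ} (hs : s ∈ O)
    {z : 𝔼 N} (hz : z ∈ (Ξ x₀).target) :
    HasDerivAt (fun t => Φ (t, (Ξ x₀).symm z)) (fderivWithin ℝ
      (fun p : ℝ × 𝔼 N => Φ (p.1, (Ξ x₀).symm p.2))
      (O ×ˢ (Ξ x₀).target) (s, z) (1, 0)) s := by
  have h1 := (((contDiffOn_chart x₀ hΦ).differentiableOn (by simp)) (s, z)
    ⟨hs, hz⟩).hasFDerivWithinAt
  have h2 : HasDerivWithinAt (fun t : ℝ => (t, z)) ((1 : ℝ), (0 : 𝔼 N)) O s :=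
    ((hasDerivAt_id s).prodMk (hasDerivAt_const s z)).hasDerivWithinAt
  exact (h1.comp_hasDerivWithinAt (t := O ×ˢ (Ξ x₀).target) s h2
    (fun t ht => mk_mem_prod ht hz)).hasDerivAt (hO.mem_nhds hs)

lemma hasDerivAt_slice (hO : IsOpen O)
    (hΦ : ContMDiffProd I O Φ) {s : ℝ} (hs : s ∈ O) (x : M) :
    HasDerivAt (fun t => Φ (t, x)) (deriv (fun t => Φ (t, x)) s) s := by
  have h := hasDerivAt_slice_chart x hO hΦ hs (mem_extChartAt_target x)
  rw [extChartAt_to_inv] at h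
  exact h.differentiableAt.hasDerivAt

lemma continuousOn_deriv_slice (hO : IsOpen O)
    (hΦ : ContMDiffProd I O Φ) :
    ContinuousOn (fun p : ℝ × M => deriv (fun t => Φ (t, p.2)) p.1) (O ×ˢ univ) := by
  rintro ⟨s, x₀⟩ ⟨hs, -⟩
  have hU : O ×ˢ (Ξ x₀).source ∈ 𝓝 (s, x₀) :=
    (hO.prod (isOpen_extChartAt_source x₀)).mem_nhds ⟨hs, mem_extChartAt_source x₀⟩
  refine ContinuousAt.continuousWithinAt ?_
  refine ContinuousOn.continuousAt ?_ hU
  have hm : MapsTo (fun p : ℝ × M => (p.1, Ξ x₀ p.2)) (O ×ˢ (Ξ x₀).source)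
      (O ×ˢ (Ξ x₀).target) := fun p hp => ⟨hp.1, (Ξ x₀).map_source hp.2⟩
  have hc : ContinuousOn (fun p : ℝ × M => (p.1, Ξ x₀ p.2))
      (O ×ˢ (Ξ x₀).source) :=
    continuousOn_fst.prodMk ((continuousOn_extChartAt x₀).comp continuousOn_snd fun p hp => hp.2)
  refine ((continuousOn_chart_fderivWithin x₀ hO hΦ (1, 0)).comp hc hm).congr fun p hp => ?_
  have h := hasDerivAt_slice_chart x₀ hO hΦ hp.1 (hm hp).2
  simp only [(Ξ x₀).left_inv hp.2] at h
  exact h.deriv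

end Param

end Coordinates

section Volume

variable {N : ℕ} {Hm : Type} [TopologicalSpace Hm]
  {I : ModelWithCorners ℝ (𝔼 N) Hm} {M : RiemMfd.{u} I}

local notation "Ξ" => extChartAt I

instance (M : RiemMfd.{u} I) : SecondCountableTopology M :=
  haveI := I.secondCountableTopology
  ChartedSpace.secondCountable_of_sigmaCompact Hm M

variable (x₀ : M)

lemma measurableSet_extChartAt_target : MeasurableSet (Ξ x₀).target := by
  rw [extChartAt_target]
  exact ((((chartAt Hm x₀).open_target).preimage I.continuous_symm).measurableSet).inter
    I.isClosed_range.measurableSet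

lemma measurableSet_extChartAt_source : MeasurableSet (Ξ x₀).source :=
  (isOpen_extChartAt_source x₀).measurableSet

lemma measurableSet_target_inter_preimage {A : Set M} (hA : MeasurableSet A) :
    MeasurableSet ((Ξ x₀).target ∩ (Ξ x₀).symm ⁻¹' A) := by
  have h := (continuousOn_extChartAt_symm (I := I) x₀).domRestrict.measurable hA
  have h2 := (MeasurableEmbedding.subtype_coe
    (measurableSet_extChartAt_target x₀)).measurableSet_image.mpr h
  convert h2 using 1
  ext z
  simp
  bound

lemma measurableSet_source_inter_preimage {A : Set (𝔼 N)}
    (hA : MeasurableSet A) :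
    MeasurableSet ((Ξ x₀).source ∩ (Ξ x₀) ⁻¹' A) := by
  have h := (continuousOn_extChartAt (I := I) x₀).domRestrict.measurable hA
  have h2 := (MeasurableEmbedding.subtype_coe
    (measurableSet_extChartAt_source x₀)).measurableSet_image.mpr h
  convert h2 using 1
  ext z
  simp
  bound

lemma chartDensity_eq (z : 𝔼 N) :
    chartDensity I M.g x₀ z = √(gram x₀ z).det := rfl

lemma chartDensity_pos {z : 𝔼 N} (hz : z ∈ (Ξ x₀).target) :
    0 < chartDensity I M.g x₀ z := Real.sqrt_pos.mpr (gram_posDef x₀ hz).det_pos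

lemma continuousOn_chartDensity :
    ContinuousOn (chartDensity I M.g x₀) (Ξ x₀).target := by
  have h :=
    continuousOn_pi.mpr fun i => continuousOn_pi.mpr fun j => continuousOn_gram x₀ i j
  exact Real.continuous_sqrt.comp_continuousOn ((continuous_id.matrix_det).comp_continuousOn h)

lemma aemeasurable_chartDensity : AEMeasurable
    (fun z => ofReal (chartDensity I M.g x₀ z))
    (volume.restrict (Ξ x₀).target) :=
  ((continuousOn_chartDensity x₀).aemeasurable (measurableSet_extChartAt_target x₀)).ennreal_ofReal

lemma aemeasurable_extChartAt_symm (D : 𝔼 N → ℝ≥0∞) :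
    AEMeasurable (Ξ x₀).symm
      ((volume.restrict (Ξ x₀).target).withDensity D) :=
  ((continuousOn_extChartAt_symm x₀).aemeasurable (measurableSet_extChartAt_target x₀)).mono_ac
    (withDensity_absolutelyContinuous _ _)

lemma lintegral_chartVol {F : M → ℝ≥0∞} (hF : Measurable F) :
    ∫⁻ x, F x ∂chartVol I M.g x₀ = ∫⁻ z in (Ξ x₀).target,
      ofReal (chartDensity I M.g x₀ z) * F ((Ξ x₀).symm z) := by
  rw [chartVol, lintegral_map' hF.aemeasurable (aemeasurable_extChartAt_symm x₀ _),
    lintegral_withDensity_eq_lintegral_mul₀ (aemeasurable_chartDensity x₀)]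
  · rfl
  · exact hF.comp_aemeasurable
      ((continuousOn_extChartAt_symm x₀).aemeasurable (measurableSet_extChartAt_target x₀))

lemma chartVol_apply {A : Set M} (hA : MeasurableSet A) :
    chartVol I M.g x₀ A = ∫⁻ z in (Ξ x₀).target ∩ (Ξ x₀).symm ⁻¹' A,
      ofReal (chartDensity I M.g x₀ z) := by
  rw [chartVol, Measure.map_apply_of_aemeasurable (aemeasurable_extChartAt_symm x₀ _) hA,
    withDensity_apply', Measure.restrict_restrict' (measurableSet_extChartAt_target x₀), inter_comm]

lemma chartVol_compl_source : chartVol I M.g x₀ (Ξ x₀).sourceᶜ = 0 := by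
  rw [chartVol_apply x₀ (measurableSet_extChartAt_source x₀).compl]
  have : (Ξ x₀).target ∩ (Ξ x₀).symm ⁻¹' (Ξ x₀).sourceᶜ = ∅ := by
    ext z
    simp_all
  rw [this]; simp

lemma sqrt_det_gramOf {z : 𝔼 N}
    (L : 𝔼 N →L[ℝ] 𝔼 N)
    (u : Fin N → TangentSpace I ((Ξ x₀).symm z))
    (hu : ∀ i, u i = ∑ j, (L (EuclideanSpace.single i 1)) j • coordVector I x₀ z j) :
    √(gramOf u).det = |L.det| * chartDensity I M.g x₀ z := by
  set P : Matrix (Fin N) (Fin N) ℝ := Matrix.of fun i j => (L (EuclideanSpace.single i 1)) j with hP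
  have hG : gramOf u = P * gram x₀ z * P.transpose := by
    ext i j
    simp only [gram, gramOf, Matrix.of_apply, Matrix.mul_apply, Matrix.transpose_apply]
    rw [hu i, hu j]
    simp only [map_sum, map_smul, FunLike.coe_sum, Finset.sum_apply,
      _root_.smul_apply, smul_eq_mul, sum_mul]
    refine sum_congr rfl fun k _ => ?_
    rw [mul_sum]
    simp only [hP, Matrix.of_apply]
    ring
  have hdet : P.det = L.det := by
    have h1 := LinearMap.det_toMatrix (EuclideanSpace.basisFun (Fin N) ℝ).toBasis
      L
    have h2 : LinearMap.toMatrix (EuclideanSpace.basisFun (Fin N) ℝ).toBasis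
        (EuclideanSpace.basisFun (Fin N) ℝ).toBasis
        L = P.transpose := by
      rfl
    simp_all
  rw [hG, Matrix.det_mul, Matrix.det_mul, Matrix.det_transpose, chartDensity_eq, hdet,
    mul_right_comm, ← sq, Real.sqrt_mul (sq_nonneg _), Real.sqrt_sq_eq_abs]

/-- A tangent vector is recovered from its coordinates in a chart. -/
lemma sum_mfderiv_extChartAt {z : 𝔼 N} (hz : z ∈ (Ξ x₀).target)
    (v : TangentSpace I ((Ξ x₀).symm z)) :
    v = ∑ j, (show 𝔼 N from
      mfderiv I 𝓘(ℝ, 𝔼 N) (Ξ x₀) ((Ξ x₀).symm z) v) j •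
      coordVector I x₀ z j := by
  have h := mfderivWithin_extChartAt_symm_comp_mfderiv_extChartAt hz
  set w : 𝔼 N :=
    mfderiv I 𝓘(ℝ, 𝔼 N) (Ξ x₀) ((Ξ x₀).symm z) v with hw
  have h2 : mfderivWithin 𝓘(ℝ, 𝔼 N) I (Ξ x₀).symm (range I) z w =
    v := congrArg (fun L => L v) h
  have h3 := (EuclideanSpace.basisFun (Fin N) ℝ).sum_repr w
  simp at h3
  rw [← h2]
  conv_lhs => rw [← h3]
  refine (map_sum (mfderivWithin 𝓘(ℝ, 𝔼 N) I (Ξ x₀).symm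
    (range I) z) _ _).trans ?_
  refine sum_congr rfl fun j _ => ?_
  exact map_smul (mfderivWithin 𝓘(ℝ, 𝔼 N) I (Ξ x₀).symm
    (range I) z) _ _

lemma sqrt_det_gramOf' {x : M} (hx : x ∈ (Ξ x₀).source)
    (L : 𝔼 N →L[ℝ] 𝔼 N) (u : Fin N → TangentSpace I x)
    (hu : ∀ i, L (EuclideanSpace.single i 1) =
      mfderiv I 𝓘(ℝ, 𝔼 N) (Ξ x₀) x (u i)) :
    √(gramOf u).det = |L.det| * chartDensity I M.g x₀ (Ξ x₀ x) := by
  obtain ⟨z, hz, rfl⟩ : ∃ z ∈ (Ξ x₀).target, (Ξ x₀).symm z = x :=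
    ⟨_, (Ξ x₀).map_source hx, (Ξ x₀).left_inv hx⟩
  rw [(Ξ x₀).right_inv hz]
  refine sqrt_det_gramOf x₀ L u fun i => ?_
  rw [hu i]
  exact sum_mfderiv_extChartAt x₀ hz (u i)

/-- The volume of a parametrized piece of a chart domain. -/
lemma chartVol_image {W : Set (𝔼 N)} (hW : MeasurableSet W)
    {p : 𝔼 N → M} (hp : ∀ z ∈ W, p z ∈ (Ξ x₀).source)
    {f' : 𝔼 N → 𝔼 N →L[ℝ] 𝔼 N}
    (hf' : ∀ z ∈ W, HasFDerivWithinAt (Ξ x₀ ∘ p) (f' z) W z) (hf : InjOn p W)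
    (u : ∀ z, Fin N → TangentSpace I (p z))
    (hu : ∀ z ∈ W, ∀ i, f' z (EuclideanSpace.single i 1) =
      mfderiv I 𝓘(ℝ, 𝔼 N) (Ξ x₀) (p z) (u z i)) :
    MeasurableSet (p '' W) ∧ chartVol I M.g x₀ (p '' W) =
      ∫⁻ z in W, ofReal √(gramOf (u z)).det := by
  have hinj := fun a ha b hb hab =>
    hf ha hb ((Ξ x₀).injOn (hp a ha) (hp b hb) hab)
  have hm1 :=
    measurable_image_of_fderivWithin hW hf' hinj
  have e1 : p '' W = (Ξ x₀).source ∩ (Ξ x₀) ⁻¹'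
      ((Ξ x₀ ∘ p) '' W) := by
    ext x
    simp only [mem_image, mem_inter_iff, mem_preimage, Function.comp_apply]
    constructor
    · bound
    · rintro ⟨hx, z, hz, h⟩; exact ⟨z, hz, (Ξ x₀).injOn (hp z hz) hx h⟩
  have hm : MeasurableSet (p '' W) := by
    rw [e1]; exact measurableSet_source_inter_preimage x₀ hm1
  refine ⟨hm, ?_⟩
  have e2 : (Ξ x₀).target ∩ (Ξ x₀).symm ⁻¹' (p '' W) =
      (Ξ x₀ ∘ p) '' W := by
    ext z
    simp only [mem_image, mem_inter_iff, mem_preimage, Function.comp_apply]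
    constructor
    · rintro ⟨hz, w, hw, h⟩; exact ⟨w, hw, by rw [h, (Ξ x₀).right_inv hz]⟩
    · rintro ⟨w, hw, rfl⟩
      exact ⟨(Ξ x₀).map_source (hp w hw), w, hw,
        ((Ξ x₀).left_inv (hp w hw)).symm⟩
  rw [chartVol_apply x₀ hm, e2, lintegral_image_eq_lintegral_abs_det_fderiv_mul volume hW hf' hinj]
  refine setLIntegral_congr_fun hW fun z hz => ?_
  simp only [Function.comp_apply]
  rw [sqrt_det_gramOf' x₀ (hp z hz) (f' z) (u z) (hu z hz), ofReal_mul (abs_nonneg _)]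

lemma chartVol_eq_of_subset (x₁ : M) {A : Set M} (hA : MeasurableSet A)
    (h₀ : A ⊆ (Ξ x₀).source) (h₁ : A ⊆ (Ξ x₁).source) :
    chartVol I M.g x₀ A = chartVol I M.g x₁ A := by
  set W := (Ξ x₁).target ∩ (Ξ x₁).symm ⁻¹' A
  have hW : MeasurableSet W := measurableSet_target_inter_preimage x₁ hA
  have himg : (Ξ x₁).symm '' W = A := by
    ext x
    constructor
    · rintro ⟨z, hz, rfl⟩; exact hz.2
    · intro hx
      have hl := (Ξ x₁).left_inv (h₁ hx)
      exact ⟨Ξ x₁ x, ⟨(Ξ x₁).map_source (h₁ hx), by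
        rw [mem_preimage, hl]; exact hx⟩, hl⟩
  have key := (chartVol_image x₀ hW (fun z hz => h₀ hz.2)
    (f' := fun z => fderivWithin ℝ (Ξ x₀ ∘ (Ξ x₁).symm) (range I) z)
    (fun z hz => by
      have hr : W ⊆ range I := fun z hz => extChartAt_target_subset_range x₁ hz.1
      refine HasFDerivWithinAt.mono ?_ hr
      refine DifferentiableWithinAt.hasFDerivWithinAt ?_
      have h1 : MDifferentiableWithinAt 𝓘(ℝ, 𝔼 N) I (Ξ x₁).symm
        (range I) z := mdifferentiableWithinAt_extChartAt_symm hz.1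
      have h0 : MDifferentiableAt I 𝓘(ℝ, 𝔼 N) (Ξ x₀)
        ((Ξ x₁).symm z) :=
        mdifferentiableAt_extChartAt (by rw [← extChartAt_source I]; exact h₀ hz.2)
      exact (h0.comp_mdifferentiableWithinAt z h1).differentiableWithinAt)
    ((Ξ x₁).symm.injOn.mono fun z hz => hz.1)
    (fun z => coordVector I x₁ z) (fun z hz i => ?_)).2
  · rw [himg] at key
    rw [key, chartVol_apply x₁ hA]
    rfl
  · have hr := extChartAt_target_subset_range x₁ hz.1
    have h1 := mdifferentiableWithinAt_extChartAt_symm hz.1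
    have hu :=
      (I.uniqueDiffOn z hr).uniqueMDiffWithinAt
    have h0 : MDifferentiableAt I 𝓘(ℝ, 𝔼 N) (Ξ x₀)
        ((Ξ x₁).symm z) :=
      mdifferentiableAt_extChartAt (by rw [← extChartAt_source I]; exact h₀ hz.2)
    have h2 := mfderiv_comp_mfderivWithin z h0 h1 hu
    rw [mfderivWithin_eq_fderivWithin] at h2
    rw [h2]
    rfl

variable (M) in
lemma exists_chart_partition : ∃ (c : ℕ → M) (D : ℕ → Set M), (∀ i, MeasurableSet (D i)) ∧
    Pairwise (Function.onFun Disjoint D) ∧ (∀ i, D i ⊆ (Ξ (c i)).source) ∧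
    ⋃ i, D i = univ := by
  obtain ⟨s, hs, hsu⟩ := TopologicalSpace.countable_cover_nhds
    (fun x : M => extChartAt_source_mem_nhds (I := I) x)
  have hne : s.Nonempty := by
    by_contra h
    rw [not_nonempty_iff_eq_empty] at h
    have := (ConnectedSpace.toNonempty : Nonempty M)
    obtain ⟨x⟩ := this
    have hx := mem_univ x
    rw [← hsu, h] at hx
    simp at hx
  obtain ⟨c, hc⟩ := hs.exists_eq_range hne
  refine ⟨c, disjointed fun i => (Ξ (c i)).source,
    fun i => MeasurableSet.disjointed (fun i => measurableSet_extChartAt_source (c i)) i,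
    disjoint_disjointed _, fun i => disjointed_subset _ _, ?_⟩
  rw [iUnion_disjointed, ← hsu, hc, biUnion_range]

/-- On a chart domain, the Riemannian measure is given by the density in the chart. -/
lemma riemVol_apply {A : Set M} (hA : MeasurableSet A) (h : A ⊆ (Ξ x₀).source) :
    dV M A = chartVol I M.g x₀ A := by
  refine le_antisymm ?_ (Measure.le_iff'.mp (le_iSup (fun x => chartVol I M.g x) x₀) A)
  obtain ⟨c, D, hD, hdisj, hsub, hun⟩ := exists_chart_partition M
  set ν : Measure M := Measure.sum fun i => (chartVol I M.g (c i)).restrict (D i) with hν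
  have hle : dV M ≤ ν := by
    refine iSup_le fun x => Measure.le_iff.mpr fun B hB => ?_
    have hB' : B = ⋃ i, B ∩ D i := by rw [← inter_iUnion, hun, inter_univ]
    rw [hν, Measure.sum_apply _ hB]
    conv_lhs => rw [hB']
    refine (measure_iUnion_le _).trans (ENNReal.tsum_le_tsum fun i => ?_)
    rw [Measure.restrict_apply hB]
    have hm : MeasurableSet (B ∩ D i) := hB.inter (hD i)
    calc chartVol I M.g x (B ∩ D i)
        ≤ chartVol I M.g x ((B ∩ D i) ∩ (Ξ x).source) +
          chartVol I M.g x (Ξ x).sourceᶜ := by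
          refine (measure_mono ?_).trans (measure_union_le _ _)
          grind
      _ = chartVol I M.g (c i) ((B ∩ D i) ∩ (Ξ x).source) := by
          rw [chartVol_compl_source, add_zero]
          exact chartVol_eq_of_subset _ _ (hm.inter (measurableSet_extChartAt_source x))
            inter_subset_right (inter_subset_left.trans (inter_subset_right.trans (hsub i)))
      _ ≤ _ := measure_mono inter_subset_left
  refine (Measure.le_iff'.mp hle A).trans ?_
  rw [hν, Measure.sum_apply _ hA]
  have : ∀ i, ((chartVol I M.g (c i)).restrict (D i)) A = chartVol I M.g x₀ (A ∩ D i) := fun i => by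
    rw [Measure.restrict_apply hA]
    exact chartVol_eq_of_subset _ _ (hA.inter (hD i)) (inter_subset_right.trans (hsub i))
      (inter_subset_left.trans h)
  simp only [this]
  rw [← measure_iUnion (fun i j hij => ((hdisj hij).mono inter_subset_right inter_subset_right))
    (fun i => hA.inter (hD i)), ← inter_iUnion, hun, inter_univ]

lemma riemVol_scaleMetric {ε : ℝ} (hε : 0 < ε) :
    riemVol I (scaleMetric I ε M.g) = ofReal (ε ^ N) • dV M := by
  have h0 : ofReal (ε ^ N) ≠ 0 := by positivity
  have ht : ofReal (ε ^ N) ≠ ⊤ := ofReal_ne_top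
  have hc : ∀ x : M, chartVol I (scaleMetric I ε M.g) x =
      ofReal (ε ^ N) • chartVol I M.g x := fun x => by
    have hd : ∀ z, chartDensity I (scaleMetric I ε M.g) x z =
        ε ^ N * chartDensity I M.g x z := fun z => by
      have : (Matrix.of fun i j : Fin N => scaleMetric I ε M.g ((Ξ x).symm z)
          (coordVector I x z i) (coordVector I x z j)) = (ε ^ 2) • gram x z := by
        rfl
      rw [chartDensity, this, Matrix.det_smul, Fintype.card_fin, ← pow_mul, mul_comm 2 N, pow_mul,
        Real.sqrt_mul (sq_nonneg _), Real.sqrt_sq (by positivity), chartDensity_eq]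
    rw [chartVol, chartVol, ← Measure.map_smul, ← withDensity_smul' _ _ ht]
    congr 2
    funext z
    rw [hd, ofReal_mul (by positivity)]
    rfl
  rw [riemVol, riemVol]
  simp only [hc]
  refine le_antisymm (iSup_le fun x => ?_) ?_
  · exact Measure.le_iff.mpr fun A _ => by
      gcongr
      exact le_iSup (fun x => chartVol I M.g x) x
  · have : (⨆ x : M, chartVol I M.g x) ≤ (ofReal (ε ^ N))⁻¹ •
        ⨆ x : M, ofReal (ε ^ N) • chartVol I M.g x := by
      refine iSup_le fun x => Measure.le_iff.mpr fun A _ => ?_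
      have := Measure.le_iff'.mp
        (le_iSup (fun x => ofReal (ε ^ N) • chartVol I M.g x) x) A
      simp at this ⊢
      rwa [← ENNReal.div_eq_inv_mul, ENNReal.le_div_iff_mul_le (Or.inl h0) (Or.inl ht), mul_comm] 
    refine Measure.le_iff.mpr fun A _ => ?_
    have := Measure.le_iff'.mp this A
    simp at this ⊢
    rwa [← ENNReal.div_eq_inv_mul, ENNReal.le_div_iff_mul_le (Or.inl h0) (Or.inl ht), mul_comm] at this

lemma lintegral_riemVol_restrict {A : Set M} (hA : MeasurableSet A)
    (h : A ⊆ (Ξ x₀).source) {F : M → ℝ≥0∞} (hF : Measurable F) :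
    ∫⁻ x in A, F x ∂dV M =
      ∫⁻ z in (Ξ x₀).target ∩ (Ξ x₀).symm ⁻¹' A,
        ofReal (chartDensity I M.g x₀ z) * F ((Ξ x₀).symm z) := by
  have h1 : (dV M).restrict A = (chartVol I M.g x₀).restrict A := by
    ext B hB
    rw [Measure.restrict_apply hB, Measure.restrict_apply hB]
    exact riemVol_apply x₀ (hB.inter hA) (inter_subset_right.trans h)
  rw [h1, ← lintegral_indicator hA, lintegral_chartVol x₀ (hF.indicator hA),
    ← Measure.restrict_restrict_of_subset (inter_subset_left),
    ← lintegral_indicator (measurableSet_target_inter_preimage x₀ hA)]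
  refine setLIntegral_congr_fun (measurableSet_extChartAt_target x₀) fun z hz => ?_
  by_cases hzA : (Ξ x₀).symm z ∈ A
  · simp_all
  simp_all

instance : IsLocallyFiniteMeasure (dV M) where
  finiteAtNhds x₀ := by
    have hc : ContinuousWithinAt (chartDensity I M.g x₀) (Ξ x₀).target
      (Ξ x₀ x₀) := continuousOn_chartDensity x₀ _ (mem_extChartAt_target x₀)
    have hev := hc.eventually_lt_const (lt_add_one (chartDensity I M.g x₀ (Ξ x₀ x₀)))
    set C := chartDensity I M.g x₀ (Ξ x₀ x₀) + 1
    obtain ⟨r, hr, hball⟩ := Metric.mem_nhdsWithin_iff.mp hev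
    set A := (Ξ x₀).source ∩ Ξ x₀ ⁻¹' Metric.ball (Ξ x₀ x₀) r
    have hA : MeasurableSet A := measurableSet_source_inter_preimage x₀ Metric.isOpen_ball.measurableSet
    refine ⟨A, (continuousOn_extChartAt x₀).isOpen_inter_preimage (isOpen_extChartAt_source x₀)
      Metric.isOpen_ball |>.mem_nhds ⟨mem_extChartAt_source x₀, Metric.mem_ball_self hr⟩, ?_⟩
    rw [riemVol_apply x₀ hA inter_subset_left, chartVol_apply x₀ hA]
    have hsub : (Ξ x₀).target ∩ (Ξ x₀).symm ⁻¹' A ⊆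
        Metric.ball (Ξ x₀ x₀) r ∩ (Ξ x₀).target := by
      rintro z ⟨hz, hzA⟩
      refine ⟨?_, hz⟩
      have := hzA.2
      rwa [mem_preimage, (Ξ x₀).right_inv hz] at this
    calc ∫⁻ z in (Ξ x₀).target ∩ (Ξ x₀).symm ⁻¹' A,
          ofReal (chartDensity I M.g x₀ z)
        ≤ ∫⁻ z in (Ξ x₀).target ∩ (Ξ x₀).symm ⁻¹' A, ofReal C :=
          setLIntegral_mono' (measurableSet_target_inter_preimage x₀ hA)
            fun z hz => ofReal_le_ofReal (hball (hsub hz)).le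
      _ = ofReal C * volume ((Ξ x₀).target ∩ (Ξ x₀).symm ⁻¹' A) := by
          rw [setLIntegral_const]
      _ < ⊤ := ENNReal.mul_lt_top ofReal_lt_top
          ((measure_mono (hsub.trans inter_subset_left)).trans_lt measure_ball_lt_top)

instance : IsFiniteMeasure (dV M) := by infer_instance

lemma exists_isOpen_subset_target_inter {U : Set M} (hU : IsOpen U) (hx : x₀ ∈ U) :
    ∃ O : Set (𝔼 N), IsOpen O ∧ O.Nonempty ∧
      O ⊆ (Ξ x₀).target ∩ (Ξ x₀).symm ⁻¹' U := by
  have h1 : (Ξ x₀).target ∩ (Ξ x₀).symm ⁻¹' U ∈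
      𝓝[range I] (Ξ x₀ x₀) := by
    refine inter_mem (extChartAt_target_mem_nhdsWithin x₀) ?_
    have := (continuousAt_extChartAt_symm (I := I) x₀).preimage_mem_nhds
      (by rw [extChartAt_to_inv]; exact hU.mem_nhds hx)
    exact mem_nhdsWithin_of_mem_nhds this
  obtain ⟨V, hV, hzV, hsub⟩ := mem_nhdsWithin.mp h1
  have hcl := I.range_subset_closure_interior (extChartAt_target_subset_range x₀ (mem_extChartAt_target x₀))
  obtain ⟨w, hw1, hw2⟩ := mem_closure_iff.mp hcl V hV hzV
  exact ⟨V ∩ interior (range I), hV.inter isOpen_interior, ⟨w, hw1, hw2⟩,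
    (inter_subset_inter_right _ interior_subset).trans hsub⟩

instance : Measure.IsOpenPosMeasure (dV M) where
  open_pos U hU hne := by
    obtain ⟨x₀, hx⟩ := hne
    intro h0
    set A := U ∩ (Ξ x₀).source
    have hAo : IsOpen A := hU.inter (isOpen_extChartAt_source x₀)
    have h1 : dV M A = 0 := measure_mono_null inter_subset_left h0
    rw [riemVol_apply x₀ hAo.measurableSet inter_subset_right,
      chartVol_apply x₀ hAo.measurableSet] at h1
    obtain ⟨O, hO, hOne, hOsub⟩ := exists_isOpen_subset_target_inter x₀ hAo
      ⟨hx, mem_extChartAt_source x₀⟩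
    have h2 :=
      le_antisymm ((lintegral_mono_set hOsub).trans_eq h1) (zero_le)
    have hae :=
      (aemeasurable_chartDensity x₀).mono_measure
        (Measure.restrict_mono (hOsub.trans inter_subset_left) le_rfl)
    rw [lintegral_eq_zero_iff' hae] at h2
    have h3 : ∀ᵐ z ∂(volume.restrict O), False := by
      filter_upwards [h2, ae_restrict_mem hO.measurableSet] with z hz hzO
      have := chartDensity_pos x₀ (hOsub hzO).1
      simp at hz
      bound
    have h4 : volume O = 0 := by
      simp_all
    exact (hO.measure_pos volume hOne).ne' h4

lemma riemVol_univ_pos : 0 < dV M univ := by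
  exact isOpen_univ.measure_pos _ univ_nonempty

end Volume

section Collar

/-- The splitting of the first coordinate. -/
def splitFirst (k : ℕ) : EuclideanSpace ℝ (Fin (k + 1)) ≃ᵐ ℝ × 𝔼 k :=
  ((MeasurableEquiv.toLp 2 (Fin (k + 1) → ℝ)).symm.trans
    (MeasurableEquiv.piFinSuccAbove (fun _ => ℝ) 0)).trans
    ((MeasurableEquiv.refl ℝ).prodCongr (MeasurableEquiv.toLp 2 (Fin k → ℝ)))

lemma splitFirst_apply {k : ℕ} (z : EuclideanSpace ℝ (Fin (k + 1))) :
    splitFirst k z = (z 0, WithLp.toLp 2 fun i => z i.succ) := rfl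

lemma measurePreserving_splitFirst (k : ℕ) : MeasurePreserving (splitFirst k) := by
  refine ((EuclideanSpace.volume_preserving_symm_measurableEquiv_toLp _).trans
    (volume_preserving_piFinSuccAbove (fun _ => ℝ) 0)).trans ?_
  exact (MeasurePreserving.id _).prod (PiLp.volume_preserving_toLp _)

/-- The splitting of the first coordinate as a continuous linear map. -/
def splitFirstL (k : ℕ) : EuclideanSpace ℝ (Fin (k + 1)) →L[ℝ] ℝ × 𝔼 k :=
  LinearMap.toContinuousLinearMap
    { toFun := fun z => (z 0, WithLp.toLp 2 fun i => z i.succ)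
      map_add' := fun z w => by ext <;> simp
      map_smul' := fun c z => by ext <;> simp }

lemma splitFirstL_apply {k : ℕ} (z : EuclideanSpace ℝ (Fin (k + 1))) :
    splitFirstL k z = splitFirst k z := rfl

lemma splitFirst_single_zero (k : ℕ) :
    splitFirstL k (EuclideanSpace.single 0 1) = (1, 0) := by
  rw [splitFirstL_apply, splitFirst_apply]
  ext i <;> simp [Fin.succ_ne_zero]

lemma splitFirst_single_succ {k : ℕ} (i : Fin k) :
    splitFirstL k (EuclideanSpace.single i.succ 1) = (0, EuclideanSpace.single i 1) := by
  rw [splitFirstL_apply, splitFirst_apply]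
  ext j
  · simp [(Fin.succ_ne_zero _).symm]
  · simp

variable {k : ℕ} {Y : RiemMfd.{u} (𝓡 k)} {X : RiemMfd.{u} (𝓑 k)} {ℓ : ℝ}

/-- A cylindrical end. -/
structure IsCollar (ℓ : ℝ) (κ : ℝ × Y → X) : Prop where
  smooth : ContMDiffOn (𝓘(ℝ, ℝ).prod (𝓡 k)) (𝓑 k) ∞ κ (Ico 0 ℓ ×ˢ univ)
  inj : InjOn κ (Ico 0 ℓ ×ˢ univ)
  isometry : ∀ t ∈ Ico 0 ℓ, ∀ (y : Y) (τ τ' : ℝ) (ξ ξ' : TangentSpace (𝓡 k) y),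
    X.g (κ (t, y))
      (mfderivWithin (𝓘(ℝ, ℝ).prod (𝓡 k)) (𝓑 k) κ (Ico 0 ℓ ×ˢ univ) (t, y)
        ((τ, ξ) : ℝ × 𝔼 k))
      (mfderivWithin (𝓘(ℝ, ℝ).prod (𝓡 k)) (𝓑 k) κ (Ico 0 ℓ ×ˢ univ) (t, y)
        ((τ', ξ') : ℝ × 𝔼 k)) =
      τ * τ' + Y.g y ξ ξ'

variable {κ : ℝ × Y → X}

lemma measurableSet_chart_prod (y₀ : Y) {B : Set (ℝ × Y)} (hB : MeasurableSet B) :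
    MeasurableSet {p : ℝ × 𝔼 k | p.2 ∈ (extChartAt (𝓡 k) y₀).target ∧
      (p.1, (extChartAt (𝓡 k) y₀).symm p.2) ∈ B} := by
  have hT : MeasurableSet ((univ : Set ℝ) ×ˢ (extChartAt (𝓡 k) y₀).target) :=
    MeasurableSet.univ.prod (measurableSet_extChartAt_target y₀)
  have hc : ContinuousOn (fun p : ℝ × 𝔼 k =>
      (p.1, (extChartAt (𝓡 k) y₀).symm p.2)) ((univ : Set ℝ) ×ˢ (extChartAt (𝓡 k) y₀).target) :=
    continuousOn_fst.prodMk
      ((continuousOn_extChartAt_symm y₀).comp continuousOn_snd fun p hp => hp.2)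
  have h := hc.domRestrict.measurable hB
  have h2 := (MeasurableEmbedding.subtype_coe hT).measurableSet_image.mpr h
  convert h2 using 1
  ext p
  simp only [mem_ofPred_eq, mem_preimage, mem_image, Subtype.exists, Set.domRestrict_apply]
  constructor
  · rintro ⟨h1, h2⟩; exact ⟨p, ⟨mem_univ _, h1⟩, h2, rfl⟩
  · rintro ⟨w, h1, h2, rfl⟩; exact ⟨h1.2, h2⟩

lemma prod_riemVol_apply (y₀ : Y) {B : Set (ℝ × Y)} (hB : MeasurableSet B)
    (hs : ∀ p ∈ B, p.2 ∈ (extChartAt (𝓡 k) y₀).source) :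
    ((volume : Measure ℝ).prod (riemVol (𝓡 k) Y.g)) B =
      ∫⁻ z in splitFirst k ⁻¹' {p | p.2 ∈ (extChartAt (𝓡 k) y₀).target ∧
        (p.1, (extChartAt (𝓡 k) y₀).symm p.2) ∈ B},
        ofReal (chartDensity (𝓡 k) Y.g y₀ (splitFirst k z).2) := by
  set W := {p : ℝ × 𝔼 k | p.2 ∈ (extChartAt (𝓡 k) y₀).target ∧
      (p.1, (extChartAt (𝓡 k) y₀).symm p.2) ∈ B} with hWdef
  have hW : MeasurableSet W := measurableSet_chart_prod y₀ hB
  have e1 := (measurePreserving_splitFirst k).setLIntegral_comp_preimage_emb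
    (splitFirst k).measurableEmbedding
    (fun p => ofReal (chartDensity (𝓡 k) Y.g y₀ p.2)) W
  rw [e1, Measure.prod_apply hB, ← lintegral_indicator hW]
  have hmeas : AEMeasurable (W.indicator fun p : ℝ × 𝔼 k =>
      ofReal (chartDensity (𝓡 k) Y.g y₀ p.2))
      ((volume : Measure ℝ).prod (volume : Measure (𝔼 k))) := by
    rw [aemeasurable_indicator_iff hW]
    refine (ContinuousOn.aemeasurable ?_ hW).ennreal_ofReal
    exact (continuousOn_chartDensity y₀).comp continuousOn_snd fun p hp => hp.1
  rw [Measure.volume_eq_prod, lintegral_prod _ hmeas]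
  refine lintegral_congr fun t => ?_
  have hBt : MeasurableSet (Prod.mk t ⁻¹' B) := measurable_prodMk_left hB
  rw [riemVol_apply y₀ hBt (fun y hy => hs _ hy), chartVol_apply y₀ hBt,
    ← lintegral_indicator (measurableSet_target_inter_preimage y₀ hBt)]
  rfl

lemma det_gramOf_succ {x : X} {y : Y} {v : Fin k → TangentSpace (𝓡 k) y}
    {u : Fin (k + 1) → TangentSpace (𝓑 k) x}
    (h0 : X.g x (u 0) (u 0) = 1) (h1 : ∀ i : Fin k, X.g x (u 0) (u i.succ) = 0)
    (h2 : ∀ i j : Fin k, X.g x (u i.succ) (u j.succ) = Y.g y (v i) (v j)) :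
    (gramOf u).det = (gramOf v).det := by
  rw [Matrix.det_succ_row_zero, Fin.sum_univ_succ, sum_eq_zero]
  · have : (gramOf u).submatrix Fin.succ (Fin.succAbove 0) = gramOf v := by
      ext i j
      simp [gramOf, h2]
    rw [this]
    simp [gramOf, h0]
  · intro i _
    simp [gramOf, h1]

lemma riemVol_collar_image_aux (hκ : IsCollar ℓ κ) (y₀ : Y) (x₀ : X) {B : Set (ℝ × Y)}
    (hB : MeasurableSet B) (hBℓ : B ⊆ Ico 0 ℓ ×ˢ univ)
    (hs : ∀ p ∈ B, p.2 ∈ (extChartAt (𝓡 k) y₀).source)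
    (hx : ∀ p ∈ B, κ p ∈ (extChartAt (𝓑 k) x₀).source) :
    MeasurableSet (κ '' B) ∧ riemVol (𝓑 k) X.g (κ '' B) =
      ((volume : Measure ℝ).prod (riemVol (𝓡 k) Y.g)) B := by
  set W := splitFirst k ⁻¹' {p : ℝ × 𝔼 k |
      p.2 ∈ (extChartAt (𝓡 k) y₀).target ∧ (p.1, (extChartAt (𝓡 k) y₀).symm p.2) ∈ B} with hWdef
  have hW : MeasurableSet W := (splitFirst k).measurable (measurableSet_chart_prod y₀ hB)
  set q : EuclideanSpace ℝ (Fin (k + 1)) → ℝ × Y :=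
    fun z => ((splitFirst k z).1, (extChartAt (𝓡 k) y₀).symm (splitFirst k z).2) with hq
  have hqW : q '' W = B := by
    ext ⟨t, y⟩
    constructor
    · rintro ⟨z, hz, h⟩; rw [← h]; exact hz.2
    · intro hty
      have hl := (extChartAt (𝓡 k) y₀).left_inv (hs _ hty)
      refine ⟨(splitFirst k).symm (t, extChartAt (𝓡 k) y₀ y), ?_, ?_⟩
      · simp only [hWdef, mem_preimage, MeasurableEquiv.apply_symm_apply, mem_ofPred_eq]
        exact ⟨(extChartAt (𝓡 k) y₀).map_source (hs _ hty), by rw [hl]; exact hty⟩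
      · simp only [hq, MeasurableEquiv.apply_symm_apply]
        rw [hl]
  have hqinj : InjOn q W := by
    intro a ha b hb hab
    simp only [hq, Prod.mk.injEq] at hab
    exact (splitFirst k).injective (Prod.ext hab.1
      ((extChartAt (𝓡 k) y₀).symm.injOn ha.1 hb.1 hab.2))
  have hqder : ∀ z ∈ W, HasMFDerivWithinAt 𝓘(ℝ, EuclideanSpace ℝ (Fin (k + 1)))
      (𝓘(ℝ, ℝ).prod (𝓡 k)) q W z
      (((ContinuousLinearMap.fst ℝ ℝ (𝔼 k)) ∘L splitFirstL k).prod
        ((mfderivWithin 𝓘(ℝ, 𝔼 k) (𝓡 k) (extChartAt (𝓡 k) y₀).symm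
          (range (𝓡 k)) (splitFirst k z).2) ∘L
          ((ContinuousLinearMap.snd ℝ ℝ (𝔼 k)) ∘L splitFirstL k))) := by
    intro z hz
    refine HasMFDerivWithinAt.prodMk ?_ ?_
    · exact ((ContinuousLinearMap.fst ℝ ℝ (𝔼 k)) ∘L
        splitFirstL k).hasMFDerivWithinAt
    · have h1 : MDifferentiableWithinAt 𝓘(ℝ, 𝔼 k) (𝓡 k)
        (extChartAt (𝓡 k) y₀).symm (range (𝓡 k)) (splitFirst k z).2 :=
        mdifferentiableWithinAt_extChartAt_symm hz.1
      have h2 : HasMFDerivWithinAt 𝓘(ℝ, EuclideanSpace ℝ (Fin (k + 1)))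
          𝓘(ℝ, 𝔼 k) (fun z => (splitFirst k z).2) W z
          ((ContinuousLinearMap.snd ℝ ℝ (𝔼 k)) ∘L splitFirstL k) :=
        ((ContinuousLinearMap.snd ℝ ℝ
          (𝔼 k)) ∘L splitFirstL k).hasMFDerivWithinAt
      exact HasMFDerivWithinAt.comp (u := range (𝓡 k)) z h1.hasMFDerivWithinAt h2
        (fun w hw => extChartAt_target_subset_range y₀ hw.1)
  have hκder : ∀ z ∈ W, HasMFDerivWithinAt (𝓘(ℝ, ℝ).prod (𝓡 k)) (𝓑 k) κ
      (Ico 0 ℓ ×ˢ univ) (q z) (mfderivWithin (𝓘(ℝ, ℝ).prod (𝓡 k)) (𝓑 k) κ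
      (Ico 0 ℓ ×ˢ univ) (q z)) := fun z hz =>
    ((hκ.smooth (q z) (hBℓ hz.2)).mdifferentiableWithinAt (by simp)).hasMFDerivWithinAt
  have heder : ∀ z ∈ W, HasMFDerivAt (𝓑 k) 𝓘(ℝ, EuclideanSpace ℝ (Fin (k + 1)))
      (extChartAt (𝓑 k) x₀) (κ (q z)) (mfderiv (𝓑 k)
        𝓘(ℝ, EuclideanSpace ℝ (Fin (k + 1))) (extChartAt (𝓑 k) x₀) (κ (q z))) := fun z hz =>
    (mdifferentiableAt_extChartAt
      (by rw [← extChartAt_source (𝓑 k)]; exact hx _ hz.2)).hasMFDerivAt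
  set u : ∀ z, Fin (k + 1) → TangentSpace (𝓑 k) (κ (q z)) := fun z i =>
    mfderivWithin (𝓘(ℝ, ℝ).prod (𝓡 k)) (𝓑 k) κ (Ico 0 ℓ ×ˢ univ) (q z)
      ((((ContinuousLinearMap.fst ℝ ℝ (𝔼 k)) ∘L splitFirstL k).prod
        ((mfderivWithin 𝓘(ℝ, 𝔼 k) (𝓡 k) (extChartAt (𝓡 k) y₀).symm
          (range (𝓡 k)) (splitFirst k z).2) ∘L
          ((ContinuousLinearMap.snd ℝ ℝ (𝔼 k)) ∘L splitFirstL k)))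
        (EuclideanSpace.single i 1)) with hu
  have key := chartVol_image x₀ hW (p := κ ∘ q) (fun z hz => hx _ hz.2)
    (f' := fun z => (mfderiv (𝓑 k) 𝓘(ℝ, EuclideanSpace ℝ (Fin (k + 1)))
        (extChartAt (𝓑 k) x₀) (κ (q z))) ∘L
      ((mfderivWithin (𝓘(ℝ, ℝ).prod (𝓡 k)) (𝓑 k) κ (Ico 0 ℓ ×ˢ univ) (q z)) ∘L
      (((ContinuousLinearMap.fst ℝ ℝ (𝔼 k)) ∘L splitFirstL k).prod
        ((mfderivWithin 𝓘(ℝ, 𝔼 k) (𝓡 k) (extChartAt (𝓡 k) y₀).symm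
          (range (𝓡 k)) (splitFirst k z).2) ∘L
          ((ContinuousLinearMap.snd ℝ ℝ (𝔼 k)) ∘L splitFirstL k)))))
    (fun z hz => by
      have := (heder z hz).comp_hasMFDerivWithinAt z ((hκder z hz).comp z (hqder z hz)
        (fun w hw => hBℓ hw.2))
      exact this.hasFDerivWithinAt)
    (fun a ha b hb hab => hqinj ha hb (hκ.inj (hBℓ ha.2) (hBℓ hb.2) hab))
    u (fun z hz i => rfl)
  rw [image_comp, hqW] at key
  refine ⟨key.1, ?_⟩
  rw [riemVol_apply x₀ key.1 (image_subset_iff.mpr hx), key.2, prod_riemVol_apply y₀ hB hs]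
  refine setLIntegral_congr_fun hW fun z hz => ?_
  have h0 : u z 0 = mfderivWithin (𝓘(ℝ, ℝ).prod (𝓡 k)) (𝓑 k) κ (Ico 0 ℓ ×ˢ univ) (q z)
      (((1 : ℝ), (0 : 𝔼 k)) : ℝ × 𝔼 k) := by
    refine congrArg (fun w : ℝ × 𝔼 k => mfderivWithin (𝓘(ℝ, ℝ).prod (𝓡 k))
      (𝓑 k) κ (Ico 0 ℓ ×ˢ univ) (q z) w) ?_
    refine Prod.ext (show (splitFirstL k (EuclideanSpace.single 0 1)).1 = 1 by
      rw [splitFirst_single_zero]) ?_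
    refine (congrArg (fun p : ℝ × 𝔼 k =>
      mfderivWithin 𝓘(ℝ, 𝔼 k) (𝓡 k) (extChartAt (𝓡 k) y₀).symm
          (range (𝓡 k)) (splitFirst k z).2 p.2) (splitFirst_single_zero k)).trans ?_
    exact map_zero (mfderivWithin 𝓘(ℝ, 𝔼 k) (𝓡 k) (extChartAt (𝓡 k) y₀).symm
          (range (𝓡 k)) (splitFirst k z).2)
  have hsucc : ∀ i : Fin k, u z i.succ = mfderivWithin (𝓘(ℝ, ℝ).prod (𝓡 k)) (𝓑 k) κ
      (Ico 0 ℓ ×ˢ univ) (q z)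
      (((0 : ℝ), coordVector (𝓡 k) y₀ (splitFirst k z).2 i) : ℝ × 𝔼 k) := by
    intro i
    refine congrArg (fun w : ℝ × 𝔼 k => mfderivWithin (𝓘(ℝ, ℝ).prod (𝓡 k))
      (𝓑 k) κ (Ico 0 ℓ ×ˢ univ) (q z) w) ?_
    refine Prod.ext (show (splitFirstL k (EuclideanSpace.single i.succ 1)).1 = 0 by
      rw [splitFirst_single_succ]) ?_
    exact congrArg (fun p : ℝ × 𝔼 k =>
      mfderivWithin 𝓘(ℝ, 𝔼 k) (𝓡 k) (extChartAt (𝓡 k) y₀).symm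
          (range (𝓡 k)) (splitFirst k z).2 p.2) (splitFirst_single_succ i)
  have hg0 : ∀ ξ : TangentSpace (𝓡 k) (q z).2, Y.g (q z).2 0 ξ = 0 := fun ξ => by
    rw [map_zero]; rfl
  have hd := det_gramOf_succ (u := u z) (v := coordVector (𝓡 k) y₀ (splitFirst k z).2)
    (by
      rw [h0]
      refine (hκ.isometry _ (hBℓ hz.2).1 _ _ _ _ _).trans ?_
      exact (congrArg (fun t : ℝ => 1 * 1 + t) (hg0 _)).trans (by norm_num))
    (fun i => by
      rw [h0, hsucc]
      refine (hκ.isometry _ (hBℓ hz.2).1 _ _ _ _ _).trans ?_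
      exact (congrArg (fun t : ℝ => 1 * 0 + t) (hg0 _)).trans (by norm_num))
    (fun i j => by
      rw [hsucc, hsucc]
      refine (hκ.isometry _ (hBℓ hz.2).1 _ _ _ _ _).trans ?_
      simp)
  simp only [Function.comp_apply]
  rw [hd]
  rfl

lemma riemVol_collar_image (hκ : IsCollar ℓ κ) {B : Set (ℝ × Y)}
    (hB : MeasurableSet B) (hBℓ : B ⊆ Ico 0 ℓ ×ˢ univ) :
    riemVol (𝓑 k) X.g (κ '' B) = ((volume : Measure ℝ).prod (riemVol (𝓡 k) Y.g)) B := by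
  obtain ⟨c, D, hD, hdisj, hsub, hun⟩ := exists_chart_partition Y
  obtain ⟨c', D', hD', hdisj', hsub', hun'⟩ := exists_chart_partition X
  have hS : MeasurableSet ((Ico 0 ℓ : Set ℝ) ×ˢ (univ : Set Y)) :=
    measurableSet_Ico.prod MeasurableSet.univ
  set P : ℕ × ℕ → Set (ℝ × Y) := fun i => B ∩ ({p | p.2 ∈ D i.1 ∧ κ p ∈ D' i.2}) with hP
  have hPm : ∀ i, MeasurableSet (P i) := fun i => by
    have h1 := hκ.smooth.continuousOn.domRestrict.measurable (hD' i.2)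
    have h2 := (MeasurableEmbedding.subtype_coe hS).measurableSet_image.mpr h1
    have h3 : P i = B ∩ (Prod.snd ⁻¹' D i.1 ∩
        (Subtype.val '' (domRestrict (Ico 0 ℓ ×ˢ univ) κ ⁻¹' D' i.2))) := by
      ext p
      simp only [hP, mem_inter_iff, mem_ofPred_eq, mem_preimage, mem_image, Subtype.exists,
        Set.domRestrict_apply]
      constructor
      · rintro ⟨a, b, c⟩; exact ⟨a, b, p, hBℓ a, c, rfl⟩
      · rintro ⟨a, b, p', _, c, rfl⟩; exact ⟨a, b, c⟩
    rw [h3]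
    exact hB.inter ((measurable_snd (hD i.1)).inter h2)
  have hPd : Pairwise (Function.onFun Disjoint P) := by
    rintro ⟨i, j⟩ ⟨i', j'⟩ hij
    refine Set.disjoint_left.mpr fun p hp hp' => hij ?_
    have h1 : i = i' := by
      by_contra h
      exact Set.disjoint_left.mp (hdisj h) hp.2.1 hp'.2.1
    have h2 : j = j' := by
      by_contra h
      exact Set.disjoint_left.mp (hdisj' h) hp.2.2 hp'.2.2
    rw [h1, h2]
  have hPu : B = ⋃ i, P i := by
    ext p
    simp only [mem_iUnion]
    constructor
    · intro hp
      obtain ⟨i, hi⟩ := mem_iUnion.mp (hun.symm ▸ mem_univ p.2 : p.2 ∈ ⋃ i, D i)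
      obtain ⟨j, hj⟩ := mem_iUnion.mp (hun'.symm ▸ mem_univ (κ p) : κ p ∈ ⋃ i, D' i)
      exact ⟨(i, j), hp, hi, hj⟩
    · rintro ⟨i, hi⟩; exact hi.1
  have haux := fun i => riemVol_collar_image_aux hκ (c i.1) (c' i.2) (hPm i)
    (inter_subset_left.trans hBℓ) (fun p hp => hsub _ hp.2.1) (fun p hp => hsub' _ hp.2.2)
  conv_lhs => rw [hPu, image_iUnion]
  conv_rhs => rw [hPu]
  rw [measure_iUnion hPd hPm, measure_iUnion _ fun i => (haux i).1]
  · exact tsum_congr fun i => (haux i).2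
  · intro i j hij
    refine Set.disjoint_left.mpr ?_
    rintro x ⟨p, hp, rfl⟩ ⟨p', hp', h⟩
    have := hκ.inj (hBℓ hp'.1) (hBℓ hp.1) h
    subst this
    exact Set.disjoint_left.mp (hPd hij) hp hp'

lemma aemeasurable_collar (hκ : IsCollar ℓ κ) :
    AEMeasurable κ (((volume : Measure ℝ).prod (riemVol (𝓡 k) Y.g)).restrict (Ico 0 ℓ ×ˢ univ)) :=
  hκ.smooth.continuousOn.aemeasurable (measurableSet_Ico.prod MeasurableSet.univ)

/-- The cylindrical ends embed isometrically, hence with their measure. -/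
lemma map_collar_le (hκ : IsCollar ℓ κ) :
    (((volume : Measure ℝ).prod (riemVol (𝓡 k) Y.g)).restrict (Ico 0 ℓ ×ˢ univ)).map κ ≤
      riemVol (𝓑 k) X.g := by
  have hS : MeasurableSet ((Ico 0 ℓ : Set ℝ) ×ˢ (univ : Set Y)) :=
    measurableSet_Ico.prod MeasurableSet.univ
  refine Measure.le_iff.mpr fun A hA => ?_
  have h1 := hκ.smooth.continuousOn.domRestrict.measurable hA
  have h2 := (MeasurableEmbedding.subtype_coe hS).measurableSet_image.mpr h1
  have h3 : κ ⁻¹' A ∩ Ico 0 ℓ ×ˢ univ =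
      (Subtype.val '' (domRestrict (Ico 0 ℓ ×ˢ univ) κ ⁻¹' A)) := by
    ext p
    simp only [mem_inter_iff, mem_preimage, mem_image, Subtype.exists, Set.domRestrict_apply]
    constructor
    · rintro ⟨a, b⟩; exact ⟨p, b, a, rfl⟩
    · rintro ⟨p', b, c, rfl⟩; exact ⟨c, b⟩
  rw [Measure.map_apply_of_aemeasurable (aemeasurable_collar hκ) hA, Measure.restrict_apply' hS,
    ← riemVol_collar_image hκ (h3 ▸ h2) inter_subset_right]
  refine measure_mono ?_
  rintro x ⟨p, hp, rfl⟩
  exact hp.1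

lemma lintegral_collar_le (hκ : IsCollar ℓ κ) {F : X → ℝ≥0∞} (hF : Measurable F) :
    ∫⁻ p in Ico 0 ℓ ×ˢ univ, F (κ p) ∂((volume : Measure ℝ).prod (riemVol (𝓡 k) Y.g)) ≤
      ∫⁻ x, F x ∂riemVol (𝓑 k) X.g := by
  rw [← lintegral_map' hF.aemeasurable (aemeasurable_collar hκ)]
  exact lintegral_mono' (map_collar_le hκ) le_rfl

/-- The boundary component at the bottom of a cylindrical end is a null set. -/
lemma riemVol_collar_boundary (hκ : IsCollar ℓ κ) (hℓ : 0 < ℓ) :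
    riemVol (𝓑 k) X.g (range fun y => κ (0, y)) = 0 := by
  have h : (range fun y => κ (0, y)) = κ '' (({0} : Set ℝ) ×ˢ (univ : Set Y)) := by
    ext x
    simp
  rw [h, riemVol_collar_image hκ ((measurableSet_singleton 0).prod MeasurableSet.univ)
    (prod_mono_left (by simpa using hℓ)), Measure.prod_prod]
  simp

end Collar

section Poincare

lemma lintegral_sq_le {α : Type*} [MeasurableSpace α] (μ : Measure α) {f : α → ℝ≥0∞}
    (hf : AEMeasurable f μ) : (∫⁻ x, f x ∂μ) ^ 2 ≤ μ univ * ∫⁻ x, f x ^ 2 ∂μ := by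
  have h := ENNReal.lintegral_mul_le_Lp_mul_Lq μ Real.HolderConjugate.two_two hf
    (aemeasurable_const (b := (1 : ℝ≥0∞)))
  simp only [Pi.mul_apply, mul_one, ENNReal.one_rpow, lintegral_const, one_mul] at h
  have h2 : (∫⁻ x, f x ∂μ) ^ 2 ≤ ((∫⁻ a, f a ^ (2 : ℝ) ∂μ) ^ (1 / (2 : ℝ)) *
      (μ univ) ^ (1 / (2 : ℝ))) ^ 2 := by gcongr
  refine h2.trans_eq ?_
  have e : ∀ a : ℝ≥0∞, (a ^ (1 / (2 : ℝ))) ^ 2 = a := fun a => by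
    rw [← ENNReal.rpow_natCast, ← ENNReal.rpow_mul]; norm_num
  rw [mul_pow, e, e, mul_comm]
  simp

lemma enorm_sq_add_le (a b : ℂ) : ‖a + b‖ₑ ^ 2 ≤ 2 * (‖a‖ₑ ^ 2 + ‖b‖ₑ ^ 2) := by
  have h : ‖a + b‖₊ ^ 2 ≤ 2 * (‖a‖₊ ^ 2 + ‖b‖₊ ^ 2) := by
    have h1 := nnnorm_add_le a b
    nlinarith [norm_nonneg (a + b), sq_nonneg (‖a‖ - ‖b‖), norm_nonneg a, norm_nonneg b]
  simp only [enorm_eq_nnnorm]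
  exact_mod_cast h

variable {E : Type*} [NormedAddCommGroup E] [NormedSpace ℝ E] [FiniteDimensional ℝ E]
  [MeasurableSpace E] [BorelSpace E] (μ : Measure E) [μ.IsAddHaarMeasure]

lemma lintegral_comp_smul_add (G : E → ℝ≥0∞) (hG : Measurable G) {t : ℝ} (ht : t ≠ 0) (c : E) :
    ∫⁻ x, G (t • x + c) ∂μ =
      ofReal |(t ^ Module.finrank ℝ E)⁻¹| * ∫⁻ x, G x ∂μ := by
  have h1 : ∫⁻ x, G (t • x + c) ∂μ = ∫⁻ w, G (w + c) ∂(μ.map (t • ·)) := by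
    rw [lintegral_map (f := fun w => G (w + c)) (hG.comp (measurable_add_const c))
      (measurable_const_smul t)]
  rw [h1, Measure.map_addHaar_smul μ ht, lintegral_smul_measure, lintegral_add_right_eq_self]
  rfl

lemma lintegral_segment_le (G : E → ℝ≥0∞) (hG : Measurable G) (K : Set E) {t : ℝ}
    (ht : 1 / 2 ≤ t) (c : E) : ∫⁻ x in K, G (t • x + c) ∂μ ≤
      2 ^ Module.finrank ℝ E * ∫⁻ x, G x ∂μ := by
  have ht0 : 0 < t := by linarith
  refine (setLIntegral_le_lintegral _ _).trans ?_
  rw [lintegral_comp_smul_add μ G hG ht0.ne' c]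
  gcongr
  have : |(t ^ Module.finrank ℝ E)⁻¹| ≤ 2 ^ Module.finrank ℝ E := by
    rw [abs_of_pos (by positivity), ← inv_pow]
    gcongr
    rw [inv_le_comm₀ ht0 (by norm_num)]
    linarith
  refine (ofReal_le_ofReal this).trans_eq ?_
  simp

lemma lintegral_lintegral_segment_le (G : E → ℝ≥0∞) (hG : Measurable G) (K : Set E) {t : ℝ} :
    ∫⁻ x in K, ∫⁻ y in K, G (t • x + (1 - t) • y) ∂μ ∂μ ≤
      2 ^ Module.finrank ℝ E * (∫⁻ x, G x ∂μ) * μ K := by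
  rcases le_total (1 / 2) t with ht | ht
  · rw [lintegral_lintegral_swap]
    · refine (lintegral_mono fun y => lintegral_segment_le μ G hG K ht _).trans_eq ?_
      simp
    fun_prop
  · refine (lintegral_mono fun x => (le_of_eq ?_).trans
      (lintegral_segment_le μ G hG K (t := 1 - t) (by linarith) (t • x))).trans_eq ?_
    · grind
    simp

/-- A Poincaré inequality on convex sets. -/
lemma poincare_convex {K : Set E} (hK : Convex ℝ K) (hKm : MeasurableSet K) {R : NNReal}
    (hR : ∀ x ∈ K, ∀ y ∈ K, ‖x - y‖ ≤ R) {φ : E → ℂ} {φ' : E → E →L[ℝ] ℂ}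
    (hφ : ∀ z ∈ K, HasFDerivWithinAt φ (φ' z) K z) (hφ' : ContinuousOn φ' K) :
    ∫⁻ x in K, ∫⁻ y in K, ‖φ x - φ y‖ₑ ^ 2 ∂μ ∂μ ≤
      (R : ℝ≥0∞) ^ 2 * 2 ^ Module.finrank ℝ E * μ K * ∫⁻ z in K, ‖φ' z‖ₑ ^ 2 ∂μ := by
  classical
  set D : E → ℝ≥0∞ := K.indicator fun z => ‖φ' z‖ₑ ^ 2 with hD
  have hDm : Measurable D := by
    have h1 : ContinuousOn (fun z => ‖φ' z‖ₑ ^ 2) K :=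
      ((ENNReal.continuous_pow 2).comp continuous_enorm).comp_continuousOn hφ'
    have h2 : D = K.piecewise (fun z => ‖φ' z‖ₑ ^ 2) 0 := by
      rfl
    exact h1.measurable_piecewise continuousOn_const hKm
  have key : ∀ x ∈ K, ∀ y ∈ K, ‖φ x - φ y‖ₑ ^ 2 ≤
      (R : ℝ≥0∞) ^ 2 * ∫⁻ t in Icc (0 : ℝ) 1, D (t • x + (1 - t) • y) := by
    intro x hx y hy
    set γ : ℝ → E := fun t => t • x + (1 - t) • y with hγ
    have hγK : MapsTo γ (Icc 0 1) K := fun t ht =>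
      hK hx hy ht.1 (by grind) (by ring)
    have hγc : Continuous γ := by fun_prop
    have hγ' : ∀ t, HasDerivAt γ (x - y) t := fun t => by
      have h1 : HasDerivAt (fun t : ℝ => t • x) ((1 : ℝ) • x) t := (hasDerivAt_id t).smul_const x
      have h2 : HasDerivAt (fun t : ℝ => (1 - t) • y) ((-1 : ℝ) • y) t :=
        ((hasDerivAt_id t).const_sub 1).smul_const y
      have := h1.add h2
      simpa [sub_eq_add_neg] using! this
    have hder : ∀ t ∈ Ioo (0 : ℝ) 1, HasDerivAt (φ ∘ γ) (φ' (γ t) (x - y)) t := fun t ht => by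
      have h1 := (hφ (γ t) (hγK (Ioo_subset_Icc_self ht))).comp_hasDerivWithinAt t
        (hγ' t).hasDerivWithinAt (hγK)
      exact h1.hasDerivAt (Icc_mem_nhds ht.1 ht.2)
    have hcont : ContinuousOn (φ ∘ γ) (Icc 0 1) := ContinuousOn.comp
      (fun z hz => (hφ z hz).continuousWithinAt) hγc.continuousOn hγK
    have hcont' : ContinuousOn (fun t => φ' (γ t) (x - y)) (Icc 0 1) :=
      (hφ'.comp hγc.continuousOn hγK).clm_apply continuousOn_const
    have hint : IntervalIntegrable (fun t => φ' (γ t) (x - y)) volume 0 1 :=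
      ContinuousOn.intervalIntegrable (by simp_all)
    have hftc := intervalIntegral.integral_eq_sub_of_hasDerivAt_of_le zero_le_one hcont hder hint
    have e1 : φ x - φ y = ∫ t in (0 : ℝ)..1, φ' (γ t) (x - y) := by
      rw [hftc]; simp [hγ]
    have e2 : ‖φ x - φ y‖ₑ ≤ ∫⁻ t in Icc (0 : ℝ) 1, ‖φ' (γ t) (x - y)‖ₑ := by
      rw [e1, intervalIntegral.integral_of_le zero_le_one]
      refine (enorm_integral_le_lintegral_enorm _).trans ?_
      exact lintegral_mono_set Ioc_subset_Icc_self
    have hae : AEMeasurable (fun t => ‖φ' (γ t) (x - y)‖ₑ) (volume.restrict (Icc (0 : ℝ) 1)) :=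
      (hcont'.aemeasurable measurableSet_Icc).enorm
    calc ‖φ x - φ y‖ₑ ^ 2 ≤ (∫⁻ t in Icc (0 : ℝ) 1, ‖φ' (γ t) (x - y)‖ₑ) ^ 2 := by gcongr
      _ ≤ _ := lintegral_sq_le _ hae
      _ = ∫⁻ t in Icc (0 : ℝ) 1, ‖φ' (γ t) (x - y)‖ₑ ^ 2 := by simp
      _ ≤ ∫⁻ t in Icc (0 : ℝ) 1, (R : ℝ≥0∞) ^ 2 * D (γ t) := by
          refine setLIntegral_mono' measurableSet_Icc fun t ht => ?_
          rw [hD, indicator_of_mem (hγK ht), ← mul_pow]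
          gcongr
          refine (ContinuousLinearMap.le_opENorm _ _).trans ?_
          rw [mul_comm]
          gcongr
          have := hR x hx y hy
          exact_mod_cast this
      _ = _ := by rw [lintegral_const_mul]; fun_prop
  have hK2 : ∫⁻ z in K, ‖φ' z‖ₑ ^ 2 ∂μ = ∫⁻ z, D z ∂μ := by simp_all
  calc ∫⁻ x in K, ∫⁻ y in K, ‖φ x - φ y‖ₑ ^ 2 ∂μ ∂μ
      ≤ ∫⁻ x in K, ∫⁻ y in K,
          (R : ℝ≥0∞) ^ 2 * (∫⁻ t in Icc (0 : ℝ) 1, D (t • x + (1 - t) • y)) ∂μ ∂μ :=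
        setLIntegral_mono' hKm fun x hx => setLIntegral_mono' hKm fun y hy => key x hx y hy
    _ = (R : ℝ≥0∞) ^ 2 * ∫⁻ t in Icc (0 : ℝ) 1, ∫⁻ x in K, ∫⁻ y in K,
          D (t • x + (1 - t) • y) ∂μ ∂μ := by
        have e1 : ∀ x, ∫⁻ y in K, (R : ℝ≥0∞) ^ 2 *
            (∫⁻ t in Icc (0 : ℝ) 1, D (t • x + (1 - t) • y)) ∂μ =
            (R : ℝ≥0∞) ^ 2 * ∫⁻ t in Icc (0 : ℝ) 1, ∫⁻ y in K, D (t • x + (1 - t) • y) ∂μ := by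
          intro x
          rw [lintegral_const_mul, lintegral_lintegral_swap]
          · fun_prop
          fun_prop
        simp only [e1]
        have hm : Measurable fun p : E × ℝ => ∫⁻ y in K, D (p.2 • p.1 + (1 - p.2) • y) ∂μ :=
          Measurable.lintegral_prod_right' (f := fun p : (E × ℝ) × E =>
              D (p.1.2 • p.1.1 + (1 - p.1.2) • p.2)) (by fun_prop)
        rw [lintegral_const_mul, lintegral_lintegral_swap]
        · fun_prop
        fun_prop
    _ ≤ (R : ℝ≥0∞) ^ 2 * ∫⁻ t in Icc (0 : ℝ) 1,
          2 ^ Module.finrank ℝ E * (∫⁻ x, D x ∂μ) * μ K := by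
        gcongr with t
        exact lintegral_lintegral_segment_le μ D hDm K
    _ = _ := by
        rw [hK2]
        simp only [lintegral_const, Measure.restrict_apply MeasurableSet.univ, univ_inter,
          Real.volume_Icc, sub_zero, ENNReal.ofReal_one, mul_one]
        ring

end Poincare

section ManifoldPoincare

variable {N : ℕ} {Hm : Type} [TopologicalSpace Hm]
  {I : ModelWithCorners ℝ (𝔼 N) Hm} {M : RiemMfd.{u} I} (x₀ : M)

local notation "Ξ" => extChartAt I

/-- A compact convex neighbourhood of the base point in the chart at `x₀`. -/
lemma exists_chart_ball : ∃ r : ℝ, 0 < r ∧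
    Metric.closedBall (Ξ x₀ x₀) r ∩ range I ⊆ (Ξ x₀).target := by
  obtain ⟨r, hr, h⟩ := Metric.mem_nhdsWithin_iff.mp (extChartAt_target_mem_nhdsWithin (I := I) x₀)
  refine ⟨r / 2, by positivity, fun z hz => h ⟨?_, hz.2⟩⟩
  exact Metric.closedBall_subset_ball (by linarith) hz.1

variable {x₀} in
/-- The open neighbourhood of `x₀` that corresponds to a ball in the chart. -/
def chartBall (x₀ : M) (r : ℝ) : Set M :=
  (Ξ x₀).source ∩ Ξ x₀ ⁻¹' Metric.ball (Ξ x₀ x₀) r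

lemma isOpen_chartBall (r : ℝ) : IsOpen (chartBall x₀ r) :=
  (continuousOn_extChartAt x₀).isOpen_inter_preimage (isOpen_extChartAt_source x₀)
      Metric.isOpen_ball

lemma mem_chartBall {r : ℝ} (hr : 0 < r) : x₀ ∈ chartBall x₀ r :=
  ⟨mem_extChartAt_source x₀, Metric.mem_ball_self hr⟩

lemma target_inter_preimage_chartBall {r : ℝ}
    (hr : Metric.closedBall (Ξ x₀ x₀) r ∩ range I ⊆ (Ξ x₀).target) :
    (Ξ x₀).target ∩ (Ξ x₀).symm ⁻¹' chartBall x₀ r =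
      Metric.ball (Ξ x₀ x₀) r ∩ range I := by
  ext z
  constructor
  · rintro ⟨hz, hzA⟩
    refine ⟨?_, extChartAt_target_subset_range x₀ hz⟩
    have := hzA.2
    simp_all
  · rintro ⟨hz, hzr⟩
    have hzt := hr ⟨Metric.ball_subset_closedBall hz, hzr⟩
    refine ⟨hzt, (Ξ x₀).map_target hzt, ?_⟩
    simp_all

/-- Uniform bounds for the metric in the chart, on a compact set. -/
lemma exists_chart_bounds {r : ℝ}
    (hr : Metric.closedBall (Ξ x₀ x₀) r ∩ range I ⊆ (Ξ x₀).target) :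
    ∃ C : ℝ, 0 < C ∧ ∀ z ∈ Metric.closedBall (Ξ x₀ x₀) r ∩ range I,
      chartDensity I M.g x₀ z ≤ C ∧ (chartDensity I M.g x₀ z)⁻¹ ≤ C ∧
      (∀ i, gram x₀ z i i ≤ C) ∧ (∀ i j, |(gram x₀ z)⁻¹ i j| ≤ C) := by
  have h := continuousOn_chartDensity x₀
  obtain ⟨C, hC⟩ := ((isCompact_closedBall _ _).inter_right
    I.isClosed_range).exists_bound_of_continuousOn ((h.prodMk
      ((h.inv₀ fun z hz => (chartDensity_pos x₀ hz).ne').prodMk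
      ((continuousOn_pi.2 fun i => continuousOn_gram x₀ i i).prodMk (continuousOn_pi.2 fun i =>
        continuousOn_pi.2 fun j => continuousOn_gram_inv x₀ i j)))).mono hr)
  refine ⟨|C| + 1, by positivity, fun z hz => ?_⟩
  have h1 := (hC z hz).trans ((le_abs_self C).trans (le_add_of_nonneg_right zero_le_one))
  have h0 : 0 ≤ |C| + 1 := by positivity
  simp only [Prod.norm_def, sup_le_iff, pi_norm_le_iff_of_nonneg h0, norm_eq_abs] at h1
  exact ⟨(le_abs_self _).trans h1.1, (le_abs_self _).trans h1.2.1,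
    fun i => (le_abs_self _).trans (h1.2.2.1 i), fun i j => (pi_norm_le_iff_of_nonneg h0).1
      ((pi_norm_le_iff_of_nonneg h0).1 h1.2.2.2 i) j⟩

lemma norm_sq_le_sum_apply (L : 𝔼 N →L[ℝ] ℂ) :
    ‖L‖ ^ 2 ≤ ∑ i, ‖L (EuclideanSpace.single i 1)‖ ^ 2 := by
  have h : ‖L‖ ≤ √(∑ i, ‖L (EuclideanSpace.single i 1)‖ ^ 2) := by
    refine ContinuousLinearMap.opNorm_le_bound _ (sqrt_nonneg _) fun v => ?_
    have hv := (EuclideanSpace.basisFun (Fin N) ℝ).sum_repr v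
    simp only [EuclideanSpace.basisFun_apply, EuclideanSpace.basisFun_repr] at hv
    conv_lhs => rw [← hv, map_sum]
    simp only [map_smul]
    refine (norm_sum_le _ _).trans ?_
    simp only [norm_smul]
    rw [EuclideanSpace.norm_eq, ← Real.sqrt_mul (sum_nonneg fun _ _ => sq_nonneg _)]
    refine le_sqrt_of_sq_le ?_
    rw [mul_comm (∑ i, ‖L _‖ ^ 2)]
    exact Finset.sum_mul_sq_le_sq_mul_sq _ _ _
  calc ‖L‖ ^ 2 ≤ (√(∑ i, ‖L (EuclideanSpace.single i 1)‖ ^ 2)) ^ 2 := by gcongr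
    _ = _ := Real.sq_sqrt (sum_nonneg fun _ _ => sq_nonneg _)

/-- In a chart, each partial derivative is dominated by the gradient. -/
lemma norm_chartDeriv_sq_le {φ : M → ℂ} {z : 𝔼 N}
    (hz : z ∈ (Ξ x₀).target)
    (hφ : MDifferentiableAt I 𝓘(ℝ, ℂ) φ ((Ξ x₀).symm z)) (i : Fin N) :
    ‖chartDeriv x₀ φ z i‖ ^ 2 ≤
      (gradProd I M.g φ φ ((Ξ x₀).symm z)).re * gram x₀ z i i := by
  rw [← mfderiv_coordVector x₀ hz hφ]
  exact norm_apply_sq_le_cometric _ _ _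

lemma gradProd_self_nonneg (φ : M → ℂ) (x : M) : 0 ≤ (gradProd I M.g φ φ x).re :=
  cometric_self_nonneg _ _

/-- The energy density of a function. -/
def energyDensity (φ : M → ℂ) (x : M) : ℝ≥0∞ := ofReal (gradProd I M.g φ φ x).re

lemma continuous_gradProd {φ ψ : M → ℂ} (hφ : ContMDiff I 𝓘(ℝ, ℂ) ∞ φ)
    (hψ : ContMDiff I 𝓘(ℝ, ℂ) ∞ ψ) : Continuous (gradProd I M.g φ ψ) := by
  have h : ContinuousOn (fun p : ℝ × M => gradProd I M.g φ ψ p.2) (univ ×ˢ univ) :=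
    continuousOn_gradProd (O := univ) (Φ := fun p : ℝ × M => φ p.2) (Ψ := fun p => ψ p.2)
      isOpen_univ (ContMDiff.contMDiffOn (hφ.comp contMDiff_snd))
      (ContMDiff.contMDiffOn (hψ.comp contMDiff_snd))
  generalize gradProd I M.g φ ψ = F at h ⊢
  rw [univ_prod_univ, continuousOn_univ] at h
  exact h.comp (by fun_prop : Continuous fun x : M => ((0 : ℝ), x))

lemma measurable_energyDensity {φ : M → ℂ} (hφ : ContMDiff I 𝓘(ℝ, ℂ) ∞ φ) :
    Measurable (energyDensity φ) :=
  (Complex.continuous_re.comp (continuous_gradProd hφ hφ)).measurable.ennreal_ofReal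

/-- The set `A` satisfies a Poincaré inequality. -/
def HasPoincare (A : Set M) : Prop :=
  ∃ C : NNReal, ∀ φ : M → ℂ, ContMDiff I 𝓘(ℝ, ℂ) ∞ φ →
    ∫⁻ x in A, ∫⁻ y in A, ‖φ x - φ y‖ₑ ^ 2 ∂dV M ∂dV M ≤
      C * ∫⁻ x, energyDensity φ x ∂dV M

/-- In a chart, the Riemannian measure and the metric are comparable with the Euclidean ones. -/
lemma exists_chart_compare (x₀ : M) : ∃ A : Set M, IsOpen A ∧ x₀ ∈ A ∧
    ∃ K : Set (𝔼 N), Bornology.IsBounded K ∧ MeasurableSet K ∧ Convex ℝ K ∧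
      K ⊆ (Ξ x₀).target ∧ ∃ C : ℝ, 0 < C ∧
      (∀ F : M → ℝ≥0∞, Measurable F → ∫⁻ x in A, F x ∂dV M ≤
        ofReal C * ∫⁻ z in K, F ((Ξ x₀).symm z)) ∧
      (∀ F : M → ℝ≥0∞, Measurable F → ∫⁻ z in K, F ((Ξ x₀).symm z) ≤
        ofReal C * ∫⁻ x, F x ∂dV M) ∧
      (∀ (φ : M → ℂ), ∀ z ∈ K, MDifferentiableAt I 𝓘(ℝ, ℂ) φ ((Ξ x₀).symm z) →
        (∀ i, ‖chartDeriv x₀ φ z i‖ ^ 2 ≤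
          C * (gradProd I M.g φ φ ((Ξ x₀).symm z)).re) ∧
        (gradProd I M.g φ φ ((Ξ x₀).symm z)).re ≤
          C * ∑ i, ‖chartDeriv x₀ φ z i‖ ^ 2) := by
  obtain ⟨r, hr0, hr⟩ := exists_chart_ball (I := I) x₀
  obtain ⟨C, hC, hb⟩ := exists_chart_bounds x₀ hr
  set K := Metric.ball (Ξ x₀ x₀) r ∩ range I with hKdef
  have hKb := inter_subset_inter_left (range I)
    (Metric.ball_subset_closedBall (x := Ξ x₀ x₀) (ε := r))
  have hKm : MeasurableSet K :=
    Metric.isOpen_ball.measurableSet.inter I.isClosed_range.measurableSet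
  have hAm : MeasurableSet (chartBall x₀ r) := (isOpen_chartBall x₀ r).measurableSet
  have hAs : chartBall x₀ r ⊆ (Ξ x₀).source := inter_subset_left
  have hTA := target_inter_preimage_chartBall x₀ hr
  have hC' : C ≤ C * (N + 1) := le_mul_of_one_le_right hC.le (by simp)
  refine ⟨chartBall x₀ r, isOpen_chartBall x₀ r, mem_chartBall x₀ hr0, K,
    Metric.isBounded_ball.subset inter_subset_left, hKm,
    (convex_ball _ _).inter I.convex_range, hKb.trans hr, C * (N + 1), by positivity,
    fun F hF => ?_, fun F hF => ?_, fun φ z hz hφ => ⟨fun i => ?_, ?_⟩⟩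
  · rw [lintegral_riemVol_restrict x₀ hAm hAs hF, hTA, ← lintegral_const_mul' _ _ ofReal_ne_top]
    refine setLIntegral_mono' hKm fun z hz => ?_
    gcongr
    exact (hb z (hKb hz)).1.trans hC'
  · refine le_trans ?_ (mul_le_mul_right (setLIntegral_le_lintegral (chartBall x₀ r) _) _)
    rw [lintegral_riemVol_restrict x₀ hAm hAs hF, hTA, ← lintegral_const_mul' _ _ ofReal_ne_top]
    refine setLIntegral_mono' hKm fun z hz => ?_
    rw [← mul_assoc, ← ofReal_mul (by positivity)]
    refine le_mul_of_one_le_left' (ENNReal.one_le_ofReal.mpr ?_)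
    rw [← inv_le_iff_one_le_mul₀ (chartDensity_pos x₀ (hr (hKb hz)))]
    exact (hb z (hKb hz)).2.1.trans hC'
  · refine (norm_chartDeriv_sq_le x₀ (hr (hKb hz)) hφ i).trans ?_
    rw [mul_comm]
    exact mul_le_mul_of_nonneg_right (((hb z (hKb hz)).2.2.1 i).trans hC')
      (gradProd_self_nonneg (I := I) φ _)
  · rw [gradProd_chart x₀ (hr (hKb hz)) hφ hφ]
    set a := chartDeriv x₀ φ z with ha
    calc (dualForm (gram x₀ z) a a).re ≤ ‖dualForm (gram x₀ z) a a‖ := Complex.re_le_norm _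
      _ ≤ ∑ i, ∑ j, C * (‖a i‖ * ‖a j‖) := by
          refine (norm_sum_le _ _).trans (sum_le_sum fun i _ => (norm_sum_le _ _).trans
            (sum_le_sum fun j _ => ?_))
          rw [norm_mul, norm_mul, Complex.norm_conj, norm_real, norm_eq_abs]
          exact mul_le_mul_of_nonneg_right ((hb z (hKb hz)).2.2.2 i j) (by positivity)
      _ = C * (∑ i, ‖a i‖) ^ 2 := by rw [sq, Finset.sum_mul_sum]; simp only [mul_sum]
      _ ≤ C * (N * ∑ i, ‖a i‖ ^ 2) := by
          gcongr
          simpa using sq_sum_le_card_mul_sum_sq (s := Finset.univ) (f := fun i => ‖a i‖)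
      _ ≤ _ := by
          rw [← mul_assoc]
          gcongr
          simp

lemma hasPoincare_chartBall : ∃ A : Set M, IsOpen A ∧ x₀ ∈ A ∧ HasPoincare A := by
  obtain ⟨A, hA, hxA, K, hKb, hKm, hKc, hKT, C, hC, hup, hlow, hgr⟩ :=
    exists_chart_compare (I := I) x₀
  refine ⟨A, hA, hxA, ?_⟩
  set R : NNReal := ⟨Metric.diam K, Metric.diam_nonneg⟩
  have hKfin := hKb.measure_lt_top (μ := volume)
  set C₁ : ℝ≥0∞ := ofReal C * (ofReal C * (R ^ 2 * 2 ^ Module.finrank ℝ (𝔼 N) * volume K *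
      (ofReal (N * C) * ofReal C)))
  have hC₁t : C₁ ≠ ⊤ := by
    finiteness
  refine ⟨C₁.toNNReal, fun φ hφ => ?_⟩
  rw [ENNReal.coe_toNNReal hC₁t]
  have hφc := hφ.continuous
  set ψ := φ ∘ (Ξ x₀).symm with hψ
  have hcd : ContDiffOn ℝ ∞ ψ (Ξ x₀).target := by
    rw [← contMDiffOn_iff_contDiffOn]
    exact hφ.comp_contMDiffOn (contMDiffOn_extChartAt_symm x₀)
  have hdr : ∀ z ∈ (Ξ x₀).target, HasFDerivWithinAt ψ (fderivWithin ℝ ψ (range I) z)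
      (range I) z := fun z hz => by
    have h1 := (hcd.differentiableOn (by simp) z hz).mono_of_mem_nhdsWithin
      (extChartAt_target_mem_nhdsWithin_of_mem hz : (Ξ x₀).target ∈ 𝓝[range I] z)
    exact h1.hasFDerivWithinAt
  have hcont : ContinuousOn (fderivWithin ℝ ψ (range I)) K := by
    have h1 := (hcd.continuousOn_fderivWithin (uniqueDiffOn_extChartAt_target x₀) (by simp)).mono hKT
    refine h1.congr fun z hz => ?_
    have hu := (uniqueDiffOn_extChartAt_target (I := I) x₀) z (hKT hz)
    exact (((hdr z (hKT hz)).mono (extChartAt_target_subset_range x₀)).fderivWithin hu).symm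
  have hpc := poincare_convex (volume : Measure (𝔼 N)) hKc hKm (R := R)
    (fun x hx y hy => (dist_eq_norm x y).symm.trans_le (Metric.dist_le_diam_of_mem hKb hx hy))
    (fun z hz => (hdr z (hKT hz)).mono (hKT.trans (extChartAt_target_subset_range x₀))) hcont
  have hgrad : ∫⁻ z in K, ‖fderivWithin ℝ ψ (range I) z‖ₑ ^ 2 ≤
      ofReal (N * C) * ∫⁻ z in K, energyDensity φ ((Ξ x₀).symm z) := by
    rw [← lintegral_const_mul' _ _ ofReal_ne_top]
    refine setLIntegral_mono' hKm fun z hz => ?_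
    rw [energyDensity, ← ofReal_mul (by positivity), ← ofReal_norm, ← ofReal_pow (norm_nonneg _)]
    refine ofReal_le_ofReal ((norm_sq_le_sum_apply _).trans ((sum_le_sum fun i _ =>
      (hgr φ z hz ((hφ.mdifferentiable (by simp)) _)).1 i).trans_eq ?_))
    simp [mul_assoc]
  have hm2 : ∀ x, Measurable fun y => ‖φ x - φ y‖ₑ ^ 2 := fun x => by
    fun_prop
  have hm3 : Measurable fun p : M × 𝔼 N =>
      ‖φ p.1 - K.indicator ψ p.2‖ₑ ^ 2 := by
    have h1 := hφc.measurable
    have h2 : Measurable (K.indicator ψ) := by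
      classical
      have : K.indicator ψ = K.piecewise ψ 0 := by
        simp
      rw [this]
      exact (hcd.continuousOn.mono hKT).measurable_piecewise continuousOn_const hKm
    fun_prop
  calc ∫⁻ x in A, ∫⁻ y in A, ‖φ x - φ y‖ₑ ^ 2 ∂dV M
        ∂dV M
      ≤ ∫⁻ x in A, ofReal C *
          (∫⁻ w in K, ‖φ x - K.indicator ψ w‖ₑ ^ 2) ∂dV M := by
        refine lintegral_mono fun x => (hup _ (hm2 x)).trans_eq ?_
        congr 1
        refine setLIntegral_congr_fun hKm fun z hz => ?_
        simp only [indicator_of_mem hz]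
        rfl
    _ ≤ ofReal C * ∫⁻ z in K, ofReal C *
          (∫⁻ w in K, ‖φ ((Ξ x₀).symm z) - K.indicator ψ w‖ₑ ^ 2) :=
        hup _ (hm3.lintegral_prod_right'.const_mul _)
    _ = ofReal C * (ofReal C * ∫⁻ z in K, ∫⁻ w in K, ‖ψ z - ψ w‖ₑ ^ 2) := by
        rw [lintegral_const_mul' _ _ ofReal_ne_top]
        congr 2
        refine setLIntegral_congr_fun hKm fun z hz => ?_
        refine setLIntegral_congr_fun hKm fun w hw => ?_
        simp only [indicator_of_mem hw]
        rfl
    _ ≤ ofReal C * (ofReal C * (R ^ 2 * 2 ^ Module.finrank ℝ (𝔼 N) * volume K *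
          (ofReal (N * C) * (ofReal C * ∫⁻ x, energyDensity φ x ∂dV M)))) := by
        gcongr
        refine hpc.trans ?_
        gcongr
        refine hgrad.trans ?_
        gcongr
        exact hlow _ (measurable_energyDensity hφ)
    _ = _ := by ring

end ManifoldPoincare
section Chain

variable {α : Type*} [MeasurableSpace α] (μ : Measure α) [IsFiniteMeasure μ] {κ : α → α → ℝ≥0∞}
  (hκ : Measurable fun p : α × α => κ p.1 p.2) (ht : ∀ x y z, κ x y ≤ 2 * (κ x z + κ z y))

include hκ ht

lemma lintegral_lintegral_chain (A B : Set α) :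
    μ (A ∩ B) * ∫⁻ x in A, ∫⁻ y in B, κ x y ∂μ ∂μ ≤
      2 * (μ B * (∫⁻ x in A, ∫⁻ y in A, κ x y ∂μ ∂μ) +
        μ A * ∫⁻ x in B, ∫⁻ y in B, κ x y ∂μ ∂μ) := by
  have hd : ∀ ν : Measure α, IsFiniteMeasure ν → Measurable fun x => ∫⁻ y, κ x y ∂ν :=
    fun ν _ => hκ.lintegral_prod_right'
  have hd' : ∀ ν : Measure α, IsFiniteMeasure ν → Measurable fun y => ∫⁻ x, κ x y ∂ν :=
    fun ν _ => hκ.lintegral_prod_left'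
  have key : ∀ x y, μ (A ∩ B) * κ x y ≤
      2 * ((∫⁻ z in A, κ x z ∂μ) + ∫⁻ z in B, κ z y ∂μ) := fun x y => by
    calc μ (A ∩ B) * κ x y = ∫⁻ _ in A ∩ B, κ x y ∂μ := by
          rw [setLIntegral_const, mul_comm]
      _ ≤ ∫⁻ z in A ∩ B, 2 * (κ x z + κ z y) ∂μ := by
          exact lintegral_mono fun z => ht x y z
      _ = 2 * ((∫⁻ z in A ∩ B, κ x z ∂μ) + ∫⁻ z in A ∩ B, κ z y ∂μ) := by
          rw [lintegral_const_mul _ (by fun_prop), lintegral_add_left (by fun_prop)]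
      _ ≤ _ := by
          gcongr
          · simp
          simp
  rw [← lintegral_const_mul _ (hd _ inferInstance)]
  calc ∫⁻ x in A, μ (A ∩ B) * (∫⁻ y in B, κ x y ∂μ) ∂μ
      ≤ ∫⁻ x in A, (∫⁻ y in B, 2 * ((∫⁻ z in A, κ x z ∂μ) +
          ∫⁻ z in B, κ z y ∂μ) ∂μ) ∂μ := by
        refine lintegral_mono fun x => ?_
        rw [← lintegral_const_mul _ (by fun_prop)]
        exact lintegral_mono fun y => key x y
    _ = ∫⁻ x in A, (2 * ((∫⁻ z in A, κ x z ∂μ) * μ B +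
          ∫⁻ y in B, ∫⁻ z in B, κ z y ∂μ ∂μ)) ∂μ := by
        refine lintegral_congr fun x => ?_
        rw [lintegral_const_mul _ ((hd' _ inferInstance).const_add _),
          lintegral_add_left measurable_const, setLIntegral_const]
    _ = 2 * ((∫⁻ x in A, ∫⁻ z in A, κ x z ∂μ ∂μ) * μ B +
          (∫⁻ y in B, ∫⁻ z in B, κ z y ∂μ ∂μ) * μ A) := by
        rw [lintegral_const_mul _ (((hd _ inferInstance).mul_const _).add_const _),
          lintegral_add_right _ measurable_const, setLIntegral_const,
          lintegral_mul_const _ (hd _ inferInstance)]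
    _ = _ := by
        rw [lintegral_lintegral_swap (μ := μ.restrict B) (ν := μ.restrict B)
          (f := fun y z => κ z y) (by fun_prop)]
        ring

lemma lintegral_lintegral_union_le (hs : ∀ x y, κ x y = κ y x) {A B : Set α} (h0 : μ (A ∩ B) ≠ 0) :
    ∫⁻ x in A ∪ B, ∫⁻ y in A ∪ B, κ x y ∂μ ∂μ ≤
      (1 + 4 * (μ univ / μ (A ∩ B))) * ((∫⁻ x in A, ∫⁻ y in A, κ x y ∂μ ∂μ) +
        ∫⁻ x in B, ∫⁻ y in B, κ x y ∂μ ∂μ) := by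
  have hd : ∀ ν : Measure α, IsFiniteMeasure ν → Measurable fun x => ∫⁻ y, κ x y ∂ν :=
    fun ν _ => hκ.lintegral_prod_right'
  set DA := ∫⁻ x in A, ∫⁻ y in A, κ x y ∂μ ∂μ with hDA
  set DB := ∫⁻ x in B, ∫⁻ y in B, κ x y ∂μ ∂μ with hDB
  have hAB : ∫⁻ x in A, ∫⁻ y in B, κ x y ∂μ ∂μ ≤
      2 * (μ univ / μ (A ∩ B)) * (DA + DB) := by
    have h := lintegral_lintegral_chain μ hκ ht A B
    rw [← hDA, ← hDB, mul_comm, ← ENNReal.le_div_iff_mul_le (Or.inl h0)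
      (Or.inl (measure_ne_top _ _))] at h
    refine h.trans ?_
    calc 2 * (μ B * DA + μ A * DB) / μ (A ∩ B)
        ≤ 2 * (μ univ * DA + μ univ * DB) / μ (A ∩ B) := by gcongr <;> simp
      _ = _ := by simp only [div_eq_mul_inv]; ring
  have hBA : ∫⁻ x in B, ∫⁻ y in A, κ x y ∂μ ∂μ =
      ∫⁻ x in A, ∫⁻ y in B, κ x y ∂μ ∂μ := by
    rw [lintegral_lintegral_swap (by fun_prop)]
    simp only [hs]
  calc ∫⁻ x in A ∪ B, ∫⁻ y in A ∪ B, κ x y ∂μ ∂μ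
      ≤ ∫⁻ x in A ∪ B, ((∫⁻ y in A, κ x y ∂μ) +
          ∫⁻ y in B, κ x y ∂μ) ∂μ :=
        lintegral_mono fun x => lintegral_union_le _ _ _
    _ ≤ (∫⁻ x in A, ((∫⁻ y in A, κ x y ∂μ) +
          ∫⁻ y in B, κ x y ∂μ) ∂μ) + ∫⁻ x in B, ((∫⁻ y in A, κ x y ∂μ) +
          ∫⁻ y in B, κ x y ∂μ) ∂μ := lintegral_union_le _ _ _
    _ ≤ (DA + 2 * (μ univ / μ (A ∩ B)) * (DA + DB)) +
        (2 * (μ univ / μ (A ∩ B)) * (DA + DB) + DB) := by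
        rw [lintegral_add_left (hd _ inferInstance), lintegral_add_left (hd _ inferInstance), hBA]
        gcongr
    _ = _ := by ring

end Chain

section ManifoldPoincare

variable {N : ℕ} {Hm : Type} [TopologicalSpace Hm]
  {I : ModelWithCorners ℝ (𝔼 N) Hm} {M : RiemMfd.{u} I}

local notation "Ξ" => extChartAt I

lemma HasPoincare.union {A B : Set M} (hA : HasPoincare A) (hB : HasPoincare B) (hAo : IsOpen A)
    (hBo : IsOpen B) (h : (A ∩ B).Nonempty) : HasPoincare (A ∪ B) := by
  obtain ⟨C₁, h₁⟩ := hA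
  obtain ⟨C₂, h₂⟩ := hB
  set μ := dV M with hμ
  have h0 : μ (A ∩ B) ≠ 0 := ((hAo.inter hBo).measure_pos μ h).ne'
  have ht : (1 + 4 * (μ univ / μ (A ∩ B))) * (C₁ + C₂) ≠ ⊤ := by
    finiteness
  refine ⟨((1 + 4 * (μ univ / μ (A ∩ B))) * (C₁ + C₂)).toNNReal, fun φ hφ => ?_⟩
  rw [ENNReal.coe_toNNReal ht]
  have := hφ.continuous.measurable
  refine (lintegral_lintegral_union_le μ (κ := fun x y => ‖φ x - φ y‖ₑ ^ 2) (by fun_prop)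
    (fun x y z => by simpa using enorm_sq_add_le (φ x - φ z) (φ z - φ y))
    (fun x y => by rw [enorm_sub_rev]) h0).trans ?_
  rw [mul_assoc, add_mul (C₁ : ℝ≥0∞)]
  bound

lemma exists_hasPoincare (x₀ x : M) : ∃ A : Set M, IsOpen A ∧ x₀ ∈ A ∧ x ∈ A ∧ HasPoincare A := by
  set S : Set M := {x | ∃ A : Set M, IsOpen A ∧ x₀ ∈ A ∧ x ∈ A ∧ HasPoincare A} with hS
  have ho : IsOpen S := by
    rw [isOpen_iff_forall_mem_open]
    grind
  have hc : IsClosed S := by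
    rw [← closure_subset_iff_isClosed]
    intro x hx
    obtain ⟨B, hB, hxB, hpB⟩ := hasPoincare_chartBall x
    obtain ⟨y, hyB, A, hA, h0, hyA, hpA⟩ := mem_closure_iff.mp hx B hB hxB
    exact ⟨A ∪ B, hA.union hB, Or.inl h0, Or.inr hxB, hpA.union hpB hA hB ⟨y, hyA, hyB⟩⟩
  have : S = univ := IsClopen.eq_univ ⟨hc, ho⟩
    (let ⟨A, hA, h0, hp⟩ := hasPoincare_chartBall x₀; ⟨x₀, A, hA, h0, h0, hp⟩)
  grind

lemma hasPoincare_univ : HasPoincare (univ : Set M) := by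
  obtain ⟨x₀⟩ : Nonempty M := inferInstance
  choose A hA h0 hx hp using exists_hasPoincare x₀
  obtain ⟨t, ht⟩ := isCompact_univ.elim_finite_subcover A hA fun x _ => mem_iUnion.mpr ⟨x, hx x⟩
  have key : ∀ s : Finset M, ∃ B, IsOpen B ∧ x₀ ∈ B ∧ HasPoincare B ∧ (⋃ i ∈ s, A i) ⊆ B := by
    classical
    intro s
    induction s using Finset.induction_on with
    | empty => exact ⟨A x₀, hA _, h0 _, hp _, by simp⟩
    | insert a s _ ih =>
      obtain ⟨B, hB, hB0, hBp, hBs⟩ := ih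
      refine ⟨A a ∪ B, (hA a).union hB, Or.inr hB0, (hp a).union hBp (hA a) hB ⟨x₀, h0 a, hB0⟩, ?_⟩
      rw [Finset.set_biUnion_insert]
      grind
  obtain ⟨B, -, -, hBp, hBs⟩ := key t
  grind

variable (M) in
/-- The Poincaré inequality on a compact connected Riemannian manifold. -/
lemma exists_poincare : ∃ C : ℝ, 0 < C ∧ ∀ φ : M → ℂ, ContMDiff I 𝓘(ℝ, ℂ) ∞ φ →
    ∫⁻ x, ‖φ x - (((dV M univ).toReal)⁻¹ : ℝ) * ∫ y, φ y ∂dV M‖ₑ ^ 2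
        ∂dV M ≤
      ofReal C * ∫⁻ x, energyDensity φ x ∂dV M := by
  obtain ⟨C, hC⟩ := hasPoincare_univ (M := M)
  set μ := dV M with hμ
  set V := (μ univ).toReal with hVdef
  have hV : 0 < V := ENNReal.toReal_pos riemVol_univ_pos.ne' (measure_ne_top _ _)
  have hVe : ofReal V = μ univ := ENNReal.ofReal_toReal (measure_ne_top _ _)
  refine ⟨V⁻¹ * C + 1, by positivity, fun φ hφ => ?_⟩
  have hint : Integrable φ μ := hφ.continuous.integrable_of_hasCompactSupport
    (HasCompactSupport.of_compactSpace φ)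
  have key : ∀ x, ‖φ x - ((V⁻¹ : ℝ) : ℂ) * ∫ y, φ y ∂μ‖ₑ ^ 2 ≤
      ofReal V⁻¹ * ∫⁻ y, ‖φ x - φ y‖ₑ ^ 2 ∂μ := fun x => by
    have e : φ x - ((V⁻¹ : ℝ) : ℂ) * ∫ y, φ y ∂μ = ((V⁻¹ : ℝ) : ℂ) * ∫ y, (φ x - φ y) ∂μ := by
      rw [integral_sub (integrable_const _) hint, integral_const, mul_sub, Measure.real,
        ← hVdef, real_smul, ← mul_assoc, ← Complex.ofReal_mul, inv_mul_cancel₀ hV.ne']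
      simp
    have hn : ‖((V⁻¹ : ℝ) : ℂ)‖ₑ = ofReal V⁻¹ := by
      rw [← ofReal_norm, norm_real, norm_of_nonneg (by positivity)]
    rw [e, enorm_mul, mul_pow, hn]
    have hm : Measurable fun y => ‖φ x - φ y‖ₑ := by
      have := hφ.continuous.measurable
      fun_prop
    calc ofReal V⁻¹ ^ 2 * ‖∫ y, (φ x - φ y) ∂μ‖ₑ ^ 2
        ≤ ofReal V⁻¹ ^ 2 * (∫⁻ y, ‖φ x - φ y‖ₑ ∂μ) ^ 2 := by
          gcongr
          exact enorm_integral_le_lintegral_enorm _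
      _ ≤ ofReal V⁻¹ ^ 2 * (μ univ * ∫⁻ y, ‖φ x - φ y‖ₑ ^ 2 ∂μ) := by
          gcongr
          exact lintegral_sq_le μ hm.aemeasurable
      _ = ofReal V⁻¹ * (ofReal V⁻¹ * ofReal V) *
            ∫⁻ y, ‖φ x - φ y‖ₑ ^ 2 ∂μ := by rw [hVe]; ring
      _ = _ := by
          rw [← ofReal_mul (by positivity), inv_mul_cancel₀ hV.ne', ENNReal.ofReal_one,
            mul_one]
  calc _ ≤ ∫⁻ x, ofReal V⁻¹ * (∫⁻ y, ‖φ x - φ y‖ₑ ^ 2 ∂μ) ∂μ := lintegral_mono key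
    _ = ofReal V⁻¹ * ∫⁻ x, ∫⁻ y, ‖φ x - φ y‖ₑ ^ 2 ∂μ ∂μ := by
        rw [lintegral_const_mul' _ _ ofReal_ne_top]
    _ ≤ ofReal V⁻¹ * (C * ∫⁻ x, energyDensity φ x ∂μ) := by
        gcongr
        simp_all
    _ ≤ _ := by
        rw [← mul_assoc]
        gcongr
        rw [← ENNReal.ofReal_coe_nnreal, ← ofReal_mul (by positivity)]
        bound

end ManifoldPoincare

section SesquilinearForms

variable {V : Type*} [AddCommGroup V] [Module ℂ V]
variable {H : Type*} [NormedAddCommGroup H] [InnerProductSpace ℂ H]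

/-- Hermitian sesquilinear forms, linear in the first argument. -/
structure IsSesq (q : V → V → ℂ) : Prop where
  add_left : ∀ f g h, q (f + g) h = q f h + q g h
  smul_left : ∀ (c : ℂ) f g, q (c • f) g = c * q f g
  symm : ∀ f g, q g f = conj (q f g)

namespace IsSesq

variable {q q' : V → V → ℂ}

lemma add_right (hq : IsSesq q) (f g h : V) : q f (g + h) = q f g + q f h := by
  rw [hq.symm (g + h) f, hq.add_left, map_add, ← hq.symm, ← hq.symm]

lemma neg_left (hq : IsSesq q) (f g : V) : q (-f) g = -q f g := by
  have := hq.smul_left (-1) f g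
  simpa using this

lemma neg_right (hq : IsSesq q) (f g : V) : q f (-g) = -q f g := by
  rw [hq.symm (-g) f, hq.neg_left, map_neg, ← hq.symm]

lemma sub_left (hq : IsSesq q) (f g h : V) : q (f - g) h = q f h - q g h := by
  rw [sub_eq_add_neg, hq.add_left, hq.neg_left, sub_eq_add_neg]

lemma sub_right (hq : IsSesq q) (f g h : V) : q f (g - h) = q f g - q f h := by
  rw [sub_eq_add_neg, hq.add_right, hq.neg_right, sub_eq_add_neg]

lemma add (hq : IsSesq q) (hq' : IsSesq q') : IsSesq fun f g => q f g + q' f g where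
  add_left f g h := by rw [hq.add_left, hq'.add_left]; ring
  smul_left c f g := by rw [hq.smul_left, hq'.smul_left]; ring
  symm f g := by rw [hq.symm, hq'.symm, map_add]

lemma real_mul (hq : IsSesq q) (r : ℝ) : IsSesq fun f g => (r : ℂ) * q f g where
  add_left f g h := by rw [hq.add_left]; ring
  smul_left c f g := by rw [hq.smul_left]; ring
  symm f g := by rw [hq.symm, map_mul, conj_ofReal]

lemma sum {κ : Type*} (s : Finset κ) {q : κ → V → V → ℂ} (hq : ∀ i, IsSesq (q i)) :
    IsSesq fun f g => ∑ i ∈ s, q i f g where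
  add_left f g h := by
    rw [← sum_add_distrib]; exact sum_congr rfl fun i _ => (hq i).add_left f g h
  smul_left c f g := by
    rw [mul_sum]; exact sum_congr rfl fun i _ => (hq i).smul_left c f g
  symm f g := by
    rw [map_sum]; exact sum_congr rfl fun i _ => (hq i).symm f g

lemma smul_smul_re (hq : IsSesq q) (c : ℂ) (f : V) :
    (q (c • f) (c • f)).re = ‖c‖ ^ 2 * (q f f).re := by
  rw [hq.smul_left, hq.symm, hq.smul_left, map_mul, ← hq.symm, ← mul_assoc, mul_conj,
    Complex.re_ofReal_mul, normSq_eq_norm_sq]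

lemma cauchy_schwarz (hq : IsSesq q) (h0 : ∀ f, 0 ≤ (q f f).re) (f g : V) :
    ‖q f g‖ ≤ √(q f f).re * √(q g g).re := by
  have h : ‖q f g‖ ^ 2 ≤ (q f f).re * (q g g).re := by
    let core : PreInnerProductSpace.Core ℂ V :=
      { inner := fun x y => q y x
        conj_inner_symm := fun x y => (hq.symm x y).symm
        re_inner_nonneg := h0
        add_left := fun x y z => hq.add_right z x y
        smul_left := fun x y r => by
          change q y (r • x) = _
          rw [hq.symm, hq.smul_left, map_mul, ← hq.symm] }
    have := InnerProductSpace.Core.inner_mul_inner_self_le (c := core) g f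
    change ‖q f g‖ * ‖q g f‖ ≤ (q g g).re * (q f f).re at this
    rw [hq.symm f g, Complex.norm_conj] at this
    rw [sq, mul_comm (q f f).re]
    exact this
  rw [← Real.sqrt_mul (h0 f)]
  exact le_sqrt_of_sq_le h

lemma sqrt_add_le (hq : IsSesq q) (h0 : ∀ f, 0 ≤ (q f f).re) (f g : V) :
    √(q (f + g) (f + g)).re ≤ √(q f f).re + √(q g g).re := by
  refine Real.sqrt_le_iff.mpr ⟨by positivity, ?_⟩
  rw [add_sq, Real.sq_sqrt (h0 f), Real.sq_sqrt (h0 g), hq.add_left, hq.add_right, hq.add_right]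
  have h1 := (Complex.re_le_norm _).trans (hq.cauchy_schwarz h0 f g)
  have h2 : (q g f).re = (q f g).re := by rw [hq.symm f g, Complex.conj_re]
  simp only [Complex.add_re, h2]
  linarith

lemma sub_rev (hq : IsSesq q) (f g : V) : q (f - g) (f - g) = q (g - f) (g - f) := by
  rw [← neg_sub, hq.neg_left, hq.neg_right, neg_neg]

lemma sqrt_sub_le (hq : IsSesq q) (h0 : ∀ f, 0 ≤ (q f f).re) (f g h : V) :
    √(q (f - h) (f - h)).re ≤ √(q (f - g) (f - g)).re + √(q (g - h) (g - h)).re := by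
  have := hq.sqrt_add_le h0 (f - g) (g - h)
  rwa [sub_add_sub_cancel] at this

/-- A form that is bounded on the diagonal by a nonnegative form is bounded by it. -/
lemma norm_le_of_diag (hq : IsSesq q) (h0 : ∀ f, 0 ≤ (q f f).re) (hq' : IsSesq q') {K : ℝ}
    (h : ∀ f, |(q' f f).re| ≤ K * (q f f).re) (hK : 0 ≤ K) (f g : V) :
    ‖q' f g‖ ≤ 3 * K * (√(q f f).re * √(q g g).re) := by
  have hs := hq'.add (hq.real_mul K)
  have hr : ∀ f, (q' f f + (K : ℂ) * q f f).re = (q' f f).re + K * (q f f).re := fun f => by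
    simp
  have hp : ∀ f, 0 ≤ (q' f f + (K : ℂ) * q f f).re := fun f => by
    rw [hr]; linarith [neg_abs_le (q' f f).re, h f]
  have hu : ∀ f, √(q' f f + (K : ℂ) * q f f).re ≤ √(2 * K) * √(q f f).re := fun f => by
    rw [← Real.sqrt_mul (by positivity)]
    refine Real.sqrt_le_sqrt ?_
    rw [hr]; linarith [le_abs_self (q' f f).re, h f]
  have h1 := hs.cauchy_schwarz hp f g
  have h2 : ‖q' f g + (K : ℂ) * q f g‖ ≤ 2 * K * (√(q f f).re * √(q g g).re) := by
    refine h1.trans ((mul_le_mul (hu f) (hu g) (by positivity) (by positivity)).trans_eq ?_)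
    have := Real.mul_self_sqrt (by positivity : 0 ≤ 2 * K)
    linear_combination (√(q f f).re * √(q g g).re) * this
  have h3 : ‖(K : ℂ) * q f g‖ ≤ K * (√(q f f).re * √(q g g).re) := by
    rw [norm_mul, norm_real, norm_of_nonneg hK]
    exact mul_le_mul_of_nonneg_left (hq.cauchy_schwarz h0 f g) hK
  have h4 : q' f g = (q' f g + (K : ℂ) * q f g) - (K : ℂ) * q f g := by ring
  rw [h4]
  refine (norm_sub_le _ _).trans ?_
  linarith

end IsSesq

lemma isSesq_inner (ι : V →ₗ[ℂ] H) : IsSesq fun f g => inner ℂ (ι g) (ι f) where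
  add_left f g h := by rw [map_add, inner_add_right]
  smul_left c f g := by rw [map_smul, inner_smul_right]
  symm f g := (inner_conj_symm _ _).symm

lemma tendsto_sqrt_zero {κ : Type*} {l : Filter κ} {a : κ → ℝ} (h : Tendsto a l (𝓝 0)) :
    Tendsto (fun i => √(a i)) l (𝓝 0) := by
  simpa using h.sqrt

lemma tendsto_of_sqrt_zero {κ : Type*} {l : Filter κ} {a : κ → ℝ} (h0 : ∀ i, 0 ≤ a i)
    (h : Tendsto (fun i => √(a i)) l (𝓝 0)) : Tendsto a l (𝓝 0) := by
  simpa [Real.sq_sqrt (h0 _)] using h.pow 2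

lemma tendsto_norm_zero_of_sq_le {κ E : Type*} [SeminormedAddCommGroup E] {l : Filter κ} {z : κ → E}
    {b : κ → ℝ} (hb : Tendsto b l (𝓝 0)) (h : ∀ᶠ i in l, ‖z i‖ ^ 2 ≤ b i) :
    Tendsto (fun i => ‖z i‖) l (𝓝 0) :=
  squeeze_zero' (.of_forall fun _ => norm_nonneg _)
    (h.mono fun _ hi => le_sqrt_of_sq_le hi) (tendsto_sqrt_zero hb)

lemma tendsto_sub_pair {E : Type*} [SeminormedAddCommGroup E] {x : ℕ → E} {y : E}
    (h : Tendsto x atTop (𝓝 y)) : Tendsto (fun l : ℕ × ℕ => x l.1 - x l.2) atTop (𝓝 0) := by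
  rw [← prod_atTop_atTop_eq, ← sub_self y]
  exact (h.comp tendsto_fst).sub (h.comp tendsto_snd)

lemma tendsto_norm_sub_sq {κ E : Type*} [SeminormedAddCommGroup E] {l : Filter κ} {x : κ → E} {y : E}
    (h : Tendsto x l (𝓝 y)) : Tendsto (fun i => ‖x i - y‖ ^ 2) l (𝓝 0) := by
  simpa using (h.sub_const y).norm.pow 2

/-- A form on a subspace that is comparable with a closed nonnegative form is closed. -/
lemma isClosedForm_of_bounds {D : Submodule ℂ H} {q h : H → H → ℂ}
    (hq : IsClosedForm (D : Set H) q) (h0 : ∀ f ∈ D, 0 ≤ (q f f).re)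
    (hh : IsSesq fun f g : D => h f g) {a C : ℝ} (ha : 0 < a)
    (hl : ∀ f ∈ D, a * (q f f).re - C * ‖f‖ ^ 2 ≤ (h f f).re)
    (hu : ∀ f ∈ D, (h f f).re ≤ C * ((q f f).re + ‖f‖ ^ 2)) : IsClosedForm (D : Set H) h where
  add_left f hf g hg k hk := hh.add_left ⟨f, hf⟩ ⟨g, hg⟩ ⟨k, hk⟩
  smul_left c f hf g hg := hh.smul_left c ⟨f, hf⟩ ⟨g, hg⟩
  symm f hf g hg := hh.symm ⟨f, hf⟩ ⟨g, hg⟩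
  semibounded := ⟨-C, fun f hf => by nlinarith [hl f hf, h0 f hf]⟩
  closed x f hx hxf hc := by
    have h1 := (hc.add (((tendsto_sub_pair hxf).norm.pow 2).const_mul C)).const_mul a⁻¹
    simp only [norm_zero, ne_eq, OfNat.ofNat_ne_zero, not_false_eq_true, zero_pow, mul_zero,
      add_zero] at h1
    obtain ⟨hfD, hq0⟩ := hq.closed x f hx hxf <|
      squeeze_zero (fun l => h0 _ (D.sub_mem (hx _) (hx _))) (fun l => by
        have := hl _ (D.sub_mem (hx l.1) (hx l.2))
        rw [← div_eq_inv_mul, le_div_iff₀ ha]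
        linarith) h1
    have hxn := tendsto_norm_sub_sq hxf
    refine ⟨hfD, tendsto_of_tendsto_of_tendsto_of_le_of_le
      (by simpa using (hq0.const_mul a).sub (hxn.const_mul C))
      (by simpa using (hq0.add hxn).const_mul C)
      (fun k => hl _ (D.sub_mem (hx k) hfD)) (fun k => hu _ (D.sub_mem (hx k) hfD))⟩

end SesquilinearForms

section Closure

variable {V : Type*} [AddCommGroup V] [Module ℂ V]
variable {H : Type*} [NormedAddCommGroup H] [InnerProductSpace ℂ H]

/-- `φ` converges to `x` in `H` and is a Cauchy sequence for the form `q`. -/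
structure ApproxSeq (ι : V →ₗ[ℂ] H) (q : V → V → ℂ) (x : H) (φ : ℕ → V) : Prop where
  tendsto : Tendsto (fun i => ι (φ i)) atTop (𝓝 x)
  cauchy : Tendsto (fun l : ℕ × ℕ => (q (φ l.1 - φ l.2) (φ l.1 - φ l.2)).re) atTop (𝓝 0)

/-- A closable nonnegative form. -/
structure IsClosable (ι : V →ₗ[ℂ] H) (q : V → V → ℂ) : Prop where
  sesq : IsSesq q
  nonneg : ∀ f, 0 ≤ (q f f).re
  closable : ∀ φ, ApproxSeq ι q 0 φ → Tendsto (fun i => (q (φ i) (φ i)).re) atTop (𝓝 0)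

variable {ι : V →ₗ[ℂ] H} {q h : V → V → ℂ} {x y : H} {φ φ' ψ ψ' : ℕ → V}

/-- The form `q + ⟨ι ·, ι ·⟩`. -/
def formSum (ι : V →ₗ[ℂ] H) (q : V → V → ℂ) (f g : V) : ℂ := q f g + inner ℂ (ι g) (ι f)

lemma formSum_re (f : V) : (formSum ι q f f).re = (q f f).re + ‖ι f‖ ^ 2 := by
  rw [formSum, Complex.add_re]
  congr 1
  exact inner_self_eq_norm_sq (𝕜 := ℂ) (ι f)

lemma tendsto_formSum {κ : Type*} {l : Filter κ} {a : κ → V}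
    (h1 : Tendsto (fun i => (q (a i) (a i)).re) l (𝓝 0))
    (h2 : Tendsto (fun i => ι (a i)) l (𝓝 0)) :
    Tendsto (fun i => √(formSum ι q (a i) (a i)).re) l (𝓝 0) := by
  simp only [formSum_re]
  exact tendsto_sqrt_zero (by simpa using h1.add (h2.norm.pow 2))

namespace IsClosable

lemma formSum_sesq (hq : IsClosable ι q) : IsSesq (formSum ι q) := hq.sesq.add (isSesq_inner ι)

lemma formSum_nonneg (hq : IsClosable ι q) (f : V) : 0 ≤ (formSum ι q f f).re := by
  rw [formSum_re]; have := hq.nonneg f; positivity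

lemma tendsto_form {κ : Type*} {l : Filter κ} (hq : IsClosable ι q) (hh : IsSesq h) {K : ℝ}
    (hK : 0 ≤ K) (hb : ∀ f, |(h f f).re| ≤ K * ((q f f).re + ‖ι f‖ ^ 2)) {a a' b b' : κ → V}
    (ha : Tendsto (fun i => √(formSum ι q (a i - a' i) (a i - a' i)).re) l (𝓝 0))
    (hb' : Tendsto (fun i => √(formSum ι q (b i - b' i) (b i - b' i)).re) l (𝓝 0))
    {M M' : ℝ} (hM : ∀ᶠ i in l, √(formSum ι q (b i) (b i)).re ≤ M)
    (hM' : ∀ᶠ i in l, √(formSum ι q (a' i) (a' i)).re ≤ M') :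
    Tendsto (fun i => h (a i) (b i) - h (a' i) (b' i)) l (𝓝 0) := by
  have hbd := hq.formSum_sesq.norm_le_of_diag hq.formSum_nonneg hh
    (fun f => by rw [formSum_re]; exact hb f) hK
  have h1 := ((ha.mul_const M).add (hb'.const_mul M')).const_mul (3 * K)
  simp only [zero_mul, mul_zero, add_zero] at h1
  refine squeeze_zero_norm' ?_ h1
  filter_upwards [hM, hM'] with i hi hi'
  rw [show h (a i) (b i) - h (a' i) (b' i) = h (a i - a' i) (b i) + h (a' i) (b i - b' i) by
    rw [hh.sub_left, hh.sub_right]; ring, mul_add (3 * K)]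
  refine (norm_add_le _ _).trans ((add_le_add (hbd _ _) (hbd _ _)).trans ?_)
  gcongr

end IsClosable

namespace ApproxSeq

lemma const_sub_tendsto (hφ : ApproxSeq ι q x φ) :
    Tendsto (fun l : ℕ × ℕ => √(formSum ι q (φ l.1 - φ l.2) (φ l.1 - φ l.2)).re) atTop (𝓝 0) :=
  tendsto_formSum hφ.cauchy (by simpa only [map_sub] using tendsto_sub_pair hφ.tendsto)

lemma bounded (hq : IsClosable ι q) (hφ : ApproxSeq ι q x φ) :
    ∃ M, ∀ᶠ i in atTop, √(formSum ι q (φ i) (φ i)).re ≤ M := by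
  obtain ⟨n, hn⟩ := eventually_atTop_prod_self'.mp
    (hφ.const_sub_tendsto.eventually (gt_mem_nhds one_pos))
  refine ⟨1 + √(formSum ι q (φ n) (φ n)).re, eventually_atTop.mpr ⟨n, fun i hi => ?_⟩⟩
  have h1 := hq.formSum_sesq.sqrt_add_le hq.formSum_nonneg (φ i - φ n) (φ n)
  rw [sub_add_cancel] at h1
  exact h1.trans (add_le_add_left (hn i hi n le_rfl).le _)

lemma sub (hq : IsClosable ι q) (hφ : ApproxSeq ι q x φ) (hψ : ApproxSeq ι q y ψ) :
    ApproxSeq ι q (x - y) fun i => φ i - ψ i where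
  tendsto := by simpa only [map_sub] using hφ.tendsto.sub hψ.tendsto
  cauchy := by
    have h1 := (tendsto_sqrt_zero hφ.cauchy).add (tendsto_sqrt_zero hψ.cauchy)
    rw [add_zero] at h1
    refine tendsto_of_sqrt_zero (fun _ => hq.nonneg _)
      (squeeze_zero (fun _ => sqrt_nonneg _) (fun l => ?_) h1)
    have := hq.sesq.sqrt_add_le hq.nonneg (φ l.1 - φ l.2) (ψ l.2 - ψ l.1)
    rw [hq.sesq.sub_rev (ψ l.2)] at this
    refine le_trans (le_of_eq ?_) this
    congr 3 <;> abel

lemma const (ι : V →ₗ[ℂ] H) {q : V → V → ℂ} (hq : IsSesq q) (f : V) :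
    ApproxSeq ι q (ι f) fun _ => f where
  tendsto := tendsto_const_nhds
  cauchy := by
    have : q 0 0 = 0 := by simpa using hq.smul_left 0 0 0
    simp [this]

lemma add (hq : IsClosable ι q) (hφ : ApproxSeq ι q x φ) (hψ : ApproxSeq ι q y ψ) :
    ApproxSeq ι q (x + y) fun i => φ i + ψ i := by
  simpa using hφ.sub hq ((ApproxSeq.const ι hq.sesq 0).sub hq hψ)

lemma smul (hq : IsClosable ι q) (hφ : ApproxSeq ι q x φ) (c : ℂ) :
    ApproxSeq ι q (c • x) fun i => c • φ i where
  tendsto := by simpa only [map_smul] using hφ.tendsto.const_smul c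
  cauchy := by simpa only [← smul_sub, hq.sesq.smul_smul_re, mul_zero] using
    hφ.cauchy.const_mul (‖c‖ ^ 2)

lemma tendsto_diff (hq : IsClosable ι q) (hφ : ApproxSeq ι q x φ) (hφ' : ApproxSeq ι q x φ') :
    Tendsto (fun i => √(formSum ι q (φ i - φ' i) (φ i - φ' i)).re) atTop (𝓝 0) := by
  have h := hφ.sub hq hφ'
  rw [sub_self] at h
  exact tendsto_formSum (hq.closable _ h) h.tendsto

lemma tendsto_form_sub (hq : IsClosable ι q) (hh : IsSesq h) {K : ℝ} (hK : 0 ≤ K)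
    (hb : ∀ f, |(h f f).re| ≤ K * ((q f f).re + ‖ι f‖ ^ 2))
    (hφ : ApproxSeq ι q x φ) (hφ' : ApproxSeq ι q x φ')
    (hψ : ApproxSeq ι q y ψ) (hψ' : ApproxSeq ι q y ψ') :
    Tendsto (fun i => h (φ i) (ψ i) - h (φ' i) (ψ' i)) atTop (𝓝 0) :=
  hq.tendsto_form hh hK hb (tendsto_diff hq hφ hφ') (tendsto_diff hq hψ hψ')
    (hψ.bounded hq).choose_spec (hφ'.bounded hq).choose_spec

lemma cauchySeq_form (hq : IsClosable ι q) (hh : IsSesq h) {K : ℝ} (hK : 0 ≤ K)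
    (hb : ∀ f, |(h f f).re| ≤ K * ((q f f).re + ‖ι f‖ ^ 2))
    (hφ : ApproxSeq ι q x φ) (hψ : ApproxSeq ι q y ψ) :
    CauchySeq fun i => h (φ i) (ψ i) := by
  rw [cauchySeq_iff_tendsto_dist_atTop_0]
  simp only [dist_eq_norm]
  refine tendsto_zero_iff_norm_tendsto_zero.mp (hq.tendsto_form hh hK hb (const_sub_tendsto hφ)
    (const_sub_tendsto hψ) (M := (hψ.bounded hq).choose) (M' := (hφ.bounded hq).choose) ?_ ?_) <;>
    rw [← prod_atTop_atTop_eq]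
  exacts [tendsto_fst.eventually (hψ.bounded hq).choose_spec,
    tendsto_snd.eventually (hφ.bounded hq).choose_spec]

end ApproxSeq

/-- The domain of the closure of `q`. -/
def closureDom (hq : IsClosable ι q) : Submodule ℂ H where
  carrier := {x | ∃ φ, ApproxSeq ι q x φ}
  add_mem' := fun ⟨_, h⟩ ⟨_, h'⟩ => ⟨_, h.add hq h'⟩
  zero_mem' := ⟨fun _ => 0, by simpa using ApproxSeq.const ι hq.sesq 0⟩
  smul_mem' := fun c _ ⟨_, h⟩ => ⟨_, h.smul hq c⟩

/-- `hbar` extends `h` by continuity. -/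
def IsFormExtension (ι : V →ₗ[ℂ] H) (q h : V → V → ℂ) (hbar : H → H → ℂ) : Prop :=
  ∀ x y φ ψ, ApproxSeq ι q x φ → ApproxSeq ι q y ψ →
    Tendsto (fun i => h (φ i) (ψ i)) atTop (𝓝 (hbar x y))

namespace IsFormExtension

variable {qbar hbar : H → H → ℂ}

lemma sesq (hq : IsClosable ι q) (hh : IsSesq h) (he : IsFormExtension ι q h hbar) :
    IsSesq fun f g : closureDom hq => hbar f g where
  add_left := by
    rintro ⟨f, a, ha⟩ ⟨g, b, hb⟩ ⟨k, c, hc⟩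
    refine tendsto_nhds_unique (he _ _ _ _ (ha.add hq hb) hc) ?_
    simp only [hh.add_left]
    exact (he _ _ _ _ ha hc).add (he _ _ _ _ hb hc)
  smul_left := by
    rintro r ⟨f, a, ha⟩ ⟨k, c, hc⟩
    refine tendsto_nhds_unique (he _ _ _ _ (ha.smul hq r) hc) ?_
    simp only [hh.smul_left]
    exact (he _ _ _ _ ha hc).const_mul r
  symm := by
    rintro ⟨f, a, ha⟩ ⟨k, c, hc⟩
    refine tendsto_nhds_unique (he _ _ _ _ hc ha) ?_
    simp only [hh.symm (a _)]
    exact (Complex.continuous_conj.tendsto _).comp (he _ _ _ _ ha hc)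

lemma tendsto_re (he : IsFormExtension ι q h hbar) (hx : ApproxSeq ι q x φ) :
    Tendsto (fun i => (h (φ i) (φ i)).re) atTop (𝓝 (hbar x x).re) :=
  (Complex.continuous_re.tendsto _).comp (he _ _ _ _ hx hx)

lemma nonneg (hq : IsClosable ι q) (he : IsFormExtension ι q q qbar) {f : H}
    (hf : f ∈ closureDom hq) : 0 ≤ (qbar f f).re :=
  ge_of_tendsto' (he.tendsto_re hf.choose_spec) fun _ => hq.nonneg _

lemma tendsto_sub (hq : IsClosable ι q) (he : IsFormExtension ι q q qbar) (hφ : ApproxSeq ι q x φ) :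
    Tendsto (fun i => √(qbar (ι (φ i) - x) (ι (φ i) - x)).re) atTop (𝓝 0) := by
  rw [Metric.tendsto_atTop]
  intro δ hδ
  obtain ⟨n, hn⟩ := eventually_atTop_prod_self'.mp
    ((tendsto_sqrt_zero hφ.cauchy).eventually (gt_mem_nhds (half_pos hδ)))
  refine ⟨n, fun k hk => ?_⟩
  rw [Real.dist_eq, sub_zero, abs_of_nonneg (sqrt_nonneg _)]
  refine lt_of_le_of_lt (le_of_tendsto (b := δ / 2)
    (he.tendsto_re ((ApproxSeq.const ι hq.sesq (φ k)).sub hq hφ)).sqrt ?_) (half_lt_self hδ)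
  filter_upwards [eventually_ge_atTop n] with i hi using (hn k hk i hi).le

/-- The closure of a closable form is closed. -/
lemma isClosedForm (hq : IsClosable ι q) (he : IsFormExtension ι q q qbar) :
    IsClosedForm (closureDom hq : Set H) qbar where
  add_left := fun f hf g hg k hk => (he.sesq hq hq.sesq).add_left ⟨f, hf⟩ ⟨g, hg⟩ ⟨k, hk⟩
  smul_left := fun c f hf g hg => (he.sesq hq hq.sesq).smul_left c ⟨f, hf⟩ ⟨g, hg⟩
  symm := fun f hf g hg => (he.sesq hq hq.sesq).symm ⟨f, hf⟩ ⟨g, hg⟩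
  semibounded := ⟨0, fun f hf => by simpa using he.nonneg hq hf⟩
  closed x f hx hxf hc := by
    have tri := (he.sesq hq hq.sesq).sqrt_sub_le fun f => he.nonneg hq f.2
    have hinv : Tendsto (fun k : ℕ => 1 / ((k : ℝ) + 1)) atTop (𝓝 0) :=
      tendsto_one_div_add_atTop_nhds_zero_nat
    have hsel : ∀ k : ℕ, ∃ v : V, √(qbar (ι v - x k) (ι v - x k)).re < 1 / ((k : ℝ) + 1) ∧
        ‖ι v - x k‖ < 1 / ((k : ℝ) + 1) := fun k => by
      obtain ⟨a, ha⟩ := hx k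
      obtain ⟨i, hi⟩ := (((he.tendsto_sub hq ha).eventually
        (gt_mem_nhds Nat.one_div_pos_of_nat)).and ((tendsto_iff_norm_sub_tendsto_zero.mp
          ha.tendsto).eventually (gt_mem_nhds Nat.one_div_pos_of_nat))).exists
      exact ⟨a i, hi⟩
    choose φ hφ1 hφ2 using hsel
    have mem : ∀ v, ι v ∈ closureDom hq := fun v => ⟨_, ApproxSeq.const ι hq.sesq v⟩
    have hφ : ApproxSeq ι q f φ := by
      refine ⟨by simpa using (squeeze_zero_norm (fun k => (hφ2 k).le) hinv).add hxf,
        tendsto_of_sqrt_zero (fun _ => hq.nonneg _) ?_⟩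
      have h1 := tendsto_sqrt_zero hc
      rw [← prod_atTop_atTop_eq] at h1 ⊢
      have h2 := ((hinv.comp tendsto_fst).add h1).add (hinv.comp tendsto_snd)
      simp only [add_zero] at h2
      refine squeeze_zero (fun _ => sqrt_nonneg _) (fun l => ?_) h2
      have e : qbar (ι (φ l.1) - ι (φ l.2)) (ι (φ l.1) - ι (φ l.2)) =
          q (φ l.1 - φ l.2) (φ l.1 - φ l.2) := by
        rw [← map_sub]
        exact tendsto_nhds_unique (he _ _ _ _ (ApproxSeq.const ι hq.sesq _)
          (ApproxSeq.const ι hq.sesq _)) tendsto_const_nhds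
      have t1 := tri ⟨_, mem (φ l.1)⟩ ⟨_, hx l.1⟩ ⟨_, mem (φ l.2)⟩
      have t2 := tri ⟨_, hx l.1⟩ ⟨_, hx l.2⟩ ⟨_, mem (φ l.2)⟩
      have t3 := (he.sesq hq hq.sesq).sub_rev ⟨_, hx l.2⟩ ⟨_, mem (φ l.2)⟩
      simp only [Submodule.coe_sub, e] at t1 t2 t3
      rw [t3] at t2
      exact t1.trans ((add_le_add (hφ1 _).le (t2.trans (add_le_add_right (hφ1 _).le _))).trans_eq
        (add_assoc _ _ _).symm)
    refine ⟨⟨φ, hφ⟩, tendsto_of_sqrt_zero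
      (fun k => he.nonneg hq ((closureDom hq).sub_mem (hx k) ⟨φ, hφ⟩)) ?_⟩
    have h1 := hinv.add (he.tendsto_sub hq hφ)
    rw [add_zero] at h1
    refine squeeze_zero (fun _ => sqrt_nonneg _) (fun k => ?_) h1
    have t1 := tri ⟨_, hx k⟩ ⟨_, mem (φ k)⟩ ⟨f, φ, hφ⟩
    rw [(he.sesq hq hq.sesq).sub_rev ⟨_, hx k⟩ ⟨_, mem (φ k)⟩] at t1
    simp only [Submodule.coe_sub] at t1
    exact t1.trans (add_le_add_left (hφ1 k).le _)

lemma isClosedForm_of_bounds (hq : IsClosable ι q) (heq : IsFormExtension ι q q qbar)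
    (hh : IsSesq h) (he : IsFormExtension ι q h hbar) {a C : ℝ} (ha : 0 < a)
    (hl : ∀ f, a * (q f f).re - C * ‖ι f‖ ^ 2 ≤ (h f f).re)
    (hu : ∀ f, (h f f).re ≤ C * ((q f f).re + ‖ι f‖ ^ 2)) :
    IsClosedForm (closureDom hq : Set H) hbar := by
  refine MagneticGraph.isClosedForm_of_bounds (heq.isClosedForm hq) (fun f hf => heq.nonneg hq hf)
    (he.sesq hq hh) ha (C := C) ?_ ?_ <;> rintro f ⟨φ, hφ⟩
  · exact le_of_tendsto_of_tendsto' (((heq.tendsto_re hφ).const_mul a).sub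
      ((hφ.tendsto.norm.pow 2).const_mul C)) (he.tendsto_re hφ) fun i => hl _
  · exact le_of_tendsto_of_tendsto' (he.tendsto_re hφ) (((heq.tendsto_re hφ).add
      (hφ.tendsto.norm.pow 2)).const_mul C) fun i => hu _

end IsFormExtension

end Closure

section DisjointUnions

lemma measurableEmbedding_sigmaMk {κ : Type*} {α : κ → Type*} [∀ i, MeasurableSpace (α i)] (i : κ) :
    MeasurableEmbedding (Sigma.mk (β := α) i) where
  injective := sigma_mk_injective
  measurable := Measurable.of_le_map (iInf_le _ i)
  measurableSet_image' := by
    intro s hs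
    rw [Sigma.instMeasurableSpace, MeasurableSpace.measurableSet_iInf]
    intro a
    change MeasurableSet (Sigma.mk a ⁻¹' (Sigma.mk i '' s))
    by_cases h : a = i
    · subst h
      rwa [preimage_image_eq _ sigma_mk_injective]
    · convert! MeasurableSet.empty
      ext x
      simp only [mem_preimage, mem_image, mem_empty_iff_false, iff_false, not_exists, not_and]
      rintro y - hy
      exact h (congrArg Sigma.fst hy).symm

lemma measurableEmbedding_inl {α β : Type*} [MeasurableSpace α] [MeasurableSpace β] :
    MeasurableEmbedding (Sum.inl : α → α ⊕ β) where
  injective := Sum.inl_injective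
  measurable := measurable_inl
  measurableSet_image' := fun _ hs => hs.inl_image

lemma measurableEmbedding_inr {α β : Type*} [MeasurableSpace α] [MeasurableSpace β] :
    MeasurableEmbedding (Sum.inr : β → α ⊕ β) where
  injective := Sum.inr_injective
  measurable := measurable_inr
  measurableSet_image' := fun _ hs => hs.inr_image

lemma eLpNorm_two_sq {α : Type*} [MeasurableSpace α] (μ : Measure α) (f : α → ℂ) :
    eLpNorm f 2 μ ^ 2 = ∫⁻ x, ‖f x‖ₑ ^ 2 ∂μ := by
  have h := eLpNorm_nnreal_pow_eq_lintegral (μ := μ) (f := f) (p := 2) (by norm_num)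
  have e : ((2 : NNReal) : ℝ≥0∞) = 2 := by norm_num
  have e' : ((2 : NNReal) : ℝ) = (2 : ℕ) := by norm_num
  rw [e, e'] at h
  simp only [ENNReal.rpow_natCast] at h
  exact h

lemma norm_sq_eq_of_inner {H : Type*} [NormedAddCommGroup H] [InnerProductSpace ℂ H] {x : H} {r : ℝ}
    (h : inner ℂ x x = (r : ℂ)) : ‖x‖ ^ 2 = r :=
  (inner_self_eq_norm_sq (𝕜 := ℂ) x).symm.trans (congrArg Complex.re h)

lemma integral_conj_mul_self {α : Type*} [MeasurableSpace α] (μ : Measure α) (f : α → ℂ) :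
    ∫ x, conj (f x) * f x ∂μ = ((∫ x, ‖f x‖ ^ 2 ∂μ : ℝ) : ℂ) := by
  simp only [← integral_complex_ofReal, ← Complex.normSq_eq_conj_mul_self,
    normSq_eq_norm_sq]

lemma lintegral_enorm_sq {α : Type*} [MeasurableSpace α] {μ : Measure α} {f : α → ℂ}
    (hf : MemLp f 2 μ) : ∫⁻ x, ‖f x‖ₑ ^ 2 ∂μ = ofReal (∫ x, ‖f x‖ ^ 2 ∂μ) := by
  rw [ofReal_integral_eq_lintegral_ofReal ((memLp_two_iff_integrable_sq_norm hf.1).mp hf)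
    (.of_forall fun _ => by positivity)]
  simp only [ofReal_pow (norm_nonneg _), ofReal_norm]

lemma norm_sq_add_le {E : Type*} [SeminormedAddCommGroup E] (a b : E) :
    ‖a + b‖ ^ 2 ≤ 2 * ‖a‖ ^ 2 + 2 * ‖b‖ ^ 2 := by
  rw [← mul_add]
  exact (pow_le_pow_left₀ (norm_nonneg _) (norm_add_le a b) 2).trans add_sq_le

lemma Lp_norm_sq {α : Type*} [MeasurableSpace α] {μ : Measure α} (f : Lp ℂ 2 μ) :
    ‖f‖ ^ 2 = ∫ x, ‖f x‖ ^ 2 ∂μ :=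
  norm_sq_eq_of_inner (by simp only [L2.inner_def, RCLike.inner_apply', integral_conj_mul_self])

lemma memLp_two_iff {α : Type*} [MeasurableSpace α] {μ : Measure α} {f : α → ℂ} :
    MemLp f 2 μ ↔ AEStronglyMeasurable f μ ∧ ∫⁻ x, ‖f x‖ₑ ^ 2 ∂μ < ⊤ := by
  rw [MemLp, ← eLpNorm_two_sq, ENNReal.pow_lt_top_iff]
  simp

variable {κ : Type*} [Fintype κ] {β : Type*} [MeasurableSpace β] {α : κ → Type*}
  [∀ i, MeasurableSpace (α i)] (μ : ∀ i, Measure (α i)) {j : ∀ i, α i → β}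

lemma lintegral_sum_map (hj : ∀ i, MeasurableEmbedding (j i)) (F : β → ℝ≥0∞) :
    ∫⁻ x, F x ∂Measure.sum (fun i => (μ i).map (j i)) = ∑ i, ∫⁻ a, F (j i a) ∂μ i := by
  rw [lintegral_sum_measure, tsum_fintype]
  exact sum_congr rfl fun i _ => (hj i).lintegral_map _

variable {μ}

lemma aestronglyMeasurable_sum_map (hj : ∀ i, MeasurableEmbedding (j i)) {f : β → ℂ} :
    AEStronglyMeasurable f (Measure.sum fun i => (μ i).map (j i)) ↔
      ∀ i, AEStronglyMeasurable (fun a => f (j i a)) (μ i) := by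
  rw [aestronglyMeasurable_sum_measure_iff]
  exact forall_congr' fun i => (hj i).aestronglyMeasurable_map_iff

lemma ae_sum_map (hj : ∀ i, MeasurableEmbedding (j i)) {p : β → Prop} :
    (∀ᵐ x ∂Measure.sum (fun i => (μ i).map (j i)), p x) ↔ ∀ i, ∀ᵐ a ∂μ i, p (j i a) := by
  rw [Measure.ae_sum_iff]
  exact forall_congr' fun i => (hj i).ae_map_iff

lemma memLp_sum_map (hj : ∀ i, MeasurableEmbedding (j i)) {f : β → ℂ} :
    MemLp f 2 (Measure.sum fun i => (μ i).map (j i)) ↔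
      ∀ i, MemLp (fun a => f (j i a)) 2 (μ i) := by
  simp only [memLp_two_iff, aestronglyMeasurable_sum_map hj, lintegral_sum_map μ hj,
    ENNReal.sum_lt_top, Finset.mem_univ, true_imp_iff, forall_and]

lemma integral_sum_map (hj : ∀ i, MeasurableEmbedding (j i)) {f : β → ℂ}
    (hf : Integrable f (Measure.sum fun i => (μ i).map (j i))) :
    ∫ x, f x ∂Measure.sum (fun i => (μ i).map (j i)) = ∑ i, ∫ a, f (j i a) ∂μ i := by
  rw [integral_sum_measure hf, tsum_fintype]
  exact sum_congr rfl fun i _ => (hj i).integral_map _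

end DisjointUnions

section GraphMeasure

variable {n : ℕ} {G : SimpleGraph (Fin n)} {d : ℝ}

notation "edgeVol" d:max e:max => Measure.restrict volume (edgeInterval d e)

lemma measurableSet_edgeInterval (e : Edge G) : MeasurableSet (edgeInterval d e) := by
  rcases e with j | e
  · exact measurableSet_Ici
  · exact measurableSet_Icc

lemma ae_graph_iff {p : (Σ _ : Edge G, ℝ) → Prop} :
    (∀ᵐ q ∂graphMeasure G d, p q) ↔ ∀ e, ∀ᵐ s ∂edgeVol d e, p ⟨e, s⟩ :=
  ae_sum_map measurableEmbedding_sigmaMk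

lemma memLp_graph_iff {f : (Σ _ : Edge G, ℝ) → ℂ} :
    MemLp f 2 (graphMeasure G d) ↔
      ∀ e, MemLp (fun s => f ⟨e, s⟩) 2 (edgeVol d e) :=
  memLp_sum_map measurableEmbedding_sigmaMk

lemma graphL2_memLp (f : GraphL2 G d) (e : Edge G) :
    MemLp (fun s => f ⟨e, s⟩) 2 (edgeVol d e) :=
  memLp_graph_iff.mp (Lp.memLp f) e

lemma integral_graph {F : (Σ _ : Edge G, ℝ) → ℂ} (hF : Integrable F (graphMeasure G d)) :
    ∫ q, F q ∂graphMeasure G d = ∑ e, ∫ s in edgeInterval d e, F ⟨e, s⟩ :=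
  integral_sum_map measurableEmbedding_sigmaMk hF

lemma graph_inner (f g : GraphL2 G d) :
    inner ℂ f g = ∑ e, ∫ s in edgeInterval d e, conj (f ⟨e, s⟩) * g ⟨e, s⟩ := by
  rw [L2.inner_def, integral_graph (L2.integrable_inner f g)]
  refine sum_congr rfl fun e _ => integral_congr_ae (.of_forall fun s => ?_)
  simp only [RCLike.inner_apply']

lemma graph_norm_sq (f : GraphL2 G d) :
    ‖f‖ ^ 2 = ∑ e, ∫ s in edgeInterval d e, ‖f ⟨e, s⟩‖ ^ 2 :=
  norm_sq_eq_of_inner (by simp only [graph_inner, integral_conj_mul_self, Complex.ofReal_sum])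

end GraphMeasure

namespace BuildingBlocks

variable {n k : ℕ} {G : SimpleGraph (Fin n)} (B : BuildingBlocks.{u} G k) {d ε : ℝ}

/-- The measure of the unscaled edge neighbourhood. -/
def edgeMeas (d : ℝ) (e : Edge G) : Measure (ℝ × B.Y e) :=
  (edgeVol d e).prod (dV (B.Y e))

/-- The Riemannian measure of the unscaled vertex manifold. -/
def vertMeas (v : Fin n) : Measure (B.X v) := dV (B.X v)

instance (v : Fin n) : IsFiniteMeasure (B.vertMeas v) :=
  inferInstanceAs (IsFiniteMeasure (riemVol _ _))

instance (e : Edge G) : IsProbabilityMeasure (dV (B.Y e)) := ⟨B.vol_Y e⟩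

lemma volY_eq (hε : 0 < ε) (e : Edge G) :
    B.volY ε e = ofReal (ε ^ k) • dV (B.Y e) := riemVol_scaleMetric hε

lemma volX_eq (hε : 0 < ε) (v : Fin n) :
    B.volX ε v = ofReal (ε ^ (k + 1)) • B.vertMeas v := riemVol_scaleMetric hε

lemma prod_volY_eq (hε : 0 < ε) (e : Edge G) :
    (edgeVol d e).prod (B.volY ε e) =
      ofReal (ε ^ k) • B.edgeMeas d e := by
  rw [B.volY_eq hε, edgeMeas, Measure.prod_smul_right]

lemma measurableEmbedding_edgePt (e : Edge G) : MeasurableEmbedding (edgePt (B := B) e) :=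
  measurableEmbedding_inl.comp (measurableEmbedding_sigmaMk (α := fun e => ℝ × B.Y e) e)

lemma measurableEmbedding_vertexPt (v : Fin n) : MeasurableEmbedding (vertexPt (B := B) v) :=
  measurableEmbedding_inr.comp (measurableEmbedding_sigmaMk (α := fun v => B.X v) v)

lemma ae_mfd_iff (hε : 0 < ε) {p : B.Point → Prop} : (∀ᵐ z ∂B.mfdMeasure d ε, p z) ↔
    (∀ e, ∀ᵐ q ∂B.edgeMeas d e, p (edgePt e q)) ∧ ∀ v, ∀ᵐ x ∂B.vertMeas v, p (vertexPt v x) := by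
  rw [mfdMeasure, ae_add_measure_iff, ae_sum_map B.measurableEmbedding_edgePt,
    ae_sum_map B.measurableEmbedding_vertexPt]
  refine and_congr (forall_congr' fun e => ?_) (forall_congr' fun v => ?_)
  · rw [B.prod_volY_eq hε, Measure.ae_ennreal_smul_measure_iff (by simp [hε])]
  · rw [B.volX_eq hε, Measure.ae_ennreal_smul_measure_iff (by simp [hε])]

lemma memLp_smul_iff {α : Type*} [MeasurableSpace α] {μ : Measure α} {c : ℝ≥0∞} (hc : c ≠ 0)
    (hc' : c ≠ ⊤) {f : α → ℂ} : MemLp f 2 (c • μ) ↔ MemLp f 2 μ := by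
  refine ⟨fun h => ?_, fun h => h.smul_measure hc'⟩
  have := h.smul_measure (ENNReal.inv_ne_top.mpr hc)
  rwa [smul_smul, ENNReal.inv_mul_cancel hc hc', one_smul] at this

lemma memLp_mfd_iff (hε : 0 < ε) {f : B.Point → ℂ} : MemLp f 2 (B.mfdMeasure d ε) ↔
    (∀ e, MemLp (fun q => f (edgePt e q)) 2 (B.edgeMeas d e)) ∧
      ∀ v, MemLp (fun x => f (vertexPt v x)) 2 (B.vertMeas v) := by
  have h : MemLp f 2 (B.mfdMeasure d ε) ↔
      MemLp f 2 (Measure.sum fun e : Edge G =>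
        ((edgeVol d e).prod (B.volY ε e)).map (edgePt e)) ∧
      MemLp f 2 (Measure.sum fun v : Fin n => (B.volX ε v).map (vertexPt v)) := by
    simp only [memLp_two_iff, mfdMeasure, aestronglyMeasurable_add_measure_iff,
      lintegral_add_measure, ENNReal.add_lt_top]
    tauto
  rw [h, memLp_sum_map B.measurableEmbedding_edgePt, memLp_sum_map B.measurableEmbedding_vertexPt]
  refine and_congr (forall_congr' fun e => ?_) (forall_congr' fun v => ?_)
  · rw [B.prod_volY_eq hε, memLp_smul_iff (by simp [hε]) ofReal_ne_top]
  · rw [B.volX_eq hε, memLp_smul_iff (by simp [hε]) ofReal_ne_top]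

lemma mfdL2_memLp (hε : 0 < ε) (x : B.MfdL2 d ε) :
    (∀ e, MemLp (fun q => x (edgePt e q)) 2 (B.edgeMeas d e)) ∧
      ∀ v, MemLp (fun z => x (vertexPt v z)) 2 (B.vertMeas v) :=
  (B.memLp_mfd_iff hε).mp (Lp.memLp x)

lemma integral_mfd (hε : 0 < ε) {F : B.Point → ℂ} (hF : Integrable F (B.mfdMeasure d ε)) :
    ∫ z, F z ∂B.mfdMeasure d ε =
      ∑ e, (ε ^ k : ℝ) * ∫ q, F (edgePt e q) ∂B.edgeMeas d e +
        ∑ v, (ε ^ (k + 1) : ℝ) * ∫ z, F (vertexPt v z) ∂B.vertMeas v := by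
  obtain ⟨h₁, h₂⟩ := integrable_add_measure.mp hF
  have h := integral_add_measure h₁ h₂
  rw [integral_sum_map B.measurableEmbedding_edgePt h₁,
    integral_sum_map B.measurableEmbedding_vertexPt h₂] at h
  refine h.trans ?_
  congr 1
  · refine sum_congr rfl fun e _ => ?_
    rw [B.prod_volY_eq hε, integral_smul_measure, toReal_ofReal (by positivity),
      real_smul]
  · refine sum_congr rfl fun v _ => ?_
    rw [B.volX_eq hε, integral_smul_measure, toReal_ofReal (by positivity),
      real_smul]

lemma mfd_inner (hε : 0 < ε) (x y : B.MfdL2 d ε) : inner ℂ x y =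
    ∑ e, (ε ^ k : ℝ) * ∫ q, conj (x (edgePt e q)) * y (edgePt e q) ∂B.edgeMeas d e +
      ∑ v, (ε ^ (k + 1) : ℝ) * ∫ z, conj (x (vertexPt v z)) * y (vertexPt v z) ∂B.vertMeas v := by
  rw [L2.inner_def, B.integral_mfd hε (L2.integrable_inner x y)]
  simp only [RCLike.inner_apply']

lemma mfd_norm_sq (hε : 0 < ε) (x : B.MfdL2 d ε) : ‖x‖ ^ 2 =
    ∑ e, ε ^ k * ∫ q, ‖x (edgePt e q)‖ ^ 2 ∂B.edgeMeas d e +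
      ∑ v, ε ^ (k + 1) * ∫ z, ‖x (vertexPt v z)‖ ^ 2 ∂B.vertMeas v :=
  norm_sq_eq_of_inner (by
    rw [B.mfd_inner hε]; simp only [integral_conj_mul_self]; push_cast; rfl)

end BuildingBlocks

section GradProd

variable {N : ℕ} {Hm : Type} [TopologicalSpace Hm]
  {I : ModelWithCorners ℝ (𝔼 N) Hm} {M : RiemMfd.{u} I}

lemma gradProd_add_left {φ φ' : M → ℂ} (ψ : M → ℂ) {x : M} (h : MDifferentiableAt I 𝓘(ℝ, ℂ) φ x)
    (h' : MDifferentiableAt I 𝓘(ℝ, ℂ) φ' x) : gradProd I M.g (φ + φ') ψ x =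
      gradProd I M.g φ ψ x + gradProd I M.g φ' ψ x := by
  refine (congrArg (fun α => cometric I M.g x α (mfderiv I 𝓘(ℝ, ℂ) ψ x)) (mfderiv_add h h')).trans ?_
  exact cometric_add_left _ _ _ _ _

lemma gradProd_smul_left {φ : M → ℂ} (ψ : M → ℂ) {x : M} (h : MDifferentiableAt I 𝓘(ℝ, ℂ) φ x)
    (c : ℂ) : gradProd I M.g (c • φ) ψ x = c * gradProd I M.g φ ψ x := by
  let α : TangentSpace I x →L[ℝ] ℂ := mfderiv I 𝓘(ℝ, ℂ) φ x
  have h1 : HasMFDerivAt I 𝓘(ℝ, ℂ) (c • φ) x (c • α) :=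
    ⟨h.hasMFDerivAt.1.const_smul c, h.hasMFDerivAt.2.const_smul c⟩
  refine (congrArg (fun α => cometric I M.g x α (mfderiv I 𝓘(ℝ, ℂ) ψ x)) h1.mfderiv).trans ?_
  exact cometric_smul_left _ _ _ _ _

lemma gradProd_symm (φ ψ : M → ℂ) (x : M) :
    gradProd I M.g ψ φ x = conj (gradProd I M.g φ ψ x) :=
  cometric_conj_symm _ _ _

lemma gradProd_scaleMetric {ε : ℝ} (hε : ε ≠ 0) (φ ψ : M → ℂ) (x : M) :
    gradProd I (scaleMetric I ε M.g) φ ψ x = ((ε ^ 2)⁻¹ : ℝ) * gradProd I M.g φ ψ x :=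
  cometric_scaleMetric hε x _ _

lemma gradProd_const_left (c : ℂ) (ψ : M → ℂ) (x : M) :
    gradProd I M.g (fun _ => c) ψ x = 0 := by
  refine (congrArg (fun α => cometric I M.g x α (mfderiv I 𝓘(ℝ, ℂ) ψ x)) mfderiv_const).trans ?_
  refine sum_eq_zero fun i _ => sum_eq_zero fun j _ => ?_
  change _ * ((0 : ℂ) * _) = 0
  rw [zero_mul, mul_zero]

lemma gradProd_const_right (c : ℂ) (ψ : M → ℂ) (x : M) :
    gradProd I M.g ψ (fun _ => c) x = 0 := by
  rw [gradProd_symm, gradProd_const_left, map_zero]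

end GradProd

namespace BuildingBlocks

variable {n k : ℕ} {G : SimpleGraph (Fin n)} (B : BuildingBlocks.{u} G k) {d ε : ℝ}

section Extend

variable (d ε)

lemma extend_add (φ ψ : B.Point → ℂ) (e : Edge G) :
    B.extend d ε (φ + ψ) e = B.extend d ε φ e + B.extend d ε ψ e := by
  funext ⟨s, y⟩
  rcases e with j | e <;> simp only [extend, Pi.add_apply] <;> split_ifs <;> rfl

lemma extend_smul (c : ℂ) (φ : B.Point → ℂ) (e : Edge G) :
    B.extend d ε (c • φ) e = c • B.extend d ε φ e := by
  funext ⟨s, y⟩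
  rcases e with j | e <;> simp only [extend, Pi.smul_apply] <;> split_ifs <;> rfl

lemma extend_zero (e : Edge G) : B.extend d ε 0 e = 0 := by
  funext ⟨s, y⟩
  rcases e with j | e <;> simp only [extend, Pi.zero_apply] <;> split_ifs <;> rfl

variable {d ε}

lemma extend_of_mem (φ : B.Point → ℂ) {e : Edge G} {s : ℝ} (hs : s ∈ edgeInterval d e)
    (y : B.Y e) : B.extend d ε φ e (s, y) = φ (edgePt e (s, y)) := by
  rcases e with j | e
  · have : ¬ s < 0 := not_lt.mpr hs
    simp [extend, this]
  · have h1 : ¬ s < -d := not_lt.mpr hs.1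
    have h2 : ¬ d < s := not_lt.mpr hs.2
    simp [extend, h1, h2]

lemma isOpen_extInterval (e : Edge G) : IsOpen (B.extInterval d ε e) := by
  rcases e with j | e
  · exact isOpen_Ioi
  · exact isOpen_Ioo

lemma edgeInterval_subset (hε : 0 < ε) (e : Edge G) :
    edgeInterval d e ⊆ B.extInterval d ε e := by
  have := mul_pos hε B.ℓ_pos
  rcases e with j | e
  · intro s hs
    have hs' : 0 ≤ s := hs
    change -(ε * B.ℓ) < s
    linarith
  · intro s hs
    exact ⟨by linarith [hs.1], by linarith [hs.2]⟩

lemma isClosed_edgeInterval (e : Edge G) : IsClosed (edgeInterval d e) := by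
  rcases e with j | e
  · exact isClosed_Ici
  · exact isClosed_Icc

end Extend

/-- Continuous functions with bounded support on an edge neighbourhood. -/
structure IsNice (d : ℝ) (e : Edge G) (f : ℝ × B.Y e → ℂ) : Prop where
  cont : ContinuousOn f (edgeInterval d e ×ˢ univ)
  supp : ∃ R, ∀ s ∈ edgeInterval d e, R < s → ∀ y, f (s, y) = 0

lemma edgeMeas_eq (d : ℝ) (e : Edge G) : B.edgeMeas d e =
    ((volume : Measure ℝ).prod (dV (B.Y e))).restrict (edgeInterval d e ×ˢ univ) := by
  rw [← Measure.prod_restrict, Measure.restrict_univ, edgeMeas]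

lemma ae_edgeMeas_of_mem {e : Edge G} {p : ℝ × B.Y e → Prop}
    (h : ∀ s ∈ edgeInterval d e, ∀ y, p (s, y)) : ∀ᵐ q ∂B.edgeMeas d e, p q := by
  rw [edgeMeas_eq]
  refine ae_restrict_of_forall_mem ((measurableSet_edgeInterval e).prod MeasurableSet.univ) ?_
  rintro ⟨s, y⟩ ⟨hs, -⟩
  exact h s hs y

namespace IsNice

variable {B} {e : Edge G} {f g : ℝ × B.Y e → ℂ}

lemma memLp (hf : B.IsNice d e f) (p : ℝ≥0∞) : MemLp f p (B.edgeMeas d e) := by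
  obtain ⟨R, hR⟩ := hf.supp
  set S : Set (ℝ × B.Y e) := edgeInterval d e ×ˢ univ with hS
  have hSm : MeasurableSet S := (measurableSet_edgeInterval e).prod MeasurableSet.univ
  obtain ⟨a, ha⟩ : ∃ a, edgeInterval d e ⊆ Ici a := by
    rcases e with j | e
    · exact ⟨0, subset_rfl⟩
    · exact ⟨-d, fun s hs => hs.1⟩
  set K : Set (ℝ × B.Y e) := (edgeInterval d e ∩ Icc a R) ×ˢ univ with hK
  have hKc : IsCompact K :=
    (isCompact_Icc.inter_left (isClosed_edgeInterval e)).prod isCompact_univ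
  have hKm : MeasurableSet K :=
    ((measurableSet_edgeInterval e).inter measurableSet_Icc).prod MeasurableSet.univ
  have hKS : K ⊆ S := prod_mono_left inter_subset_left
  obtain ⟨C, hC⟩ := hKc.exists_bound_of_continuousOn (hf.cont.mono hKS)
  set m := (volume : Measure ℝ).prod (dV (B.Y e)) with hm
  rw [edgeMeas_eq]
  have h1 : f =ᵐ[m.restrict S] K.indicator f := by
    refine ae_restrict_of_forall_mem hSm ?_
    rintro ⟨s, y⟩ ⟨hs, -⟩
    by_cases h : s ≤ R
    · rw [indicator_of_mem]
      exact ⟨⟨hs, ha hs, h⟩, mem_univ _⟩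
    · rw [hR s hs (not_le.mp h), indicator_of_notMem]
      exact fun h' => h h'.1.2.2
  rw [memLp_congr_ae h1, memLp_indicator_iff_restrict hKm, Measure.restrict_restrict hKm,
    inter_eq_left.mpr hKS]
  have : IsFiniteMeasure (m.restrict K) := ⟨by
    rw [Measure.restrict_apply_univ, hm, hK, Measure.prod_prod]
    refine ENNReal.mul_lt_top ?_ (measure_lt_top _ _)
    exact (measure_mono inter_subset_right).trans_lt measure_Icc_lt_top⟩
  refine MemLp.of_bound ((hf.cont.mono hKS).aestronglyMeasurable hKm) C ?_
  exact ae_restrict_of_forall_mem hKm hC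

lemma integrable (hf : B.IsNice d e f) : Integrable f (B.edgeMeas d e) :=
  memLp_one_iff_integrable.mp (hf.memLp 1)

lemma add (hf : B.IsNice d e f) (hg : B.IsNice d e g) : B.IsNice d e fun q => f q + g q where
  cont := hf.cont.add hg.cont
  supp := by
    obtain ⟨R, hR⟩ := hf.supp
    obtain ⟨R', hR'⟩ := hg.supp
    exact ⟨max R R', fun s hs h y => by
      rw [hR s hs ((le_max_left _ _).trans_lt h), hR' s hs ((le_max_right _ _).trans_lt h),
        add_zero]⟩

lemma const_mul (hf : B.IsNice d e f) (c : ℂ) : B.IsNice d e fun q => c * f q where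
  cont := continuousOn_const.mul hf.cont
  supp := by
    obtain ⟨R, hR⟩ := hf.supp
    exact ⟨R, fun s hs h y => by rw [hR s hs h, mul_zero]⟩

lemma mul_conj (hf : B.IsNice d e f) (hg : B.IsNice d e g) :
    B.IsNice d e fun q => f q * conj (g q) where
  cont := hf.cont.mul (Complex.continuous_conj.comp_continuousOn hg.cont)
  supp := by
    obtain ⟨R, hR⟩ := hf.supp
    exact ⟨R, fun s hs h y => by rw [hR s hs h, zero_mul]⟩

end IsNice

/-- The longitudinal derivative of the extension of a function. -/
def extDeriv (d ε : ℝ) (φ : B.Point → ℂ) (e : Edge G) (q : ℝ × B.Y e) : ℂ :=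
  deriv (fun t => B.extend d ε φ e (t, q.2)) q.1

/-- The product of the transverse derivatives of extensions, for the unscaled metric. -/
def extGrad (d ε : ℝ) (φ ψ : B.Point → ℂ) (e : Edge G) (q : ℝ × B.Y e) : ℂ :=
  gradProd (𝓡 k) (B.Y e).g (fun y => B.extend d ε φ e (q.1, y))
    (fun y => B.extend d ε ψ e (q.1, y)) q.2

/-- The product of the derivatives on a vertex manifold, for the unscaled metric. -/
def vertGrad (φ ψ : B.Point → ℂ) (v : Fin n) (x : B.X v) : ℂ :=
  gradProd (𝓑 k) (B.X v).g (fun x => φ (vertexPt v x)) (fun x => ψ (vertexPt v x)) x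

variable {B} {φ φ' ψ : B.Point → ℂ}

namespace IsTestFunction

lemma add (hφ : B.IsTestFunction d ε φ) (hψ : B.IsTestFunction d ε ψ) :
    B.IsTestFunction d ε (φ + ψ) where
  smooth_vertex v := (hφ.smooth_vertex v).add (hψ.smooth_vertex v)
  smooth_edge e := by
    rw [extend_add]
    exact (hφ.smooth_edge e).add (hψ.smooth_edge e)
  compact_support := by
    obtain ⟨R, hR⟩ := hφ.compact_support
    obtain ⟨R', hR'⟩ := hψ.compact_support
    exact ⟨max R R', fun j s y h => by
      rw [Pi.add_apply, hR j s y ((le_max_left _ _).trans_lt h),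
        hR' j s y ((le_max_right _ _).trans_lt h), add_zero]⟩

lemma smul (hφ : B.IsTestFunction d ε φ) (c : ℂ) : B.IsTestFunction d ε (c • φ) where
  smooth_vertex v := by
    have h : ContMDiff 𝓘(ℝ, ℂ) 𝓘(ℝ, ℂ) ∞ fun z : ℂ => c * z :=
      (contDiff_const.mul contDiff_id).contMDiff
    exact h.comp (hφ.smooth_vertex v)
  smooth_edge e := by
    rw [extend_smul]
    have h : ContMDiff 𝓘(ℝ, ℂ) 𝓘(ℝ, ℂ) ∞ fun z : ℂ => c * z :=
      (contDiff_const.mul contDiff_id).contMDiff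
    exact h.comp_contMDiffOn (hφ.smooth_edge e)
  compact_support := by
    obtain ⟨R, hR⟩ := hφ.compact_support
    exact ⟨R, fun j s y h => by rw [Pi.smul_apply, hR j s y h, smul_zero]⟩

lemma zero : B.IsTestFunction d ε 0 where
  smooth_vertex v := contMDiff_const
  smooth_edge e := by
    rw [extend_zero]
    exact contMDiffOn_const
  compact_support := ⟨0, fun _ _ _ _ => rfl⟩

lemma exists_supp (hφ : B.IsTestFunction d ε φ) (e : Edge G) :
    ∃ R, ∀ s ∈ edgeInterval d e, R < s → ∀ y, ∀ᶠ t in 𝓝 s, ∀ y', B.extend d ε φ e (t, y') = 0 ∧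
      B.extend d ε φ e (s, y) = 0 := by
  rcases e with j | e
  · obtain ⟨R, hR⟩ := hφ.compact_support
    refine ⟨max R 0, fun s hs h y => ?_⟩
    have key : ∀ t, max R 0 < t → ∀ y, B.extend d ε φ (Sum.inl j) (t, y) = 0 := fun t ht y => by
      rw [B.extend_of_mem φ (show t ∈ edgeInterval d (Sum.inl j : Edge G) from
        ((le_max_right _ _).trans ht.le)), hR j t y ((le_max_left _ _).trans_lt ht)]
    filter_upwards [lt_mem_nhds h] with t ht y'
    exact ⟨key t ht y', key s h y⟩
  · exact ⟨d, fun s hs h => absurd hs.2 (not_le.mpr h)⟩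

lemma nice_extend (hε : 0 < ε) (hφ : B.IsTestFunction d ε φ) (e : Edge G) :
    B.IsNice d e (B.extend d ε φ e) where
  cont := (hφ.smooth_edge e).continuousOn.mono (prod_mono_left (B.edgeInterval_subset hε e))
  supp := by
    obtain ⟨R, hR⟩ := hφ.exists_supp e
    exact ⟨R, fun s hs h y => ((hR s hs h y).self_of_nhds y).2⟩

lemma hasDerivAt_extend (hφ : B.IsTestFunction d ε φ) {e : Edge G} {s : ℝ}
    (hs : s ∈ B.extInterval d ε e) (y : B.Y e) :
    HasDerivAt (fun t => B.extend d ε φ e (t, y)) (B.extDeriv d ε φ e (s, y)) s :=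
  hasDerivAt_slice (B.isOpen_extInterval e) (hφ.smooth_edge e) hs y

lemma continuousOn_extDeriv (hφ : B.IsTestFunction d ε φ) (e : Edge G) :
    ContinuousOn (B.extDeriv d ε φ e) (B.extInterval d ε e ×ˢ univ) :=
  continuousOn_deriv_slice (B.isOpen_extInterval e) (hφ.smooth_edge e)

lemma nice_extDeriv (hε : 0 < ε) (hφ : B.IsTestFunction d ε φ) (e : Edge G) :
    B.IsNice d e (B.extDeriv d ε φ e) where
  cont := (hφ.continuousOn_extDeriv e).mono (prod_mono_left (B.edgeInterval_subset hε e))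
  supp := by
    obtain ⟨R, hR⟩ := hφ.exists_supp e
    refine ⟨R, fun s hs h y => ?_⟩
    have h1 : (fun t => B.extend d ε φ e (t, y)) =ᶠ[𝓝 s] fun _ => 0 :=
      (hR s hs h y).mono fun t ht => (ht y).1
    rw [extDeriv, h1.deriv_eq, deriv_const]

lemma continuousOn_extGrad (hφ : B.IsTestFunction d ε φ) (hψ : B.IsTestFunction d ε ψ)
    (e : Edge G) : ContinuousOn (B.extGrad d ε φ ψ e) (B.extInterval d ε e ×ˢ univ) :=
  continuousOn_gradProd (B.isOpen_extInterval e) (hφ.smooth_edge e) (hψ.smooth_edge e)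

lemma nice_extGrad (hε : 0 < ε) (hφ : B.IsTestFunction d ε φ) (hψ : B.IsTestFunction d ε ψ)
    (e : Edge G) : B.IsNice d e (B.extGrad d ε φ ψ e) where
  cont := (hφ.continuousOn_extGrad hψ e).mono (prod_mono_left (B.edgeInterval_subset hε e))
  supp := by
    obtain ⟨R, hR⟩ := hφ.exists_supp e
    refine ⟨R, fun s hs h y => ?_⟩
    have h1 : (fun y' => B.extend d ε φ e (s, y')) = fun _ => 0 :=
      funext fun y' => ((hR s hs h y).self_of_nhds y').1
    have h2 := gradProd_const_left (M := B.Y e) 0 (fun y' => B.extend d ε ψ e (s, y')) y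
    rw [← h1] at h2
    exact h2

lemma continuous_vertex (hφ : B.IsTestFunction d ε φ) (v : Fin n) :
    Continuous fun x : B.X v => φ (vertexPt v x) := (hφ.smooth_vertex v).continuous

lemma continuous_vertGrad (hφ : B.IsTestFunction d ε φ) (hψ : B.IsTestFunction d ε ψ)
    (v : Fin n) : Continuous (B.vertGrad φ ψ v) :=
  continuous_gradProd (hφ.smooth_vertex v) (hψ.smooth_vertex v)

lemma memLp (hε : 0 < ε) (hφ : B.IsTestFunction d ε φ) : MemLp φ 2 (B.mfdMeasure d ε) := by
  rw [B.memLp_mfd_iff hε]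
  refine ⟨fun e => ((hφ.nice_extend hε e).memLp 2).ae_eq ?_, fun v => ?_⟩
  · exact B.ae_edgeMeas_of_mem fun s hs y => B.extend_of_mem φ hs y
  · exact (hφ.continuous_vertex v).memLp_of_hasCompactSupport (HasCompactSupport.of_compactSpace _)

lemma extDeriv_add (hφ : B.IsTestFunction d ε φ) (hψ : B.IsTestFunction d ε ψ) {e : Edge G}
    {s : ℝ} (hs : s ∈ B.extInterval d ε e) (y : B.Y e) :
    B.extDeriv d ε (φ + ψ) e (s, y) = B.extDeriv d ε φ e (s, y) + B.extDeriv d ε ψ e (s, y) := by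
  have h := (hφ.hasDerivAt_extend hs y).add (hψ.hasDerivAt_extend hs y)
  rw [extDeriv, extend_add]
  exact h.deriv

lemma extDeriv_smul (hφ : B.IsTestFunction d ε φ) (c : ℂ) {e : Edge G}
    {s : ℝ} (hs : s ∈ B.extInterval d ε e) (y : B.Y e) :
    B.extDeriv d ε (c • φ) e (s, y) = c * B.extDeriv d ε φ e (s, y) := by
  have h := (hφ.hasDerivAt_extend hs y).const_mul c
  rw [extDeriv, extend_smul]
  exact h.deriv

lemma mdifferentiableAt_extend (hφ : B.IsTestFunction d ε φ) {e : Edge G}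
    {s : ℝ} (hs : s ∈ B.extInterval d ε e) (y : B.Y e) :
    MDifferentiableAt (𝓡 k) 𝓘(ℝ, ℂ) (fun y => B.extend d ε φ e (s, y)) y :=
  mdifferentiableAt_slice (B.isOpen_extInterval e) (hφ.smooth_edge e) hs y

lemma extGrad_add (hφ : B.IsTestFunction d ε φ) (hφ' : B.IsTestFunction d ε φ') (ψ : B.Point → ℂ)
    {e : Edge G} {s : ℝ} (hs : s ∈ B.extInterval d ε e) (y : B.Y e) :
    B.extGrad d ε (φ + φ') ψ e (s, y) =
      B.extGrad d ε φ ψ e (s, y) + B.extGrad d ε φ' ψ e (s, y) := by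
  have h := gradProd_add_left (M := B.Y e) (fun y => B.extend d ε ψ e (s, y))
    (hφ.mdifferentiableAt_extend hs y) (hφ'.mdifferentiableAt_extend hs y)
  rw [extGrad, extend_add]
  exact h

lemma extGrad_smul (hφ : B.IsTestFunction d ε φ) (c : ℂ) (ψ : B.Point → ℂ)
    {e : Edge G} {s : ℝ} (hs : s ∈ B.extInterval d ε e) (y : B.Y e) :
    B.extGrad d ε (c • φ) ψ e (s, y) = c * B.extGrad d ε φ ψ e (s, y) := by
  have h := gradProd_smul_left (M := B.Y e) (fun y => B.extend d ε ψ e (s, y))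
    (hφ.mdifferentiableAt_extend hs y) c
  rw [extGrad, extend_smul]
  exact h

end IsTestFunction

variable (B) in
/-- The space of test functions. -/
def testSpace (d ε : ℝ) : Submodule ℂ (B.Point → ℂ) where
  carrier := {φ | B.IsTestFunction d ε φ}
  add_mem' := IsTestFunction.add
  zero_mem' := IsTestFunction.zero
  smul_mem' c _ h := h.smul c

variable (B) in
/-- Test functions as elements of `L²`. -/
def testToL2 (hε : 0 < ε) : B.testSpace d ε →ₗ[ℂ] B.MfdL2 d ε where
  toFun φ := (IsTestFunction.memLp hε φ.2).toLp φ.1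
  map_add' _ _ := rfl
  map_smul' _ _ := rfl

lemma testToL2_coeFn (hε : 0 < ε) (φ : B.testSpace d ε) :
    B.testToL2 hε φ =ᵐ[B.mfdMeasure d ε] φ.1 :=
  MemLp.coeFn_toLp (IsTestFunction.memLp hε φ.2)

lemma testToL2_ae (hε : 0 < ε) (φ : B.testSpace d ε) :
    (∀ e, ∀ᵐ q ∂B.edgeMeas d e, B.testToL2 hε φ (edgePt e q) = B.extend d ε φ.1 e q) ∧
      ∀ v, ∀ᵐ x ∂B.vertMeas v, B.testToL2 hε φ (vertexPt v x) = φ.1 (vertexPt v x) := by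
  obtain ⟨h₁, h₂⟩ := (B.ae_mfd_iff hε).mp (testToL2_coeFn hε φ)
  refine ⟨fun e => ?_, h₂⟩
  filter_upwards [h₁ e, B.ae_edgeMeas_of_mem (p := fun q => B.extend d ε φ.1 e q =
    φ.1 (edgePt e q)) fun s hs y => B.extend_of_mem φ.1 hs y] with q h h'
  rw [h, h']

end BuildingBlocks

lemma isSesq_integral {V α : Type*} [AddCommGroup V] [Module ℂ V] [MeasurableSpace α]
    {μ : Measure α} {F : V → V → α → ℂ} (hi : ∀ f g, Integrable (F f g) μ)
    (hadd : ∀ f g h, ∀ᵐ a ∂μ, F (f + g) h a = F f h a + F g h a)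
    (hsmul : ∀ (c : ℂ) f g, ∀ᵐ a ∂μ, F (c • f) g a = c * F f g a)
    (hsymm : ∀ f g, ∀ᵐ a ∂μ, F g f a = conj (F f g a)) :
    IsSesq fun f g => ∫ a, F f g a ∂μ where
  add_left f g h := by rw [integral_congr_ae (hadd f g h), integral_add (hi f h) (hi g h)]
  smul_left c f g := by rw [integral_congr_ae (hsmul c f g), integral_const_mul]
  symm f g := by rw [integral_congr_ae (hsymm f g), integral_conj]

lemma ae_mem_interior_edgeInterval {n : ℕ} {G : SimpleGraph (Fin n)} {d : ℝ} (e : Edge G) :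
    ∀ᵐ s ∂edgeVol d e, s ∈ interior (edgeInterval d e) := by
  refine ((ae_restrict_iff' (measurableSet_edgeInterval e)).mpr ?_)
  rcases e with j | e
  · have h : ∀ᵐ s : ℝ, s ≠ 0 := by simp [ae_iff]
    filter_upwards [h] with s hs hs'
    have e1 : edgeInterval d (Sum.inl j : Edge G) = Ici 0 := rfl
    rw [e1, interior_Ici]
    exact lt_of_le_of_ne hs' (Ne.symm hs)
  · have h : ∀ᵐ s : ℝ, s ≠ d := by simp [ae_iff]
    have h' : ∀ᵐ s : ℝ, s ≠ -d := by simp [ae_iff]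
    filter_upwards [h, h'] with s hs hs2 hs'
    have e1 : edgeInterval d (Sum.inr e : Edge G) = Icc (-d) d := rfl
    rw [e1, interior_Icc]
    exact ⟨lt_of_le_of_ne hs'.1 (Ne.symm hs2), lt_of_le_of_ne hs'.2 hs⟩

/-- The vector potential, extended by zero to the outer edges. -/
def edgePotential {n : ℕ} {G : SimpleGraph (Fin n)} (A : InnerEdge G → ℝ) : Edge G → ℝ := Sum.elim (fun _ => 0) A

namespace BuildingBlocks

variable {n k : ℕ} {G : SimpleGraph (Fin n)} {B : BuildingBlocks.{u} G k} {d ε : ℝ}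
  {φ ψ : B.Point → ℂ}

variable (B d ε) in
/-- The covariant longitudinal derivative. -/
def covDeriv (A : InnerEdge G → ℝ) (φ : B.Point → ℂ) (e : Edge G) (q : ℝ × B.Y e) : ℂ :=
  B.extDeriv d ε φ e q + Complex.I * edgePotential A e * B.extend d ε φ e q

variable (B d ε) in
/-- The part of the form that belongs to an edge. -/
def edgePart (A : InnerEdge G → ℝ) (e : Edge G) (φ ψ : B.Point → ℂ) : ℂ :=
  ∫ q, (B.covDeriv d ε A φ e q * conj (B.covDeriv d ε A ψ e q) +
    ((ε ^ 2)⁻¹ : ℝ) * B.extGrad d ε φ ψ e q) ∂B.edgeMeas d e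

variable (B d ε) in
/-- The product in the middle of an inner edge. -/
def midPart (e : InnerEdge G) (φ ψ : B.Point → ℂ) : ℂ :=
  ∫ q in Ioc (-ε) ε ×ˢ univ, B.extend d ε φ (Sum.inr e) q * conj (B.extend d ε ψ (Sum.inr e) q)
    ∂B.edgeMeas d (Sum.inr e)

variable (B) in
/-- The derivatives on a vertex manifold. -/
def vertGradPart (v : Fin n) (φ ψ : B.Point → ℂ) : ℂ := ∫ x, B.vertGrad φ ψ v x ∂B.vertMeas v

variable (B) in
/-- The product on a vertex manifold. -/
def vertPart (v : Fin n) (φ ψ : B.Point → ℂ) : ℂ :=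
  ∫ x, φ (vertexPt v x) * conj (ψ (vertexPt v x)) ∂B.vertMeas v

variable (B d ε) in
/-- The form `𝔥_ε` on test functions, in terms of the unscaled metrics. -/
def testForm (A wE : InnerEdge G → ℝ) (wV : Fin n → ℝ) (φ ψ : B.Point → ℂ) : ℂ :=
  ∑ e, (ε ^ k : ℝ) * B.edgePart d ε A e φ ψ +
    ∑ e, (wE e / (2 * ε) * ε ^ k : ℝ) * B.midPart d ε e φ ψ +
    ∑ v, ((ε ^ (k + 1) * (ε ^ 2)⁻¹ : ℝ) * B.vertGradPart v φ ψ +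
      (wV v / (ε * B.vertexVol v) * ε ^ (k + 1) : ℝ) * B.vertPart v φ ψ)

namespace IsTestFunction

lemma nice_covDeriv (hε : 0 < ε) (hφ : B.IsTestFunction d ε φ) (A : InnerEdge G → ℝ) (e : Edge G) :
    B.IsNice d e (B.covDeriv d ε A φ e) :=
  (hφ.nice_extDeriv hε e).add ((hφ.nice_extend hε e).const_mul _)

lemma nice_edgePart (hε : 0 < ε) (hφ : B.IsTestFunction d ε φ) (hψ : B.IsTestFunction d ε ψ)
    (A : InnerEdge G → ℝ) (e : Edge G) :
    B.IsNice d e fun q => B.covDeriv d ε A φ e q * conj (B.covDeriv d ε A ψ e q) +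
      ((ε ^ 2)⁻¹ : ℝ) * B.extGrad d ε φ ψ e q :=
  ((hφ.nice_covDeriv hε A e).mul_conj (hψ.nice_covDeriv hε A e)).add
    ((hφ.nice_extGrad hε hψ e).const_mul _)

end IsTestFunction

lemma integral_edge (hε : 0 < ε) {e : Edge G} {F : ℝ × B.Y e → ℂ} (hF : B.IsNice d e F)
    {f : ℝ → B.Y e → ℂ} (h : ∀ s ∈ interior (edgeInterval d e), ∀ y, f s y = F (s, y)) :
    ∫ s in edgeInterval d e, ∫ y, f s y ∂B.volY ε e = (ε ^ k : ℝ) * ∫ q, F q ∂B.edgeMeas d e := by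
  have h1 : ∫ q, F q ∂B.edgeMeas d e = ∫ s in edgeInterval d e, ∫ y, F (s, y) ∂riemVol (𝓡 k)
      (B.Y e).g := integral_prod _ hF.integrable
  rw [h1, ← integral_const_mul]
  refine integral_congr_ae ?_
  filter_upwards [ae_mem_interior_edgeInterval e] with s hs
  rw [B.volY_eq hε, integral_smul_measure, toReal_ofReal (by positivity),
    real_smul]
  simp only [h s hs]

lemma longDeriv_eq (φ : B.Point → ℂ) {e : Edge G} {s : ℝ} (hs : s ∈ interior (edgeInterval d e))
    (y : B.Y e) : B.longDeriv φ e s y = B.extDeriv d ε φ e (s, y) := by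
  refine Filter.EventuallyEq.deriv_eq ?_
  filter_upwards [isOpen_interior.mem_nhds hs] with t ht
  exact (B.extend_of_mem φ (interior_subset ht) y).symm

lemma transProd_eq (hε : 0 < ε) (φ ψ : B.Point → ℂ) {e : Edge G} {s : ℝ}
    (hs : s ∈ edgeInterval d e) (y : B.Y e) :
    B.transProd ε φ ψ e s y = ((ε ^ 2)⁻¹ : ℝ) * B.extGrad d ε φ ψ e (s, y) := by
  have h : ∀ φ : B.Point → ℂ,
      (fun y => φ (edgePt e (s, y))) = fun y => B.extend d ε φ e (s, y) :=
    fun φ => funext fun y => (B.extend_of_mem φ hs y).symm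
  rw [transProd, h φ, h ψ]
  exact gradProd_scaleMetric hε.ne' _ _ _

lemma mfdSesq_eq (hε : 0 < ε) (hεd : ε ≤ d) (hφ : B.IsTestFunction d ε φ)
    (hψ : B.IsTestFunction d ε ψ) (A wE : InnerEdge G → ℝ) (wV : Fin n → ℝ) :
    B.mfdSesq d ε A wE wV φ ψ = B.testForm d ε A wE wV φ ψ := by
  have hd : 0 < d := hε.trans_le hεd
  have e1 : ∀ j : Fin n, ∫ s in Ioi (0 : ℝ), ∫ y,
      (B.longDeriv φ (Sum.inl j) s y * conj (B.longDeriv ψ (Sum.inl j) s y) +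
        B.transProd ε φ ψ (Sum.inl j) s y) ∂B.volY ε (Sum.inl j) =
      (ε ^ k : ℝ) * B.edgePart d ε A (Sum.inl j) φ ψ := fun j => by
    rw [edgePart, ← integral_edge hε (hφ.nice_edgePart hε hψ A _) (f := fun s y =>
      (B.longDeriv φ (Sum.inl j) s y * conj (B.longDeriv ψ (Sum.inl j) s y) +
        B.transProd ε φ ψ (Sum.inl j) s y)), ← integral_Ici_eq_integral_Ioi]
    · rfl
    · intro s hs y
      rw [longDeriv_eq φ hs (ε := ε), longDeriv_eq ψ hs (ε := ε),
        transProd_eq hε φ ψ (interior_subset hs)]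
      simp [covDeriv, edgePotential]
  have e2 : ∀ e : InnerEdge G, ∫ s in (-d)..d, ∫ y,
      ((B.longDeriv φ (Sum.inr e) s y + Complex.I * A e * φ (edgePt (Sum.inr e) (s, y))) *
          conj (B.longDeriv ψ (Sum.inr e) s y + Complex.I * A e * ψ (edgePt (Sum.inr e) (s, y))) +
        B.transProd ε φ ψ (Sum.inr e) s y) ∂B.volY ε (Sum.inr e) =
      (ε ^ k : ℝ) * B.edgePart d ε A (Sum.inr e) φ ψ := fun e => by
    rw [edgePart, ← integral_edge hε (hφ.nice_edgePart hε hψ A _) (f := fun s y =>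
      ((B.longDeriv φ (Sum.inr e) s y + Complex.I * A e * φ (edgePt (Sum.inr e) (s, y))) *
          conj (B.longDeriv ψ (Sum.inr e) s y + Complex.I * A e * ψ (edgePt (Sum.inr e) (s, y))) +
        B.transProd ε φ ψ (Sum.inr e) s y)), intervalIntegral.integral_of_le (by linarith),
      ← integral_Icc_eq_integral_Ioc]
    · rfl
    · intro s hs y
      rw [longDeriv_eq φ hs (ε := ε), longDeriv_eq ψ hs (ε := ε),
        transProd_eq hε φ ψ (interior_subset hs), ← B.extend_of_mem φ (interior_subset hs) (ε := ε),
        ← B.extend_of_mem ψ (interior_subset hs) (ε := ε)]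
      rfl
  have e3 : ∀ e : InnerEdge G, ∫ s in (-ε)..ε, ∫ y,
      φ (edgePt (Sum.inr e) (s, y)) * conj (ψ (edgePt (Sum.inr e) (s, y))) ∂B.volY ε (Sum.inr e) =
      (ε ^ k : ℝ) * B.midPart d ε e φ ψ := fun e => by
    have hN := (hφ.nice_extend hε (Sum.inr e)).mul_conj (hψ.nice_extend hε (Sum.inr e))
    have hsub : Ioc (-ε) ε ⊆ edgeInterval d (Sum.inr e : Edge G) := fun s hs =>
      ⟨by linarith [hs.1], hs.2.trans hεd⟩
    have h1 : ((volume.restrict (edgeInterval d (Sum.inr e : Edge G))).prod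
        (riemVol (𝓡 k) (B.Y (Sum.inr e)).g)).restrict (Ioc (-ε) ε ×ˢ univ) =
        (volume.restrict (Ioc (-ε) ε)).prod (riemVol (𝓡 k) (B.Y (Sum.inr e)).g) := by
      rw [← Measure.prod_restrict, Measure.restrict_univ,
        Measure.restrict_restrict measurableSet_Ioc, inter_eq_left.mpr hsub]
    have hI := hN.integrable.restrict (s := Ioc (-ε) ε ×ˢ (univ : Set (B.Y (Sum.inr e))))
    rw [edgeMeas, h1] at hI
    rw [midPart, edgeMeas, h1, integral_prod _ hI, intervalIntegral.integral_of_le (by linarith),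
      ← integral_const_mul]
    refine setIntegral_congr_fun measurableSet_Ioc fun s hs => ?_
    rw [B.volY_eq hε, integral_smul_measure, toReal_ofReal (by positivity),
      real_smul]
    simp only [B.extend_of_mem φ (hsub hs) (ε := ε), B.extend_of_mem ψ (hsub hs) (ε := ε)]
  have e4 : ∀ v, ∫ x, gradProd (𝓑 k) (scaleMetric (𝓑 k) ε (B.X v).g)
        (fun x' => φ (vertexPt v x')) (fun x' => ψ (vertexPt v x')) x ∂B.volX ε v =
      (ε ^ (k + 1) * (ε ^ 2)⁻¹ : ℝ) * B.vertGradPart v φ ψ := fun v => by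
    have h : ∫ x, gradProd (𝓑 k) (scaleMetric (𝓑 k) ε (B.X v).g)
        (fun x' => φ (vertexPt v x')) (fun x' => ψ (vertexPt v x')) x ∂B.vertMeas v =
        ((ε ^ 2)⁻¹ : ℝ) * B.vertGradPart v φ ψ := by
      rw [vertGradPart, ← integral_const_mul]
      exact integral_congr_ae (.of_forall fun x => gradProd_scaleMetric hε.ne' _ _ _)
    rw [B.volX_eq hε, integral_smul_measure, toReal_ofReal (by positivity),
      real_smul, h, Complex.ofReal_mul, mul_assoc]
  have e5 : ∀ v, ∫ x, φ (vertexPt v x) * conj (ψ (vertexPt v x)) ∂B.volX ε v =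
      (ε ^ (k + 1) : ℝ) * B.vertPart v φ ψ := fun v => by
    rw [B.volX_eq hε, integral_smul_measure, toReal_ofReal (by positivity),
      real_smul, vertPart]
  rw [mfdSesq, testForm]
  simp only [e1, e2, e3, e4, e5, Fintype.sum_sum_type, sum_add_distrib]
  have e6 : ∀ e : InnerEdge G, ((wE e / (2 * ε) : ℝ) : ℂ) * (((ε ^ k : ℝ) : ℂ) *
      B.midPart d ε e φ ψ) = ((wE e / (2 * ε) * ε ^ k : ℝ) : ℂ) * B.midPart d ε e φ ψ := fun e => by
    rw [← mul_assoc, ← Complex.ofReal_mul]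
  have e7 : ∀ v, ((wV v / (ε * B.vertexVol v) : ℝ) : ℂ) * (((ε ^ (k + 1) : ℝ) : ℂ) *
      B.vertPart v φ ψ) =
        ((wV v / (ε * B.vertexVol v) * ε ^ (k + 1) : ℝ) : ℂ) * B.vertPart v φ ψ := fun v => by
    rw [← mul_assoc, ← Complex.ofReal_mul]
  simp only [e6, e7]
  ring

lemma extend_ae {e : Edge G} (hε : 0 < ε) {p : ℝ × B.Y e → Prop}
    (h : ∀ s ∈ B.extInterval d ε e, ∀ y, p (s, y)) : ∀ᵐ q ∂B.edgeMeas d e, p q :=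
  B.ae_edgeMeas_of_mem fun s hs y => h s (B.edgeInterval_subset hε e hs) y

lemma covDeriv_add (hφ : B.IsTestFunction d ε φ) (hψ : B.IsTestFunction d ε ψ)
    (A : InnerEdge G → ℝ) {e : Edge G} {s : ℝ} (hs : s ∈ B.extInterval d ε e) (y : B.Y e) :
    B.covDeriv d ε A (φ + ψ) e (s, y) =
      B.covDeriv d ε A φ e (s, y) + B.covDeriv d ε A ψ e (s, y) := by
  simp only [covDeriv, hφ.extDeriv_add hψ hs, extend_add, Pi.add_apply]
  ring

lemma covDeriv_smul (hφ : B.IsTestFunction d ε φ) (c : ℂ) (A : InnerEdge G → ℝ) {e : Edge G}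
    {s : ℝ} (hs : s ∈ B.extInterval d ε e) (y : B.Y e) :
    B.covDeriv d ε A (c • φ) e (s, y) = c * B.covDeriv d ε A φ e (s, y) := by
  simp only [covDeriv, hφ.extDeriv_smul c hs, extend_smul, Pi.smul_apply, smul_eq_mul]
  ring

lemma isSesq_edgePart (hε : 0 < ε) (A : InnerEdge G → ℝ) (e : Edge G) :
    IsSesq fun φ ψ : B.testSpace d ε => B.edgePart d ε A e φ.1 ψ.1 := by
  refine isSesq_integral (F := fun φ ψ : B.testSpace d ε => fun q =>
    (B.covDeriv d ε A φ.1 e q * conj (B.covDeriv d ε A ψ.1 e q) +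
    ((ε ^ 2)⁻¹ : ℝ) * B.extGrad d ε φ.1 ψ.1 e q)) (fun φ ψ => ?_) (fun φ ψ χ => ?_)
    (fun c φ ψ => ?_) (fun φ ψ => ?_)
  · exact (IsTestFunction.nice_edgePart hε φ.2 ψ.2 A e).integrable
  · refine extend_ae hε fun s hs y => ?_
    have h1 := covDeriv_add φ.2 ψ.2 A hs y
    have h2 := IsTestFunction.extGrad_add φ.2 ψ.2 χ.1 hs y
    simp only [Submodule.coe_add, h1, h2]
    ring
  · refine extend_ae hε fun s hs y => ?_
    have h1 := covDeriv_smul φ.2 c A hs y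
    have h2 := IsTestFunction.extGrad_smul φ.2 c ψ.1 hs y
    simp only [Submodule.coe_smul, h1, h2]
    ring
  · refine .of_forall fun q => ?_
    have h : B.extGrad d ε ψ.1 φ.1 e q = conj (B.extGrad d ε φ.1 ψ.1 e q) := gradProd_symm _ _ _
    simp only [map_add, map_mul, Complex.conj_conj, conj_ofReal, h]
    ring

lemma isSesq_midPart (hε : 0 < ε) (e : InnerEdge G) :
    IsSesq fun φ ψ : B.testSpace d ε => B.midPart d ε e φ.1 ψ.1 := by
  refine isSesq_integral (F := fun φ ψ : B.testSpace d ε => fun q =>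
    B.extend d ε φ.1 (Sum.inr e) q * conj (B.extend d ε ψ.1 (Sum.inr e) q)) (fun φ ψ => ?_)
    (fun φ ψ χ => ?_) (fun c φ ψ => ?_) (fun φ ψ => ?_)
  · exact ((IsTestFunction.nice_extend hε φ.2 _).mul_conj
      (IsTestFunction.nice_extend hε ψ.2 _)).integrable.restrict
  · refine .of_forall fun q => ?_
    simp only [Submodule.coe_add, extend_add, Pi.add_apply]
    ring
  · refine .of_forall fun q => ?_
    simp only [Submodule.coe_smul, extend_smul, Pi.smul_apply, smul_eq_mul]
    ring
  · refine .of_forall fun q => ?_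
    simp only [map_mul, Complex.conj_conj]
    ring

lemma isSesq_vertGradPart (v : Fin n) :
    IsSesq fun φ ψ : B.testSpace d ε => B.vertGradPart v φ.1 ψ.1 := by
  refine isSesq_integral (F := fun φ ψ : B.testSpace d ε => B.vertGrad φ.1 ψ.1 v) (fun φ ψ => ?_)
    (fun φ ψ χ => ?_) (fun c φ ψ => ?_) (fun φ ψ => ?_)
  · exact (IsTestFunction.continuous_vertGrad φ.2 ψ.2 v).integrable_of_hasCompactSupport
      (HasCompactSupport.of_compactSpace _)
  · exact .of_forall fun x => gradProd_add_left (M := B.X v) _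
      ((IsTestFunction.smooth_vertex φ.2 v).mdifferentiable (by simp) x)
      ((IsTestFunction.smooth_vertex ψ.2 v).mdifferentiable (by simp) x)
  · exact .of_forall fun x => gradProd_smul_left (M := B.X v) _
      ((IsTestFunction.smooth_vertex φ.2 v).mdifferentiable (by simp) x) c
  · exact .of_forall fun x => gradProd_symm (M := B.X v) _ _ _

lemma integrable_vert (hφ : B.IsTestFunction d ε φ) (hψ : B.IsTestFunction d ε ψ) (v : Fin n) :
    Integrable (fun x => φ (vertexPt v x) * conj (ψ (vertexPt v x))) (B.vertMeas v) :=
  Continuous.integrable_of_hasCompactSupport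
    ((hφ.continuous_vertex v).mul (Complex.continuous_conj.comp (hψ.continuous_vertex v)))
    (HasCompactSupport.of_compactSpace _)

lemma isSesq_vertPart (v : Fin n) :
    IsSesq fun φ ψ : B.testSpace d ε => B.vertPart v φ.1 ψ.1 := by
  refine isSesq_integral (F := fun φ ψ : B.testSpace d ε => fun x =>
    φ.1 (vertexPt v x) * conj (ψ.1 (vertexPt v x))) (fun φ ψ => integrable_vert φ.2 ψ.2 v)
    (fun φ ψ χ => ?_) (fun c φ ψ => ?_) (fun φ ψ => ?_)
  · refine .of_forall fun q => ?_
    simp only [Submodule.coe_add, Pi.add_apply]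
    ring
  · refine .of_forall fun q => ?_
    simp only [Submodule.coe_smul, Pi.smul_apply, smul_eq_mul]
    ring
  · refine .of_forall fun q => ?_
    simp only [map_mul, Complex.conj_conj]
    ring

lemma isSesq_testForm (hε : 0 < ε) (A wE : InnerEdge G → ℝ) (wV : Fin n → ℝ) :
    IsSesq fun φ ψ : B.testSpace d ε => B.testForm d ε A wE wV φ.1 ψ.1 :=
  ((IsSesq.sum _ fun e => (isSesq_edgePart hε A e).real_mul _).add
    (IsSesq.sum _ fun e => (isSesq_midPart hε e).real_mul _)).add
    (IsSesq.sum _ fun v => ((isSesq_vertGradPart v).real_mul _).add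
      ((isSesq_vertPart v).real_mul _))

lemma testToL2_inner (hε : 0 < ε) (φ ψ : B.testSpace d ε) :
    inner ℂ (B.testToL2 hε ψ) (B.testToL2 hε φ) =
      ∑ e, (ε ^ k : ℝ) * ∫ q, B.extend d ε φ.1 e q * conj (B.extend d ε ψ.1 e q) ∂B.edgeMeas d e +
        ∑ v, (ε ^ (k + 1) : ℝ) * B.vertPart v φ.1 ψ.1 := by
  rw [B.mfd_inner hε]
  congr 1
  · refine sum_congr rfl fun e _ => ?_
    congr 1
    refine integral_congr_ae ?_
    filter_upwards [(testToL2_ae hε φ).1 e, (testToL2_ae hε ψ).1 e] with q h h'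
    rw [h, h', mul_comm]
  · refine sum_congr rfl fun v _ => ?_
    congr 1
    refine integral_congr_ae ?_
    filter_upwards [(testToL2_ae hε φ).2 v, (testToL2_ae hε ψ).2 v] with q h h'
    rw [h, h', mul_comm]

end BuildingBlocks

section EuclideanClosability

lemma tendsto_toLp_zero {α : Type*} [MeasurableSpace α] {μ : Measure α} {f : ℕ → α → ℂ}
    (hf : ∀ i, MemLp (f i) 2 μ) :
    Tendsto (fun i => (hf i).toLp (f i)) atTop (𝓝 0) ↔
      Tendsto (fun i => ∫⁻ x, ‖f i x‖ₑ ^ 2 ∂μ) atTop (𝓝 0) := by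
  have h : ∀ i, edist ((hf i).toLp (f i)) 0 ^ 2 = ∫⁻ x, ‖f i x‖ₑ ^ 2 ∂μ := fun i => by
    rw [edist_zero_right, Lp.enorm_toLp, eLpNorm_two_sq]
  rw [tendsto_iff_edist_tendsto_0]
  simp only [← h]
  refine ⟨fun h => ?_, fun h => ?_⟩
  · have := (ENNReal.continuous_pow 2).continuousAt.tendsto.comp h
    rwa [zero_pow two_ne_zero] at this
  · have := (ENNReal.continuous_rpow_const (y := 1 / 2)).continuousAt.tendsto.comp h
    simp only [one_div, inv_pos, Nat.ofNat_pos, ENNReal.zero_rpow_of_pos] at this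
    refine this.congr fun i => ?_
    rw [Function.comp_apply, ← ENNReal.rpow_natCast, ← ENNReal.rpow_mul]
    norm_num

lemma cauchySeq_toLp {α : Type*} [MeasurableSpace α] {μ : Measure α} {f : ℕ → α → ℂ}
    (hf : ∀ i, MemLp (f i) 2 μ)
    (hc : Tendsto (fun l : ℕ × ℕ => ∫⁻ x, ‖f l.1 x - f l.2 x‖ₑ ^ 2 ∂μ) atTop (𝓝 0)) :
    CauchySeq fun i => (hf i).toLp (f i) := by
  rw [EMetric.cauchySeq_iff]
  intro δ hδ
  have h1 := hc.eventually (gt_mem_nhds (ENNReal.pow_pos hδ 2))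
  rw [eventually_atTop_prod_self'] at h1
  obtain ⟨n, hn⟩ := h1
  refine ⟨n, fun i hi j hj => ?_⟩
  have h2 := hn i hi j hj
  have h3 : ∫⁻ x, ‖f i x - f j x‖ₑ ^ 2 ∂μ = eLpNorm (f i - f j) 2 μ ^ 2 := by
    rw [eLpNorm_two_sq]; rfl
  simp only [h3] at h2
  rw [Lp.edist_toLp_toLp]
  exact lt_of_not_ge fun h => absurd h2 (not_lt.mpr (pow_le_pow_left' h 2))

variable {E : Type*} [NormedAddCommGroup E] [NormedSpace ℝ E] [FiniteDimensional ℝ E]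
  [MeasurableSpace E] [BorelSpace E] {μ : Measure E} [μ.IsAddHaarMeasure]

/-- Directional derivatives are closable. -/
lemma tendsto_lineDeriv_zero {U : Set E} (hU : IsOpen U) (v : E) {f f' : ℕ → E → ℂ}
    (hd : ∀ i, ∀ x ∈ U, HasLineDerivAt ℝ (f i) (f' i x) x v)
    (hf : ∀ i, MemLp (f i) 2 (μ.restrict U)) (hf' : ∀ i, MemLp (f' i) 2 (μ.restrict U))
    (h0 : Tendsto (fun i => ∫⁻ x in U, ‖f i x‖ₑ ^ 2 ∂μ) atTop (𝓝 0))
    (hc : Tendsto (fun l : ℕ × ℕ => ∫⁻ x in U, ‖f' l.1 x - f' l.2 x‖ₑ ^ 2 ∂μ) atTop (𝓝 0)) :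
    Tendsto (fun i => ∫⁻ x in U, ‖f' i x‖ₑ ^ 2 ∂μ) atTop (𝓝 0) := by
  obtain ⟨g, hg⟩ := cauchySeq_tendsto_of_complete (cauchySeq_toLp hf' hc)
  rw [← tendsto_toLp_zero hf']
  rw [← tendsto_toLp_zero hf] at h0
  suffices h : g = 0 by rwa [h] at hg
  have hUm := hU.measurableSet
  have key : ∀ η : E → ℝ, ContDiff ℝ ∞ η → HasCompactSupport η → tsupport η ⊆ U →
      ∫ x, η x • g x ∂μ = 0 := by
    intro η hη hηc hηU
    set η' : E → ℝ := fun x => fderiv ℝ η x v with hη'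
    have hη'c : Continuous η' := (hη.continuous_fderiv (by simp)).clm_apply continuous_const
    have hη's : HasCompactSupport η' := hηc.fderiv_apply (𝕜 := ℝ) v
    have hsub' : tsupport η' ⊆ tsupport η := tsupport_fderiv_apply_subset ℝ v
    have m1 : MemLp (fun x => (η x : ℂ)) 2 (μ.restrict U) :=
      ((hη.continuous.memLp_of_hasCompactSupport hηc (p := 2) (μ := μ)).restrict U).ofReal
    have m2 : MemLp (fun x => (η' x : ℂ)) 2 (μ.restrict U) :=
      ((hη'c.memLp_of_hasCompactSupport hη's (p := 2) (μ := μ)).restrict U).ofReal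
    have hint : ∀ {θ : E → ℝ} {k : E → ℂ}, tsupport θ ⊆ U →
        MemLp (fun x => (θ x : ℂ)) 2 (μ.restrict U) → MemLp k 2 (μ.restrict U) →
        Integrable (fun x => θ x • k x) μ := fun {θ k} hs h1 h2 => by
      have h3 : IntegrableOn (fun x => θ x • k x) U μ := by
        have := h1.integrable_mul h2
        bound
      refine (integrableOn_iff_integrable_of_support_subset ?_).mp h3
      intro x hx
      refine hs (subset_tsupport _ ?_)
      simp_all
    have hinn : ∀ {θ : E → ℝ} {k : E → ℂ} (_ : tsupport θ ⊆ U)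
        (h1 : MemLp (fun x => (θ x : ℂ)) 2 (μ.restrict U)) (h2 : MemLp k 2 (μ.restrict U)),
        inner ℂ (h1.toLp _) (h2.toLp _) = ∫ x, θ x • k x ∂μ := fun {θ k} hs h1 h2 => by
      rw [L2.inner_def, ← setIntegral_eq_integral_of_forall_compl_eq_zero (s := U)
        (f := fun x => θ x • k x)]
      · refine integral_congr_ae ?_
        filter_upwards [h1.coeFn_toLp, h2.coeFn_toLp] with x e1 e2
        rw [e1, e2, RCLike.inner_apply', conj_ofReal, real_smul]
      · intro x hx
        rw [image_eq_zero_of_notMem_tsupport fun h => hx (hs h), zero_smul]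
    have hparts : ∀ i, inner ℂ (m1.toLp _) ((hf' i).toLp _) =
        -inner ℂ (m2.toLp _) ((hf i).toLp _) := fun i => by
      rw [hinn hηU m1, hinn (hsub'.trans hηU) m2]
      exact integral_bilinear_hasLineDerivAt_right_eq_neg_left_of_integrable
        (B := ContinuousLinearMap.lsmul ℝ ℝ) (v := v) (f := η) (f' := η') (g := f i) (g' := f' i)
        (hint (hsub'.trans hηU) m2 (hf i)) (hint hηU m1 (hf' i)) (hint hηU m1 (hf i))
        (fun x _ => ((hη.differentiable (by simp)) x).hasFDerivAt.hasLineDerivAt v)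
        (fun x hx => hd i x (hηU hx))
    have l1 : Tendsto (fun i => inner ℂ (m1.toLp _) ((hf' i).toLp (f' i))) atTop
        (𝓝 (inner ℂ (m1.toLp _) g)) := Tendsto.inner tendsto_const_nhds hg
    have l2 : Tendsto (fun i => -inner ℂ (m2.toLp _) ((hf i).toLp (f i))) atTop (𝓝 0) := by
      have := (Tendsto.inner (𝕜 := ℂ) (tendsto_const_nhds (x := m2.toLp _)) h0).neg
      simpa using this
    simp only [hparts] at l1
    have h3 := tendsto_nhds_unique l1 l2
    have h4 := hinn hηU m1 (Lp.memLp g)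
    rw [Lp.toLp_coeFn] at h4
    rw [← h4, h3]
  have hloc : LocallyIntegrableOn g U μ :=
    (locallyIntegrableOn_of_locallyIntegrable_restrict
      ((Lp.memLp g).locallyIntegrable (by norm_num)))
  have h5 := hU.ae_eq_zero_of_integral_contDiff_smul_eq_zero hloc key
  rw [Lp.eq_zero_iff_ae_eq_zero]
  exact (ae_restrict_iff' hUm).mpr h5

end EuclideanClosability

section ProductClosability

variable {N : ℕ} {Hm : Type} [TopologicalSpace Hm]
  {I : ModelWithCorners ℝ (𝔼 N) Hm} {M : RiemMfd.{u} I}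
  {O S : Set ℝ}

local notation "Ξ" => extChartAt I

local notation "Λ" S:max M:max => Measure.prod (Measure.restrict volume S) (dV M)

/-- The derivative in the direction of the first factor. -/
def fstDeriv (Φ : ℝ × M → ℂ) (p : ℝ × M) : ℂ := deriv (fun t => Φ (t, p.2)) p.1

/-- The energy density in the direction of the second factor. -/
def sndEnergy (Φ : ℝ × M → ℂ) (p : ℝ × M) : ℝ :=
  (gradProd I M.g (fun x => Φ (p.1, x)) (fun x => Φ (p.1, x)) p.2).re

lemma aemeasurable_chart (hSO : S ⊆ O) (hSm : MeasurableSet S) {x₀ : M} {K : Set (𝔼 N)}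
    (hK : MeasurableSet K) (hKT : K ⊆ (Ξ x₀).target) {F : ℝ × M → ℝ≥0∞}
    (hF : ContinuousOn F (O ×ˢ univ)) : AEMeasurable (fun p : ℝ × 𝔼 N => F (p.1, (Ξ x₀).symm p.2))
      ((volume.restrict S).prod (volume.restrict K)) := by
  rw [Measure.prod_restrict]
  exact (hF.comp (continuousOn_fst.prodMk ((continuousOn_extChartAt_symm x₀).comp continuousOn_snd
    fun p hp => hKT hp.2)) fun p hp => ⟨hSO hp.1, mem_univ _⟩).aemeasurable (hSm.prod hK)

lemma lintegral_chart_le (hSO : S ⊆ O) (hSm : MeasurableSet S) {x₀ : M}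
    {K : Set (𝔼 N)} (hK : MeasurableSet K)
    (hKT : K ⊆ (Ξ x₀).target) {C : ℝ}
    (hC : ∀ F : M → ℝ≥0∞, Measurable F → ∫⁻ z in K, F ((Ξ x₀).symm z) ≤
      ofReal C * ∫⁻ x, F x ∂dV M)
    {F : ℝ × M → ℝ≥0∞} (hF : ContinuousOn F (O ×ˢ univ)) :
    ∫⁻ p, F (p.1, (Ξ x₀).symm p.2) ∂(volume.restrict S).prod (volume.restrict K) ≤
      ofReal C * ∫⁻ p, F p ∂Λ S M := by
  have hm2 : AEMeasurable F (Λ S M) := by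
    rw [← Measure.restrict_univ (μ := dV M), Measure.prod_restrict]
    exact (hF.mono (prod_mono_left hSO)).aemeasurable (hSm.prod MeasurableSet.univ)
  rw [lintegral_prod _ (aemeasurable_chart hSO hSm hK hKT hF), lintegral_prod _ hm2, ← lintegral_const_mul' _ _ ofReal_ne_top]
  exact setLIntegral_mono' hSm fun s hs => hC _ (hF.comp_continuous (by fun_prop)
    fun x => ⟨hSO hs, mem_univ _⟩ : Continuous fun x => F (s, x)).measurable

lemma lintegral_le_chart (hSO : S ⊆ O) (hSm : MeasurableSet S) {x₀ : M}
    {K : Set (𝔼 N)} (hK : MeasurableSet K)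
    (hKT : K ⊆ (Ξ x₀).target) {C : ℝ} {A : Set M}
    (hC : ∀ F : M → ℝ≥0∞, Measurable F → ∫⁻ x in A, F x ∂dV M ≤
      ofReal C * ∫⁻ z in K, F ((Ξ x₀).symm z))
    {F : ℝ × M → ℝ≥0∞} (hF : ContinuousOn F (O ×ˢ univ)) :
    ∫⁻ s in S, ∫⁻ x in A, F (s, x) ∂dV M ≤ ofReal C *
      ∫⁻ p, F (p.1, (Ξ x₀).symm p.2) ∂(volume.restrict S).prod (volume.restrict K) := by
  rw [lintegral_prod _ (aemeasurable_chart hSO hSm hK hKT hF), ← lintegral_const_mul' _ _ ofReal_ne_top]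
  exact setLIntegral_mono' hSm fun s hs => hC _ (hF.comp_continuous (by fun_prop)
    fun x => ⟨hSO hs, mem_univ _⟩ : Continuous fun x => F (s, x)).measurable

variable {Φ : ℕ → ℝ × M → ℂ}

lemma continuousOn_fstDeriv_sq (hO : IsOpen O) {Φ : ℝ × M → ℂ}
    (hΦ : ContMDiffProd I O Φ) :
    ContinuousOn (fun p => ‖fstDeriv Φ p‖ₑ ^ 2) (O ×ˢ univ) :=
  ((ENNReal.continuous_pow 2).comp continuous_enorm).comp_continuousOn
    (continuousOn_deriv_slice hO hΦ)

lemma continuousOn_sndEnergy (hO : IsOpen O) {Φ : ℝ × M → ℂ}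
    (hΦ : ContMDiffProd I O Φ) :
    ContinuousOn (fun p => ofReal (sndEnergy Φ p)) (O ×ˢ univ) :=
  (ENNReal.continuous_ofReal.comp Complex.continuous_re).comp_continuousOn
    (continuousOn_gradProd hO hΦ hΦ)

variable (hO : IsOpen O) (hSO : S ⊆ O) (hSm : MeasurableSet S)
  (hS : interior S =ᵐ[volume] S)
  (hΦ : ∀ i, ContMDiffProd I O (Φ i))
  (f0 : ∀ i, ∫⁻ p, ‖Φ i p‖ₑ ^ 2 ∂Λ S M < ⊤)
  (f1 : ∀ i, ∫⁻ p, ‖fstDeriv (Φ i) p‖ₑ ^ 2 ∂Λ S M < ⊤)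
  (f2 : ∀ i, ∫⁻ p, ofReal (sndEnergy (Φ i) p) ∂Λ S M < ⊤)
  (h0 : Tendsto (fun i => ∫⁻ p, ‖Φ i p‖ₑ ^ 2 ∂Λ S M) atTop (𝓝 0))
  (h1 : Tendsto (fun l : ℕ × ℕ => ∫⁻ p, ‖fstDeriv (Φ l.1 - Φ l.2) p‖ₑ ^ 2 ∂Λ S M) atTop (𝓝 0))
  (h2 : Tendsto (fun l : ℕ × ℕ => ∫⁻ p, ofReal (sndEnergy (Φ l.1 - Φ l.2) p) ∂Λ S M) atTop (𝓝 0))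

include hO hSO hSm hS hΦ f0 f1 f2 h0 h1 h2

/-- The derivatives on a product are closable, locally in the second factor. -/
lemma exists_tendsto_local (x₀ : M) :
    ∃ A : Set M, IsOpen A ∧ x₀ ∈ A ∧
      Tendsto (fun i => ∫⁻ s in S, ∫⁻ x in A, ‖fstDeriv (Φ i) (s, x)‖ₑ ^ 2 ∂dV M)
        atTop (𝓝 0) ∧
      Tendsto (fun i => ∫⁻ s in S, ∫⁻ x in A, ofReal (sndEnergy (Φ i) (s, x))
        ∂dV M) atTop (𝓝 0) := by
  obtain ⟨A, hA, hxA, K, -, hK, hKc, hKT, C, hC, hup, hlow, hgr⟩ := exists_chart_compare x₀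
  refine ⟨A, hA, hxA, ?_⟩
  set T := (Ξ x₀).target with hT
  set ν := (volume.restrict S).prod (volume.restrict K) with hν
  set U : Set (ℝ × 𝔼 N) := interior S ×ˢ interior K with hUdef
  have hU : IsOpen U := isOpen_interior.prod isOpen_interior
  have hUν : (volume : Measure (ℝ × 𝔼 N)).restrict U = ν := by
    rw [hν, hUdef, Measure.volume_eq_prod, ← Measure.prod_restrict, Measure.restrict_congr_set hS,
      Measure.restrict_congr_set (interior_ae_eq_of_null_frontier (hKc.addHaar_frontier volume))]
  have hsub : S ×ˢ K ⊆ O ×ˢ T := prod_mono hSO hKT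
  have hνS : ν = (volume : Measure (ℝ × 𝔼 N)).restrict (S ×ˢ K) := by
    rw [hν, Measure.prod_restrict, Measure.volume_eq_prod]
  have hSKm : MeasurableSet (S ×ˢ K) := hSm.prod hK
  have : (volume : Measure (ℝ × 𝔼 N)).IsAddHaarMeasure := by
    rw [Measure.volume_eq_prod]; infer_instance
  set f : (ℝ × M → ℂ) → ℝ × 𝔼 N → ℂ :=
    fun Ψ p => Ψ (p.1, (Ξ x₀).symm p.2) with hf
  set D : ℝ × 𝔼 N → (ℝ × M → ℂ) → ℝ × 𝔼 N → ℂ :=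
    fun v Ψ p => fderivWithin ℝ (f Ψ) (O ×ˢ T) p v with hD
  have hfd : ∀ i, ContDiffOn ℝ ∞ (f (Φ i)) (O ×ˢ T) := fun i => contDiffOn_chart x₀ (hΦ i)
  have hDsub : ∀ v i j, ∀ p ∈ S ×ˢ K, D v (Φ i - Φ j) p = D v (Φ i) p - D v (Φ j) p := by
    intro v i j p hp
    have e : fderivWithin ℝ (f (Φ i - Φ j)) (O ×ˢ T) p =
        fderivWithin ℝ (f (Φ i)) (O ×ˢ T) p - fderivWithin ℝ (f (Φ j)) (O ×ˢ T) p :=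
      fderivWithin_sub (uniqueDiffOn_prod_target x₀ hO p (hsub hp))
        ((hfd i).differentiableOn (by simp) p (hsub hp))
        ((hfd j).differentiableOn (by simp) p (hsub hp))
    simp only [hD, e]
    rfl
  have hD1 : ∀ Ψ : ℝ × M → ℂ, ContMDiffProd I O Ψ →
      ∀ p ∈ S ×ˢ K, fstDeriv Ψ (p.1, (Ξ x₀).symm p.2) = D (1, 0) Ψ p :=
    fun Ψ hΨ p hp => (hasDerivAt_slice_chart x₀ hO hΨ (hSO hp.1) (hKT hp.2)).deriv
  have hD2 : ∀ Ψ : ℝ × M → ℂ, ContMDiffProd I O Ψ →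
      ∀ p ∈ S ×ˢ K, (∀ a, ‖D (0, EuclideanSpace.single a 1) Ψ p‖ ^ 2 ≤
        C * sndEnergy Ψ (p.1, (Ξ x₀).symm p.2)) ∧
        sndEnergy Ψ (p.1, (Ξ x₀).symm p.2) ≤
          C * ∑ a, ‖D (0, EuclideanSpace.single a 1) Ψ p‖ ^ 2 := by
    intro Ψ hΨ p hp
    have h := hgr (fun x => Ψ (p.1, x)) p.2 hp.2
      (mdifferentiableAt_slice hO hΨ (hSO hp.1) _)
    have e : ∀ a, chartDeriv x₀ (fun x => Ψ (p.1, x)) p.2 a =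
        D (0, EuclideanSpace.single a 1) Ψ p := fun a =>
      chartDeriv_slice x₀ hΨ (hSO hp.1) (hKT hp.2) a
    simp only [e] at h
    exact h
  have hΦs : ∀ i j, ContMDiffProd I O (Φ i - Φ j) :=
    fun i j => (hΦ i).sub (hΦ j)
  have hcont0 : ∀ i, ContinuousOn (fun p => ‖Φ i p‖ₑ ^ 2) (O ×ˢ (univ : Set M)) := fun i =>
    ((ENNReal.continuous_pow 2).comp continuous_enorm).comp_continuousOn (hΦ i).continuousOn
  have hae : ∀ {p : ℝ × 𝔼 N → Prop}, (∀ q ∈ S ×ˢ K, p q) →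
      ∀ᵐ q ∂ν, p q := fun h => by
    rw [hνS]; exact ae_restrict_of_forall_mem hSKm h
  have b0 : ∀ i, ∫⁻ p, ‖f (Φ i) p‖ₑ ^ 2 ∂ν ≤ ofReal C *
      ∫⁻ p, ‖Φ i p‖ₑ ^ 2 ∂Λ S M := fun i =>
    lintegral_chart_le hSO hSm hK hKT hlow (hcont0 i)
  have b1 : ∀ Ψ : ℝ × M → ℂ, ContMDiffProd I O Ψ →
      ∫⁻ p, ‖D (1, 0) Ψ p‖ₑ ^ 2 ∂ν ≤ ofReal C *
        ∫⁻ p, ‖fstDeriv Ψ p‖ₑ ^ 2 ∂Λ S M := fun Ψ hΨ => by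
    refine (le_of_eq (lintegral_congr_ae ?_)).trans
      (lintegral_chart_le hSO hSm hK hKT hlow (continuousOn_fstDeriv_sq hO hΨ))
    exact hae fun p hp => congrArg (fun z => ‖z‖ₑ ^ 2) (hD1 Ψ hΨ p hp).symm
  have b2 : ∀ Ψ : ℝ × M → ℂ, ContMDiffProd I O Ψ → ∀ a,
      ∫⁻ p, ‖D (0, EuclideanSpace.single a 1) Ψ p‖ₑ ^ 2 ∂ν ≤ ofReal C *
        (ofReal C * ∫⁻ p, ofReal (sndEnergy Ψ p) ∂Λ S M) := fun Ψ hΨ a => by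
    refine le_trans ?_ (mul_le_mul_right (lintegral_chart_le hSO hSm hK hKT hlow
      (continuousOn_sndEnergy hO hΨ)) _)
    rw [← lintegral_const_mul' _ _ ofReal_ne_top]
    refine lintegral_mono_ae (hae fun p hp => ?_)
    rw [← ofReal_mul hC.le, ← ofReal_norm, ← ofReal_pow (norm_nonneg _)]
    exact ofReal_le_ofReal ((hD2 Ψ hΨ p hp).1 a)
  have hDc : ∀ v i, ContinuousOn (D v (Φ i)) (S ×ˢ K) := fun v i =>
    (continuousOn_chart_fderivWithin x₀ hO (hΦ i) v).mono hsub
  have hmem : ∀ {g : ℝ × 𝔼 N → ℂ}, ContinuousOn g (S ×ˢ K) →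
      ∫⁻ p, ‖g p‖ₑ ^ 2 ∂ν < ⊤ → MemLp g 2 (volume.restrict U) := fun {g} hg h => by
    rw [hUν, memLp_two_iff]
    refine ⟨?_, h⟩
    rw [hνS]
    exact hg.aestronglyMeasurable hSKm
  have hCt : ∀ {a : ℝ≥0∞}, a < ⊤ → ofReal C * a < ⊤ := fun h =>
    ENNReal.mul_lt_top ofReal_lt_top h
  have t0 : ∀ {κ : Type} {l : Filter κ} {a : κ → ℝ≥0∞}, Tendsto a l (𝓝 0) →
      Tendsto (fun i => ofReal C * a i) l (𝓝 0) := fun h => by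
    have := ENNReal.Tendsto.const_mul h (Or.inr (ofReal_ne_top (r := C)))
    rwa [mul_zero] at this
  have main : ∀ v, (∀ i, ∫⁻ p, ‖D v (Φ i) p‖ₑ ^ 2 ∂ν < ⊤) →
      Tendsto (fun l : ℕ × ℕ => ∫⁻ p, ‖D v (Φ l.1 - Φ l.2) p‖ₑ ^ 2 ∂ν) atTop (𝓝 0) →
      Tendsto (fun i => ∫⁻ p, ‖D v (Φ i) p‖ₑ ^ 2 ∂ν) atTop (𝓝 0) := by
    intro v hfin hc
    rw [← hUν]
    refine tendsto_lineDeriv_zero (f := fun i => f (Φ i)) hU v (fun i p hp => ?_) (fun i => ?_)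
      (fun i => ?_) ?_ ?_
    · have hp' : p ∈ S ×ˢ K := prod_mono interior_subset interior_subset hp
      have hn : O ×ˢ T ∈ 𝓝 p := mem_of_superset (hU.mem_nhds hp)
        ((Set.prod_mono interior_subset interior_subset).trans hsub)
      have h := ((hfd i).differentiableOn (by simp) p (hsub hp')).hasFDerivWithinAt.hasFDerivAt hn
      exact h.hasLineDerivAt v
    · exact hmem ((hfd i).continuousOn.mono hsub) ((b0 i).trans_lt (hCt (f0 i)))
    · exact hmem (hDc v i) (hfin i)
    · rw [hUν]
      exact tendsto_nhds_bot_mono' (t0 h0) b0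
    · rw [hUν]
      refine hc.congr fun l => lintegral_congr_ae (hae fun p hp => ?_)
      rw [hDsub v _ _ p hp]
  have c1 := main (1, 0) (fun i => (b1 _ (hΦ i)).trans_lt (hCt (f1 i)))
    (tendsto_nhds_bot_mono' (t0 h1)
      fun l => b1 _ (hΦs _ _))
  have c2 : ∀ a, Tendsto (fun i => ∫⁻ p, ‖D (0, EuclideanSpace.single a 1) (Φ i) p‖ₑ ^ 2 ∂ν)
      atTop (𝓝 0) := fun a =>
    main _ (fun i => (b2 _ (hΦ i) a).trans_lt (hCt (hCt (f2 i))))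
      (tendsto_nhds_bot_mono' (t0 (t0 h2)) fun l => b2 _ (hΦs _ _) a)
  constructor
  · refine tendsto_nhds_bot_mono' (t0 c1) fun i => ?_
    refine (lintegral_le_chart hSO hSm hK hKT hup (continuousOn_fstDeriv_sq hO (hΦ i))).trans ?_
    refine mul_le_mul_right (le_of_eq (lintegral_congr_ae (hae fun p hp => ?_))) _
    rw [hD1 _ (hΦ i) p hp]
  · have c4 := tendsto_finsetSum (Finset.univ : Finset (Fin N)) fun a _ => c2 a
    rw [Finset.sum_const_zero] at c4
    have c3 := t0 (t0 c4)
    refine tendsto_nhds_bot_mono' c3 fun i => ?_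
    refine (lintegral_le_chart hSO hSm hK hKT hup (continuousOn_sndEnergy hO (hΦ i))).trans ?_
    refine mul_le_mul_right ?_ _
    rw [← lintegral_finsetSum' _ fun a _ => ?_, ← lintegral_const_mul' _ _ ofReal_ne_top]
    · refine lintegral_mono_ae (hae fun p hp => ?_)
      refine (ofReal_le_ofReal (hD2 _ (hΦ i) p hp).2).trans_eq ?_
      rw [ofReal_mul hC.le, ENNReal.ofReal_sum_of_nonneg fun _ _ => by positivity]
      congr 1
      refine sum_congr rfl fun a _ => ?_
      rw [ofReal_pow (norm_nonneg _), ofReal_norm]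
    · rw [hνS]
      exact (((hDc _ i).aemeasurable hSKm).enorm).pow_const 2

/-- The derivatives on a product are closable. -/
lemma tendsto_product_energy :
    Tendsto (fun i => ∫⁻ p, ‖fstDeriv (Φ i) p‖ₑ ^ 2 ∂Λ S M) atTop (𝓝 0) ∧
      Tendsto (fun i => ∫⁻ p, ofReal (sndEnergy (Φ i) p) ∂Λ S M) atTop (𝓝 0) := by
  choose A hA hxA hA1 hA2 using exists_tendsto_local hO hSO hSm hS hΦ f0 f1 f2 h0 h1 h2
  obtain ⟨t, ht⟩ := isCompact_univ.elim_finite_subcover A hA fun x _ => mem_iUnion.mpr ⟨x, hxA x⟩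
  have key : ∀ {F : ℝ × M → ℝ≥0∞}, ContinuousOn F (O ×ˢ univ) →
      ∫⁻ p, F p ∂Λ S M ≤
        ∑ a ∈ t, ∫⁻ s in S, ∫⁻ x in A a, F (s, x) ∂dV M := by
    intro F hF
    have hm : ∀ B : Set M, MeasurableSet B →
        AEMeasurable F ((volume.restrict S).prod ((dV M).restrict B)) := fun B hB => by
      rw [Measure.prod_restrict]
      exact (hF.mono (prod_mono hSO (subset_univ _))).aemeasurable (hSm.prod hB)
    have hm' := hm univ MeasurableSet.univ
    rw [Measure.restrict_univ] at hm'
    rw [lintegral_prod _ hm', ← lintegral_finsetSum' _ fun a _ =>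
      (hm (A a) (hA a).measurableSet).lintegral_prod_right']
    refine lintegral_mono fun s => ?_
    have : ∀ r : Finset M, ∫⁻ x in ⋃ a ∈ r, A a, F (s, x) ∂dV M ≤
        ∑ a ∈ r, ∫⁻ x in A a, F (s, x) ∂dV M := by
      classical
      intro r
      induction r using Finset.induction_on with
      | empty => simp
      | insert a r ha ih =>
        rw [Finset.set_biUnion_insert, Finset.sum_insert ha]
        exact (lintegral_union_le _ _ _).trans (by gcongr)
    have h3 := this t
    rwa [univ_subset_iff.mp ht, Measure.restrict_univ] at h3
  have z : ∀ {a : M → ℕ → ℝ≥0∞}, (∀ x, Tendsto (a x) atTop (𝓝 0)) →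
      Tendsto (fun i => ∑ x ∈ t, a x i) atTop (𝓝 0) := fun h => by
    have := tendsto_finsetSum t fun x _ => h x
    rwa [Finset.sum_const_zero] at this
  exact ⟨tendsto_nhds_bot_mono' (z hA1)
      fun i => key (continuousOn_fstDeriv_sq hO (hΦ i)),
    tendsto_nhds_bot_mono' (z hA2)
      fun i => key (continuousOn_sndEnergy hO (hΦ i))⟩

end ProductClosability

namespace BuildingBlocks

variable {n k : ℕ} {G : SimpleGraph (Fin n)} {B : BuildingBlocks.{u} G k} {d ε : ℝ}
  {φ ψ : B.Point → ℂ}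

section Components

variable (B d ε)

def edgeMass (e : Edge G) (φ : B.Point → ℂ) : ℝ := ∫ q, ‖B.extend d ε φ e q‖ ^ 2 ∂B.edgeMeas d e

def edgeLong (e : Edge G) (φ : B.Point → ℂ) : ℝ := ∫ q, ‖B.extDeriv d ε φ e q‖ ^ 2 ∂B.edgeMeas d e

def edgeCov (A : InnerEdge G → ℝ) (e : Edge G) (φ : B.Point → ℂ) : ℝ :=
  ∫ q, ‖B.covDeriv d ε A φ e q‖ ^ 2 ∂B.edgeMeas d e

def edgeTrans (e : Edge G) (φ : B.Point → ℂ) : ℝ := ∫ q, (B.extGrad d ε φ φ e q).re ∂B.edgeMeas d e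

def midMass (e : InnerEdge G) (φ : B.Point → ℂ) : ℝ :=
  ∫ q in Ioc (-ε) ε ×ˢ univ, ‖B.extend d ε φ (Sum.inr e) q‖ ^ 2 ∂B.edgeMeas d (Sum.inr e)

def vertMass (v : Fin n) (φ : B.Point → ℂ) : ℝ := ∫ x, ‖φ (vertexPt v x)‖ ^ 2 ∂B.vertMeas v

def vertEnergy (v : Fin n) (φ : B.Point → ℂ) : ℝ := ∫ x, (B.vertGrad φ φ v x).re ∂B.vertMeas v

variable {B d ε}

lemma edgeMass_nonneg (e : Edge G) (φ : B.Point → ℂ) : 0 ≤ B.edgeMass d ε e φ :=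
  integral_nonneg fun _ => by positivity

lemma edgeLong_nonneg (e : Edge G) (φ : B.Point → ℂ) : 0 ≤ B.edgeLong d ε e φ :=
  integral_nonneg fun _ => by positivity

lemma edgeTrans_nonneg (e : Edge G) (φ : B.Point → ℂ) : 0 ≤ B.edgeTrans d ε e φ :=
  integral_nonneg fun _ => gradProd_self_nonneg _ _

lemma midMass_nonneg (e : InnerEdge G) (φ : B.Point → ℂ) : 0 ≤ B.midMass d ε e φ :=
  integral_nonneg fun _ => by positivity

lemma vertMass_nonneg (v : Fin n) (φ : B.Point → ℂ) : 0 ≤ B.vertMass v φ :=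
  integral_nonneg fun _ => by positivity

lemma vertEnergy_nonneg (v : Fin n) (φ : B.Point → ℂ) : 0 ≤ B.vertEnergy v φ :=
  integral_nonneg fun _ => gradProd_self_nonneg _ _

namespace IsNice

variable {e : Edge G} {f : ℝ × B.Y e → ℂ}

lemma integrable_norm_sq (hf : B.IsNice d e f) :
    Integrable (fun q => ‖f q‖ ^ 2) (B.edgeMeas d e) :=
  (memLp_two_iff_integrable_sq_norm (hf.memLp 2).1).mp (hf.memLp 2)

lemma lintegral_eq (hf : B.IsNice d e f) : ∫⁻ q, ‖f q‖ₑ ^ 2 ∂B.edgeMeas d e =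
    ofReal (∫ q, ‖f q‖ ^ 2 ∂B.edgeMeas d e) := by
  rw [ofReal_integral_eq_lintegral_ofReal hf.integrable_norm_sq
    (.of_forall fun _ => by positivity)]
  simp

end IsNice

namespace IsTestFunction

lemma lintegral_trans (hε : 0 < ε) (hφ : B.IsTestFunction d ε φ) (e : Edge G) :
    ∫⁻ q, ofReal (B.extGrad d ε φ φ e q).re ∂B.edgeMeas d e =
      ofReal (B.edgeTrans d ε e φ) :=
  (ofReal_integral_eq_lintegral_ofReal (hφ.nice_extGrad hε hφ e).integrable.re
    (.of_forall fun _ => gradProd_self_nonneg _ _)).symm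

lemma integrable_vert_norm_sq (hφ : B.IsTestFunction d ε φ) (v : Fin n) :
    Integrable (fun x => ‖φ (vertexPt v x)‖ ^ 2) (B.vertMeas v) :=
  Continuous.integrable_of_hasCompactSupport ((hφ.continuous_vertex v).norm.pow 2)
    (HasCompactSupport.of_compactSpace _)

lemma integrable_vertGrad (hφ : B.IsTestFunction d ε φ) (hψ : B.IsTestFunction d ε ψ) (v : Fin n) :
    Integrable (B.vertGrad φ ψ v) (B.vertMeas v) :=
  (hφ.continuous_vertGrad hψ v).integrable_of_hasCompactSupport (HasCompactSupport.of_compactSpace _)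

lemma lintegral_vertMass (hφ : B.IsTestFunction d ε φ) (v : Fin n) :
    ∫⁻ x, ‖φ (vertexPt v x)‖ₑ ^ 2 ∂B.vertMeas v = ofReal (B.vertMass v φ) := by
  rw [vertMass, ofReal_integral_eq_lintegral_ofReal (hφ.integrable_vert_norm_sq v)
    (.of_forall fun _ => by positivity)]
  simp

lemma lintegral_vertEnergy (hφ : B.IsTestFunction d ε φ) (v : Fin n) :
    ∫⁻ x, energyDensity (M := B.X v) (fun x => φ (vertexPt v x)) x ∂B.vertMeas v =
      ofReal (B.vertEnergy v φ) :=
  (ofReal_integral_eq_lintegral_ofReal (hφ.integrable_vertGrad hφ v).re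
    (.of_forall fun _ => gradProd_self_nonneg _ _)).symm

lemma edgePart_re (hε : 0 < ε) (hφ : B.IsTestFunction d ε φ) (A : InnerEdge G → ℝ) (e : Edge G) :
    (B.edgePart d ε A e φ φ).re = B.edgeCov d ε A e φ + (ε ^ 2)⁻¹ * B.edgeTrans d ε e φ := by
  have h1 := (hφ.nice_covDeriv hε A e).integrable_norm_sq
  have h2 : Integrable (fun q => (B.extGrad d ε φ φ e q).re) (B.edgeMeas d e) :=
    (hφ.nice_extGrad hε hφ e).integrable.re
  have h3 : (B.edgePart d ε A e φ φ).re = ∫ q, ((B.covDeriv d ε A φ e q *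
      conj (B.covDeriv d ε A φ e q) + ((ε ^ 2)⁻¹ : ℝ) * B.extGrad d ε φ φ e q)).re
        ∂B.edgeMeas d e := (integral_re (hφ.nice_edgePart hε hφ A e).integrable).symm
  rw [h3, edgeCov, edgeTrans, ← integral_const_mul, ← integral_add h1 (h2.const_mul _)]
  simp only [Complex.add_re, Complex.re_ofReal_mul, mul_conj, Complex.ofReal_re,
    normSq_eq_norm_sq]

lemma midPart_re (e : InnerEdge G) : (B.midPart d ε e φ φ).re = B.midMass d ε e φ := by
  have : B.midPart d ε e φ φ = ((B.midMass d ε e φ : ℝ) : ℂ) := by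
    rw [midMass, ← integral_complex_ofReal]
    refine integral_congr_ae (.of_forall fun q => ?_)
    simp only [mul_conj, normSq_eq_norm_sq]
  simp_all

lemma vertPart_re (v : Fin n) : (B.vertPart v φ φ).re = B.vertMass v φ := by
  have : B.vertPart v φ φ = ((B.vertMass v φ : ℝ) : ℂ) := by
    rw [vertMass, ← integral_complex_ofReal]
    refine integral_congr_ae (.of_forall fun q => ?_)
    simp only [mul_conj, normSq_eq_norm_sq]
  simp_all

lemma vertGradPart_re (hφ : B.IsTestFunction d ε φ) (v : Fin n) :
    (B.vertGradPart v φ φ).re = B.vertEnergy v φ :=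
  (integral_re (hφ.integrable_vertGrad hφ v)).symm

lemma testForm_re (hε : 0 < ε) (hφ : B.IsTestFunction d ε φ) (A wE : InnerEdge G → ℝ)
    (wV : Fin n → ℝ) : (B.testForm d ε A wE wV φ φ).re =
      ∑ e, ε ^ k * (B.edgeCov d ε A e φ + (ε ^ 2)⁻¹ * B.edgeTrans d ε e φ) +
      ∑ e, wE e / (2 * ε) * ε ^ k * B.midMass d ε e φ +
      ∑ v, (ε ^ (k + 1) * (ε ^ 2)⁻¹ * B.vertEnergy v φ +
        wV v / (ε * B.vertexVol v) * ε ^ (k + 1) * B.vertMass v φ) := by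
  simp only [testForm, Complex.add_re, Complex.re_sum, Complex.re_ofReal_mul, hφ.edgePart_re hε,
    midPart_re, vertPart_re, hφ.vertGradPart_re]

lemma edgeCov_zero (e : Edge G) : B.edgeCov d ε 0 e φ = B.edgeLong d ε e φ := by
  have : edgePotential (0 : InnerEdge G → ℝ) e = 0 := by bound
  simp [edgeCov, edgeLong, covDeriv, this]

lemma testForm_zero_re (hε : 0 < ε) (hφ : B.IsTestFunction d ε φ) :
    (B.testForm d ε 0 0 0 φ φ).re =
      ∑ e, ε ^ k * (B.edgeLong d ε e φ + (ε ^ 2)⁻¹ * B.edgeTrans d ε e φ) +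
      ∑ v, ε ^ (k + 1) * (ε ^ 2)⁻¹ * B.vertEnergy v φ := by
  rw [hφ.testForm_re hε]
  simp only [edgeCov_zero, Pi.zero_apply, zero_div, zero_mul, Finset.sum_const_zero, add_zero]

lemma testForm_zero_nonneg (hε : 0 < ε) (hφ : B.IsTestFunction d ε φ) :
    0 ≤ (B.testForm d ε 0 0 0 φ φ).re := by
  rw [hφ.testForm_zero_re hε]
  have h1 := fun e => edgeLong_nonneg (d := d) (ε := ε) e φ
  have h2 := fun e => edgeTrans_nonneg (d := d) (ε := ε) e φ
  have h3 := fun v => vertEnergy_nonneg v φ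
  refine add_nonneg (sum_nonneg fun e _ => ?_) (sum_nonneg fun v _ => ?_)
  · bound
  bound

lemma edgeCov_le (hε : 0 < ε) (hφ : B.IsTestFunction d ε φ) (A : InnerEdge G → ℝ) (e : Edge G) :
    B.edgeCov d ε A e φ ≤ 2 * B.edgeLong d ε e φ + 2 * edgePotential A e ^ 2 * B.edgeMass d ε e φ := by
  have h1 := (hφ.nice_extDeriv hε e).integrable_norm_sq
  have h2 := (hφ.nice_extend hε e).integrable_norm_sq
  rw [edgeLong, edgeMass, ← integral_const_mul, ← integral_const_mul,
    ← integral_add (h1.const_mul _) (h2.const_mul _)]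
  refine integral_mono (hφ.nice_covDeriv hε A e).integrable_norm_sq
    ((h1.const_mul _).add (h2.const_mul _)) fun q => ?_
  simp only [covDeriv]
  set a := B.extDeriv d ε φ e q
  set b := B.extend d ε φ e q
  have h3 := norm_add_le a (Complex.I * edgePotential A e * b)
  rw [norm_mul, norm_mul, Complex.norm_I, one_mul, norm_real, norm_eq_abs] at h3
  have h4 := sq_abs (edgePotential A e)
  have h5 :=
    pow_le_pow_left₀ (norm_nonneg _) h3 2
  nlinarith [sq_nonneg (‖a‖ - |edgePotential A e| * ‖b‖)]

lemma edgeLong_le (hε : 0 < ε) (hφ : B.IsTestFunction d ε φ) (A : InnerEdge G → ℝ) (e : Edge G) :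
    B.edgeLong d ε e φ ≤ 2 * B.edgeCov d ε A e φ + 2 * edgePotential A e ^ 2 * B.edgeMass d ε e φ := by
  have h1 := (hφ.nice_covDeriv hε A e).integrable_norm_sq
  have h2 := (hφ.nice_extend hε e).integrable_norm_sq
  rw [edgeCov, edgeMass, ← integral_const_mul, ← integral_const_mul,
    ← integral_add (h1.const_mul _) (h2.const_mul _)]
  refine integral_mono (hφ.nice_extDeriv hε e).integrable_norm_sq
    ((h1.const_mul _).add (h2.const_mul _)) fun q => ?_
  simp only [covDeriv]
  set a := B.extDeriv d ε φ e q
  set b := B.extend d ε φ e q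
  have h3 := norm_sub_le (a + Complex.I * edgePotential A e * b) (Complex.I * edgePotential A e * b)
  rw [add_sub_cancel_right, norm_mul (Complex.I * (edgePotential A e : ℂ)), norm_mul, Complex.norm_I,
    one_mul, norm_real, norm_eq_abs] at h3
  have h4 := sq_abs (edgePotential A e)
  set r := ‖a + Complex.I * edgePotential A e * b‖
  have h5 :=
    pow_le_pow_left₀ (norm_nonneg _) h3 2
  nlinarith [sq_nonneg (r - |edgePotential A e| * ‖b‖)]

lemma midMass_le (hε : 0 < ε) (hφ : B.IsTestFunction d ε φ) (e : InnerEdge G) :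
    B.midMass d ε e φ ≤ B.edgeMass d ε (Sum.inr e) φ :=
  setIntegral_le_integral (hφ.nice_extend hε _).integrable_norm_sq
    (.of_forall fun _ => by positivity)

end IsTestFunction

lemma testToL2_norm_sq (hε : 0 < ε) (φ : B.testSpace d ε) : ‖B.testToL2 hε φ‖ ^ 2 =
    ∑ e, ε ^ k * B.edgeMass d ε e φ.1 + ∑ v, ε ^ (k + 1) * B.vertMass v φ.1 := by
  rw [B.mfd_norm_sq hε]
  congr 1
  · refine sum_congr rfl fun e _ => ?_
    congr 1
    refine integral_congr_ae ?_
    filter_upwards [(testToL2_ae hε φ).1 e] with q h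
    rw [h]
  · refine sum_congr rfl fun v _ => ?_
    congr 1
    refine integral_congr_ae ?_
    filter_upwards [(testToL2_ae hε φ).2 v] with q h
    rw [h]

/-- The constant in the comparison of the form with the free form. -/
def formBound (B : BuildingBlocks.{u} G k) (ε : ℝ) (A wE : InnerEdge G → ℝ) (wV : Fin n → ℝ) : ℝ :=
  2 + 2 * ∑ e, edgePotential A e ^ 2 + ∑ e, |wE e / (2 * ε)| + ∑ v, |wV v / (ε * B.vertexVol v)|

lemma formBound_pos (A wE : InnerEdge G → ℝ) (wV : Fin n → ℝ) : 0 < B.formBound ε A wE wV := by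
  unfold formBound; positivity

lemma testForm_bounds (hε : 0 < ε) (A wE : InnerEdge G → ℝ) (wV : Fin n → ℝ)
    (φ : B.testSpace d ε) :
    1 / 2 * (B.testForm d ε 0 0 0 φ.1 φ.1).re - B.formBound ε A wE wV * ‖B.testToL2 hε φ‖ ^ 2 ≤
        (B.testForm d ε A wE wV φ.1 φ.1).re ∧
      (B.testForm d ε A wE wV φ.1 φ.1).re ≤ B.formBound ε A wE wV *
        ((B.testForm d ε 0 0 0 φ.1 φ.1).re + ‖B.testToL2 hε φ‖ ^ 2) := by
  have hφ : B.IsTestFunction d ε φ.1 := φ.2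
  set N := ‖B.testToL2 hε φ‖ ^ 2 with hN
  set Q := (B.testForm d ε 0 0 0 φ.1 φ.1).re with hQ
  have hN' := testToL2_norm_sq hε φ
  rw [← hN] at hN'
  have hQ' := hφ.testForm_zero_re hε
  rw [← hQ] at hQ'
  have hm := fun e => edgeMass_nonneg (d := d) (ε := ε) e φ.1
  have hvm := fun v => vertMass_nonneg v φ.1
  have hl := fun e => edgeLong_nonneg (d := d) (ε := ε) e φ.1
  have ht := fun e => edgeTrans_nonneg (d := d) (ε := ε) e φ.1
  have hve := fun v => vertEnergy_nonneg v φ.1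
  have hNe : 0 ≤ ∑ e, ε ^ k * B.edgeMass d ε e φ.1 :=
    sum_nonneg fun e _ => mul_nonneg (by positivity) (hm e)
  have hNv : 0 ≤ ∑ v, ε ^ (k + 1) * B.vertMass v φ.1 :=
    sum_nonneg fun e _ => mul_nonneg (by positivity) (hvm e)
  have hQv : 0 ≤ ∑ v, ε ^ (k + 1) * (ε ^ 2)⁻¹ * B.vertEnergy v φ.1 :=
    sum_nonneg fun e _ => mul_nonneg (by positivity) (hve e)
  have hN0 : 0 ≤ N := by positivity
  have hQ0 : 0 ≤ Q := hφ.testForm_zero_nonneg hε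
  have hme : ∀ e, ε ^ k * B.edgeMass d ε e φ.1 ≤ N := fun e => by
    have := single_le_sum (f := fun e => ε ^ k * B.edgeMass d ε e φ.1)
      (fun e _ => mul_nonneg (by positivity) (hm e)) (Finset.mem_univ e)
    linarith
  have hmv : ∀ v, ε ^ (k + 1) * B.vertMass v φ.1 ≤ N := fun v => by
    have := single_le_sum (f := fun v => ε ^ (k + 1) * B.vertMass v φ.1)
      (fun e _ => mul_nonneg (by positivity) (hvm e)) (Finset.mem_univ v)
    linarith
  set α := ∑ e, edgePotential A e ^ 2 with hα
  have hα0 : 0 ≤ α := by positivity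
  have hαe : ∀ e, edgePotential A e ^ 2 ≤ α := fun e =>
    single_le_sum (f := fun e => edgePotential A e ^ 2) (fun e _ => by positivity)
      (Finset.mem_univ e)
  set a1 := ∑ e, |wE e / (2 * ε)| with ha1
  set a2 := ∑ v, |wV v / (ε * B.vertexVol v)| with ha2
  have ha10 : 0 ≤ a1 := by positivity
  have ha20 : 0 ≤ a2 := by positivity
  have hmid : |∑ e, wE e / (2 * ε) * ε ^ k * B.midMass d ε e φ.1| ≤ a1 * N := by
    refine (Finset.abs_sum_le_sum_abs _ _).trans ?_
    rw [ha1, sum_mul]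
    refine sum_le_sum fun e _ => ?_
    have h0 := midMass_nonneg (d := d) (ε := ε) e φ.1
    rw [mul_assoc, abs_mul, abs_of_nonneg (a := ε ^ k * _) (by positivity)]
    refine mul_le_mul_of_nonneg_left ((mul_le_mul_of_nonneg_left (hφ.midMass_le hε e)
      (by positivity)).trans (hme _)) (abs_nonneg _)
  have hvert : |∑ v, wV v / (ε * B.vertexVol v) * ε ^ (k + 1) * B.vertMass v φ.1| ≤ a2 * N := by
    refine (Finset.abs_sum_le_sum_abs _ _).trans ?_
    rw [ha2, sum_mul]
    refine sum_le_sum fun v _ => ?_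
    have h0 := hvm v
    rw [mul_assoc, abs_mul, abs_of_nonneg (a := ε ^ (k + 1) * _) (by positivity)]
    bound
  have hup : ∑ e, ε ^ k * (B.edgeCov d ε A e φ.1 + (ε ^ 2)⁻¹ * B.edgeTrans d ε e φ.1) ≤
      2 * ∑ e, ε ^ k * (B.edgeLong d ε e φ.1 + (ε ^ 2)⁻¹ * B.edgeTrans d ε e φ.1) +
        2 * α * ∑ e, ε ^ k * B.edgeMass d ε e φ.1 := by
    rw [mul_sum, mul_sum, ← sum_add_distrib]
    refine sum_le_sum fun e _ => ?_
    have h1 := hφ.edgeCov_le hε A e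
    have h2 :=
      mul_le_mul_of_nonneg_right (hαe e) (hm e)
    have h3 : 0 ≤ (ε ^ 2)⁻¹ * B.edgeTrans d ε e φ.1 := mul_nonneg (by positivity) (ht e)
    have h4 : B.edgeCov d ε A e φ.1 + (ε ^ 2)⁻¹ * B.edgeTrans d ε e φ.1 ≤
        2 * (B.edgeLong d ε e φ.1 + (ε ^ 2)⁻¹ * B.edgeTrans d ε e φ.1) +
          2 * α * B.edgeMass d ε e φ.1 := by linarith
    refine (mul_le_mul_of_nonneg_left h4 (by positivity : 0 ≤ ε ^ k)).trans_eq (by ring)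
  have hlow : 1 / 2 * ∑ e, ε ^ k * (B.edgeLong d ε e φ.1 + (ε ^ 2)⁻¹ * B.edgeTrans d ε e φ.1) -
        α * ∑ e, ε ^ k * B.edgeMass d ε e φ.1 ≤
      ∑ e, ε ^ k * (B.edgeCov d ε A e φ.1 + (ε ^ 2)⁻¹ * B.edgeTrans d ε e φ.1) := by
    rw [mul_sum, mul_sum, ← Finset.sum_sub_distrib]
    refine sum_le_sum fun e _ => ?_
    have h1 := hφ.edgeLong_le hε A e
    have h2 :=
      mul_le_mul_of_nonneg_right (hαe e) (hm e)
    have h3 : 0 ≤ (ε ^ 2)⁻¹ * B.edgeTrans d ε e φ.1 := mul_nonneg (by positivity) (ht e)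
    have h4 : 1 / 2 * (B.edgeLong d ε e φ.1 + (ε ^ 2)⁻¹ * B.edgeTrans d ε e φ.1) -
          α * B.edgeMass d ε e φ.1 ≤
        B.edgeCov d ε A e φ.1 + (ε ^ 2)⁻¹ * B.edgeTrans d ε e φ.1 := by linarith
    refine le_trans (le_of_eq (by ring)) (mul_le_mul_of_nonneg_left h4 (by positivity : 0 ≤ ε ^ k))
  rw [hφ.testForm_re hε, sum_add_distrib, formBound, ← hα, ← ha1, ← ha2]
  have hNeN : ∑ e, ε ^ k * B.edgeMass d ε e φ.1 ≤ N := by linarith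
  have h5 := mul_le_mul_of_nonneg_left hNeN hα0
  obtain ⟨h6, h7⟩ := abs_le.mp hmid
  obtain ⟨h8, h9⟩ := abs_le.mp hvert
  have p1 := mul_nonneg hα0 hN0
  have p2 := mul_nonneg hα0 hQ0
  have p3 := mul_nonneg ha10 hQ0
  have p4 := mul_nonneg ha20 hQ0
  constructor
  · nlinarith
  · nlinarith

end Components

end BuildingBlocks

namespace BuildingBlocks

variable {n k : ℕ} {G : SimpleGraph (Fin n)} {B : BuildingBlocks.{u} G k} {d ε : ℝ}

section Closability

lemma edgeMass_le (hε : 0 < ε) (φ : B.testSpace d ε) (e : Edge G) :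
    ε ^ k * B.edgeMass d ε e φ.1 ≤ ‖B.testToL2 hε φ‖ ^ 2 := by
  rw [testToL2_norm_sq]
  have h1 : 0 ≤ ∑ v, ε ^ (k + 1) * B.vertMass v φ.1 :=
    sum_nonneg fun v _ => mul_nonneg (by positivity) (vertMass_nonneg v φ.1)
  have h2 := single_le_sum (f := fun e => ε ^ k * B.edgeMass d ε e φ.1)
    (fun e _ => mul_nonneg (by positivity) (edgeMass_nonneg e φ.1)) (Finset.mem_univ e)
  linarith

lemma vertMass_le (hε : 0 < ε) (φ : B.testSpace d ε) (v : Fin n) :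
    ε ^ (k + 1) * B.vertMass v φ.1 ≤ ‖B.testToL2 hε φ‖ ^ 2 := by
  rw [testToL2_norm_sq]
  have h1 : 0 ≤ ∑ e, ε ^ k * B.edgeMass d ε e φ.1 :=
    sum_nonneg fun v _ => mul_nonneg (by positivity) (edgeMass_nonneg v φ.1)
  have h2 := single_le_sum (f := fun v => ε ^ (k + 1) * B.vertMass v φ.1)
    (fun v _ => mul_nonneg (by positivity) (vertMass_nonneg v φ.1)) (Finset.mem_univ v)
  linarith

lemma IsTestFunction.edgeEnergy_le {φ : B.Point → ℂ} (hε : 0 < ε) (hφ : B.IsTestFunction d ε φ)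
    (e : Edge G) : ε ^ k * (B.edgeLong d ε e φ + (ε ^ 2)⁻¹ * B.edgeTrans d ε e φ) ≤
      (B.testForm d ε 0 0 0 φ φ).re := by
  rw [hφ.testForm_zero_re hε]
  have h1 : 0 ≤ ∑ v, ε ^ (k + 1) * (ε ^ 2)⁻¹ * B.vertEnergy v φ :=
    sum_nonneg fun v _ => mul_nonneg (by positivity) (vertEnergy_nonneg v φ)
  have h2 := single_le_sum
    (f := fun e => ε ^ k * (B.edgeLong d ε e φ + (ε ^ 2)⁻¹ * B.edgeTrans d ε e φ))
    (fun e _ => mul_nonneg (by positivity) (add_nonneg (edgeLong_nonneg e φ)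
      (mul_nonneg (by positivity) (edgeTrans_nonneg e φ)))) (Finset.mem_univ e)
  linarith

lemma IsTestFunction.edgeLong_le_form {φ : B.Point → ℂ} (hε : 0 < ε)
    (hφ : B.IsTestFunction d ε φ) (e : Edge G) :
    ε ^ k * B.edgeLong d ε e φ ≤ (B.testForm d ε 0 0 0 φ φ).re := by
  refine le_trans ?_ (hφ.edgeEnergy_le hε e)
  have := edgeTrans_nonneg (d := d) (ε := ε) e φ
  bound

lemma IsTestFunction.edgeTrans_le_form {φ : B.Point → ℂ} (hε : 0 < ε)
    (hφ : B.IsTestFunction d ε φ) (e : Edge G) :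
    ε ^ k * ((ε ^ 2)⁻¹ * B.edgeTrans d ε e φ) ≤ (B.testForm d ε 0 0 0 φ φ).re := by
  refine le_trans ?_ (hφ.edgeEnergy_le hε e)
  have := edgeLong_nonneg (d := d) (ε := ε) e φ
  bound

lemma IsTestFunction.vertEnergy_le_form {φ : B.Point → ℂ} (hε : 0 < ε)
    (hφ : B.IsTestFunction d ε φ) (v : Fin n) :
    ε ^ (k + 1) * (ε ^ 2)⁻¹ * B.vertEnergy v φ ≤ (B.testForm d ε 0 0 0 φ φ).re := by
  rw [hφ.testForm_zero_re hε]
  have h1 : 0 ≤ ∑ e, ε ^ k * (B.edgeLong d ε e φ + (ε ^ 2)⁻¹ * B.edgeTrans d ε e φ) :=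
    sum_nonneg fun e _ => mul_nonneg (by positivity) (add_nonneg (edgeLong_nonneg e φ)
      (mul_nonneg (by positivity) (edgeTrans_nonneg e φ)))
  have h2 := single_le_sum (f := fun v => ε ^ (k + 1) * (ε ^ 2)⁻¹ * B.vertEnergy v φ)
    (fun v _ => mul_nonneg (by positivity) (vertEnergy_nonneg v φ)) (Finset.mem_univ v)
  linarith

lemma tendsto_zero_of_mul_le {γ : Type*} {l : Filter γ} {a b : γ → ℝ} {c : ℝ} (hc : 0 < c)
    (h0 : ∀ i, 0 ≤ a i) (h : ∀ i, c * a i ≤ b i) (hb : Tendsto b l (𝓝 0)) :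
    Tendsto a l (𝓝 0) := by
  have h1 := hb.const_mul c⁻¹
  rw [mul_zero] at h1
  refine squeeze_zero h0 (fun i => ?_) h1
  rw [← div_eq_inv_mul, le_div_iff₀ hc, mul_comm]
  exact h i

lemma extend_sub (d ε : ℝ) (φ ψ : B.Point → ℂ) (e : Edge G) :
    B.extend d ε (φ - ψ) e = B.extend d ε φ e - B.extend d ε ψ e := by
  funext ⟨s, y⟩
  rcases e with j | e <;> simp only [extend, Pi.sub_apply] <;> split_ifs <;> rfl

lemma tendsto_ofReal_zero {γ : Type*} {l : Filter γ} {a : γ → ℝ} (h : Tendsto a l (𝓝 0)) :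
    Tendsto (fun i => ofReal (a i)) l (𝓝 0) := by
  have := ENNReal.tendsto_ofReal h
  simp_all

lemma tendsto_of_ofReal {γ : Type*} {l : Filter γ} {a : γ → ℝ} (h0 : ∀ i, 0 ≤ a i)
    (h : Tendsto (fun i => ofReal (a i)) l (𝓝 0)) : Tendsto a l (𝓝 0) := by
  have := (ENNReal.tendsto_toReal ENNReal.zero_ne_top).comp h
  exact this.congr fun i => toReal_ofReal (h0 i)

lemma tendsto_edgeEnergy (hε : 0 < ε) {φ : ℕ → B.testSpace d ε} (e : Edge G)
    (h0 : Tendsto (fun i => B.edgeMass d ε e (φ i).1) atTop (𝓝 0))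
    (h1 : Tendsto (fun l : ℕ × ℕ => B.edgeLong d ε e (φ l.1 - φ l.2).1) atTop (𝓝 0))
    (h2 : Tendsto (fun l : ℕ × ℕ => B.edgeTrans d ε e (φ l.1 - φ l.2).1) atTop (𝓝 0)) :
    Tendsto (fun i => B.edgeLong d ε e (φ i).1) atTop (𝓝 0) ∧
      Tendsto (fun i => B.edgeTrans d ε e (φ i).1) atTop (𝓝 0) := by
  have hm : ∀ f : B.testSpace d ε, ∫⁻ q, ‖B.extend d ε f.1 e q‖ₑ ^ 2 ∂B.edgeMeas d e =
      ofReal (B.edgeMass d ε e f.1) := fun f =>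
    (IsTestFunction.nice_extend hε f.2 e).lintegral_eq
  have hl : ∀ f : B.testSpace d ε, ∫⁻ q, ‖fstDeriv (B.extend d ε f.1 e) q‖ₑ ^ 2 ∂B.edgeMeas d e =
      ofReal (B.edgeLong d ε e f.1) := fun f =>
    (IsTestFunction.nice_extDeriv hε f.2 e).lintegral_eq
  have ht : ∀ f : B.testSpace d ε, ∫⁻ q, ofReal
      (sndEnergy (B.extend d ε f.1 e) q) ∂B.edgeMeas d e =
      ofReal (B.edgeTrans d ε e f.1) := fun f => IsTestFunction.lintegral_trans hε f.2 e
  have hsub : ∀ l : ℕ × ℕ, B.extend d ε (φ l.1).1 e - B.extend d ε (φ l.2).1 e =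
      B.extend d ε (φ l.1 - φ l.2).1 e := fun l => (extend_sub d ε _ _ e).symm
  have key := tendsto_product_energy
    (B.isOpen_extInterval (ε := ε) e)
    (B.edgeInterval_subset hε e) (measurableSet_edgeInterval e) ?_
    (fun i => IsTestFunction.smooth_edge (φ i).2 e)
    (fun i => (hm (φ i)).trans_lt ofReal_lt_top)
    (fun i => (hl (φ i)).trans_lt ofReal_lt_top)
    (fun i => (ht (φ i)).trans_lt ofReal_lt_top)
    ((tendsto_ofReal_zero h0).congr fun i => (hm (φ i)).symm)
    ((tendsto_ofReal_zero h1).congr fun l => by rw [hsub l]; exact (hl _).symm)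
    ((tendsto_ofReal_zero h2).congr fun l => by rw [hsub l]; exact (ht _).symm)
  · exact ⟨tendsto_of_ofReal (fun i => edgeLong_nonneg e _) (key.1.congr fun i => hl (φ i)),
      tendsto_of_ofReal (fun i => edgeTrans_nonneg e _) (key.2.congr fun i => ht (φ i))⟩
  · have := ae_mem_interior_edgeInterval (d := d) e
    rw [ae_restrict_iff' (measurableSet_edgeInterval e)] at this
    filter_upwards [this] with s hs
    exact propext ⟨fun h => interior_subset h, hs⟩

lemma tendsto_vertEnergy {φ : ℕ → B.testSpace d ε} (v : Fin n)
    (h0 : Tendsto (fun i => B.vertMass v (φ i).1) atTop (𝓝 0))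
    (h2 : Tendsto (fun l : ℕ × ℕ => B.vertEnergy v (φ l.1 - φ l.2).1) atTop (𝓝 0)) :
    Tendsto (fun i => B.vertEnergy v (φ i).1) atTop (𝓝 0) := by
  let Φ : B.testSpace d ε → ℝ × B.X v → ℂ := fun f p => f.1 (vertexPt v p.2)
  have hS : (volume.restrict (Icc (0 : ℝ) 1)) univ = 1 := by simp
  have hΦ : ∀ f, ContMDiff (𝓘(ℝ, ℝ).prod (𝓑 k)) 𝓘(ℝ, ℂ) ∞ (Φ f) := fun f =>
    (IsTestFunction.smooth_vertex f.2 v).comp contMDiff_snd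
  have hprod : ∀ F : B.X v → ℝ≥0∞, Measurable F →
      ∫⁻ p : ℝ × B.X v, F p.2 ∂(volume.restrict (Icc (0 : ℝ) 1)).prod (B.vertMeas v) =
        ∫⁻ x, F x ∂B.vertMeas v := fun F hF => by
    rw [lintegral_prod (fun p => F p.2) (hF.comp measurable_snd).aemeasurable]
    simp
  have hm : ∀ f : B.testSpace d ε, ∫⁻ q, ‖Φ f q‖ₑ ^ 2
      ∂(volume.restrict (Icc 0 1)).prod (B.vertMeas v) =
      ofReal (B.vertMass v f.1) := fun f => by
    rw [← IsTestFunction.lintegral_vertMass f.2 v]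
    exact hprod (fun x => ‖f.1 (vertexPt v x)‖ₑ ^ 2)
      ((IsTestFunction.continuous_vertex f.2 v).measurable.enorm.pow_const 2)
  have hl : ∀ f : B.testSpace d ε, ∫⁻ q, ‖fstDeriv (Φ f) q‖ₑ ^ 2
      ∂(volume.restrict (Icc 0 1)).prod (B.vertMeas v) = 0 := fun f => by
    have : ∀ q, fstDeriv (Φ f) q = 0 := fun q => deriv_const q.1 (f.1 (vertexPt v q.2))
    simp [this]
  have ht : ∀ f : B.testSpace d ε, ∫⁻ q, ofReal (sndEnergy (Φ f) q)
      ∂(volume.restrict (Icc 0 1)).prod (B.vertMeas v) =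
      ofReal (B.vertEnergy v f.1) := fun f => by
    rw [← IsTestFunction.lintegral_vertEnergy f.2 v]
    exact hprod _ (measurable_energyDensity (IsTestFunction.smooth_vertex f.2 v))
  have key := tendsto_product_energy
    (Φ := fun i => Φ (φ i)) isOpen_univ (subset_univ _) measurableSet_Icc
    (by rw [interior_Icc]; exact Ioo_ae_eq_Icc)
    (fun i => (hΦ (φ i)).contMDiffOn)
    (fun i => (hm (φ i)).trans_lt ofReal_lt_top)
    (fun i => (hl (φ i)).trans_lt ENNReal.zero_lt_top)
    (fun i => (ht (φ i)).trans_lt ofReal_lt_top)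
    ((tendsto_ofReal_zero h0).congr fun i => (hm (φ i)).symm)
    (tendsto_const_nhds.congr fun l => (hl (φ l.1 - φ l.2)).symm)
    ((tendsto_ofReal_zero h2).congr fun l => (ht (φ l.1 - φ l.2)).symm)
  exact tendsto_of_ofReal (fun i => vertEnergy_nonneg v _) (key.2.congr fun i => ht (φ i))

lemma isClosable_testForm (hε : 0 < ε) : IsClosable (B.testToL2 (d := d) hε)
    fun φ ψ : B.testSpace d ε => B.testForm d ε 0 0 0 φ.1 ψ.1 where
  sesq := isSesq_testForm hε 0 0 0
  nonneg f := IsTestFunction.testForm_zero_nonneg hε f.2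
  closable φ hφ := by
    have hN := hφ.tendsto.norm.pow 2
    simp at hN
    have hc := hφ.cauchy
    have pk : 0 < ε ^ k := by positivity
    have h1 : ∀ e, Tendsto (fun i => B.edgeLong d ε e (φ i).1) atTop (𝓝 0) ∧
        Tendsto (fun i => B.edgeTrans d ε e (φ i).1) atTop (𝓝 0) := fun e => by
      refine tendsto_edgeEnergy hε e ?_ ?_ ?_
      · exact tendsto_zero_of_mul_le pk (fun i => edgeMass_nonneg e _)
          (fun i => edgeMass_le hε (φ i) e) hN
      · exact tendsto_zero_of_mul_le pk (fun i => edgeLong_nonneg e _)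
          (fun l => IsTestFunction.edgeLong_le_form hε (φ l.1 - φ l.2).2 e) hc
      · refine tendsto_zero_of_mul_le (c := ε ^ k * (ε ^ 2)⁻¹) (by positivity)
          (fun i => edgeTrans_nonneg e _) (fun l => ?_) hc
        rw [mul_assoc]
        exact IsTestFunction.edgeTrans_le_form hε (φ l.1 - φ l.2).2 e
    have h2 : ∀ v, Tendsto (fun i => B.vertEnergy v (φ i).1) atTop (𝓝 0) := fun v => by
      refine tendsto_vertEnergy v ?_ ?_
      · exact tendsto_zero_of_mul_le (by positivity)
          (fun i => vertMass_nonneg v _) (fun i => vertMass_le hε (φ i) v) hN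
      · exact tendsto_zero_of_mul_le (by positivity)
          (fun i => vertEnergy_nonneg v _)
          (fun l => IsTestFunction.vertEnergy_le_form hε (φ l.1 - φ l.2).2 v) hc
    have h3 : Tendsto (fun i => ∑ e, ε ^ k * (B.edgeLong d ε e (φ i).1 +
        (ε ^ 2)⁻¹ * B.edgeTrans d ε e (φ i).1) + ∑ v, ε ^ (k + 1) * (ε ^ 2)⁻¹ *
          B.vertEnergy v (φ i).1) atTop (𝓝 (∑ e : Edge G, ε ^ k * (0 + (ε ^ 2)⁻¹ * 0) +
            ∑ v : Fin n, ε ^ (k + 1) * (ε ^ 2)⁻¹ * 0)) :=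
      (tendsto_finsetSum _ fun e _ => ((h1 e).1.add ((h1 e).2.const_mul _)).const_mul _).add
        (tendsto_finsetSum _ fun v _ => (h2 v).const_mul _)
    simp only [mul_zero, add_zero, Finset.sum_const_zero] at h3
    exact h3.congr fun i => (IsTestFunction.testForm_zero_re hε (φ i).2).symm

end Closability

section Extension

lemma isApprox_iff (hε : 0 < ε) (hεd : ε ≤ d) {x : B.MfdL2 d ε} {φ : ℕ → B.Point → ℂ} :
    B.IsApprox d ε x φ ↔ ∃ ψ : ℕ → B.testSpace d ε, (fun i => (ψ i).1) = φ ∧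
      ApproxSeq (B.testToL2 hε) (fun φ ψ : B.testSpace d ε => B.testForm d ε 0 0 0 φ.1 ψ.1) x ψ := by
  have key : ∀ ψ : ℕ → B.testSpace d ε, B.IsApprox d ε x (fun i => (ψ i).1) ↔
      ApproxSeq (B.testToL2 hε) (fun φ ψ : B.testSpace d ε => B.testForm d ε 0 0 0 φ.1 ψ.1) x ψ :=
    fun ψ => by
    have e1 : Tendsto (fun i => eLpNorm ((ψ i).1 - ⇑x) 2 (B.mfdMeasure d ε)) atTop (𝓝 0) ↔
        Tendsto (fun i => B.testToL2 hε (ψ i)) atTop (𝓝 x) := by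
      rw [Lp.tendsto_Lp_iff_tendsto_eLpNorm']
      refine tendsto_congr fun i => eLpNorm_congr_ae ?_
      filter_upwards [testToL2_coeFn hε (ψ i)] with z hz
      simp_all
    have e2 : ∀ l : ℕ × ℕ, B.mfdSesq d ε 0 0 0 ((ψ l.1).1 - (ψ l.2).1) ((ψ l.1).1 - (ψ l.2).1) =
        B.testForm d ε 0 0 0 (ψ l.1 - ψ l.2).1 (ψ l.1 - ψ l.2).1 := fun l =>
      mfdSesq_eq hε hεd (ψ l.1 - ψ l.2).2 (ψ l.1 - ψ l.2).2 0 0 0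
    refine ⟨fun h => ⟨e1.mp h.tendsto, ?_⟩, fun h => ⟨fun i => (ψ i).2, e1.mpr h.tendsto, ?_⟩⟩
    · exact h.cauchy.congr fun l => congrArg Complex.re (e2 l)
    · exact h.cauchy.congr fun l => (congrArg Complex.re (e2 l)).symm
  refine ⟨fun h => ⟨fun i => ⟨φ i, h.test i⟩, rfl, (key _).mp h⟩, ?_⟩
  rintro ⟨ψ, rfl, h⟩
  grind

lemma mfdH1_eq (hε : 0 < ε) (hεd : ε ≤ d) :
    B.mfdH1 d ε = (closureDom (isClosable_testForm (B := B) (d := d) hε) : Set (B.MfdL2 d ε)) := by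
  ext x
  refine ⟨fun ⟨φ, hφ⟩ => ?_, fun ⟨ψ, hψ⟩ => ⟨_, (isApprox_iff hε hεd).mpr ⟨ψ, rfl, hψ⟩⟩⟩
  obtain ⟨ψ, -, hψ⟩ := (isApprox_iff hε hεd).mp hφ
  exact ⟨ψ, hψ⟩

lemma abs_testForm_le (hε : 0 < ε) (A wE : InnerEdge G → ℝ) (wV : Fin n → ℝ)
    (φ : B.testSpace d ε) : |(B.testForm d ε A wE wV φ.1 φ.1).re| ≤ B.formBound ε A wE wV *
      ((B.testForm d ε 0 0 0 φ.1 φ.1).re + ‖B.testToL2 hε φ‖ ^ 2) := by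
  obtain ⟨h1, h2⟩ := testForm_bounds hε A wE wV φ
  have h3 := (isClosable_testForm (B := B) (d := d) hε).nonneg φ
  have h4 := mul_nonneg (formBound_pos (B := B) (ε := ε) A wE wV).le h3
  exact abs_le.mpr ⟨by linarith, h2⟩

lemma isFormExtension_mfdSesqH1 (hε : 0 < ε) (hεd : ε ≤ d) (A wE : InnerEdge G → ℝ)
    (wV : Fin n → ℝ) : IsFormExtension (B.testToL2 (d := d) hε)
      (fun φ ψ : B.testSpace d ε => B.testForm d ε 0 0 0 φ.1 ψ.1)
      (fun φ ψ : B.testSpace d ε => B.testForm d ε A wE wV φ.1 ψ.1)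
      (B.mfdSesqH1 d ε A wE wV) := by
  intro x y φ ψ hφ hψ
  have happ : ∀ z : B.MfdL2 d ε, (∃ χ, ApproxSeq (B.testToL2 hε)
      (fun φ ψ : B.testSpace d ε => B.testForm d ε 0 0 0 φ.1 ψ.1) z χ) →
      ∃ χ : ℕ → B.testSpace d ε, (fun i => (χ i).1) = B.approx d ε z ∧ ApproxSeq (B.testToL2 hε)
      (fun φ ψ : B.testSpace d ε => B.testForm d ε 0 0 0 φ.1 ψ.1) z χ := by
    rintro z ⟨χ, hχ⟩
    have h : ∃ φ, B.IsApprox d ε z φ := ⟨_, (isApprox_iff hε hεd).mpr ⟨χ, rfl, hχ⟩⟩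
    refine (isApprox_iff hε hεd).mp ?_
    rw [approx, dif_pos h]
    exact h.choose_spec
  obtain ⟨φ', hφ'e, hφ'⟩ := happ x ⟨φ, hφ⟩
  obtain ⟨ψ', hψ'e, hψ'⟩ := happ y ⟨ψ, hψ⟩
  have hq := isClosable_testForm (B := B) (d := d) hε
  have hh := isSesq_testForm (B := B) (d := d) hε A wE wV
  have hK := (formBound_pos (B := B) (ε := ε) A wE wV).le
  have hb := abs_testForm_le (B := B) (d := d) hε A wE wV
  have h1 : Tendsto (fun i => B.mfdSesq d ε A wE wV (B.approx d ε x i) (B.approx d ε y i)) atTop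
      (𝓝 (B.mfdSesqH1 d ε A wE wV x y)) := by
    refine tendsto_nhds_limUnder (cauchySeq_tendsto_of_complete ?_)
    have h2 := ApproxSeq.cauchySeq_form hq hh hK hb hφ' hψ'
    rw [← hφ'e, ← hψ'e]
    exact (funext fun i => mfdSesq_eq hε hεd (φ' i).2 (ψ' i).2 A wE wV) ▸ h2
  have h3 := (ApproxSeq.tendsto_form_sub hq hh hK hb hφ hφ' hψ hψ').add h1
  rw [zero_add] at h3
  refine h3.congr fun i => ?_
  rw [← hφ'e, ← hψ'e, mfdSesq_eq hε hεd (φ' i).2 (ψ' i).2 A wE wV, sub_add_cancel]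

lemma isClosedForm_mfdSesqH1 (hε : 0 < ε) (hεd : ε ≤ d) (A wE : InnerEdge G → ℝ)
    (wV : Fin n → ℝ) : IsClosedForm (B.mfdH1 d ε) (B.mfdSesqH1 d ε A wE wV) := by
  rw [mfdH1_eq hε hεd]
  exact IsFormExtension.isClosedForm_of_bounds (isClosable_testForm hε)
    (isFormExtension_mfdSesqH1 hε hεd 0 0 0) (isSesq_testForm hε A wE wV)
    (isFormExtension_mfdSesqH1 hε hεd A wE wV) one_half_pos
    (fun φ => (testForm_bounds hε A wE wV φ).1) (fun φ => (testForm_bounds hε A wE wV φ).2)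

end Extension

end BuildingBlocks

namespace BuildingBlocks

variable {n k : ℕ} {G : SimpleGraph (Fin n)} (B : BuildingBlocks.{u} G k) {d ε : ℝ}

section Density

instance : Finite (EdgeEnd G) :=
  Finite.of_injective (β := Fin n ⊕ InnerEdge G ⊕ InnerEdge G) (fun a => match a with
    | EdgeEnd.outer j => Sum.inl j
    | EdgeEnd.left e => Sum.inr (Sum.inl e)
    | EdgeEnd.right e => Sum.inr (Sum.inr e)) (by
    rintro (j | e | e) (j' | e' | e') h <;> simp_all)

lemma isCollar (a : EdgeEnd G) : IsCollar B.ℓ (B.collar a) :=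
  ⟨B.collar_smooth a, B.collar_inj a, B.collar_isometry a⟩

lemma collar_zero_mem (a : EdgeEnd G) (y : B.Y a.edge) :
    B.collar a (0, y) ∈ (𝓑 k).boundary (B.X a.vertex) := by
  have h : (⟨a.vertex, B.collar a (0, y)⟩ : Σ v, B.X v) ∈
      {x : Σ v, B.X v | x.2 ∈ (𝓑 k).boundary (B.X x.1)} :=
    B.boundary_eq ▸ mem_range_self (⟨a, y⟩ : Σ a : EdgeEnd G, B.Y a.edge)
  exact h

lemma vertMeas_boundary (v : Fin n) : B.vertMeas v ((𝓑 k).boundary (B.X v)) = 0 := by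
  have h : (𝓑 k).boundary (B.X v) ⊆ ⋃ a : EdgeEnd G, {x | ∃ y,
      (⟨a.vertex, B.collar a (0, y)⟩ : Σ v, B.X v) = ⟨v, x⟩} := by
    intro x hx
    have h' : (⟨v, x⟩ : Σ v, B.X v) ∈ range fun q : (Σ a : EdgeEnd G, B.Y a.edge) =>
        (⟨q.1.vertex, B.collar q.1 (0, q.2)⟩ : Σ v, B.X v) := by
      rw [B.boundary_eq]; exact hx
    obtain ⟨⟨a, y⟩, hq⟩ := h'
    exact mem_iUnion.mpr ⟨a, y, hq⟩
  refine measure_mono_null h (measure_iUnion_null fun a => ?_)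
  by_cases hv : a.vertex = v
  · subst hv
    refine measure_mono_null ?_ (riemVol_collar_boundary (B.isCollar a) B.ℓ_pos)
    rintro x ⟨y, hy⟩
    exact ⟨y, eq_of_heq (Sigma.mk.inj hy).2⟩
  · refine measure_mono_null (t := ∅) ?_ measure_empty
    rintro x ⟨y, hy⟩
    exact hv (congrArg Sigma.fst hy)

/-- Functions on the vertex manifolds that vanish near the boundary extend by zero beyond it. -/
lemma contMDiffOn_collar_extend (a : EdgeEnd G) {g : B.X a.vertex → ℂ}
    (hg : ContMDiff (𝓑 k) 𝓘(ℝ, ℂ) ∞ g)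
    (h0 : tsupport g ⊆ ((𝓑 k).boundary (B.X a.vertex))ᶜ) :
    ContMDiffOn (𝓘(ℝ, ℝ).prod (𝓡 k)) 𝓘(ℝ, ℂ) ∞
      (fun p : ℝ × B.Y a.edge => if 0 < p.1 then g (B.collar a p) else 0)
      (Iio B.ℓ ×ˢ univ) := by
  rintro ⟨t, y⟩ ⟨ht, -⟩
  refine ContMDiffAt.contMDiffWithinAt ?_
  have hcf : Tendsto (Prod.fst : ℝ × B.Y a.edge → ℝ) (𝓝 (t, y)) (𝓝 t) := continuous_fst.tendsto _
  rcases lt_trichotomy t 0 with h | h | h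
  · refine contMDiffAt_const (c := (0 : ℂ)) |>.congr_of_eventuallyEq ?_
    filter_upwards [hcf.eventually (gt_mem_nhds h)] with p hp
    rw [if_neg (not_lt.mpr hp.le)]
  · subst h
    refine contMDiffAt_const (c := (0 : ℂ)) |>.congr_of_eventuallyEq ?_
    have hb : B.collar a (0, y) ∉ tsupport g := fun h => h0 h (B.collar_zero_mem a y)
    have hz := notMem_tsupport_iff_eventuallyEq.mp hb
    have hc : ContinuousWithinAt (B.collar a) (Ico 0 B.ℓ ×ˢ univ) (0, y) :=
      (B.collar_smooth a).continuousOn _ ⟨⟨le_rfl, B.ℓ_pos⟩, mem_univ _⟩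
    have h1 := eventually_nhdsWithin_iff.mp (hc.eventually hz)
    filter_upwards [h1, hcf.eventually (gt_mem_nhds B.ℓ_pos)] with p hp hp'
    split_ifs with h2
    · exact hp ⟨⟨h2.le, hp'⟩, mem_univ _⟩
    · rfl
  · have hn : Ico 0 B.ℓ ×ˢ univ ∈ 𝓝 ((t, y) : ℝ × B.Y a.edge) :=
      prod_mem_nhds (Ico_mem_nhds h ht) univ_mem
    have h1 := (hg _).comp (t, y) (((B.collar_smooth a) (t, y) (mem_of_mem_nhds hn)).contMDiffAt hn)
    refine h1.congr_of_eventuallyEq ?_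
    filter_upwards [hcf.eventually (lt_mem_nhds h)] with p hp
    rw [if_pos hp]
    rfl

variable {B}

/-- A function that lives on the edge neighbourhoods. -/
lemma isTestFunction_edge {F : ∀ e, ℝ × B.Y e → ℂ}
    (hF : ∀ e, ContMDiff (𝓘(ℝ, ℝ).prod (𝓡 k)) 𝓘(ℝ, ℂ) ∞ (F e))
    (h0 : ∀ e s y, s ∉ edgeInterval d e → F e (s, y) = 0)
    (hR : ∃ R : ℝ, ∀ (j : Fin n) (s : ℝ) (y : B.Y (Sum.inl j)), R < s → F (Sum.inl j) (s, y) = 0) :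
    B.IsTestFunction d ε (Sum.elim (fun z => F z.1 z.2) 0) ∧
      ∀ e, B.extend d ε (Sum.elim (fun z => F z.1 z.2) 0) e = F e := by
  have h : ∀ e, B.extend d ε (Sum.elim (fun z => F z.1 z.2) 0) e = F e := by
    rintro (j | e) <;> funext ⟨s, y⟩
    · by_cases hs : s < 0
      · simp [extend, hs, h0 (Sum.inl j) s y (fun h => not_lt.mpr h hs)]
      · simp [extend, hs]
    · by_cases hs : s < -d
      · simp [extend, hs, h0 (Sum.inr e) s y (fun h => not_lt.mpr h.1 hs)]
      · by_cases hs' : d < s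
        · simp [extend, hs, hs', h0 (Sum.inr e) s y (fun h => not_lt.mpr h.2 hs')]
        · simp [extend, hs, hs']
  exact ⟨⟨fun v => contMDiff_const, fun e => by rw [h]; exact (hF e).contMDiffOn, hR⟩, h⟩

/-- A function that lives on the vertex neighbourhoods. -/
lemma isTestFunction_vertex (hε : 0 < ε) (hd : 0 < d) {g : ∀ v, B.X v → ℂ}
    (hg : ∀ v, ContMDiff (𝓑 k) 𝓘(ℝ, ℂ) ∞ (g v))
    (h0 : ∀ v, tsupport (g v) ⊆ ((𝓑 k).boundary (B.X v))ᶜ) :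
    B.IsTestFunction d ε (Sum.elim 0 (fun z => g z.1 z.2)) where
  smooth_vertex := hg
  smooth_edge := by
    have key : ∀ (a : EdgeEnd G) (r c : ℝ) (S : Set ℝ), (∀ s ∈ S, r * s + c < B.ℓ) →
        ContMDiffOn (𝓘(ℝ, ℝ).prod (𝓡 k)) 𝓘(ℝ, ℂ) ∞ (fun p : ℝ × B.Y a.edge =>
          if 0 < r * p.1 + c then g a.vertex (B.collar a (r * p.1 + c, p.2)) else 0)
          (S ×ˢ univ) := fun a r c S hS => by
      have h1 : ContMDiff 𝓘(ℝ, ℝ) 𝓘(ℝ, ℝ) ∞ fun s : ℝ => r * s + c :=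
        ((contDiff_const.mul contDiff_id).add contDiff_const).contMDiff
      have h2 : ContMDiff (𝓘(ℝ, ℝ).prod (𝓡 k)) (𝓘(ℝ, ℝ).prod (𝓡 k)) ∞
          fun p : ℝ × B.Y a.edge => (r * p.1 + c, p.2) :=
        (h1.comp contMDiff_fst).prodMk contMDiff_snd
      exact (B.contMDiffOn_collar_extend a (hg _) (h0 _)).comp h2.contMDiffOn
        fun p hp => ⟨hS _ hp.1, mem_univ _⟩
    rintro (j | e)
    · refine (key (EdgeEnd.outer j) (-ε⁻¹) 0 (B.extInterval d ε (Sum.inl j)) ?_).congr ?_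
      · intro s hs
        have hs' : -(ε * B.ℓ) < s := hs
        have : ε⁻¹ * -(ε * B.ℓ) < ε⁻¹ * s := mul_lt_mul_of_pos_left hs' (by positivity)
        have e1 : ε⁻¹ * -(ε * B.ℓ) = -B.ℓ := by field_simp
        linarith
      · rintro ⟨s, y⟩ -
        have e1 : -ε⁻¹ * s + 0 = -s / ε := by ring
        have e2 : 0 < -s / ε ↔ s < 0 := by rw [div_pos_iff_of_pos_right hε, neg_pos]
        simp only [extend, e1, e2]
        rfl
    · refine ((key (EdgeEnd.left e) (-ε⁻¹) (-d / ε) (B.extInterval d ε (Sum.inr e)) ?_).add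
        (key (EdgeEnd.right e) (ε⁻¹) (-d / ε) (B.extInterval d ε (Sum.inr e)) ?_)).congr ?_
      · intro s hs
        have : ε⁻¹ * (-d - ε * B.ℓ) < ε⁻¹ * s := mul_lt_mul_of_pos_left hs.1 (by positivity)
        have e1 : ε⁻¹ * (-d - ε * B.ℓ) = -d / ε - B.ℓ := by field_simp
        linarith
      · intro s hs
        have : ε⁻¹ * s < ε⁻¹ * (d + ε * B.ℓ) := mul_lt_mul_of_pos_left hs.2 (by positivity)
        have e1 : ε⁻¹ * (d + ε * B.ℓ) = - (-d / ε) + B.ℓ := by field_simp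
        linarith
      · rintro ⟨s, y⟩ -
        have e1 : -ε⁻¹ * s + -d / ε = (-d - s) / ε := by ring
        have e2 : 0 < (-d - s) / ε ↔ s < -d := by
          rw [div_pos_iff_of_pos_right hε, sub_pos]
        have e3 : ε⁻¹ * s + -d / ε = (s - d) / ε := by ring
        have e4 : 0 < (s - d) / ε ↔ d < s := by
          rw [div_pos_iff_of_pos_right hε, sub_pos]
        change _ = (if 0 < -ε⁻¹ * s + -d / ε then
            g e.fst (B.collar (EdgeEnd.left e) (-ε⁻¹ * s + -d / ε, y)) else 0) +
          if 0 < ε⁻¹ * s + -d / ε then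
            g e.snd (B.collar (EdgeEnd.right e) (ε⁻¹ * s + -d / ε, y)) else 0
        simp only [extend, e1, e2, e3, e4]
        by_cases hs : s < -d
        · have : ¬ d < s := by linarith
          simp only [hs, this, if_true, if_false, add_zero]
          rfl
        · by_cases hs' : d < s
          · simp only [hs, hs', if_true, if_false, zero_add]
            rfl
          · simp only [hs, hs', if_false, add_zero]
            rfl
  compact_support := ⟨0, fun _ _ _ _ => rfl⟩

lemma inner_testToL2 (hε : 0 < ε) (φ : B.testSpace d ε) (x : B.MfdL2 d ε) :
    inner ℂ (B.testToL2 hε φ) x =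
      ∑ e, (ε ^ k : ℝ) * ∫ q, conj (B.extend d ε φ.1 e q) * x (edgePt e q) ∂B.edgeMeas d e +
        ∑ v, (ε ^ (k + 1) : ℝ) *
          ∫ z, conj (φ.1 (vertexPt v z)) * x (vertexPt v z) ∂B.vertMeas v := by
  rw [B.mfd_inner hε]
  congr 1
  · refine sum_congr rfl fun e _ => ?_
    congr 1
    refine integral_congr_ae ?_
    filter_upwards [(testToL2_ae hε φ).1 e] with q h
    rw [h]
  · refine sum_congr rfl fun v _ => ?_
    congr 1
    refine integral_congr_ae ?_
    filter_upwards [(testToL2_ae hε φ).2 v] with q h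
    rw [h]

lemma memLp_locallyIntegrable {α : Type*} [MeasurableSpace α] [TopologicalSpace α]
    {μ : Measure α} [IsLocallyFiniteMeasure μ] {f : α → ℂ} (hf : MemLp f 2 μ) :
    LocallyIntegrable f μ := hf.locallyIntegrable (by norm_num)

lemma dense_mfdH1 (hε : 0 < ε) (hεd : ε ≤ d) : Dense (B.mfdH1 d ε) := by
  classical
  have hd : 0 < d := hε.trans_le hεd
  have pk : ((ε ^ k : ℝ) : ℂ) ≠ 0 := by exact_mod_cast (by positivity : ε ^ k ≠ 0)
  have pk' : ((ε ^ (k + 1) : ℝ) : ℂ) ≠ 0 := by exact_mod_cast (by positivity : ε ^ (k + 1) ≠ 0)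
  rw [mfdH1_eq hε hεd, Submodule.dense_iff_topologicalClosure_eq_top,
    Submodule.topologicalClosure_eq_top_iff, Submodule.eq_bot_iff]
  intro x hx
  have hx0 : ∀ φ : B.testSpace d ε, inner ℂ (B.testToL2 hε φ) x = 0 := fun φ =>
    (Submodule.mem_orthogonal _ _).mp hx _ ⟨_, ApproxSeq.const _ (isSesq_testForm hε 0 0 0) φ⟩
  obtain ⟨hxe, hxv⟩ := B.mfdL2_memLp hε x
  have h1 : ∀ e, ∀ᵐ q ∂B.edgeMeas d e, x (edgePt e q) = 0 := fun e => by
    have hloc : LocallyIntegrable (fun q => x (edgePt e q)) (B.edgeMeas d e) := by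
      have : IsLocallyFiniteMeasure (B.edgeMeas d e) := by unfold edgeMeas; infer_instance
      exact memLp_locallyIntegrable (hxe e)
    have hU : IsOpen (interior (edgeInterval d e) ×ˢ (univ : Set (B.Y e))) :=
      isOpen_interior.prod isOpen_univ
    have key := hU.ae_eq_zero_of_integral_contMDiff_smul_eq_zero (𝓘(ℝ, ℝ).prod (𝓡 k))
      (hloc.locallyIntegrableOn _) fun g hg hgc hgs => ?_
    · have hi := ae_mem_interior_edgeInterval (d := d) e
      have hi' : ∀ᵐ q ∂B.edgeMeas d e, q.1 ∈ interior (edgeInterval d e) :=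
        Measure.quasiMeasurePreserving_fst.ae hi
      filter_upwards [key, hi'] with q h h'
      exact h ⟨h', mem_univ _⟩
    · set F : ∀ e, ℝ × B.Y e → ℂ := Function.update (fun _ _ => 0) e fun q => (g q : ℂ) with hF
      have hFe : F e = fun q => (g q : ℂ) := Function.update_self ..
      have hFn : ∀ e', e' ≠ e → F e' = fun _ => 0 := fun e' h => Function.update_of_ne h ..
      have hg0 : ∀ q, q ∉ interior (edgeInterval d e) ×ˢ (univ : Set (B.Y e)) → g q = 0 :=
        fun q hq => image_eq_zero_of_notMem_tsupport fun h => hq (hgs h)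
      have ht := isTestFunction_edge (d := d) (ε := ε) (F := F) (fun e' => ?_)
        (fun e' s y hs => ?_) ?_
      · have h2 := hx0 ⟨_, ht.1⟩
        rw [inner_testToL2, Finset.sum_eq_single e, sum_eq_zero, add_zero, ht.2, hFe] at h2
        · have h3 := (mul_eq_zero.mp h2).resolve_left pk
          simpa only [conj_ofReal, real_smul] using h3
        · intro v _
          simp
        · intro e' _ he'
          rw [ht.2, hFn e' he']
          simp
        · simp
      · by_cases h : e' = e
        · subst h
          rw [hFe]
          exact (Complex.ofRealCLM.contDiff.contMDiff (n := ∞)).comp hg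
        · rw [hFn e' h]
          exact contMDiff_const
      · by_cases h : e' = e
        · subst h
          rw [hFe]
          simp only
          rw [hg0 _ fun h => hs (interior_subset h.1), Complex.ofReal_zero]
        · rw [hFn e' h]
      · obtain ⟨R, hR⟩ := (hgc.isCompact.image continuous_fst).bddAbove
        refine ⟨R, fun j s y hs => ?_⟩
        by_cases h : Sum.inl j = e
        · subst h
          rw [hFe]
          simp only
          rw [image_eq_zero_of_notMem_tsupport fun h => not_le.mpr hs (hR ⟨_, h, rfl⟩),
            Complex.ofReal_zero]
        · rw [hFn _ h]
  have h2 : ∀ v, ∀ᵐ z ∂B.vertMeas v, x (vertexPt v z) = 0 := fun v => by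
    have hloc : LocallyIntegrable (fun z => x (vertexPt v z)) (B.vertMeas v) :=
      memLp_locallyIntegrable (hxv v)
    have hU : IsOpen ((𝓑 k).boundary (B.X v))ᶜ :=
      ((𝓑 k).isClosed_boundary (M := B.X v) (n := ∞) (by simp)).isOpen_compl
    have key := hU.ae_eq_zero_of_integral_contMDiff_smul_eq_zero (𝓑 k)
      (hloc.locallyIntegrableOn _) fun g hg hgc hgs => ?_
    · have hi : ∀ᵐ z ∂B.vertMeas v, z ∉ (𝓑 k).boundary (B.X v) :=
        measure_eq_zero_iff_ae_notMem.mp (B.vertMeas_boundary v)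
      filter_upwards [key, hi] with z h h'
      exact h h'
    · set F : ∀ v, B.X v → ℂ := Function.update (fun _ _ => 0) v fun q => (g q : ℂ) with hF
      have hFe : F v = fun q => (g q : ℂ) := Function.update_self ..
      have hFn : ∀ v', v' ≠ v → F v' = fun _ => 0 := fun e' h => Function.update_of_ne h ..
      have ht := isTestFunction_vertex (d := d) (ε := ε) hε hd (g := F) (fun v' => ?_)
        (fun v' => ?_)
      · have h2 := hx0 ⟨_, ht⟩
        rw [inner_testToL2, sum_eq_zero, zero_add, Finset.sum_eq_single v] at h2
        · have h3 := (mul_eq_zero.mp h2).resolve_left pk'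
          simp only [Sum.elim_inr, hFe, conj_ofReal] at h3
          simpa only [real_smul] using h3
        · intro v' _ hv'
          simp [hFn v' hv']
        · simp
        · intro e _
          refine mul_eq_zero_of_right _ ?_
          rw [← integral_zero (ℝ × B.Y e) ℂ (μ := B.edgeMeas d e)]
          refine integral_congr_ae (B.ae_edgeMeas_of_mem fun s hs y => ?_)
          simp only [B.extend_of_mem _ hs, Sum.elim_inl, Pi.zero_apply, map_zero, zero_mul]
      · by_cases h : v' = v
        · subst h
          rw [hFe]
          exact (Complex.ofRealCLM.contDiff.contMDiff (n := ∞)).comp hg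
        · rw [hFn v' h]
          exact contMDiff_const
      · by_cases h : v' = v
        · subst h
          rw [hFe]
          refine (closure_mono fun z hz => ?_).trans hgs
          simpa using hz
        · rw [hFn v' h]
          simp [tsupport]
  have h3 : x =ᵐ[B.mfdMeasure d ε] 0 := (B.ae_mfd_iff hε).mpr ⟨h1, h2⟩
  exact (Lp.eq_zero_iff_ae_eq_zero).mpr h3

lemma isAdmissible_mfdForm (hε : 0 < ε) (hεd : ε ≤ d) (A wE : InnerEdge G → ℝ)
    (wV : Fin n → ℝ) : (B.mfdForm d ε A wE wV).IsAdmissible where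
  subspace := ⟨_, (mfdH1_eq hε hεd).symm⟩
  dense := dense_mfdH1 hε hεd
  free_nonneg f hf := by
    refine IsFormExtension.nonneg (isClosable_testForm hε)
      (isFormExtension_mfdSesqH1 hε hεd 0 0 0) ?_
    have hf' : f ∈ B.mfdH1 d ε := hf
    rwa [mfdH1_eq hε hεd] at hf'
  free_closed := isClosedForm_mfdSesqH1 hε hεd 0 0 0
  form_closed := isClosedForm_mfdSesqH1 hε hεd A wE wV

end Density

end BuildingBlocks

section WeakDerivatives

variable {n : ℕ} {G : SimpleGraph (Fin n)} {d : ℝ}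

/-- The element of `L²(Γ)` with given components. -/
def ofEdges (F : Edge G → ℝ → ℂ)
    (hF : ∀ e, MemLp (F e) 2 (edgeVol d e)) : GraphL2 G d :=
  (memLp_graph_iff (f := fun q => F q.1 q.2).mpr hF).toLp _

lemma ofEdges_ae (F : Edge G → ℝ → ℂ)
    (hF : ∀ e, MemLp (F e) 2 (edgeVol d e)) (e : Edge G) :
    ∀ᵐ s ∂edgeVol d e, ofEdges F hF ⟨e, s⟩ = F e s :=
  ae_graph_iff.mp (MemLp.coeFn_toLp (memLp_graph_iff (f := fun q => F q.1 q.2).mpr hF)) e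

lemma graphL2_ext {f g : GraphL2 G d}
    (h : ∀ e, ∀ᵐ s ∂edgeVol d e, f ⟨e, s⟩ = g ⟨e, s⟩) : f = g :=
  Lp.ext (ae_graph_iff.mpr h)

lemma graphL2_add_ae (f g : GraphL2 G d) (e : Edge G) :
    ∀ᵐ s ∂edgeVol d e, (f + g) ⟨e, s⟩ = f ⟨e, s⟩ + g ⟨e, s⟩ :=
  ae_graph_iff.mp (Lp.coeFn_add f g) e

lemma graphL2_smul_ae (c : ℂ) (f : GraphL2 G d) (e : Edge G) :
    ∀ᵐ s ∂edgeVol d e, (c • f) ⟨e, s⟩ = c * f ⟨e, s⟩ :=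
  ae_graph_iff.mp (Lp.coeFn_smul c f) e

lemma edge_norm_sq_le (f : GraphL2 G d) (e : Edge G) :
    ∫ s in edgeInterval d e, ‖f ⟨e, s⟩‖ ^ 2 ≤ ‖f‖ ^ 2 := by
  rw [graph_norm_sq]
  exact single_le_sum (f := fun e => ∫ s in edgeInterval d e, ‖f ⟨e, s⟩‖ ^ 2)
    (fun e _ => integral_nonneg fun _ => by positivity) (Finset.mem_univ e)

lemma integrable_edge_norm_sq (f : GraphL2 G d) (e : Edge G) :
    IntegrableOn (fun s => ‖f ⟨e, s⟩‖ ^ 2) (edgeInterval d e) :=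
  (memLp_two_iff_integrable_sq_norm (graphL2_memLp f e).1).mp (graphL2_memLp f e)

lemma edge_uIcc_subset {e : Edge G} {s t : ℝ} (hs : s ∈ edgeInterval d e)
    (ht : t ∈ edgeInterval d e) : uIcc s t ⊆ edgeInterval d e := by
  rcases e with j | e
  · exact (ordConnected_Ici (a := (0 : ℝ))).uIcc_subset hs ht
  · exact (ordConnected_Icc (a := -d) (b := d)).uIcc_subset hs ht

lemma edge_uIoc_subset {e : Edge G} {s t : ℝ} (hs : s ∈ edgeInterval d e)
    (ht : t ∈ edgeInterval d e) : uIoc s t ⊆ edgeInterval d e :=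
  uIoc_subset_uIcc.trans (edge_uIcc_subset hs ht)

lemma edge_intervalIntegrable {F' : ℝ → ℂ} {e : Edge G}
    (hF : MemLp F' 2 (edgeVol d e)) {s t : ℝ} (hs : s ∈ edgeInterval d e)
    (ht : t ∈ edgeInterval d e) : IntervalIntegrable F' volume s t := by
  rw [intervalIntegrable_iff]
  have h1 : MemLp F' 2 (volume.restrict (uIoc s t)) :=
    hF.mono_measure (Measure.restrict_mono (edge_uIoc_subset hs ht) le_rfl)
  have : IsFiniteMeasure (volume.restrict (uIoc s t)) := ⟨by simp [uIoc]⟩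
  exact h1.integrable (by norm_num)

lemma norm_integral_sq_le_of_memLp {F : ℝ → ℂ} {S : Set ℝ} {s t : ℝ} (h : uIoc s t ⊆ S)
    (hF : MemLp F 2 (volume.restrict S)) :
    ‖∫ x in s..t, F x‖ ^ 2 ≤ |t - s| * ∫ x in S, ‖F x‖ ^ 2 := by
  rw [intervalIntegral.norm_intervalIntegral_eq, ← ENNReal.ofReal_le_ofReal_iff (by positivity),
    ofReal_mul (abs_nonneg _), ← lintegral_enorm_sq hF, ofReal_pow (norm_nonneg _),
    ofReal_norm, abs_sub_comm, ← max_sub_min_eq_abs', ← Real.volume_Ioc,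
    ← Measure.restrict_apply_univ]
  exact (pow_le_pow_left' (enorm_integral_le_lintegral_enorm _) 2).trans ((lintegral_sq_le _
    (hF.mono_measure (Measure.restrict_mono h le_rfl)).1.enorm).trans
      (mul_le_mul_right (lintegral_mono_set h) _))

lemma norm_integral_sq_le (f' : GraphL2 G d) {e : Edge G} {s t : ℝ} (hs : s ∈ edgeInterval d e)
    (ht : t ∈ edgeInterval d e) : ‖∫ x in s..t, f' ⟨e, x⟩‖ ^ 2 ≤ |t - s| * ‖f'‖ ^ 2 :=
  (norm_integral_sq_le_of_memLp (edge_uIoc_subset hs ht) (graphL2_memLp f' e)).trans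
    (mul_le_mul_of_nonneg_left (edge_norm_sq_le f' e) (abs_nonneg _))

/-- `f` has the weak derivative `f'`, and the absolutely continuous representative `F`. -/
abbrev IsRep (f f' : GraphL2 G d) (F : Edge G → ℝ → ℂ) : Prop :=
  IsEdgeRep f F fun e s => f' ⟨e, s⟩

lemma IsEdgeRep.exists_isRep {f : GraphL2 G d} {F F' : Edge G → ℝ → ℂ} (h : IsEdgeRep f F F') :
    ∃ f', IsRep f f' F ∧ ∀ e, ∀ᵐ s ∂edgeVol d e, f' ⟨e, s⟩ = F' e s := by
  refine ⟨ofEdges F' h.memLp, ⟨h.ae_eq, fun e => graphL2_memLp _ e, fun e s hs t ht => ?_⟩,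
    ofEdges_ae F' h.memLp⟩
  rw [h.ftc e s hs t ht]
  refine intervalIntegral.integral_congr_ae_restrict ?_
  have := ofEdges_ae F' h.memLp e
  exact (ae_restrict_of_ae_restrict_of_subset (edge_uIoc_subset hs ht) this).mono
    fun x hx => hx.symm

namespace IsEdgeRep

variable {f f' g g' : GraphL2 G d} {F K : Edge G → ℝ → ℂ}

lemma add (hf : IsRep f f' F) (hg : IsRep g g' K) : IsRep (f + g) (f' + g') (F + K) where
  ae_eq e := by
    filter_upwards [graphL2_add_ae f g e, hf.ae_eq e, hg.ae_eq e] with s h1 h2 h3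
    rw [h1, h2, h3]; rfl
  memLp e := graphL2_memLp _ e
  ftc e s hs t ht := by
    have h1 : ∫ x in s..t, (f' + g') ⟨e, x⟩ = ∫ x in s..t, (f' ⟨e, x⟩ + g' ⟨e, x⟩) :=
      intervalIntegral.integral_congr_ae_restrict
        (ae_restrict_of_ae_restrict_of_subset (edge_uIoc_subset hs ht) (graphL2_add_ae f' g' e))
    rw [h1, intervalIntegral.integral_add (edge_intervalIntegrable (hf.memLp e) hs ht)
      (edge_intervalIntegrable (hg.memLp e) hs ht), ← hf.ftc e s hs t ht, ← hg.ftc e s hs t ht]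
    simp only [Pi.add_apply]
    ring

lemma smul (hf : IsRep f f' F) (c : ℂ) : IsRep (c • f) (c • f') (c • F) where
  ae_eq e := by
    filter_upwards [graphL2_smul_ae c f e, hf.ae_eq e] with s h1 h2
    rw [h1, h2]; rfl
  memLp e := graphL2_memLp _ e
  ftc e s hs t ht := by
    have h1 : ∫ x in s..t, (c • f') ⟨e, x⟩ = ∫ x in s..t, c * f' ⟨e, x⟩ :=
      intervalIntegral.integral_congr_ae_restrict
        (ae_restrict_of_ae_restrict_of_subset (edge_uIoc_subset hs ht) (graphL2_smul_ae c f' e))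
    rw [h1, intervalIntegral.integral_const_mul, ← hf.ftc e s hs t ht]
    simp only [Pi.smul_apply, smul_eq_mul]
    ring

lemma sub (hf : IsRep f f' F) (hg : IsRep g g' K) : IsRep (f - g) (f' - g') (F - K) := by
  have h := hf.add (hg.smul (-1))
  simp only [neg_smul, one_smul] at h
  simpa only [sub_eq_add_neg] using h

lemma zero : IsRep (0 : GraphL2 G d) 0 0 := by
  have h0 : ∀ e : Edge G, ∀ᵐ s ∂edgeVol d e,
      (0 : GraphL2 G d) ⟨e, s⟩ = 0 := fun e => ae_graph_iff.mp (Lp.coeFn_zero ℂ 2 _) e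
  refine ⟨fun e => (h0 e).mono fun s hs => hs, fun e => graphL2_memLp _ e,
    fun e s hs t ht => ?_⟩
  have h1 : ∫ x in s..t, (0 : GraphL2 G d) ⟨e, x⟩ = ∫ x in s..t, (0 : ℂ) :=
    intervalIntegral.integral_congr_ae_restrict
      (ae_restrict_of_ae_restrict_of_subset (edge_uIoc_subset hs ht) (h0 e))
  rw [h1]
  simp

lemma norm_sub_sq_le (hf : IsRep f f' F) {e : Edge G} {s t : ℝ} (hs : s ∈ edgeInterval d e)
    (ht : t ∈ edgeInterval d e) : ‖F e t - F e s‖ ^ 2 ≤ |t - s| * ‖f'‖ ^ 2 := by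
  rw [hf.ftc e s hs t ht]
  exact norm_integral_sq_le f' hs ht

lemma continuousOn (hf : IsRep f f' F) (e : Edge G) : ContinuousOn (F e) (edgeInterval d e) := by
  refine fun s hs => tendsto_iff_norm_sub_tendsto_zero.mpr (tendsto_norm_zero_of_sq_le
    (b := fun t => |t - s| * ‖f'‖ ^ 2) ?_ ?_)
  · have h : Continuous fun t => |t - s| * ‖f'‖ ^ 2 := by fun_prop
    simpa using (h.tendsto s).mono_left (nhdsWithin_le_nhds (s := edgeInterval d e))
  · filter_upwards [self_mem_nhdsWithin] with t ht using hf.norm_sub_sq_le hs ht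

/-- Sobolev's inequality on an interval. -/
lemma length_mul_norm_sq_le (hf : IsRep f f' F) {e : Edge G} {a b t : ℝ} (hab : a ≤ b)
    (h : Icc a b ⊆ edgeInterval d e) (ht : t ∈ Icc a b) :
    (b - a) * ‖F e t‖ ^ 2 ≤ 2 * ‖f‖ ^ 2 + 2 * (b - a) ^ 2 * ‖f'‖ ^ 2 := by
  have hi : IntegrableOn (fun s => 2 * ‖f ⟨e, s⟩‖ ^ 2 + 2 * (b - a) * ‖f'‖ ^ 2) (Icc a b) :=
    (((integrable_edge_norm_sq f e).mono_set h).const_mul 2).add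
      (integrableOn_const (by simp))
  have h1 : ∫ s in Icc a b, ‖F e t‖ ^ 2 ≤
      ∫ s in Icc a b, (2 * ‖f ⟨e, s⟩‖ ^ 2 + 2 * (b - a) * ‖f'‖ ^ 2) := by
    refine integral_mono_ae (integrableOn_const (by simp)) hi ?_
    filter_upwards [ae_restrict_of_ae_restrict_of_subset h (hf.ae_eq e),
      ae_restrict_mem measurableSet_Icc] with s hs hsm
    rw [hs]
    have h2 := hf.norm_sub_sq_le (h hsm) (h ht)
    have h3 : |t - s| ≤ b - a := abs_le.mpr ⟨by linarith [ht.1, hsm.2], by linarith [ht.2, hsm.1]⟩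
    have h4 := norm_sq_add_le (F e s) (F e t - F e s)
    rw [add_sub_cancel] at h4
    have h5 : |t - s| * ‖f'‖ ^ 2 ≤ (b - a) * ‖f'‖ ^ 2 := by gcongr
    linarith
  rw [setIntegral_const, integral_add (((integrable_edge_norm_sq f e).mono_set h).const_mul 2)
    (integrableOn_const (by simp)), setIntegral_const, integral_const_mul] at h1
  simp only [measureReal_def, Real.volume_Icc, toReal_ofReal (sub_nonneg.mpr hab),
    smul_eq_mul] at h1
  have h2 : ∫ s in Icc a b, ‖f ⟨e, s⟩‖ ^ 2 ≤ ‖f‖ ^ 2 :=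
    (setIntegral_mono_set (integrable_edge_norm_sq f e)
      (.of_forall fun _ => by positivity) h.eventuallyLE).trans (edge_norm_sq_le f e)
  nlinarith

lemma norm_sq_le (hf : IsRep f f' F) {e : Edge G} {t L : ℝ} (hL : 0 < L) (hLd : L ≤ d)
    (ht : t ∈ edgeInterval d e) : ‖F e t‖ ^ 2 ≤ 2 / L * ‖f‖ ^ 2 + 2 * L * ‖f'‖ ^ 2 := by
  have key : ∀ a : ℝ, Icc a (a + L) ⊆ edgeInterval d e → t ∈ Icc a (a + L) →
      ‖F e t‖ ^ 2 ≤ 2 / L * ‖f‖ ^ 2 + 2 * L * ‖f'‖ ^ 2 := fun a h h' => by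
    have h1 := hf.length_mul_norm_sq_le (by linarith) h h'
    rw [add_sub_cancel_left] at h1
    rw [← mul_le_mul_iff_right₀ hL]
    refine h1.trans_eq ?_
    field_simp
  rcases e with j | e
  · have ht' : 0 ≤ t := ht
    exact key t (fun s hs => ht'.trans hs.1) ⟨le_rfl, by linarith⟩
  · by_cases h : t ≤ 0
    · exact key t (fun s hs => ⟨ht.1.trans hs.1, hs.2.trans (by linarith)⟩)
        ⟨le_rfl, by linarith⟩
    · exact key (t - L) (fun s hs => ⟨by linarith [hs.1], hs.2.trans (by linarith [ht.2])⟩)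
        ⟨by linarith, by linarith⟩

lemma norm_outer_sq_le (hf : IsRep f f' F) (j : Fin n) :
    ‖F (Sum.inl j) 0‖ ^ 2 ≤ 2 * ‖f‖ ^ 2 + 2 * ‖f'‖ ^ 2 := by
  have := hf.length_mul_norm_sq_le (e := Sum.inl j) (a := 0) (b := 1) (t := 0) zero_le_one
    (fun s hs => hs.1) ⟨le_rfl, zero_le_one⟩
  simpa using this

lemma eq_of_isRep_zero (hd : 0 < d) (h : IsRep 0 f' F) :
    f' = 0 ∧ ∀ e, ∀ s ∈ edgeInterval d e, F e s = 0 := by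
  have hF : ∀ e, ∀ s ∈ edgeInterval d e, F e s = 0 := fun e s hs => by
    have h1 : Tendsto (fun L : ℝ => 2 / L * ‖(0 : GraphL2 G d)‖ ^ 2 + 2 * L * ‖f'‖ ^ 2) (𝓝[>] 0)
        (𝓝 0) := by
      have : Continuous fun L : ℝ => 2 * L * ‖f'‖ ^ 2 := by fun_prop
      have h2 := (this.tendsto 0).mono_left (nhdsWithin_le_nhds (s := Ioi (0 : ℝ)))
      simpa using h2
    have h2 : ‖F e s‖ ^ 2 ≤ 0 := by
      refine ge_of_tendsto h1 ?_
      filter_upwards [Ioc_mem_nhdsGT hd] with L hL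
      exact h.norm_sq_le hL.1 hL.2 hs
    have h3 : ‖F e s‖ ^ 2 = 0 := le_antisymm h2 (by positivity)
    exact norm_eq_zero.mp (pow_eq_zero_iff two_ne_zero |>.mp h3)
  refine ⟨graphL2_ext fun e => ?_, hF⟩
  have h0 : ∀ᵐ s ∂edgeVol d e, (0 : GraphL2 G d) ⟨e, s⟩ = 0 :=
    ae_graph_iff.mp (Lp.coeFn_zero ℂ 2 _) e
  have hloc : LocallyIntegrable ((edgeInterval d e).indicator fun s => f' ⟨e, s⟩) :=
    ((memLp_indicator_iff_restrict (measurableSet_edgeInterval e)).mpr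
      (h.memLp e)).locallyIntegrable (by norm_num)
  have h1 := ae_restrict_of_ae (s := edgeInterval d e) (LocallyIntegrable.ae_hasDerivAt_integral hloc)
  filter_upwards [h0, h1, ae_mem_interior_edgeInterval e] with s h0 h1 hs
  have h2 := h1 s
  have h3 : (fun x => ∫ y in s..x, (edgeInterval d e).indicator (fun s => f' ⟨e, s⟩) y) =ᶠ[𝓝 s]
      fun _ => 0 := by
    filter_upwards [isOpen_interior.mem_nhds hs] with x hx
    have h4 : ∫ y in s..x, (edgeInterval d e).indicator (fun s => f' ⟨e, s⟩) y =
        ∫ y in s..x, f' ⟨e, y⟩ := by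
      refine intervalIntegral.integral_congr fun y hy => ?_
      exact indicator_of_mem (edge_uIcc_subset (interior_subset hs) (interior_subset hx) hy) _
    rw [h4, ← h.ftc e s (interior_subset hs) x (interior_subset hx), hF e x (interior_subset hx),
      hF e s (interior_subset hs), sub_zero]
  have h5 := h2.unique ((hasDerivAt_const s (0 : ℂ)).congr_of_eventuallyEq h3)
  rw [indicator_of_mem (interior_subset hs)] at h5
  rw [h5, h0]

lemma unique (hd : 0 < d) (hf : IsRep f f' F) (hg : IsRep f g' K) :
    f' = g' ∧ ∀ e, ∀ s ∈ edgeInterval d e, F e s = K e s := by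
  have h := hf.sub hg
  rw [sub_self] at h
  obtain ⟨h1, h2⟩ := eq_of_isRep_zero hd h
  exact ⟨sub_eq_zero.mp h1, fun e s hs => sub_eq_zero.mp (h2 e s hs)⟩

lemma edgeRep_eq (hd : 0 < d) (hf : IsRep f f' F) :
    (∀ e, ∀ s ∈ edgeInterval d e, (edgeRep f).1 e s = F e s) ∧
      ∀ e, ∀ᵐ s ∂edgeVol d e, (edgeRep f).2 e s = f' ⟨e, s⟩ := by
  have h : ∃ P : (Edge G → ℝ → ℂ) × (Edge G → ℝ → ℂ), IsEdgeRep f P.1 P.2 := ⟨(F, _), hf⟩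
  have h1 : IsEdgeRep f (edgeRep f).1 (edgeRep f).2 := by
    rw [edgeRep, dif_pos h]
    exact h.choose_spec
  obtain ⟨g', hg, hg'⟩ := h1.exists_isRep
  obtain ⟨h2, h3⟩ := hg.unique hd hf
  refine ⟨h3, fun e => (hg' e).mono fun s hs => ?_⟩
  rw [← hs, h2]

lemma endValue_eq (hd : 0 < d) (hf : IsRep f f' F) (a : EdgeEnd G) :
    endValue f a = F a.edge (a.pos d) := by
  refine (hf.edgeRep_eq hd).1 _ _ ?_
  rcases a with j | e | e
  · exact (le_refl (0 : ℝ) : (0 : ℝ) ≤ 0)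
  · exact left_mem_Icc.mpr (by linarith)
  · exact right_mem_Icc.mpr (by linarith)

lemma tendsto_rep {x x' : ℕ → GraphL2 G d} {X : ℕ → Edge G → ℝ → ℂ} (hd : 0 < d)
    (hx : ∀ i, IsRep (x i) (x' i) (X i)) (hf : IsRep f f' F) (h : Tendsto x atTop (𝓝 f))
    (h' : Tendsto x' atTop (𝓝 f')) {e : Edge G} {s : ℝ} (hs : s ∈ edgeInterval d e) :
    Tendsto (fun i => X i e s) atTop (𝓝 (F e s)) :=
  tendsto_iff_norm_sub_tendsto_zero.mpr (tendsto_norm_zero_of_sq_le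
    (by simpa using ((tendsto_norm_sub_sq h).const_mul (2 / d)).add
          ((tendsto_norm_sub_sq h').const_mul (2 * d)))
    (.of_forall fun i => ((hx i).sub hf).norm_sq_le hd le_rfl hs))

/-- The weak derivative is a closed operator. -/
lemma exists_limit {x x' : ℕ → GraphL2 G d} {X : ℕ → Edge G → ℝ → ℂ} (hd : 0 < d)
    (hx : ∀ i, IsRep (x i) (x' i) (X i)) (h : Tendsto x atTop (𝓝 f))
    (h' : Tendsto x' atTop (𝓝 f')) : ∃ F, IsRep f f' F := by
  have hcau : ∀ e, ∀ s ∈ edgeInterval d e, ∃ z, Tendsto (fun i => X i e s) atTop (𝓝 z) := by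
    intro e s hs
    refine cauchySeq_tendsto_of_complete ?_
    simp only [cauchySeq_iff_tendsto_dist_atTop_0, dist_eq_norm]
    exact tendsto_norm_zero_of_sq_le (by simpa using
      ((((tendsto_sub_pair h).norm.pow 2).const_mul (2 / d)).add
        (((tendsto_sub_pair h').norm.pow 2).const_mul (2 * d))))
      (.of_forall fun l => ((hx l.1).sub (hx l.2)).norm_sq_le hd le_rfl hs)
  choose! F hF using hcau
  refine ⟨F, fun e => ?_, fun e => graphL2_memLp _ e, fun e s hs t ht => ?_⟩
  · obtain ⟨ns, hns, hae⟩ := (tendstoInMeasure_of_tendsto_Lp h).exists_seq_tendsto_ae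
    filter_upwards [ae_graph_iff.mp hae e, ae_all_iff.mpr fun i => (hx i).ae_eq e,
      ae_restrict_mem (measurableSet_edgeInterval e)] with s h1 h2 hs
    refine tendsto_nhds_unique h1 ?_
    simp only [h2]
    exact (hF e s hs).comp hns.tendsto_atTop
  · refine tendsto_nhds_unique ((hF e t ht).sub (hF e s hs)) ?_
    simp only [(hx _).ftc e s hs t ht]
    refine tendsto_iff_norm_sub_tendsto_zero.mpr (tendsto_norm_zero_of_sq_le
      (by simpa using (tendsto_norm_sub_sq h').const_mul |t - s|) (.of_forall fun i => ?_))
    refine le_trans (le_of_eq ?_) (norm_integral_sq_le (x' i - f') hs ht)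
    rw [← intervalIntegral.integral_sub (edge_intervalIntegrable (graphL2_memLp _ e) hs ht)
      (edge_intervalIntegrable (graphL2_memLp _ e) hs ht)]
    congr 2
    exact intervalIntegral.integral_congr_ae_restrict
      ((ae_restrict_of_ae_restrict_of_subset (edge_uIoc_subset hs ht)
        (ae_graph_iff.mp (Lp.coeFn_sub (x' i) f') e)).mono fun x hx => hx.symm)

variable {F' : Edge G → ℝ → ℂ} (hF : ∀ e, MemLp (F e) 2 (edgeVol d e))
  (hF' : ∀ e, MemLp (F' e) 2 (edgeVol d e))

lemma of_ftc (h : ∀ e, ∀ s ∈ edgeInterval d e, ∀ t ∈ edgeInterval d e,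
      F e t - F e s = ∫ x in s..t, F' e x) :
    IsRep (ofEdges F hF) (ofEdges F' hF') F where
  ae_eq := ofEdges_ae F hF
  memLp e := graphL2_memLp _ e
  ftc e _ hs _ ht := (h e _ hs _ ht).trans (intervalIntegral.integral_congr_ae_restrict
    (ae_restrict_of_ae_restrict_of_subset (edge_uIoc_subset hs ht) (ofEdges_ae F' hF' e))).symm

/-- Continuously differentiable functions have weak derivatives. -/
lemma of_hasDerivAt (h : ∀ e, ∀ s ∈ edgeInterval d e, HasDerivAt (F e) (F' e s) s) :
    IsRep (ofEdges F hF) (ofEdges F' hF') F :=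
  of_ftc hF hF' fun e s hs t ht => (intervalIntegral.integral_eq_sub_of_hasDerivAt
    (fun x hx => h e x (edge_uIcc_subset hs ht hx)) (edge_intervalIntegrable (hF' e) hs ht)).symm

end IsEdgeRep

end WeakDerivatives

section SmoothApproximation

lemma integrable_norm_sub_sq {μ : Measure ℝ} {f g : ℝ → ℂ} (hf : MemLp f 2 μ) (hg : MemLp g 2 μ) :
    Integrable (fun s => ‖f s - g s‖ ^ 2) μ :=
  (memLp_two_iff_integrable_sq_norm (hf.sub hg).1).mp (hf.sub hg)

/-- Smooth functions with compact support in an open set are dense in `L²`. -/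
lemma exists_smooth_approx {U : Set ℝ} (hU : IsOpen U) {f : ℝ → ℂ}
    (hf : MemLp f 2 (volume.restrict U)) {η : ℝ} (hη : 0 < η) :
    ∃ g : ℝ → ℂ, ContDiff ℝ ∞ g ∧ HasCompactSupport g ∧ tsupport g ⊆ U ∧
      ∫ s in U, ‖g s - f s‖ ^ 2 < η := by
  let K : Submodule ℂ (Lp ℂ 2 (volume.restrict U)) :=
    { carrier := {x | ∃ g : ℝ → ℂ, ContDiff ℝ ∞ g ∧ HasCompactSupport g ∧ tsupport g ⊆ U ∧
        x =ᵐ[volume.restrict U] g}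
      zero_mem' := ⟨0, contDiff_const, HasCompactSupport.zero, by simp [tsupport],
        Lp.coeFn_zero _ _ _⟩
      add_mem' := by
        rintro x y ⟨g, h1, h2, h3, h4⟩ ⟨g', h1', h2', h3', h4'⟩
        exact ⟨g + g', h1.add h1', h2.add h2', (tsupport_add g g').trans (union_subset h3 h3'),
          (Lp.coeFn_add x y).trans (h4.add h4')⟩
      smul_mem' := by
        rintro c x ⟨g, h1, h2, h3, h4⟩
        exact ⟨c • g, contDiff_const.smul h1, h2.smul_left (f := fun _ => c),
          (tsupport_smul_subset_right (fun _ => c) g).trans h3,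
          (Lp.coeFn_smul c x).trans (h4.const_smul c)⟩ }
  have hK : K.topologicalClosure = ⊤ := by
    rw [Submodule.topologicalClosure_eq_top_iff, Submodule.eq_bot_iff]
    intro x hx
    have hloc : LocallyIntegrable x (volume.restrict U) :=
      (Lp.memLp x).locallyIntegrable (by norm_num)
    have key := hU.ae_eq_zero_of_integral_contDiff_smul_eq_zero (hloc.locallyIntegrableOn U)
      fun g hg hgc hgs => ?_
    · refine (Lp.eq_zero_iff_ae_eq_zero).mpr ?_
      filter_upwards [key, ae_restrict_mem hU.measurableSet] with s h h'
      exact h h'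
    · have hgm : MemLp (fun s => (g s : ℂ)) 2 (volume.restrict U) :=
        (Complex.continuous_ofReal.comp hg.continuous).memLp_of_hasCompactSupport
          (hgc.comp_left Complex.ofReal_zero)
      have hmem : hgm.toLp _ ∈ K := ⟨fun s => (g s : ℂ), Complex.ofRealCLM.contDiff.comp hg,
        hgc.comp_left Complex.ofReal_zero, (tsupport_comp_subset Complex.ofReal_zero g).trans hgs,
        hgm.coeFn_toLp⟩
      have h1 := (Submodule.mem_orthogonal _ _).mp hx _ hmem
      rw [L2.inner_def] at h1
      rw [← h1]
      refine integral_congr_ae ?_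
      filter_upwards [hgm.coeFn_toLp] with s hs
      rw [RCLike.inner_apply', hs, conj_ofReal, real_smul]
  have hmem : hf.toLp f ∈ closure (K : Set (Lp ℂ 2 (volume.restrict U))) := by
    rw [← Submodule.topologicalClosure_coe, hK]; trivial
  obtain ⟨x, ⟨g, h1, h2, h3, h4⟩, hx⟩ := Metric.mem_closure_iff.mp hmem (√η) (Real.sqrt_pos.mpr hη)
  refine ⟨g, h1, h2, h3, ?_⟩
  have h5 : ∫ s in U, ‖g s - f s‖ ^ 2 = ‖hf.toLp f - x‖ ^ 2 := by
    rw [Lp_norm_sq]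
    refine integral_congr_ae ?_
    filter_upwards [Lp.coeFn_sub (hf.toLp f) x, hf.coeFn_toLp, h4] with s e1 e2 e3
    rw [e1, Pi.sub_apply, e2, e3, norm_sub_rev]
  rw [h5, ← Real.sq_sqrt hη.le, ← dist_eq_norm]
  exact pow_lt_pow_left₀ hx dist_nonneg two_ne_zero

lemma contDiff_primitive {h : ℝ → ℂ} (hh : ContDiff ℝ ∞ h) (a : ℝ) (z : ℂ) :
    ContDiff ℝ ∞ (fun t => z + ∫ x in a..t, h x) ∧
      ∀ t, HasDerivAt (fun t => z + ∫ x in a..t, h x) (h t) t := by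
  have h1 : ∀ t, HasDerivAt (fun t => z + ∫ x in a..t, h x) (h t) t := fun t =>
    (intervalIntegral.integral_hasDerivAt_right (hh.continuous.intervalIntegrable _ _)
      hh.continuous.aestronglyMeasurable.stronglyMeasurableAtFilter
      hh.continuous.continuousAt).const_add z
  refine ⟨contDiff_infty_iff_deriv.mpr ⟨fun t => (h1 t).differentiableAt, ?_⟩, h1⟩
  rwa [funext fun t => (h1 t).deriv]

lemma exists_smooth_cutoff : ∃ χ : ℝ → ℝ, ContDiff ℝ ∞ χ ∧ (∀ s ≤ 0, χ s = 1) ∧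
    (∀ s, 1 ≤ s → χ s = 0) ∧ ∀ s, |deriv χ s| ≤ 2 := by
  let b : ContDiffBump (1 / 2 : ℝ) := ⟨5 / 16, 3 / 8, by norm_num, by norm_num⟩
  have hsm : ContDiff ℝ ∞ (b.normed volume) := b.contDiff_normed
  have hder : ∀ s, HasDerivAt (fun s => 1 - ∫ t in (0 : ℝ)..s, b.normed volume t)
      (-b.normed volume s) s := fun s =>
    (intervalIntegral.integral_hasDerivAt_right (hsm.continuous.intervalIntegrable _ _)
      (hsm.continuous.stronglyMeasurableAtFilter _ _) hsm.continuous.continuousAt).const_sub 1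
  have hd' := funext fun s => (hder s).deriv
  have hsupp : Function.support (b.normed volume) = Ioo (1 / 8) (7 / 8) := by
    rw [b.support_normed_eq, Real.ball_eq_Ioo]
    norm_num [b]
  refine ⟨_, contDiff_infty_iff_deriv.mpr ⟨fun s => (hder s).differentiableAt, hd' ▸ hsm.neg⟩,
    fun s hs => ?_, fun s hs => ?_, fun s => ?_⟩
  · rw [intervalIntegral.integral_congr (g := fun _ => 0), intervalIntegral.integral_zero, sub_zero]
    refine fun t ht => Function.notMem_support.mp fun h => ?_
    rw [hsupp] at h
    rw [uIcc_of_ge hs] at ht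
    linarith [h.1, ht.2]
  · rw [intervalIntegral.integral_eq_integral_of_support_subset, b.integral_normed, sub_self]
    rw [hsupp]
    exact fun t ht => ⟨by linarith [ht.1], by linarith [ht.2]⟩
  · rw [(hder s).deriv, abs_neg, abs_of_nonneg (b.nonneg_normed s)]
    refine (b.normed_le_div_measure_closedBall_rIn volume s).trans ?_
    rw [measureReal_def, Real.volume_closedBall]
    norm_num

lemma memLp_Icc_of_continuous {h : ℝ → ℂ} (hh : Continuous h) (a b : ℝ) :
    MemLp h 2 (volume.restrict (Icc a b)) := by
  obtain ⟨C, hC⟩ := isCompact_Icc.exists_bound_of_continuousOn hh.continuousOn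
  exact MemLp.of_bound hh.aestronglyMeasurable C (ae_restrict_of_forall_mem measurableSet_Icc hC)

/-- Approximation on a bounded interval by functions that are constant outside. -/
lemma exists_approx_bounded {a b : ℝ} (hab : a < b) {F F' : ℝ → ℂ}
    (hF' : MemLp F' 2 (volume.restrict (Icc a b)))
    (hF : ∀ s ∈ Icc a b, ∀ t ∈ Icc a b, F t - F s = ∫ x in s..t, F' x) {η : ℝ} (hη : 0 < η) :
    ∃ H : ℝ → ℂ, ContDiff ℝ ∞ H ∧ (∀ s ≤ a, H s = F a) ∧ (∀ s, b ≤ s → H s = F b) ∧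
      ∫ s in Icc a b, ‖deriv H s - F' s‖ ^ 2 ≤ η ∧ ∫ s in Icc a b, ‖H s - F s‖ ^ 2 ≤ η := by
  have hba : 0 < b - a := sub_pos.mpr hab
  have hD0 : 0 < 10 * (1 + (b - a) ^ 2) := by positivity
  obtain ⟨χ, hχs, hχ1, hχ0, hχd⟩ := exists_smooth_cutoff
  obtain ⟨g, hg, -, hgs, hgη⟩ := exists_smooth_approx isOpen_Ioo
    (hF'.mono_measure (Measure.restrict_mono Ioo_subset_Icc_self le_rfl)) (div_pos hη hD0)
  rw [← integral_Icc_eq_integral_Ioo] at hgη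
  set X := ∫ s in Icc a b, ‖g s - F' s‖ ^ 2 with hX
  have hg0 : ∀ s, s ∉ Ioo a b → g s = 0 := fun s hs =>
    image_eq_zero_of_notMem_tsupport fun h => hs (hgs h)
  have ma : a ∈ Icc a b := left_mem_Icc.mpr hab.le
  have mb : b ∈ Icc a b := right_mem_Icc.mpr hab.le
  have hgL := memLp_Icc_of_continuous hg.continuous a b
  have ig : ∀ s t, IntervalIntegrable g volume s t := fun s t => hg.continuous.intervalIntegrable _ _
  have hsub : ∀ s ∈ Icc a b, uIoc a s ⊆ Icc a b := fun s hs =>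
    uIoc_subset_uIcc.trans (ordConnected_Icc.uIcc_subset ma hs)
  have iF : ∀ s ∈ Icc a b, IntervalIntegrable F' volume a s := fun s hs => by
    rw [intervalIntegrable_iff]
    exact (hF'.integrable (by norm_num)).mono_measure (Measure.restrict_mono (hsub s hs) le_rfl)
  obtain ⟨hP, hPd⟩ := contDiff_primitive hg a (F a)
  set c : ℂ := ∫ s in a..b, (F' s - g s) with hc
  have hcn : ‖c‖ ^ 2 ≤ (b - a) * X := by
    have h1 := norm_integral_sq_le_of_memLp (hsub b mb) (hF'.sub hgL)
    rw [abs_of_pos hba] at h1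
    simpa only [Pi.sub_apply, norm_sub_rev (F' _)] using h1
  set θ : ℝ → ℝ := fun s => 1 - χ ((s - a) / (b - a)) with hθ
  have hθs : ContDiff ℝ ∞ θ := by fun_prop
  have hθd : ∀ s, ‖deriv θ s‖ ≤ 2 / (b - a) := fun s => by
    have h1 := ((hχs.differentiable (by simp) ((s - a) / (b - a))).hasDerivAt.comp s
      (((hasDerivAt_id s).sub_const a).div_const (b - a))).const_sub 1
    change HasDerivAt θ _ s at h1
    rw [h1.deriv, norm_neg, mul_one_div, norm_div, norm_of_nonneg hba.le]
    exact div_le_div_of_nonneg_right (hχd _) hba.le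
  obtain ⟨H, hHe⟩ : ∃ H : ℝ → ℂ, H = fun t => (F a + ∫ x in a..t, g x) + c * θ t := ⟨_, rfl⟩
  have hH : ContDiff ℝ ∞ H := by
    rw [hHe]; exact hP.add (contDiff_const.mul (Complex.ofRealCLM.contDiff.comp hθs))
  have hHd : ∀ s, HasDerivAt H (g s + c * (deriv θ s : ℝ)) s := fun s => by
    rw [hHe]
    exact (hPd s).add
      (((hθs.differentiable (by simp) s).hasDerivAt.ofReal_comp).const_mul c)
  have hHa : ∀ s ≤ a, H s = F a := fun s hs => by
    have h1 : ∫ x in a..s, g x = ∫ x in a..s, (0 : ℂ) :=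
      intervalIntegral.integral_congr fun x hx => hg0 x fun h => by
        rw [uIcc_of_ge hs] at hx
        exact absurd h.1 (not_lt.mpr hx.2)
    rw [hHe]
    simp [h1, hθ, hχ1 _ (div_nonpos_of_nonpos_of_nonneg (sub_nonpos.mpr hs) hba.le)]
  have hHb : ∀ s, b ≤ s → H s = F b := fun s hs => by
    have h1 : ∫ x in b..s, g x = ∫ x in b..s, (0 : ℂ) :=
      intervalIntegral.integral_congr fun x hx => hg0 x fun h => by
        rw [uIcc_of_le hs] at hx
        exact absurd h.2 (not_lt.mpr hx.1)
    rw [hHe]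
    simp only [← intervalIntegral.integral_add_adjacent_intervals (ig a b) (ig b s), h1, hθ,
      hχ0 _ ((one_le_div hba).mpr (sub_le_sub_right hs a)), hc,
      intervalIntegral.integral_sub (iF b mb) (ig a b), ← hF a ma b mb]
    simp
  have hdL := memLp_Icc_of_continuous (hH.continuous_deriv (by simp)) a b
  have hder : ∫ s in Icc a b, ‖deriv H s - F' s‖ ^ 2 ≤ 10 * X := by
    have i1 : IntegrableOn (fun s => 2 * ‖g s - F' s‖ ^ 2) (Icc a b) :=
      (integrable_norm_sub_sq hgL hF').const_mul 2
    have h1 : ∫ s in Icc a b, ‖deriv H s - F' s‖ ^ 2 ≤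
        ∫ s in Icc a b, (2 * ‖g s - F' s‖ ^ 2 + 2 * (‖c‖ * (2 / (b - a))) ^ 2) := by
      refine integral_mono_of_nonneg (.of_forall fun _ => by positivity)
        (i1.add (integrableOn_const (by simp))) (.of_forall fun s => ?_)
      have h2 := norm_sq_add_le (g s - F' s) (c * (deriv θ s : ℝ))
      rw [← add_sub_right_comm, ← (hHd s).deriv, norm_mul, norm_real] at h2
      refine h2.trans (add_le_add_right (mul_le_mul_of_nonneg_left ?_ zero_le_two) _)
      gcongr
      exact hθd s
    rw [integral_add i1 (integrableOn_const (by simp)), integral_const_mul, setIntegral_const,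
      Real.volume_real_Icc_of_le hab.le, smul_eq_mul] at h1
    have h3 : (b - a) * (2 * (‖c‖ * (2 / (b - a))) ^ 2) = 8 * (‖c‖ ^ 2 / (b - a)) := by
      field_simp; ring
    have h4 := (div_le_iff₀' hba).mpr hcn
    linarith
  rw [lt_div_iff₀ hD0] at hgη
  have hX0 : 0 ≤ X := integral_nonneg fun _ => by positivity
  have hX1 : 0 ≤ X * (b - a) ^ 2 := by positivity
  refine ⟨H, hH, hHa, hHb, by linarith, ?_⟩
  have h5 : ∀ s ∈ Icc a b, ‖H s - F s‖ ^ 2 ≤ (b - a) * (10 * X) := fun s hs => by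
    have h6 : H s - F s = ∫ x in a..s, (deriv H x - F' x) := by
      rw [intervalIntegral.integral_sub ((hH.continuous_deriv (by simp)).intervalIntegrable _ _)
        (iF s hs), intervalIntegral.integral_deriv_eq_sub' _ rfl
        (fun x _ => (hHd x).differentiableAt) (hH.continuous_deriv (by simp)).continuousOn,
        ← hF a ma s hs, hHa a le_rfl]
      ring
    rw [h6]
    refine (norm_integral_sq_le_of_memLp (hsub s hs) (hdL.sub hF')).trans ?_
    rw [abs_of_nonneg (sub_nonneg.mpr hs.1)]
    exact mul_le_mul (sub_le_sub_right hs.2 a) hder (integral_nonneg fun _ => by positivity) hba.le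
  have h7 := norm_setIntegral_le_of_norm_le_const (μ := volume) (s := Icc a b) (by simp)
    fun s hs => (norm_of_nonneg (sq_nonneg _)).trans_le (h5 s hs)
  rw [Real.volume_real_Icc_of_le hab.le] at h7
  linarith [Real.le_norm_self (∫ s in Icc a b, ‖H s - F s‖ ^ 2)]

end SmoothApproximation

section HalfLineApproximation

lemma setIntegral_norm_sub_sq_le {P Q : ℝ → ℂ} {b c δ : ℝ} (hb : 0 ≤ b) (hc : 0 ≤ c) (hPc : Continuous P)
    (hQ : MemLp Q 2 (volume.restrict (Ici 0))) (h : ∫ s in Icc 0 b, ‖P s - Q s‖ ^ 2 ≤ δ)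
    (hP : ∀ s, b < s → ‖P s‖ ^ 2 ≤ (Icc b (b + 1)).indicator (fun _ => c) s) :
    ∫ s in Ici 0, ‖P s - Q s‖ ^ 2 ≤ δ + 2 * c + 2 * ∫ s in Ici b, ‖Q s‖ ^ 2 := by
  have hs1 : Icc 0 b ⊆ Ici (0 : ℝ) := fun s hs => hs.1
  have hs2 : Icc b (b + 1) ⊆ Ici (0 : ℝ) := fun s hs => hb.trans hs.1
  have hs3 : Ici b ⊆ Ici (0 : ℝ) := Ici_subset_Ici.mpr hb
  have i1 : IntegrableOn ((Icc 0 b).indicator fun s => ‖P s - Q s‖ ^ 2) (Ici 0) :=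
    ((integrable_indicator_iff measurableSet_Icc).mpr (integrable_norm_sub_sq
      (memLp_Icc_of_continuous hPc 0 b)
      (hQ.mono_measure (Measure.restrict_mono hs1 le_rfl)))).integrableOn
  have i2 : IntegrableOn (fun s => 2 * (Icc b (b + 1)).indicator (fun _ => c) s) (Ici 0) :=
    ((integrableOn_const (s := Icc b (b + 1)) (C := c) (by simp)).integrable_indicator
      measurableSet_Icc).restrict.const_mul 2
  have i3 : IntegrableOn (fun s => 2 * (Ici b).indicator (fun s => ‖Q s‖ ^ 2) s) (Ici 0) :=
    (((memLp_two_iff_integrable_sq_norm hQ.1).mp hQ).indicator measurableSet_Ici).const_mul 2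
  have h1 := integral_mono_of_nonneg (μ := volume.restrict (Ici 0)) (f := fun s => ‖P s - Q s‖ ^ 2)
    (.of_forall fun _ => by positivity) ((i1.add i2).add i3)
    (ae_restrict_of_forall_mem measurableSet_Ici fun s hs => ?_)
  · rw [integral_add' (i1.add i2) i3, integral_add' i1 i2, integral_const_mul, integral_const_mul,
      setIntegral_indicator measurableSet_Icc, setIntegral_indicator measurableSet_Icc,
      setIntegral_indicator measurableSet_Ici, inter_eq_right.mpr hs1, inter_eq_right.mpr hs2,
      inter_eq_right.mpr hs3, setIntegral_const, Real.volume_real_Icc_of_le (by linarith),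
      add_sub_cancel_left, one_smul] at h1
    linarith
  · rcases le_or_gt s b with h2 | h2
    · have e1 : 0 ≤ (Icc b (b + 1)).indicator (fun _ => c) s := indicator_nonneg (fun _ _ => hc) s
      have e2 : 0 ≤ (Ici b).indicator (fun s => ‖Q s‖ ^ 2) s :=
        indicator_nonneg (fun _ _ => by positivity) s
      simp only [Pi.add_apply, indicator_of_mem (show s ∈ Icc 0 b from ⟨hs, h2⟩)]
      linarith
    · have h3 := norm_sq_add_le (P s) (-Q s)
      rw [norm_neg, ← sub_eq_add_neg] at h3
      simp only [Pi.add_apply, indicator_of_notMem (show s ∉ Icc 0 b from fun h => h2.not_ge h.2),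
        indicator_of_mem (show s ∈ Ici b from h2.le)]
      linarith [hP s h2]

/-- Approximation on a half-line by functions that are constant outside and vanish at infinity. -/
lemma exists_approx_outer {F F' : ℝ → ℂ} (hFL : MemLp F 2 (volume.restrict (Ici 0)))
    (hF' : MemLp F' 2 (volume.restrict (Ici 0)))
    (hF : ∀ s ∈ Ici (0 : ℝ), ∀ t ∈ Ici (0 : ℝ), F t - F s = ∫ x in s..t, F' x)
    {η : ℝ} (hη : 0 < η) :
    ∃ H : ℝ → ℂ, ContDiff ℝ ∞ H ∧ (∀ s ≤ 0, H s = F 0) ∧ (∃ R, ∀ s, R < s → H s = 0) ∧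
      ∫ s in Ici 0, ‖deriv H s - F' s‖ ^ 2 ≤ η ∧ ∫ s in Ici 0, ‖H s - F s‖ ^ 2 ≤ η := by
  have iF := (memLp_two_iff_integrable_sq_norm hFL.1).mp hFL
  have iF' := (memLp_two_iff_integrable_sq_norm hF'.1).mp hF'
  have iT : IntegrableOn (fun s => ‖F s‖ ^ 2 + ‖F' s‖ ^ 2) (Ici 0) := iF.add iF'
  have hT0 : ∀ s, 0 ≤ ‖F s‖ ^ 2 + ‖F' s‖ ^ 2 := fun s => by positivity
  obtain ⟨m, hm⟩ : ∃ m : ℕ, ∫ s in Ici (m : ℝ), (‖F s‖ ^ 2 + ‖F' s‖ ^ 2) ≤ η / 16 := by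
    have h1 := tendsto_setIntegral_of_antitone (μ := volume) (s := fun m : ℕ => Ici (m : ℝ))
      (f := fun s => ‖F s‖ ^ 2 + ‖F' s‖ ^ 2) (fun _ => measurableSet_Ici)
      (fun i j h => Ici_subset_Ici.mpr (Nat.cast_le.mpr h)) ⟨0, by simpa using iT⟩
    have h2 : ⋂ m : ℕ, Ici (m : ℝ) = ∅ := by
      ext x
      simp only [mem_iInter, mem_Ici, mem_empty_iff_false, iff_false, not_forall, not_le]
      exact exists_nat_gt x
    rw [h2, setIntegral_empty] at h1
    exact (h1.eventually (ge_mem_nhds (by positivity))).exists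
  have iTm := iT.mono_set (Ici_subset_Ici.mpr (Nat.cast_nonneg m))
  have htail : ∀ {S : Set ℝ} {φ : ℝ → ℝ}, S ⊆ Ici (m : ℝ) → MeasurableSet S → (∀ s, 0 ≤ φ s) →
      (∀ s, φ s ≤ ‖F s‖ ^ 2 + ‖F' s‖ ^ 2) → ∫ s in S, φ s ≤ η / 16 := fun hS hSm h0 h =>
    (integral_mono_of_nonneg (.of_forall h0) (iTm.mono_set hS) (.of_forall h)).trans
      ((setIntegral_mono_set iTm (.of_forall hT0) hS.eventuallyLE).trans hm)
  obtain ⟨b, hb, hFb⟩ : ∃ b ∈ Ioc (m : ℝ) (m + 1), ‖F b‖ ^ 2 ≤ η / 16 := by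
    have hS : Ioc (m : ℝ) (m + 1) ⊆ Ici (m : ℝ) := fun s hs => hs.1.le
    obtain ⟨b, hb, h⟩ := exists_le_setAverage (μ := volume) (s := Ioc (m : ℝ) (m + 1)) (by simp)
      (by simp) (IntegrableOn.mono_set iF (hS.trans (Ici_subset_Ici.mpr (Nat.cast_nonneg m))))
    refine ⟨b, hb, h.trans ?_⟩
    rw [setAverage_eq, measureReal_def, Real.volume_Ioc]
    simpa using htail hS measurableSet_Ioc (fun s => sq_nonneg ‖F s‖)
      fun s => le_add_of_nonneg_right (sq_nonneg _)
  have hb0 : 0 < b := (Nat.cast_nonneg m).trans_lt hb.1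
  have hsub : Icc 0 b ⊆ Ici (0 : ℝ) := fun s hs => hs.1
  obtain ⟨H, hH, hHa, hHb, hH1, hH2⟩ := exists_approx_bounded hb0
    (hF'.mono_measure (Measure.restrict_mono hsub le_rfl))
    (fun s hs t ht => hF s (hsub hs) t (hsub ht)) (by positivity : 0 < η / 4)
  obtain ⟨χ, hχs, hχ1, hχ0, hχd⟩ := exists_smooth_cutoff
  have hχb : ∀ s, b < s → ∀ z : ℝ, |z| ≤ 2 → (b + 1 < s → z = 0) →
      ‖(z : ℂ) * F b‖ ^ 2 ≤ (Icc b (b + 1)).indicator (fun _ => 4 * ‖F b‖ ^ 2) s := by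
    intro s hs z hz hz0
    rw [norm_mul, mul_pow, norm_real, norm_eq_abs]
    by_cases h : s ≤ b + 1
    · rw [indicator_of_mem (show s ∈ Icc b (b + 1) from ⟨hs.le, h⟩)]
      gcongr
      nlinarith [abs_nonneg z]
    · rw [indicator_of_notMem fun h' => h h'.2, hz0 (not_le.mp h)]
      simp
  have hχ2 : ∀ s, 0 ≤ s → |χ s| ≤ 2 := fun s hs => by
    rcases le_or_gt 1 s with h | h
    · simp [hχ0 s h]
    · have h1 := convex_univ.norm_image_sub_le_of_norm_deriv_le
        (fun x _ => hχs.differentiable (by simp) x) (fun x _ => hχd x) (mem_univ 1) (mem_univ s)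
      rw [hχ0 1 le_rfl, sub_zero, norm_eq_abs, norm_eq_abs] at h1
      linarith [abs_le.mpr (show -1 ≤ s - 1 ∧ s - 1 ≤ 1 from ⟨by linarith, by linarith⟩)]
  set K : ℝ → ℂ := fun s => (χ (s - b) : ℂ) * H s with hK
  have hKs : ContDiff ℝ ∞ K :=
    (Complex.ofRealCLM.contDiff.comp (hχs.comp (contDiff_id.sub contDiff_const))).mul hH
  have hKl : ∀ s ≤ b, K s = H s := fun s hs => by simp [hK, hχ1 _ (sub_nonpos.mpr hs)]
  have hKr : ∀ s, b < s → K s = χ (s - b) * F b := fun s hs => by simp [hK, hHb s hs.le]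
  have hKd : ∀ s, b < s → deriv K s = (deriv χ (s - b) : ℝ) * F b := fun s hs => by
    have h1 : K =ᶠ[𝓝 s] fun s => χ (s - b) * F b := by
      filter_upwards [lt_mem_nhds hs] with t ht using hKr t ht
    rw [h1.deriv_eq]
    exact ((((hχs.differentiable (by simp) (s - b)).hasDerivAt.comp_sub_const s b).ofReal_comp).mul_const
      (F b)).deriv
  have hχ3 : ∀ s, b + 1 < s → deriv χ (s - b) = 0 := fun s hs => by
    have h1 : χ =ᶠ[𝓝 (s - b)] fun _ => 0 := by
      filter_upwards [lt_mem_nhds (show 1 < s - b by linarith)] with t ht using hχ0 t ht.le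
    rw [h1.deriv_eq, deriv_const]
  have hb1 : Ici b ⊆ Ici (m : ℝ) := Ici_subset_Ici.mpr hb.1.le
  refine ⟨K, hKs, fun s hs => (hKl s (hs.trans hb0.le)).trans (hHa s hs), ⟨b + 1, fun s hs => ?_⟩,
    (setIntegral_norm_sub_sq_le (δ := η / 4) (c := 4 * ‖F b‖ ^ 2) hb0.le (by positivity) (hKs.continuous_deriv (by simp))
      hF' ?_ fun s hs => ?_).trans ?_, (setIntegral_norm_sub_sq_le (δ := η / 4) (c := 4 * ‖F b‖ ^ 2) hb0.le
      (by positivity) hKs.continuous hFL ?_ fun s hs => ?_).trans ?_⟩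
  · simp [hKr s (by linarith), hχ0 (s - b) (by linarith)]
  · refine le_of_eq_of_le ?_ hH1
    rw [integral_Icc_eq_integral_Ioo, integral_Icc_eq_integral_Ioo]
    refine setIntegral_congr_fun measurableSet_Ioo fun s hs => ?_
    have h1 : K =ᶠ[𝓝 s] H := by
      filter_upwards [gt_mem_nhds hs.2] with t ht using hKl t ht.le
    simp only [h1.deriv_eq]
  · rw [hKd s hs]
    exact hχb s hs _ (hχd _) (hχ3 s)
  · linarith [htail hb1 measurableSet_Ici (fun s => sq_nonneg ‖F' s‖)
      fun s => le_add_of_nonneg_left (sq_nonneg _)]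
  · exact le_of_eq_of_le (setIntegral_congr_fun measurableSet_Icc fun s hs => by
      simp only [hKl s hs.2]) hH2
  · rw [hKr s hs]
    exact hχb s hs _ (hχ2 (s - b) (by linarith)) fun h => hχ0 (s - b) (by linarith)
  · linarith [htail hb1 measurableSet_Ici (fun s => sq_nonneg ‖F s‖)
      fun s => le_add_of_nonneg_right (sq_nonneg _)]

end HalfLineApproximation

section GraphForm

variable {n : ℕ} {G : SimpleGraph (Fin n)} {d : ℝ}

lemma memLp_bdd_mul {m : Edge G → ℝ → ℂ} (hm : ∀ e, Measurable (m e)) {C : ℝ}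
    (hC : ∀ e s, ‖m e s‖ ≤ C) (f : GraphL2 G d) (e : Edge G) :
    MemLp (fun s => m e s * f ⟨e, s⟩) 2 (edgeVol d e) :=
  (graphL2_memLp f e).of_le_mul ((hm e).aestronglyMeasurable.mul (graphL2_memLp f e).1)
    (.of_forall fun s => by
      rw [norm_mul]; exact mul_le_mul_of_nonneg_right (hC e s) (norm_nonneg _))

lemma norm_bdd_mul_le {m : Edge G → ℝ → ℂ} (hm : ∀ e, Measurable (m e)) {C : ℝ}
    (hC : ∀ e s, ‖m e s‖ ≤ C) (f : GraphL2 G d) : ‖ofEdges _ (memLp_bdd_mul hm hC f)‖ ≤ C * ‖f‖ :=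
  Lp.norm_le_mul_norm_of_ae_le_mul (ae_graph_iff.mpr fun e => by
    filter_upwards [ofEdges_ae _ (memLp_bdd_mul hm hC f) e] with s h
    rw [h, norm_mul]
    exact mul_le_mul_of_nonneg_right (hC e s) (norm_nonneg _))

/-- Multiplication by a bounded function. -/
def edgeMul {m : Edge G → ℝ → ℂ} (hm : ∀ e, Measurable (m e)) {C : ℝ}
    (hC : ∀ e s, ‖m e s‖ ≤ C) : GraphL2 G d →L[ℂ] GraphL2 G d :=
  LinearMap.mkContinuous
    { toFun := fun f => ofEdges (fun e s => m e s * f ⟨e, s⟩) (memLp_bdd_mul hm hC f)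
      map_add' := fun f g => graphL2_ext fun e => by
        filter_upwards [ofEdges_ae _ (memLp_bdd_mul hm hC (f + g)) e,
          ofEdges_ae _ (memLp_bdd_mul hm hC f) e, ofEdges_ae _ (memLp_bdd_mul hm hC g) e,
          graphL2_add_ae f g e, graphL2_add_ae (ofEdges _ (memLp_bdd_mul hm hC f))
            (ofEdges _ (memLp_bdd_mul hm hC g)) e] with s h1 h2 h3 h4 h5
        rw [h1, h5, h2, h3, h4, mul_add]
      map_smul' := fun c f => graphL2_ext fun e => by
        filter_upwards [ofEdges_ae _ (memLp_bdd_mul hm hC (c • f)) e,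
          ofEdges_ae _ (memLp_bdd_mul hm hC f) e, graphL2_smul_ae c f e,
          graphL2_smul_ae c (ofEdges _ (memLp_bdd_mul hm hC f)) e] with s h1 h2 h3 h4
        rw [h1, RingHom.id_apply, h4, h2, h3, mul_left_comm] } C
    (norm_bdd_mul_le hm hC)

lemma edgeMul_ae {m : Edge G → ℝ → ℂ} (hm : ∀ e, Measurable (m e)) {C : ℝ}
    (hC : ∀ e s, ‖m e s‖ ≤ C) (f : GraphL2 G d) (e : Edge G) :
    ∀ᵐ s ∂edgeVol d e, edgeMul hm hC f ⟨e, s⟩ = m e s * f ⟨e, s⟩ :=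
  ofEdges_ae _ (memLp_bdd_mul hm hC f) e

lemma norm_potential_le (A : InnerEdge G → ℝ) (e : Edge G) (_ : ℝ) :
    ‖Complex.I * (edgePotential A e : ℂ)‖ ≤ ∑ e, |edgePotential A e| := by
  rw [norm_mul, Complex.norm_I, one_mul, norm_real]
  exact single_le_sum (f := fun e => |edgePotential A e|) (fun e _ => abs_nonneg _)
    (Finset.mem_univ e)

/-- Multiplication by `iA`. -/
def potMul (A : InnerEdge G → ℝ) : GraphL2 G d →L[ℂ] GraphL2 G d :=
  edgeMul (fun _ => measurable_const) (norm_potential_le A)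

lemma potMul_ae (A : InnerEdge G → ℝ) (f : GraphL2 G d) (e : Edge G) :
    ∀ᵐ s ∂edgeVol d e,
      potMul A f ⟨e, s⟩ = Complex.I * edgePotential A e * f ⟨e, s⟩ :=
  edgeMul_ae _ (norm_potential_le A) f e

lemma norm_potMul_sq_le (A : InnerEdge G → ℝ) (f : GraphL2 G d) :
    ‖potMul A f‖ ^ 2 ≤ (∑ e, |edgePotential A e|) ^ 2 * ‖f‖ ^ 2 := by
  rw [← mul_pow]
  exact pow_le_pow_left₀ (norm_nonneg _)
    (norm_bdd_mul_le (fun _ => measurable_const) (norm_potential_le A) f) 2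

lemma potMul_zero (f : GraphL2 G d) : potMul 0 f = 0 := by
  have h := norm_potMul_sq_le 0 f
  have h1 : ∑ e : Edge G, |edgePotential (0 : InnerEdge G → ℝ) e| = 0 :=
    sum_eq_zero fun e _ => by rcases e with j | e <;> simp [edgePotential]
  rw [h1, zero_pow two_ne_zero, zero_mul] at h
  exact norm_eq_zero.mp (pow_eq_zero_iff two_ne_zero |>.mp (le_antisymm h (by positivity)))

variable {f f' g g' : GraphL2 G d} {F K : Edge G → ℝ → ℂ}

lemma outer_zero_mem (j : Fin n) : (0 : ℝ) ∈ edgeInterval d (Sum.inl j : Edge G) :=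
  (le_refl (0 : ℝ) : (0 : ℝ) ≤ 0)

lemma inner_zero_mem (hd : 0 < d) (e : InnerEdge G) : (0 : ℝ) ∈ edgeInterval d (Sum.inr e : Edge G) :=
  ⟨by linarith, hd.le⟩

lemma graphSesq_eq (hd : 0 < d) (hf : IsRep f f' F) (hg : IsRep g g' K) (A wE : InnerEdge G → ℝ)
    (wV : Fin n → ℝ) : graphSesq G d A wE wV f g =
      inner ℂ (g' + potMul A g) (f' + potMul A f) +
      ∑ e, wE e * (F (Sum.inr e) 0 * conj (K (Sum.inr e) 0)) +
      ∑ v, wV v * (F (Sum.inl v) 0 * conj (K (Sum.inl v) 0)) := by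
  obtain ⟨hF, hF'⟩ := hf.edgeRep_eq hd
  obtain ⟨hK, hK'⟩ := hg.edgeRep_eq hd
  have hcov : ∀ {f f' : GraphL2 G d} {F : Edge G → ℝ → ℂ}, IsRep f f' F → ∀ e,
      ∀ᵐ s ∂edgeVol d e, (f' + potMul A f) ⟨e, s⟩ =
        (edgeRep f).2 e s + Complex.I * edgePotential A e * (edgeRep f).1 e s := by
    intro f f' F hf e
    obtain ⟨hF, hF'⟩ := hf.edgeRep_eq hd
    filter_upwards [graphL2_add_ae f' (potMul A f) e, potMul_ae A f e, hF' e, hf.ae_eq e,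
      ae_restrict_mem (measurableSet_edgeInterval e)] with s h1 h2 h3 h4 hs
    rw [h1, h2, h3, h4, hF e s hs]
  have e1 : ∀ e, ∫ s in edgeInterval d e, conj ((g' + potMul A g) ⟨e, s⟩) *
        (f' + potMul A f) ⟨e, s⟩ = ∫ s in edgeInterval d e,
      ((edgeRep f).2 e s + Complex.I * edgePotential A e * (edgeRep f).1 e s) *
      conj ((edgeRep g).2 e s + Complex.I * edgePotential A e * (edgeRep g).1 e s) := fun e => by
    refine integral_congr_ae ?_
    filter_upwards [hcov hf e, hcov hg e] with s h1 h2
    rw [h1, h2, mul_comm]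
  have e2 : ∀ j : Fin n, ∫ s in Ioi (0 : ℝ), (edgeRep f).2 (Sum.inl j) s *
      conj ((edgeRep g).2 (Sum.inl j) s) = ∫ s in edgeInterval d (Sum.inl j : Edge G),
      ((edgeRep f).2 (Sum.inl j) s + Complex.I * edgePotential A (Sum.inl j) *
        (edgeRep f).1 (Sum.inl j) s) * conj ((edgeRep g).2 (Sum.inl j) s + Complex.I *
        edgePotential A (Sum.inl j) * (edgeRep g).1 (Sum.inl j) s) := fun j => by
    rw [← integral_Ici_eq_integral_Ioi]
    simp only [edgePotential, Sum.elim_inl, Complex.ofReal_zero, mul_zero, zero_mul, add_zero]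
    rfl
  have e3 : ∀ e : InnerEdge G, ∫ s in (-d)..d, ((edgeRep f).2 (Sum.inr e) s + Complex.I * A e *
        (edgeRep f).1 (Sum.inr e) s) * conj ((edgeRep g).2 (Sum.inr e) s + Complex.I *
        A e * (edgeRep g).1 (Sum.inr e) s) = ∫ s in edgeInterval d (Sum.inr e : Edge G),
      ((edgeRep f).2 (Sum.inr e) s + Complex.I * edgePotential A (Sum.inr e) *
        (edgeRep f).1 (Sum.inr e) s) * conj ((edgeRep g).2 (Sum.inr e) s + Complex.I *
        edgePotential A (Sum.inr e) * (edgeRep g).1 (Sum.inr e) s) := fun e => by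
    rw [intervalIntegral.integral_of_le (by linarith), ← integral_Icc_eq_integral_Ioc]
    rfl
  have e4 : ∀ e : InnerEdge G, (edgeRep f).1 (Sum.inr e) 0 = F (Sum.inr e) 0 ∧
      (edgeRep g).1 (Sum.inr e) 0 = K (Sum.inr e) 0 := fun e =>
    ⟨hF _ _ (inner_zero_mem hd e), hK _ _ (inner_zero_mem hd e)⟩
  have e5 : ∀ v, vertexValue f v = F (Sum.inl v) 0 ∧ vertexValue g v = K (Sum.inl v) 0 := fun v =>
    ⟨hf.endValue_eq hd (EdgeEnd.outer v), hg.endValue_eq hd (EdgeEnd.outer v)⟩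
  rw [graph_inner, Fintype.sum_sum_type]
  simp only [e1, ← e2, ← e3]
  simp only [graphSesq, (e4 _).1, (e4 _).2, (e5 _).1, (e5 _).2, sum_add_distrib]
  ring

lemma graphSesq_free (hd : 0 < d) (hf : IsRep f f' F) (hg : IsRep g g' K) :
    graphSesq G d 0 0 0 f g = inner ℂ g' f' := by
  rw [graphSesq_eq hd hf hg]
  simp [potMul_zero]

lemma graphSesq_free_re (hd : 0 < d) (hf : IsRep f f' F) :
    (graphSesq G d 0 0 0 f f).re = ‖f'‖ ^ 2 := by
  rw [graphSesq_free hd hf hf]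
  exact inner_self_eq_norm_sq (𝕜 := ℂ) f'

lemma mem_graphH1 : f ∈ graphH1 G d ↔ ∃ f' F, IsRep f f' F ∧
    ∃ c : Fin n → ℂ, ∀ a : EdgeEnd G, F a.edge (a.pos d) = c a.vertex := by
  refine ⟨fun ⟨F, F', h, c, hc⟩ => ?_, fun ⟨f', F, h, c, hc⟩ => ⟨F, _, h, c, hc⟩⟩
  obtain ⟨f', hf', -⟩ := h.exists_isRep
  exact ⟨f', F, hf', c, hc⟩

variable (G d) in
/-- `H¹(Γ)` as a subspace. -/
def graphH1Sub : Submodule ℂ (GraphL2 G d) where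
  carrier := graphH1 G d
  add_mem' := by
    intro f g hf hg
    obtain ⟨f', F, h, c, hc⟩ := mem_graphH1.mp hf
    obtain ⟨g', K, h', c', hc'⟩ := mem_graphH1.mp hg
    exact mem_graphH1.mpr ⟨_, _, h.add h', c + c', fun a => by
      simp only [Pi.add_apply, hc, hc']⟩
  zero_mem' := mem_graphH1.mpr ⟨0, 0, IsEdgeRep.zero, 0, fun _ => rfl⟩
  smul_mem' := by
    intro r f hf
    obtain ⟨f', F, h, c, hc⟩ := mem_graphH1.mp hf
    exact mem_graphH1.mpr ⟨_, _, h.smul r, r • c, fun a => by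
      simp only [Pi.smul_apply, hc]⟩

lemma isSesq_graphSesq (hd : 0 < d) (A wE : InnerEdge G → ℝ) (wV : Fin n → ℝ) :
    IsSesq fun f g : graphH1Sub G d => graphSesq G d A wE wV f g where
  add_left := by
    rintro ⟨f, hf⟩ ⟨g, hg⟩ ⟨k, hk⟩
    obtain ⟨f', F, h, -⟩ := mem_graphH1.mp hf
    obtain ⟨g', K, h', -⟩ := mem_graphH1.mp hg
    obtain ⟨k', M, h'', -⟩ := mem_graphH1.mp hk
    change graphSesq G d A wE wV (f + g) k = _
    rw [graphSesq_eq hd (h.add h') h'', graphSesq_eq hd h h'', graphSesq_eq hd h' h'', map_add,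
      add_add_add_comm f', inner_add_right]
    simp only [Pi.add_apply, add_mul, mul_add, sum_add_distrib]
    ring
  smul_left := by
    rintro c ⟨f, hf⟩ ⟨g, hg⟩
    obtain ⟨f', F, h, -⟩ := mem_graphH1.mp hf
    obtain ⟨g', K, h', -⟩ := mem_graphH1.mp hg
    change graphSesq G d A wE wV (c • f) g = _
    rw [graphSesq_eq hd (h.smul c) h', graphSesq_eq hd h h', map_smul, ← smul_add,
      inner_smul_right, mul_add, mul_add, mul_sum, mul_sum]
    simp only [Pi.smul_apply, smul_eq_mul, mul_left_comm c, mul_assoc]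
  symm := by
    rintro ⟨f, hf⟩ ⟨g, hg⟩
    obtain ⟨f', F, h, -⟩ := mem_graphH1.mp hf
    obtain ⟨g', K, h', -⟩ := mem_graphH1.mp hg
    rw [graphSesq_eq hd h h', graphSesq_eq hd h' h, map_add, map_add, map_sum, map_sum,
      inner_conj_symm]
    simp only [map_mul, conj_ofReal, Complex.conj_conj, mul_comm (K _ _)]

lemma isClosedForm_free (hd : 0 < d) : IsClosedForm (graphH1 G d) (graphSesq G d 0 0 0) where
  add_left f hf g hg k hk := (isSesq_graphSesq hd 0 0 0).add_left ⟨f, hf⟩ ⟨g, hg⟩ ⟨k, hk⟩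
  smul_left c f hf g hg := (isSesq_graphSesq hd 0 0 0).smul_left c ⟨f, hf⟩ ⟨g, hg⟩
  symm f hf g hg := (isSesq_graphSesq hd 0 0 0).symm ⟨f, hf⟩ ⟨g, hg⟩
  semibounded := ⟨0, fun f hf => by
    obtain ⟨f', F, h, -⟩ := mem_graphH1.mp hf
    rw [graphSesq_free_re hd h, zero_mul]
    positivity⟩
  closed x f hx hxf hc := by
    choose x' X hX c hcv using fun i => mem_graphH1.mp (hx i)
    have h2 : CauchySeq x' := by
      simp only [cauchySeq_iff_tendsto_dist_atTop_0, dist_eq_norm]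
      exact tendsto_norm_zero_of_sq_le hc (.of_forall fun l =>
        (graphSesq_free_re hd ((hX l.1).sub (hX l.2))).ge)
    obtain ⟨f', hf'⟩ := cauchySeq_tendsto_of_complete h2
    obtain ⟨F, hF⟩ := IsEdgeRep.exists_limit hd hX hxf hf'
    have hpos : ∀ a : EdgeEnd G, a.pos d ∈ edgeInterval d a.edge := by
      rintro (j | e | e)
      · exact outer_zero_mem j
      · exact left_mem_Icc.mpr (by linarith)
      · exact right_mem_Icc.mpr (by linarith)
    refine ⟨mem_graphH1.mpr ⟨f', F, hF, fun v => F (Sum.inl v) 0, fun a => ?_⟩, ?_⟩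
    · refine tendsto_nhds_unique (IsEdgeRep.tendsto_rep hd hX hF hxf hf' (hpos a)) ?_
      refine (IsEdgeRep.tendsto_rep hd hX hF hxf hf' (outer_zero_mem a.vertex)).congr fun i => ?_
      exact (hcv i (EdgeEnd.outer a.vertex)).trans (hcv i a).symm
    · exact (tendsto_norm_sub_sq hf').congr fun i => (graphSesq_free_re hd ((hX i).sub hF)).symm

lemma abs_sum_weights_le (hd : 0 < d) (hf : IsRep f f' F) (wE : InnerEdge G → ℝ) (wV : Fin n → ℝ)
    {L : ℝ} (hL : 0 < L) (hLd : L ≤ d) :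
    |∑ e, wE e * ‖F (Sum.inr e) 0‖ ^ 2 + ∑ v, wV v * ‖F (Sum.inl v) 0‖ ^ 2| ≤
      (∑ e, |wE e| + ∑ v, |wV v|) * (2 / L * ‖f‖ ^ 2 + 2 * L * ‖f'‖ ^ 2) := by
  rw [add_mul, sum_mul, sum_mul]
  refine (abs_add_le _ _).trans (add_le_add ?_ ?_)
  · refine (Finset.abs_sum_le_sum_abs _ _).trans (sum_le_sum fun e _ => ?_)
    rw [abs_mul, abs_of_nonneg (sq_nonneg ‖F (Sum.inr e) 0‖)]
    exact mul_le_mul_of_nonneg_left (hf.norm_sq_le hL hLd (inner_zero_mem hd e)) (abs_nonneg _)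
  · refine (Finset.abs_sum_le_sum_abs _ _).trans (sum_le_sum fun e _ => ?_)
    rw [abs_mul, abs_of_nonneg (sq_nonneg ‖F (Sum.inl e) 0‖)]
    exact mul_le_mul_of_nonneg_left (hf.norm_sq_le hL hLd (outer_zero_mem e)) (abs_nonneg _)

lemma graphSesq_re (hd : 0 < d) (hf : IsRep f f' F) (A wE : InnerEdge G → ℝ) (wV : Fin n → ℝ) :
    (graphSesq G d A wE wV f f).re = ‖f' + potMul A f‖ ^ 2 +
      (∑ e, wE e * ‖F (Sum.inr e) 0‖ ^ 2 + ∑ v, wV v * ‖F (Sum.inl v) 0‖ ^ 2) := by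
  rw [graphSesq_eq hd hf hf, Complex.add_re, Complex.add_re, Complex.re_sum, Complex.re_sum,
    add_assoc]
  simp only [Complex.re_ofReal_mul, mul_conj, Complex.ofReal_re, normSq_eq_norm_sq]
  congr 1
  exact inner_self_eq_norm_sq (𝕜 := ℂ) _

lemma isClosedForm_graphSesq (hd : 0 < d) (A wE : InnerEdge G → ℝ) (wV : Fin n → ℝ) :
    IsClosedForm (graphH1 G d) (graphSesq G d A wE wV) := by
  set W := ∑ e, |wE e| + ∑ v, |wV v| with hW
  have hW0 : 0 ≤ W := by positivity
  set L := min d (1 / (8 * (W + 1))) with hL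
  have hL0 : 0 < L := lt_min hd (by positivity)
  have hLW : 2 * L * W ≤ 1 / 4 := by
    have h1 : L ≤ 1 / (8 * (W + 1)) := min_le_right _ _
    have h2 : L * (8 * (W + 1)) ≤ 1 := (le_div_iff₀ (by positivity)).mp h1
    nlinarith
  set α := (∑ e, |edgePotential A e|) ^ 2 with hα
  have hα0 : 0 ≤ α := by positivity
  have hWL : 0 ≤ W * (2 / L) := by positivity
  have key : ∀ f ∈ graphH1 G d, 1 / 4 * (graphSesq G d 0 0 0 f f).re -
      (3 + 2 * α + W * (2 / L)) * ‖f‖ ^ 2 ≤ (graphSesq G d A wE wV f f).re ∧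
      (graphSesq G d A wE wV f f).re ≤ (3 + 2 * α + W * (2 / L)) *
        ((graphSesq G d 0 0 0 f f).re + ‖f‖ ^ 2) := by
    intro f hf
    obtain ⟨f', F, h, -⟩ := mem_graphH1.mp hf
    rw [graphSesq_free_re hd h, graphSesq_re hd h]
    have h1 := abs_le.mp (abs_sum_weights_le hd h wE wV hL0 (min_le_left _ _))
    have h2 := norm_potMul_sq_le A f
    have h6 := norm_sq_add_le f' (potMul A f)
    have h7 := norm_sq_add_le (f' + potMul A f) (-potMul A f)
    rw [norm_neg, add_neg_cancel_right] at h7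
    rw [← hW] at h1
    have h5 : W * (2 / L * ‖f‖ ^ 2 + 2 * L * ‖f'‖ ^ 2) ≤ W * (2 / L) * ‖f‖ ^ 2 +
        1 / 4 * ‖f'‖ ^ 2 := by
      have := mul_le_mul_of_nonneg_right hLW (sq_nonneg ‖f'‖)
      nlinarith
    have p1 := mul_nonneg hα0 (sq_nonneg ‖f'‖)
    have p2 := mul_nonneg hWL (sq_nonneg ‖f'‖)
    have p3 := mul_nonneg hα0 (sq_nonneg ‖f‖)
    constructor
    · nlinarith [sq_nonneg ‖f‖]
    · nlinarith [sq_nonneg ‖f‖, sq_nonneg ‖f'‖]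
  refine isClosedForm_of_bounds (D := graphH1Sub G d) (isClosedForm_free hd) (fun f hf => ?_)
    (isSesq_graphSesq hd A wE wV) (by norm_num : (0 : ℝ) < 1 / 4) (fun f hf => (key f hf).1)
    fun f hf => (key f hf).2
  obtain ⟨f', F, h, -⟩ := mem_graphH1.mp hf
  rw [graphSesq_free_re hd h]
  positivity

lemma norm_sub_ofEdges_sq (f : GraphL2 G d) {H : Edge G → ℝ → ℂ}
    (hH : ∀ e, MemLp (H e) 2 (edgeVol d e)) :
    ‖ofEdges H hH - f‖ ^ 2 = ∑ e, ∫ s in edgeInterval d e, ‖H e s - f ⟨e, s⟩‖ ^ 2 := by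
  rw [graph_norm_sq]
  refine sum_congr rfl fun e _ => integral_congr_ae ?_
  filter_upwards [ofEdges_ae H hH e, ae_graph_iff.mp (Lp.coeFn_sub (ofEdges H hH) f) e]
    with s h1 h2
  rw [h2, Pi.sub_apply, h1]

lemma dense_graphH1 (hd : 0 < d) : Dense (graphH1 G d) := by
  intro f
  rw [Metric.mem_closure_iff]
  intro η hη
  have hU : ∀ e : Edge G, volume.restrict (interior (edgeInterval d e)) =
      edgeVol d e := fun e => by
    rcases e with j | e
    · change volume.restrict (interior (Ici (0 : ℝ))) = volume.restrict (Ici 0)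
      rw [interior_Ici]; exact restrict_Ioi_eq_restrict_Ici
    · change volume.restrict (interior (Icc (-d) d)) = volume.restrict (Icc (-d) d)
      rw [interior_Icc]; exact restrict_Ioo_eq_restrict_Icc
  set N : ℝ := Fintype.card (Edge G) + 1 with hN
  have hN0 : 0 < N := by positivity
  choose H hs hc hsub hap using fun e => exists_smooth_approx (isOpen_interior (s := edgeInterval d e))
    (by rw [hU]; exact graphL2_memLp f e) (div_pos (pow_pos hη 2) hN0)
  have hm : ∀ e, MemLp (H e) 2 (edgeVol d e) := fun e =>
    (hs e).continuous.memLp_of_hasCompactSupport (hc e)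
  have hm' : ∀ e, MemLp (deriv (H e)) 2 (edgeVol d e) := fun e =>
    ((hs e).continuous_deriv (by simp)).memLp_of_hasCompactSupport (hc e).deriv
  have hrep := IsEdgeRep.of_hasDerivAt (d := d) hm hm'
    fun e s _ => ((hs e).differentiable (by simp) s).hasDerivAt
  refine ⟨ofEdges H hm, mem_graphH1.mpr ⟨_, _, hrep, 0, fun a => ?_⟩, ?_⟩
  · refine image_eq_zero_of_notMem_tsupport fun h => ?_
    have h1 := hsub _ h
    rcases a with j | e | e
    · change (0 : ℝ) ∈ interior (Ici 0) at h1
      rw [interior_Ici] at h1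
      exact lt_irrefl (0 : ℝ) (mem_Ioi.mp h1)
    · change -d ∈ interior (Icc (-d) d) at h1
      rw [interior_Icc] at h1
      exact lt_irrefl _ h1.1
    · change d ∈ interior (Icc (-d) d) at h1
      rw [interior_Icc] at h1
      exact lt_irrefl _ h1.2
  · rw [dist_comm, dist_eq_norm]
    refine lt_of_pow_lt_pow_left₀ 2 hη.le ?_
    rw [norm_sub_ofEdges_sq]
    refine lt_of_le_of_lt (sum_le_sum (g := fun _ => η ^ 2 / N) fun e _ => ?_) ?_
    · rw [← hU e]; exact (hap e).le
    · rw [sum_const, nsmul_eq_mul, card_univ, mul_div_assoc', div_lt_iff₀ hN0, mul_comm]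
      have : 0 < η ^ 2 := by positivity
      nlinarith

lemma isAdmissible_graphForm (hd : 0 < d) (A wE : InnerEdge G → ℝ) (wV : Fin n → ℝ) :
    (graphForm G d A wE wV).IsAdmissible where
  subspace := ⟨graphH1Sub G d, rfl⟩
  dense := dense_graphH1 hd
  free_nonneg f hf := by
    obtain ⟨f', F, h, -⟩ := mem_graphH1.mp hf
    refine le_of_le_of_eq ?_ (graphSesq_free_re hd h).symm
    positivity
  free_closed := isClosedForm_free hd
  form_closed := isClosedForm_graphSesq hd A wE wV

end GraphForm

section Lift

/-- `ε^{k/2}`. -/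
def upScale (k : ℕ) (ε : ℝ) : ℝ := ε ^ ((k : ℝ) / 2)

/-- `ε^{-k/2}`. -/
def downScale (k : ℕ) (ε : ℝ) : ℝ := ε ^ (-(k : ℝ) / 2)

lemma upScale_sq {ε : ℝ} (hε : 0 < ε) (k : ℕ) : upScale k ε ^ 2 = ε ^ k := by
  rw [upScale, ← Real.rpow_natCast, ← Real.rpow_mul hε.le, ← Real.rpow_natCast]
  congr 1; push_cast; ring

lemma downScale_mul_upScale {ε : ℝ} (hε : 0 < ε) (k : ℕ) : downScale k ε * upScale k ε = 1 := by
  rw [upScale, downScale, ← Real.rpow_add hε, neg_div, neg_add_cancel, Real.rpow_zero]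

lemma pow_mul_downScale {ε : ℝ} (hε : 0 < ε) (k : ℕ) : ε ^ k * downScale k ε = upScale k ε := by
  rw [← upScale_sq hε, sq, mul_assoc, mul_comm (upScale k ε) (downScale k ε),
    downScale_mul_upScale hε, mul_one]

lemma pow_mul_downScale_sq {ε : ℝ} (hε : 0 < ε) (k : ℕ) : ε ^ k * downScale k ε ^ 2 = 1 := by
  rw [sq, ← mul_assoc, pow_mul_downScale hε, mul_comm, downScale_mul_upScale hε]

lemma lintegral_fiber_sq_le {α β : Type*} [MeasurableSpace α] [MeasurableSpace β] {μ : Measure α}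
    {ν : Measure β} [SFinite μ] [IsProbabilityMeasure ν] {f : α × β → ℂ}
    (hf : MemLp f 2 (μ.prod ν)) : MemLp (fun s => ∫ y, f (s, y) ∂ν) 2 μ := by
  rw [memLp_two_iff] at hf ⊢
  refine ⟨hf.1.integral_prod_right', lt_of_le_of_lt ?_ hf.2⟩
  rw [lintegral_prod (fun q => ‖f q‖ₑ ^ 2) (hf.1.enorm.pow_const 2)]
  refine lintegral_mono_ae ?_
  filter_upwards [hf.1.prodMk_left] with s hs
  refine (pow_le_pow_left' (enorm_integral_le_lintegral_enorm _) 2).trans ?_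
  refine (lintegral_sq_le ν hs.enorm).trans ?_
  rw [measure_univ, one_mul]

namespace BuildingBlocks

variable {n k : ℕ} {G : SimpleGraph (Fin n)} {B : BuildingBlocks.{u} G k} {d ε : ℝ}

variable (B ε) in
/-- The function `ε^{-k/2} (⨁ₑ fₑ ⊗ 1 ⊕ ⨁ᵥ c(v))`. -/
def liftFun (z : (GraphL2 G d) × (Fin n → ℂ)) : B.Point → ℂ :=
  Sum.elim (fun q => downScale k ε * z.1 ⟨q.1, q.2.1⟩) (fun q => downScale k ε * z.2 q.1)

lemma memLp_liftFun (hε : 0 < ε) (z : GraphL2 G d × (Fin n → ℂ)) :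
    MemLp (B.liftFun ε z) 2 (B.mfdMeasure d ε) :=
  (B.memLp_mfd_iff hε).mpr ⟨fun e => ((graphL2_memLp z.1 e).comp_fst _).const_mul _,
    fun v => memLp_const (downScale k ε * z.2 v : ℂ)⟩

lemma ae_fst {e : Edge G} {p : ℝ → Prop} (h : ∀ᵐ s ∂edgeVol d e, p s) :
    ∀ᵐ q ∂B.edgeMeas d e, p q.1 := Measure.quasiMeasurePreserving_fst.ae h

variable (B) in
/-- The operator `(f, c) ↦ ε^{-k/2} (⨁ₑ fₑ ⊗ 1 ⊕ ⨁ᵥ c(v))`. -/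
def lift (hε : 0 < ε) : (GraphL2 G d × (Fin n → ℂ)) →ₗ[ℂ] B.MfdL2 d ε where
  toFun z := (memLp_liftFun hε z).toLp _
  map_add' z w := by
    rw [← MemLp.toLp_add, MemLp.toLp_eq_toLp_iff, Filter.EventuallyEq, B.ae_mfd_iff hε]
    refine ⟨fun e => ?_, fun v => .of_forall fun x => mul_add _ _ _⟩
    filter_upwards [ae_fst (graphL2_add_ae z.1 w.1 e)] with q h
    exact (congrArg (fun t : ℂ => (downScale k ε : ℂ) * t) h).trans (mul_add _ _ _)
  map_smul' c z := by
    rw [RingHom.id_apply, ← MemLp.toLp_const_smul, MemLp.toLp_eq_toLp_iff, Filter.EventuallyEq,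
      B.ae_mfd_iff hε]
    refine ⟨fun e => ?_, fun v => .of_forall fun x => mul_left_comm _ _ _⟩
    filter_upwards [ae_fst (graphL2_smul_ae c z.1 e)] with q h
    exact (congrArg (fun t : ℂ => (downScale k ε : ℂ) * t) h).trans (mul_left_comm _ _ _)

lemma lift_coeFn (hε : 0 < ε) (z : GraphL2 G d × (Fin n → ℂ)) :
    B.lift hε z =ᵐ[B.mfdMeasure d ε] B.liftFun ε z :=
  MemLp.coeFn_toLp (memLp_liftFun hε z)

lemma norm_lift_sq (hε : 0 < ε) (z : GraphL2 G d × (Fin n → ℂ)) :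
    ‖B.lift hε z‖ ^ 2 = ‖z.1‖ ^ 2 + ∑ v, ε * B.vertexVol v * ‖z.2 v‖ ^ 2 := by
  obtain ⟨h1, h2⟩ := (B.ae_mfd_iff hε).mp (lift_coeFn (B := B) hε z)
  rw [B.mfd_norm_sq hε, graph_norm_sq]
  have hp := pow_mul_downScale_sq hε k
  refine congrArg₂ _ (sum_congr rfl fun e _ => ?_) (sum_congr rfl fun v _ => ?_)
  · have h3 : ∫ q, ‖B.lift hε z (edgePt e q)‖ ^ 2 ∂B.edgeMeas d e =
        ∫ q : ℝ × B.Y e, downScale k ε ^ 2 * ‖z.1 ⟨e, q.1⟩‖ ^ 2 ∂B.edgeMeas d e := by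
      refine integral_congr_ae ?_
      filter_upwards [h1 e] with q h
      simp only [h, liftFun, Sum.elim_inl, norm_mul, norm_real, mul_pow, norm_eq_abs,
        sq_abs]
    rw [h3, integral_const_mul, ← mul_assoc, hp, one_mul]
    exact (integral_fun_fst (fun s => ‖z.1 ⟨e, s⟩‖ ^ 2)).trans (by simp)
  · have h3 : ∫ x, ‖B.lift hε z (vertexPt v x)‖ ^ 2 ∂B.vertMeas v =
        ∫ _, downScale k ε ^ 2 * ‖z.2 v‖ ^ 2 ∂B.vertMeas v := by
      refine integral_congr_ae ?_
      filter_upwards [h2 v] with q h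
      simp only [h, liftFun, Sum.elim_inr, norm_mul, norm_real, mul_pow, norm_eq_abs,
        sq_abs]
    rw [h3, integral_const, smul_eq_mul, pow_succ]
    change ε ^ k * ε * (B.vertexVol v * _) = _
    linear_combination (ε * B.vertexVol v * ‖z.2 v‖ ^ 2) * hp

variable (B d) in
/-- The operator `J`, as an isometry. -/
def liftIsometry (hε : 0 < ε) : GraphL2 G d →ₗᵢ[ℂ] B.MfdL2 d ε where
  toLinearMap := B.lift hε ∘ₗ LinearMap.inl ℂ _ _
  norm_map' f := by
    refine (sq_eq_sq₀ (norm_nonneg _) (norm_nonneg _)).mp ((norm_lift_sq hε (f, 0)).trans ?_)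
    simp

variable (B d) in
/-- The operator `J`. -/
abbrev liftJ (hε : 0 < ε) : GraphL2 G d →L[ℂ] B.MfdL2 d ε :=
  (B.liftIsometry d hε).toContinuousLinearMap

variable (B d) in
/-- The operator `J*`. -/
abbrev dropJ (hε : 0 < ε) : B.MfdL2 d ε →L[ℂ] GraphL2 G d :=
  ContinuousLinearMap.adjoint (B.liftJ d hε)

lemma isLift_liftJ (hε : 0 < ε) : B.IsLift d ε (B.liftJ d hε) := fun f => by
  filter_upwards [lift_coeFn (B := B) hε (f, 0)] with z hz
  refine hz.trans ?_
  rcases z with ⟨e, s, y⟩ | ⟨v, x⟩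
  · rfl
  · exact mul_zero _

lemma dropJ_liftJ (hε : 0 < ε) (f : GraphL2 G d) : B.dropJ d hε (B.liftJ d hε f) = f :=
  ext_inner_left ℂ fun g => (ContinuousLinearMap.adjoint_inner_right _ _ _).trans
    (LinearIsometry.inner_map_map _ g f)

lemma norm_dropJ_le (hε : 0 < ε) (x : B.MfdL2 d ε) : ‖B.dropJ d hε x‖ ≤ ‖x‖ := by
  refine ((B.dropJ d hε).le_opNorm x).trans ?_
  rw [LinearIsometryEquiv.norm_map]
  exact mul_le_of_le_one_left (norm_nonneg _) (LinearIsometry.norm_toContinuousLinearMap_le _)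

lemma integral_mul_conj_fst (hε : 0 < ε) {e : Edge G} {F : ℝ × B.Y e → ℂ} {m : ℝ → ℂ}
    (hF : MemLp F 2 (B.edgeMeas d e)) (hm : MemLp m 2 (edgeVol d e)) :
    (ε ^ k : ℝ) * ∫ q, F q * conj (downScale k ε * m q.1) ∂B.edgeMeas d e =
      ∫ s in edgeInterval d e, conj (m s) *
        (upScale k ε * ∫ y, F (s, y) ∂dV (B.Y e)) := by
  have h1 : Integrable (fun q : ℝ × B.Y e => F q * conj (downScale k ε * m q.1)) (B.edgeMeas d e) :=
    hF.integrable_mul (((hm.comp_fst _).const_mul _).star)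
  refine (congrArg _ (integral_prod _ h1)).trans ?_
  rw [← integral_const_mul]
  refine integral_congr_ae (.of_forall fun s => ?_)
  simp only [integral_mul_const, map_mul, conj_ofReal]
  rw [← pow_mul_downScale hε, Complex.ofReal_mul]
  ring

lemma memLp_fiber {e : Edge G} {F : ℝ × B.Y e → ℂ} (hF : MemLp F 2 (B.edgeMeas d e)) :
    MemLp (fun s => (upScale k ε : ℂ) * ∫ y, F (s, y) ∂dV (B.Y e)) 2
      (edgeVol d e) := (lintegral_fiber_sq_le hF).const_mul _

lemma dropJ_eq (hε : 0 < ε) {x : B.MfdL2 d ε} {F : ∀ e, ℝ × B.Y e → ℂ}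
    (hF : ∀ e, MemLp (F e) 2 (B.edgeMeas d e))
    (h : ∀ e, ∀ᵐ q ∂B.edgeMeas d e, x (edgePt e q) = F e q) :
    B.dropJ d hε x = ofEdges _ fun e => memLp_fiber (ε := ε) (hF e) := by
  refine ext_inner_left ℂ fun f => ?_
  rw [ContinuousLinearMap.adjoint_inner_right, B.mfd_inner hε, graph_inner]
  obtain ⟨h1, h2⟩ := (B.ae_mfd_iff hε).mp (isLift_liftJ (B := B) hε f)
  have h3 : ∀ v, ∫ z, conj (B.liftJ d hε f (vertexPt v z)) * x (vertexPt v z) ∂B.vertMeas v = 0 :=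
    fun v => integral_eq_zero_of_ae ((h2 v).mono fun z hz => by
      beta_reduce; rw [hz, map_zero, zero_mul]; rfl)
  simp only [h3, mul_zero, Finset.sum_const_zero, add_zero]
  refine sum_congr rfl fun e _ => ?_
  have h4 : ∫ q, conj (B.liftJ d hε f (edgePt e q)) * x (edgePt e q) ∂B.edgeMeas d e =
      ∫ q, F e q * conj (downScale k ε * f ⟨e, q.1⟩) ∂B.edgeMeas d e := by
    refine integral_congr_ae ?_
    filter_upwards [h1 e, h e] with q hq hq'
    rw [hq, hq', mul_comm]
    rfl
  rw [h4, integral_mul_conj_fst hε (hF e) (graphL2_memLp f e)]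
  refine integral_congr_ae ?_
  filter_upwards [ofEdges_ae _ (fun e => memLp_fiber (ε := ε) (hF e)) e] with s hs
  rw [hs]

/-- An element of `L²` that vanishes on the vertex manifolds. -/
def edgeEl (hε : 0 < ε) {F : ∀ e, ℝ × B.Y e → ℂ} (hF : ∀ e, MemLp (F e) 2 (B.edgeMeas d e)) :
    B.MfdL2 d ε :=
  ((B.memLp_mfd_iff hε (f := Sum.elim (fun z => F z.1 z.2) 0)).mpr
    ⟨hF, fun _ => MemLp.zero⟩).toLp _

lemma edgeEl_ae (hε : 0 < ε) {F : ∀ e, ℝ × B.Y e → ℂ}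
    (hF : ∀ e, MemLp (F e) 2 (B.edgeMeas d e)) :
    (∀ e, ∀ᵐ q ∂B.edgeMeas d e, edgeEl hε hF (edgePt e q) = F e q) ∧
      ∀ v, ∀ᵐ x ∂B.vertMeas v, edgeEl hε hF (vertexPt v x) = 0 :=
  (B.ae_mfd_iff hε).mp (MemLp.coeFn_toLp _)

lemma norm_fiber_sq_le (hε : 0 < ε) {F : ∀ e, ℝ × B.Y e → ℂ}
    (hF : ∀ e, MemLp (F e) 2 (B.edgeMeas d e)) :
    ‖ofEdges _ fun e => memLp_fiber (ε := ε) (hF e)‖ ^ 2 ≤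
      ∑ e, ε ^ k * ∫ q, ‖F e q‖ ^ 2 ∂B.edgeMeas d e := by
  obtain ⟨h1, h2⟩ := edgeEl_ae hε hF
  rw [← dropJ_eq hε hF h1]
  refine (pow_le_pow_left₀ (norm_nonneg _) (norm_dropJ_le hε _) 2).trans_eq ?_
  have h3 : ∀ v, ∫ z, ‖edgeEl hε hF (vertexPt v z)‖ ^ 2 ∂B.vertMeas v = 0 :=
    fun v => integral_eq_zero_of_ae ((h2 v).mono fun z hz => by simp [hz])
  rw [B.mfd_norm_sq hε]
  simp only [h3, mul_zero, Finset.sum_const_zero, add_zero]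
  refine sum_congr rfl fun e _ => congrArg _ (integral_congr_ae ?_)
  filter_upwards [h1 e] with q hq
  rw [hq]

end BuildingBlocks
end Lift

section Profile

variable {n : ℕ} {G : SimpleGraph (Fin n)} {d : ℝ}

/-- Smooth functions on the edges that are constant beyond the vertices. -/
structure IsProfile (d : ℝ) (H : Edge G → ℝ → ℂ) (c : Fin n → ℂ) : Prop where
  smooth : ∀ e, ContDiff ℝ ∞ (H e)
  outer : ∀ j, ∀ s ≤ 0, H (Sum.inl j) s = c j
  left : ∀ e, ∀ s ≤ -d, H (Sum.inr e) s = c e.fst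
  right : ∀ e s, d ≤ s → H (Sum.inr e) s = c e.snd
  supp : ∃ R, ∀ j s, R < s → H (Sum.inl j) s = 0

lemma memLp_Ici_of_continuous {h : ℝ → ℂ} (hh : Continuous h) {R : ℝ} (hR : ∀ s, R < s → h s = 0) :
    MemLp h 2 (volume.restrict (Ici 0)) := by
  refine (((memLp_indicator_iff_restrict measurableSet_Icc).mpr
    (memLp_Icc_of_continuous hh 0 R)).restrict (Ici 0)).ae_eq ?_
  refine (ae_restrict_mem measurableSet_Ici).mono fun s hs => ?_
  by_cases h : s ≤ R
  · exact indicator_of_mem (show s ∈ Icc 0 R from ⟨hs, h⟩) _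
  · rw [hR s (not_le.mp h), indicator_of_notMem fun h' => h h'.2]

namespace IsProfile

variable {H : Edge G → ℝ → ℂ} {c : Fin n → ℂ}

lemma memLp (hH : IsProfile d H c) (e : Edge G) :
    MemLp (H e) 2 (edgeVol d e) := by
  rcases e with j | e
  · exact memLp_Ici_of_continuous (hH.smooth _).continuous (hH.supp.choose_spec j)
  · exact memLp_Icc_of_continuous (hH.smooth _).continuous _ _

lemma memLp_deriv (hH : IsProfile d H c) (e : Edge G) :
    MemLp (deriv (H e)) 2 (edgeVol d e) := by
  have h := (hH.smooth e).continuous_deriv (by simp)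
  rcases e with j | e
  · refine memLp_Ici_of_continuous h (R := hH.supp.choose) fun s hs => ?_
    rw [EventuallyEq.deriv_eq (f := fun _ => 0), deriv_const]
    filter_upwards [lt_mem_nhds hs] with t ht using hH.supp.choose_spec j t ht
  · exact memLp_Icc_of_continuous h _ _

end IsProfile

lemma exists_profile (hd : 0 < d) {f f' : GraphL2 G d} {F : Edge G → ℝ → ℂ} (hf : IsRep f f' F)
    {c : Fin n → ℂ} (hc : ∀ a : EdgeEnd G, F a.edge (a.pos d) = c a.vertex) {η : ℝ} (hη : 0 < η) :
    ∃ (H : Edge G → ℝ → ℂ) (hH : IsProfile d H c), ‖ofEdges H hH.memLp - f‖ ^ 2 ≤ η ∧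
      ‖ofEdges (fun e => deriv (H e)) hH.memLp_deriv - f'‖ ^ 2 ≤ η := by
  set N : ℝ := Fintype.card (Edge G) + 1 with hN
  have hN0 : 0 < N := by positivity
  have hm : ∀ e, MemLp (F e) 2 (edgeVol d e) := fun e =>
    (memLp_congr_ae (hf.ae_eq e)).mp (graphL2_memLp f e)
  choose Ho so ho To h1 h2 using fun j => exists_approx_outer (hm (Sum.inl j)) (hf.memLp (Sum.inl j))
    (hf.ftc (Sum.inl j)) (div_pos hη hN0)
  choose Hi si hl hr h3 h4 using fun e => exists_approx_bounded (by linarith : -d < d)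
    (hf.memLp (Sum.inr e)) (hf.ftc (Sum.inr e)) (div_pos hη hN0)
  obtain ⟨R, hR⟩ := (Set.finite_range fun j => (To j).choose).bddAbove
  have hH : IsProfile d (Sum.elim Ho Hi) c :=
    { smooth := by rintro (j | e); exacts [so j, si e]
      outer := fun j s hs => (ho j s hs).trans (hc (EdgeEnd.outer j))
      left := fun e s hs => (hl e s hs).trans (hc (EdgeEnd.left e))
      right := fun e s hs => (hr e s hs).trans (hc (EdgeEnd.right e))
      supp := ⟨R, fun j s hs => (To j).choose_spec s ((hR ⟨j, rfl⟩).trans_lt hs)⟩ }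
  have hsum : ∀ g : GraphL2 G d, ∀ K : Edge G → ℝ → ℂ, ∀ hK : ∀ e, MemLp (K e) 2 _,
      (∀ e, ∫ s in edgeInterval d e, ‖K e s - g ⟨e, s⟩‖ ^ 2 ≤ η / N) →
      ‖ofEdges K hK - g‖ ^ 2 ≤ η := fun g K hK h => by
    rw [norm_sub_ofEdges_sq]
    refine (sum_le_sum fun e _ => h e).trans ?_
    rw [sum_const, nsmul_eq_mul, card_univ, mul_div_assoc', div_le_iff₀ hN0]
    nlinarith
  refine ⟨_, hH, hsum _ _ _ fun e => ?_, hsum _ _ _ fun e => ?_⟩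
  · have h5 : ∫ s in edgeInterval d e, ‖Sum.elim Ho Hi e s - f ⟨e, s⟩‖ ^ 2 =
        ∫ s in edgeInterval d e, ‖Sum.elim Ho Hi e s - F e s‖ ^ 2 :=
      integral_congr_ae ((hf.ae_eq e).mono fun s hs => by simp only [hs])
    rw [h5]
    rcases e with j | e; exacts [h2 j, h4 e]
  · rcases e with j | e; exacts [h1 j, h3 e]

namespace BuildingBlocks

variable {k : ℕ} {B : BuildingBlocks.{u} G k} {ε : ℝ} {H : Edge G → ℝ → ℂ} {c : Fin n → ℂ}

/-! ### Lifts of profiles -/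

variable (B ε) in
/-- The lift of a profile. -/
def profileFun (H : Edge G → ℝ → ℂ) (c : Fin n → ℂ) : B.Point → ℂ :=
  Sum.elim (fun q => downScale k ε * H q.1 q.2.1) (fun q => downScale k ε * c q.1)

lemma extend_profileFun (hH : IsProfile d H c) (e : Edge G) (q : ℝ × B.Y e) :
    B.extend d ε (B.profileFun ε H c) e q = downScale k ε * H e q.1 := by
  obtain ⟨s, y⟩ := q
  rcases e with j | e
  · by_cases h : s < 0
    · exact (if_pos h).trans (by rw [hH.outer j s h.le]; rfl)
    · exact if_neg h
  · by_cases h : s < -d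
    · exact (if_pos h).trans (by rw [hH.left e s h.le]; rfl)
    · refine (if_neg h).trans ?_
      by_cases h' : d < s
      · exact (if_pos h').trans (by rw [hH.right e s h'.le]; rfl)
      · exact if_neg h'

lemma isTestFunction_profileFun (hH : IsProfile d H c) :
    B.IsTestFunction d ε (B.profileFun ε H c) where
  smooth_vertex v := contMDiff_const (c := (downScale k ε * c v : ℂ))
  smooth_edge e := by
    rw [show B.extend d ε (B.profileFun ε H c) e = fun q => downScale k ε * H e q.1 from
      funext (extend_profileFun hH e)]
    exact ((contDiff_const.mul (hH.smooth e)).contMDiff.comp contMDiff_fst).contMDiffOn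
  compact_support := ⟨hH.supp.choose, fun j s y hs => by
    change (downScale k ε : ℂ) * H (Sum.inl j) s = 0
    rw [hH.supp.choose_spec j s hs, mul_zero]⟩

lemma testToL2_profileFun (hε : 0 < ε) (hH : IsProfile d H c) :
    B.testToL2 hε ⟨_, isTestFunction_profileFun hH⟩ = B.lift hε (ofEdges H hH.memLp, c) := by
  refine Lp.ext ((B.ae_mfd_iff hε).mpr ?_)
  obtain ⟨h1, h2⟩ := (B.ae_mfd_iff hε).mp (lift_coeFn (B := B) hε (ofEdges H hH.memLp, c))
  obtain ⟨h3, h4⟩ := testToL2_ae hε ⟨_, isTestFunction_profileFun (B := B) (ε := ε) hH⟩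
  refine ⟨fun e => ?_, fun v => ?_⟩
  · filter_upwards [h1 e, h3 e, ae_fst (ofEdges_ae H hH.memLp e)] with q e1 e2 e3
    rw [e1, e2, extend_profileFun hH, ← e3]
    rfl
  · filter_upwards [h2 v, h4 v] with q e1 e2
    rw [e1, e2]
    rfl

lemma extDeriv_profileFun (hH : IsProfile d H c) (e : Edge G) (q : ℝ × B.Y e) :
    B.extDeriv d ε (B.profileFun ε H c) e q = downScale k ε * deriv (H e) q.1 := by
  rw [extDeriv]
  simp only [extend_profileFun hH]
  exact deriv_const_mul _ ((hH.smooth e).differentiable (by simp) _)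

/-! ### Averages of test functions over the transverse manifolds -/

/-- `ε^{k/2}` times the average over the transverse manifolds. -/
def fiberAvg (ε : ℝ) (F : ∀ e, ℝ × B.Y e → ℂ) (e : Edge G) (s : ℝ) : ℂ :=
  upScale k ε * ∫ y, F e (s, y) ∂dV (B.Y e)

/-- The weak derivative of the image of a test function under `J*`. -/
def dropDeriv (hε : 0 < ε) (φ : B.testSpace d ε) : GraphL2 G d :=
  ofEdges (fiberAvg ε (B.extDeriv d ε φ.1))
    fun e => memLp_fiber ((IsTestFunction.nice_extDeriv hε φ.2 e).memLp 2)

lemma dropJ_testToL2 (hε : 0 < ε) (φ : B.testSpace d ε) : B.dropJ d hε (B.testToL2 hε φ) =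
    ofEdges (fiberAvg ε (B.extend d ε φ.1))
      fun e => memLp_fiber ((IsTestFunction.nice_extend hε φ.2 e).memLp 2) :=
  dropJ_eq hε (fun e => (IsTestFunction.nice_extend hε φ.2 e).memLp 2) (testToL2_ae hε φ).1

lemma IsNice.integrable_slice {e : Edge G} {F : ℝ × B.Y e → ℂ} (hF : B.IsNice d e F) {s : ℝ}
    (hs : s ∈ edgeInterval d e) :
    Integrable (fun y => F (s, y)) (dV (B.Y e)) :=
  Continuous.integrable_of_hasCompactSupport
    (hF.cont.comp_continuous (by fun_prop) fun y => ⟨hs, mem_univ y⟩)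
    (HasCompactSupport.of_compactSpace _)

lemma isRep_dropJ (hε : 0 < ε) (φ : B.testSpace d ε) : IsRep (B.dropJ d hε (B.testToL2 hε φ))
    (dropDeriv hε φ) (fiberAvg ε (B.extend d ε φ.1)) := by
  rw [dropJ_testToL2]
  refine IsEdgeRep.of_ftc _ _ fun e s hs t ht => ?_
  have hn := IsTestFunction.nice_extDeriv hε φ.2 e
  have h1 := fun {s : ℝ} (hs : s ∈ edgeInterval d e) =>
    (IsTestFunction.nice_extend hε φ.2 e).integrable_slice hs
  have h2 : Integrable (Function.uncurry fun x y => B.extDeriv d ε φ.1 e (x, y))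
      ((volume.restrict (uIoc s t)).prod (dV (B.Y e))) :=
    hn.integrable.mono_measure
      (Measure.prod_mono (Measure.restrict_mono (edge_uIoc_subset hs ht) le_rfl) le_rfl)
  simp only [fiberAvg]
  rw [intervalIntegral.integral_const_mul, intervalIntegral_integral_swap h2, ← mul_sub,
    ← integral_sub (h1 ht) (h1 hs)]
  refine congrArg _ (integral_congr_ae (.of_forall fun y => ?_))
  refine (intervalIntegral.integral_eq_sub_of_hasDerivAt (fun x hx =>
    IsTestFunction.hasDerivAt_extend φ.2 (B.edgeInterval_subset hε e (edge_uIcc_subset hs ht hx)) y)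
    (ContinuousOn.intervalIntegrable (hn.cont.comp (by fun_prop) fun x hx =>
      ⟨edge_uIcc_subset hs ht hx, mem_univ y⟩))).symm

lemma norm_dropDeriv_sq_le (hε : 0 < ε) (φ : B.testSpace d ε) :
    ‖dropDeriv hε φ‖ ^ 2 ≤ (B.testForm d ε 0 0 0 φ.1 φ.1).re := by
  refine (norm_fiber_sq_le hε fun e => (IsTestFunction.nice_extDeriv hε φ.2 e).memLp 2).trans ?_
  rw [IsTestFunction.testForm_zero_re hε φ.2]
  refine (sum_le_sum fun e _ => mul_le_mul_of_nonneg_left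
    (le_add_of_nonneg_right ?_) (by positivity)).trans (le_add_of_nonneg_right ?_)
  · exact mul_nonneg (by positivity) (edgeTrans_nonneg e φ.1)
  · exact sum_nonneg fun v _ => mul_nonneg (by positivity) (vertEnergy_nonneg v φ.1)

lemma norm_midWeight_le (ε : ℝ) (w : InnerEdge G → ℝ) (e : Edge G) (s : ℝ) :
    ‖Sum.elim (fun _ _ => (0 : ℂ)) (fun e => (Ioc (-ε) ε).indicator fun _ => (w e / (2 * ε) : ℝ)) e s‖
      ≤ ∑ e, |w e / (2 * ε)| := by
  rcases e with j | e
  · simpa using sum_nonneg fun e _ => abs_nonneg _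
  · refine (norm_indicator_le_norm_self (fun _ => ((w e / (2 * ε) : ℝ) : ℂ)) s).trans ?_
    rw [norm_real]
    exact single_le_sum (f := fun e => |w e / (2 * ε)|) (fun e _ => abs_nonneg _)
      (Finset.mem_univ e)

/-- Multiplication by `wₑ / (2 ε)` on the middle parts `[-ε, ε]` of the inner edges. -/
def midMul (ε : ℝ) (w : InnerEdge G → ℝ) : GraphL2 G d →L[ℂ] GraphL2 G d :=
  edgeMul (by rintro (j | e); exacts [measurable_const, measurable_const.indicator measurableSet_Ioc])
    (norm_midWeight_le ε w)

lemma inner_midMul (w : InnerEdge G → ℝ) (f g : GraphL2 G d) : inner ℂ f (midMul ε w g) =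
    ∑ e, (w e / (2 * ε) : ℝ) * ∫ s in edgeInterval d (Sum.inr e : Edge G),
      conj ((Ioc (-ε) ε).indicator (fun s => f ⟨Sum.inr e, s⟩) s) * g ⟨Sum.inr e, s⟩ := by
  have h := edgeMul_ae (d := d) (by
    rintro (j | e); exacts [measurable_const, measurable_const.indicator measurableSet_Ioc])
    (norm_midWeight_le (G := G) ε w) g
  rw [graph_inner, Fintype.sum_sum_type, sum_eq_zero fun j _ => ?_, zero_add]
  · refine sum_congr rfl fun e _ => ?_
    rw [← integral_const_mul]
    refine integral_congr_ae ((h (Sum.inr e)).mono fun s hs => ?_)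
    refine (congrArg (fun t => conj (f ⟨Sum.inr e, s⟩) * t) hs).trans ?_
    by_cases h1 : s ∈ Ioc (-ε) ε
    · simp only [Sum.elim_inr, indicator_of_mem h1]; ring
    · simp [indicator_of_notMem h1]
  · refine integral_eq_zero_of_ae ((h (Sum.inl j)).mono fun s hs => ?_)
    refine (congrArg (fun t => conj (f ⟨Sum.inl j, s⟩) * t) hs).trans ?_
    simp

lemma vertexVol_pos (v : Fin n) : 0 < B.vertexVol v :=
  ENNReal.toReal_pos riemVol_univ_pos.ne' (measure_ne_top (B.vertMeas v) _)

lemma testForm_profile (hε : 0 < ε) (ψ : B.testSpace d ε) (hH : IsProfile d H c)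
    (A wE : InnerEdge G → ℝ) (wV : Fin n → ℝ) :
    B.testForm d ε A wE wV ψ.1 (B.profileFun ε H c) =
      inner ℂ (ofEdges (fun e => deriv (H e)) hH.memLp_deriv + potMul A (ofEdges H hH.memLp))
        (dropDeriv hε ψ + potMul A (B.dropJ d hε (B.testToL2 hε ψ))) +
      inner ℂ (ofEdges H hH.memLp) (midMul ε wE (B.dropJ d hε (B.testToL2 hε ψ))) +
      ∑ v, wV v * (upScale k ε * B.vertexAvg ψ.1 v * conj (c v)) := by
  have hψ := fun e => IsTestFunction.nice_extend hε ψ.2 e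
  have hψ' := fun e => IsTestFunction.nice_extDeriv hε ψ.2 e
  have hg := ofEdges_ae (fiberAvg ε (B.extend d ε ψ.1)) fun e => memLp_fiber ((hψ e).memLp 2)
  rw [← dropJ_testToL2 hε] at hg
  have hg' := ofEdges_ae (fiberAvg ε (B.extDeriv d ε ψ.1)) fun e => memLp_fiber ((hψ' e).memLp 2)
  rw [testForm]
  refine congrArg₂ _ (congrArg₂ _ ?_ ?_) ?_
  · rw [graph_inner]
    refine sum_congr rfl fun e _ => ?_
    have h1 : B.edgePart d ε A e ψ.1 (B.profileFun ε H c) = ∫ q, B.covDeriv d ε A ψ.1 e q *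
        conj (downScale k ε * (deriv (H e) q.1 + Complex.I * edgePotential A e * H e q.1))
          ∂B.edgeMeas d e := by
      refine integral_congr_ae (.of_forall fun q => ?_)
      have h2 : B.extGrad d ε ψ.1 (B.profileFun ε H c) e q = 0 := by
        rw [extGrad]
        simp only [extend_profileFun hH]
        exact gradProd_const_right _ _ _
      simp only [h2, mul_zero, add_zero]
      rw [covDeriv, covDeriv, extDeriv_profileFun hH, extend_profileFun hH]
      congr 2
      ring
    have hm : MemLp (fun s => deriv (H e) s + Complex.I * edgePotential A e * H e s) 2
        (edgeVol d e) := (hH.memLp_deriv e).add ((hH.memLp e).const_mul _)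
    rw [h1, integral_mul_conj_fst hε ((IsTestFunction.nice_covDeriv hε ψ.2 A e).memLp 2) hm]
    refine integral_congr_ae ?_
    filter_upwards [hg e, hg' e, ofEdges_ae H hH.memLp e, ofEdges_ae _ hH.memLp_deriv e,
      potMul_ae A (ofEdges H hH.memLp) e, potMul_ae A (B.dropJ d hε (B.testToL2 hε ψ)) e,
      graphL2_add_ae (ofEdges (fun e => deriv (H e)) hH.memLp_deriv) (potMul A (ofEdges H hH.memLp)) e,
      graphL2_add_ae (dropDeriv hε ψ) (potMul A (B.dropJ d hε (B.testToL2 hε ψ))) e,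
      ae_restrict_mem (measurableSet_edgeInterval e)] with s e1 e2 e3 e4 e5 e6 e7 e8 hs
    rw [e7, e8, e5, e6, e3, e4, e1, dropDeriv, e2]
    simp only [covDeriv, fiberAvg]
    rw [integral_add ((hψ' e).integrable_slice hs) (((hψ e).integrable_slice hs).const_mul _),
      integral_const_mul]
    ring
  · rw [inner_midMul]
    refine sum_congr rfl fun e _ => ?_
    have h1 : B.midPart d ε e ψ.1 (B.profileFun ε H c) = ∫ q, B.extend d ε ψ.1 (Sum.inr e) q *
        conj (downScale k ε * (Ioc (-ε) ε).indicator (H (Sum.inr e)) q.1)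
          ∂B.edgeMeas d (Sum.inr e) := by
      rw [midPart, ← integral_indicator (measurableSet_Ioc.prod MeasurableSet.univ)]
      refine integral_congr_ae (.of_forall fun q => ?_)
      by_cases hq : q.1 ∈ Ioc (-ε) ε
      · simp only [indicator_of_mem (show q ∈ Ioc (-ε) ε ×ˢ univ from ⟨hq, mem_univ _⟩),
          indicator_of_mem hq, extend_profileFun hH]
      · simp only [indicator_of_notMem (fun h : q ∈ Ioc (-ε) ε ×ˢ univ => hq h.1),
          indicator_of_notMem hq, mul_zero, map_zero]
    rw [h1, Complex.ofReal_mul, mul_assoc, integral_mul_conj_fst hε ((hψ _).memLp 2)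
      ((hH.memLp (Sum.inr e)).indicator measurableSet_Ioc)]
    refine congrArg _ (integral_congr_ae ?_)
    filter_upwards [hg (Sum.inr e), ofEdges_ae H hH.memLp (Sum.inr e)] with s e1 e2
    rw [e1]
    by_cases hs : s ∈ Ioc (-ε) ε
    · simp only [indicator_of_mem hs, e2]; rfl
    · simp only [indicator_of_notMem hs, map_zero, zero_mul]
  · refine sum_congr rfl fun v _ => ?_
    have h1 : B.vertGradPart v ψ.1 (B.profileFun ε H c) = 0 :=
      integral_eq_zero_of_ae (.of_forall fun x =>
        gradProd_const_right (downScale k ε * c v : ℂ) _ x)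
    have h2 : B.vertPart v ψ.1 (B.profileFun ε H c) =
        (∫ x, ψ.1 (vertexPt v x) ∂B.vertMeas v) * conj (downScale k ε * c v) :=
      integral_mul_const (conj (downScale k ε * c v)) fun x => ψ.1 (vertexPt v x)
    have h3 := (vertexVol_pos (B := B) v).ne'
    rw [h1, h2, mul_zero, zero_add, vertexAvg, ← pow_mul_downScale hε, map_mul, conj_ofReal]
    push_cast
    have h4 : (ε : ℂ) ≠ 0 := Complex.ofReal_ne_zero.mpr hε.ne'
    have h5 : (B.vertexVol v : ℂ) ≠ 0 := Complex.ofReal_ne_zero.mpr h3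
    rw [vertMeas]
    field_simp
    ring

end BuildingBlocks
end Profile

section Limits

variable {n k : ℕ} {G : SimpleGraph (Fin n)} {B : BuildingBlocks.{u} G k} {d ε : ℝ}

lemma cauchySeq_of_norm_sq {E : Type*} [SeminormedAddCommGroup E] {x : ℕ → E}
    {b : ℕ × ℕ → ℝ} (hb : Tendsto b atTop (𝓝 0))
    (h : ∀ i j, ‖x i - x j‖ ^ 2 ≤ b (i, j)) : CauchySeq x := by
  rw [cauchySeq_iff_tendsto_dist_atTop_0]
  have h1 := hb.sqrt
  rw [Real.sqrt_zero] at h1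
  refine squeeze_zero (fun _ => dist_nonneg) (fun l => ?_) h1
  rw [dist_eq_norm]
  exact le_sqrt_of_sq_le (h l.1 l.2)

lemma tendsto_of_norm_sub_sq {E : Type*} [SeminormedAddCommGroup E] {x : ℕ → E} {y : E}
    (h : ∀ i : ℕ, ‖x i - y‖ ^ 2 ≤ 1 / ((i : ℝ) + 1)) : Tendsto x atTop (𝓝 y) := by
  rw [tendsto_iff_norm_sub_tendsto_zero]
  have h1 := (tendsto_one_div_add_atTop_nhds_zero_nat (𝕜 := ℝ)).sqrt
  rw [Real.sqrt_zero] at h1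
  exact squeeze_zero (fun _ => norm_nonneg _) (fun i => le_sqrt_of_sq_le (h i)) h1

namespace BuildingBlocks

/-- Convergence of test functions in `H¹`. -/
abbrev TestApprox (hε : 0 < ε) (x : B.MfdL2 d ε) (ψ : ℕ → B.testSpace d ε) : Prop :=
  ApproxSeq (B.testToL2 hε) (fun φ ψ : B.testSpace d ε => B.testForm d ε 0 0 0 φ.1 ψ.1) x ψ

lemma dropDeriv_sub (hd : 0 < d) (hε : 0 < ε) (φ ψ : B.testSpace d ε) :
    dropDeriv hε φ - dropDeriv hε ψ = dropDeriv hε (φ - ψ) := by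
  have h := (isRep_dropJ hε φ).sub (isRep_dropJ hε ψ)
  rw [← map_sub, ← map_sub] at h
  exact (h.unique hd (isRep_dropJ hε (φ - ψ))).1

lemma exists_rep_dropJ (hd : 0 < d) (hε : 0 < ε) {x : B.MfdL2 d ε} {ψ : ℕ → B.testSpace d ε}
    (h : TestApprox hε x ψ) : ∃ g' K, IsRep (B.dropJ d hε x) g' K ∧
      Tendsto (fun i => dropDeriv hε (ψ i)) atTop (𝓝 g') := by
  obtain ⟨g', hg'⟩ := cauchySeq_tendsto_of_complete (cauchySeq_of_norm_sq h.cauchy fun i j => by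
    rw [dropDeriv_sub hd]; exact norm_dropDeriv_sq_le hε _)
  obtain ⟨K, hK⟩ := IsEdgeRep.exists_limit hd (fun i => isRep_dropJ hε (ψ i))
    (((B.dropJ d hε).continuous.tendsto x).comp h.tendsto) hg'
  exact ⟨g', K, hK, hg'⟩

variable (B d) in
/-- `ε^{k/2}` times the averages over the vertex manifolds. -/
def scaledAvg (hε : 0 < ε) (v : Fin n) : B.MfdL2 d ε →L[ℂ] ℂ :=
  ((ε * B.vertexVol v)⁻¹ : ℂ) • innerSL ℂ (B.lift hε (0, Pi.single v 1))

lemma scaledAvg_eq (hε : 0 < ε) (v : Fin n) (x : B.MfdL2 d ε) :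
    B.scaledAvg d hε v x = upScale k ε * B.vertexAvg x v := by
  obtain ⟨h1, h2⟩ := (B.ae_mfd_iff hε).mp (lift_coeFn (B := B) (d := d) hε (0, Pi.single v 1))
  have h3 : inner ℂ (B.lift hε (0, Pi.single v 1)) x =
      (ε ^ (k + 1) : ℝ) * (downScale k ε * ∫ z, x (vertexPt v z) ∂B.vertMeas v) := by
    rw [B.mfd_inner hε, sum_eq_zero, zero_add, Finset.sum_eq_single v]
    · refine congrArg _ ((integral_congr_ae ((h2 v).mono fun z hz => ?_)).trans
        (integral_const_mul (downScale k ε : ℂ) fun z => x (vertexPt v z)))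
      simp [hz, liftFun]
    · intro w _ hw
      refine mul_eq_zero_of_right _ (integral_eq_zero_of_ae ((h2 w).mono fun z hz => ?_))
      simp [hz, liftFun, hw]
    · exact fun h => absurd (Finset.mem_univ v) h
    · intro e _
      refine mul_eq_zero_of_right _ (integral_eq_zero_of_ae ?_)
      filter_upwards [h1 e, ae_fst (ae_graph_iff.mp (Lp.coeFn_zero ℂ 2 (graphMeasure G d)) e)]
        with q hq hq'
      rw [hq]
      change conj (downScale k ε * (0 : GraphL2 G d) ⟨e, q.1⟩) * _ = 0
      rw [hq']
      simp
  have h4 : (ε : ℂ) ≠ 0 := Complex.ofReal_ne_zero.mpr hε.ne'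
  have h5 : (B.vertexVol v : ℂ) ≠ 0 := Complex.ofReal_ne_zero.mpr (vertexVol_pos v).ne'
  change ((ε * B.vertexVol v)⁻¹ : ℂ) * inner ℂ (B.lift hε (0, Pi.single v 1)) x = _
  rw [h3, vertexAvg, vertMeas, ← pow_mul_downScale hε]
  push_cast
  field_simp
  ring

lemma vertexAvg_testToL2 (hε : 0 < ε) (φ : B.testSpace d ε) (v : Fin n) :
    B.vertexAvg (B.testToL2 hε φ) v = B.vertexAvg φ.1 v :=
  congrArg _ (integral_congr_ae ((testToL2_ae hε φ).2 v))

lemma isTestApprox_lift (hd : 0 < d) (hε : 0 < ε) {f f' : GraphL2 G d} {F : Edge G → ℝ → ℂ}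
    (hf : IsRep f f' F) {c : Fin n → ℂ} (hc : ∀ a : EdgeEnd G, F a.edge (a.pos d) = c a.vertex) :
    ∃ (H : ℕ → Edge G → ℝ → ℂ) (hH : ∀ i, IsProfile d (H i) c),
      Tendsto (fun i => ofEdges (H i) (hH i).memLp) atTop (𝓝 f) ∧
      Tendsto (fun i => ofEdges (fun e => deriv (H i e)) (hH i).memLp_deriv) atTop (𝓝 f') ∧
      TestApprox hε (B.lift hε (f, c)) fun i => ⟨_, isTestFunction_profileFun (hH i)⟩ := by
  choose H hH h1 h2 using fun i : ℕ => exists_profile hd hf hc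
    (by positivity : (0 : ℝ) < 1 / ((i : ℝ) + 1))
  have ht := tendsto_of_norm_sub_sq h2
  refine ⟨H, hH, tendsto_of_norm_sub_sq h1, ht, tendsto_of_norm_sub_sq fun i => ?_, ?_⟩
  · rw [testToL2_profileFun hε (hH i), ← map_sub, norm_lift_sq]
    simpa using h1 i
  · have h3 := (((tendsto_iff_norm_sub_tendsto_zero.mp ht).comp tendsto_fst).add
      ((tendsto_iff_norm_sub_tendsto_zero.mp ht).comp tendsto_snd)).pow 2
    rw [prod_atTop_atTop_eq, add_zero, zero_pow two_ne_zero] at h3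
    refine squeeze_zero (fun l => IsTestFunction.testForm_zero_nonneg hε (Subtype.prop _))
      (fun l => ?_) h3
    set χ : B.testSpace d ε := ⟨_, isTestFunction_profileFun (hH l.1)⟩ -
      ⟨_, isTestFunction_profileFun (hH l.2)⟩ with hχ
    have h4 : B.testForm d ε 0 0 0 χ.1 χ.1 = inner ℂ
        (ofEdges (fun e => deriv (H l.1 e)) (hH l.1).memLp_deriv -
          ofEdges (fun e => deriv (H l.2 e)) (hH l.2).memLp_deriv) (dropDeriv hε χ) := by
      refine ((isSesq_testForm hε 0 0 0).sub_right χ ⟨_, isTestFunction_profileFun (hH l.1)⟩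
        ⟨_, isTestFunction_profileFun (hH l.2)⟩).trans ?_
      rw [inner_sub_left]
      have hm : ∀ g : GraphL2 G d, midMul ε 0 g = 0 := fun g => graphL2_ext fun e => by
        filter_upwards [edgeMul_ae _ (norm_midWeight_le ε 0) g e,
          ae_graph_iff.mp (Lp.coeFn_zero ℂ 2 (graphMeasure G d)) e] with s h h'
        refine h.trans ?_
        rw [h']
        rcases e with j | e <;> simp
      exact congrArg₂ _ ((testForm_profile hε χ (hH l.1) 0 0 0).trans (by simp [potMul_zero, hm]))
        ((testForm_profile hε χ (hH l.2) 0 0 0).trans (by simp [potMul_zero, hm]))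
    have h5 := norm_dropDeriv_sq_le hε χ
    have h6 : (B.testForm d ε 0 0 0 χ.1 χ.1).re ≤ _ :=
      (Complex.re_le_norm _).trans ((congrArg norm h4).trans_le (norm_inner_le_norm _ _))
    have h7 := norm_sub_le_norm_sub_add_norm_sub
      (ofEdges (fun e => deriv (H l.1 e)) (hH l.1).memLp_deriv) f'
      (ofEdges (fun e => deriv (H l.2 e)) (hH l.2).memLp_deriv)
    rw [norm_sub_rev f'] at h7
    refine le_trans ?_ (pow_le_pow_left₀ (norm_nonneg _) h7 2)
    nlinarith [sq_nonneg (‖ofEdges (fun e => deriv (H l.1 e)) (hH l.1).memLp_deriv -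
      ofEdges (fun e => deriv (H l.2 e)) (hH l.2).memLp_deriv‖ - ‖dropDeriv hε χ‖),
      norm_nonneg (dropDeriv hε χ)]

lemma mfdSesqH1_lift (hε : 0 < ε) (hεd : ε ≤ d) {x : B.MfdL2 d ε} {ψ : ℕ → B.testSpace d ε}
    (hx : TestApprox hε x ψ) {g' : GraphL2 G d}
    (hg' : Tendsto (fun i => dropDeriv hε (ψ i)) atTop (𝓝 g')) {f f' : GraphL2 G d}
    {F : Edge G → ℝ → ℂ} (hf : IsRep f f' F) {c : Fin n → ℂ}
    (hc : ∀ a : EdgeEnd G, F a.edge (a.pos d) = c a.vertex)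
    (A wE : InnerEdge G → ℝ) (wV : Fin n → ℝ) :
    B.mfdSesqH1 d ε A wE wV x (B.lift hε (f, c)) =
      inner ℂ (f' + potMul A f) (g' + potMul A (B.dropJ d hε x)) +
      inner ℂ f (midMul ε wE (B.dropJ d hε x)) +
      ∑ v, wV v * (B.scaledAvg d hε v x * conj (c v)) := by
  obtain ⟨H, hH, h1, h2, h3⟩ := isTestApprox_lift (B := B) (hε.trans_le hεd) hε hf hc
  refine tendsto_nhds_unique
    (isFormExtension_mfdSesqH1 hε hεd A wE wV x (B.lift hε (f, c)) ψ _ hx h3) ?_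
  simp only [testForm_profile hε _ (hH _), ← vertexAvg_testToL2 hε, ← scaledAvg_eq hε]
  have hg : Tendsto (fun i => B.dropJ d hε (B.testToL2 hε (ψ i))) atTop (𝓝 (B.dropJ d hε x)) :=
    ((B.dropJ d hε).continuous.tendsto x).comp hx.tendsto
  exact (((h2.add (((potMul A).continuous.tendsto f).comp h1)).inner
    (hg'.add (((potMul A).continuous.tendsto _).comp hg))).add
    (h1.inner (((midMul ε wE).continuous.tendsto _).comp hg))).add
    (tendsto_finsetSum _ fun v _ => ((((B.scaledAvg d hε v).continuous.tendsto x).comp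
      hx.tendsto).mul_const _).const_mul _)

end BuildingBlocks
end Limits

section Estimates

lemma IsCollar.hasDerivAt {k : ℕ} {Y : RiemMfd.{u} (𝓡 k)} {X : RiemMfd.{u} (𝓑 k)} {ℓ : ℝ}
    {κ : ℝ × Y → X} (hκ : IsCollar ℓ κ) {u : X → ℂ} (hu : ContMDiff (𝓑 k) 𝓘(ℝ, ℂ) ∞ u)
    {t : ℝ} (ht : t ∈ Ioo 0 ℓ) (y : Y) :
    ∃ D : ℂ, HasDerivAt (fun s => u (κ (s, y))) D t ∧ ‖D‖ₑ ^ 2 ≤ energyDensity u (κ (t, y)) := by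
  have hn : Ico 0 ℓ ×ˢ univ ∈ 𝓝 (t, y) := prod_mem_nhds (Ico_mem_nhds ht.1 ht.2) univ_mem
  have h1 : MDifferentiableAt (𝓘(ℝ, ℝ).prod (𝓡 k)) (𝓑 k) κ (t, y) :=
    ((hκ.smooth _ (mem_of_mem_nhds hn)).contMDiffAt hn).mdifferentiableAt (by simp)
  have h2 := (hu.mdifferentiable (by simp)) (κ (t, y))
  have h3 : HasMFDerivAt 𝓘(ℝ, ℝ) (𝓘(ℝ, ℝ).prod (𝓡 k)) (fun s : ℝ => (s, y)) t _ :=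
    (hasMFDerivAt_id t).prodMk (hasMFDerivAt_const y t)
  obtain ⟨L, hL, hL1⟩ : ∃ L : ℝ →L[ℝ] ℂ, HasFDerivAt (fun s => u (κ (s, y))) L t ∧
      L 1 = mfderiv (𝓑 k) 𝓘(ℝ, ℂ) u (κ (t, y)) (mfderiv (𝓘(ℝ, ℝ).prod (𝓡 k)) (𝓑 k) κ
        (t, y) (((1 : ℝ), 0) : ℝ × 𝔼 k)) := by
    refine ⟨_, hasMFDerivAt_iff_hasFDerivAt.mp (HasMFDerivAt.comp (f := fun s : ℝ => (s, y))
      (g := u ∘ κ) t (h2.hasMFDerivAt.comp (t, y) h1.hasMFDerivAt) h3), ?_⟩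
    rfl
  refine ⟨L 1, hL.hasDerivAt, ?_⟩
  set ξ : TangentSpace (𝓑 k) (κ (t, y)) :=
    mfderivWithin (𝓘(ℝ, ℝ).prod (𝓡 k)) (𝓑 k) κ (Ico 0 ℓ ×ˢ univ) (t, y)
      (((1 : ℝ), 0) : ℝ × 𝔼 k) with hξ
  have h5 : X.g (κ (t, y)) ξ ξ = 1 := by
    refine (hκ.isometry t ⟨ht.1.le, ht.2⟩ y 1 1 0 0).trans ?_
    rw [map_zero, mul_one, add_zero]
  have h6 := norm_apply_sq_le_cometric (κ (t, y)) (mfderiv (𝓑 k) 𝓘(ℝ, ℂ) u (κ (t, y))) ξ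
  rw [h5, mul_one] at h6
  rw [energyDensity, ← ofReal_norm, ← ofReal_pow (norm_nonneg _)]
  refine ofReal_le_ofReal (le_trans (le_of_eq ?_) h6)
  rw [hξ, mfderivWithin_of_mem_nhds hn, hL1]
  rfl

/-- A trace inequality on a cylindrical end. -/
lemma IsCollar.trace_le {k : ℕ} {Y : RiemMfd.{u} (𝓡 k)} {X : RiemMfd.{u} (𝓑 k)} {ℓ : ℝ}
    {κ : ℝ × Y → X} (hκ : IsCollar ℓ κ) {u : X → ℂ}
    (hu : ContMDiff (𝓑 k) 𝓘(ℝ, ℂ) ∞ u) {W : ℝ → Y → ℂ}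
    (hW : ∀ t ∈ Ioo 0 ℓ, ∀ y, W t y = u (κ (t, y)))
    (hc : ∀ y, ContDiffOn ℝ 1 (fun t => W t y) (Ico 0 ℓ)) (m : ℂ) :
    ofReal ℓ * ∫⁻ y, ‖W 0 y - m‖ₑ ^ 2 ∂riemVol (𝓡 k) Y.g ≤
      2 * (∫⁻ x, ‖u x - m‖ₑ ^ 2 ∂riemVol (𝓑 k) X.g +
      ofReal ℓ ^ 2 * ∫⁻ x, energyDensity u x ∂riemVol (𝓑 k) X.g) := by
  set ν := riemVol (𝓡 k) Y.g with hν
  set μ : Measure ℝ := volume.restrict (Ioo 0 ℓ) with hμ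
  have hμ1 : μ univ = ofReal ℓ := by rw [hμ, Measure.restrict_apply_univ]; simp
  have hle : μ.prod ν ≤ (volume.prod ν).restrict (Ico 0 ℓ ×ˢ univ) := by
    rw [← Measure.prod_restrict, Measure.restrict_univ]
    exact Measure.prod_mono (Measure.restrict_mono Ioo_subset_Ico_self le_rfl) le_rfl
  have hκm : AEMeasurable κ (μ.prod ν) := (aemeasurable_collar hκ).mono_measure hle
  have hQm : Measurable (energyDensity u) := measurable_energyDensity hu
  have hPm : Measurable fun x => ‖u x - m‖ₑ ^ 2 :=
    (hu.continuous.measurable.sub_const m).enorm.pow_const 2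
  have hcol : ∀ F : X → ℝ≥0∞, Measurable F →
      ∫⁻ q, F (κ q) ∂μ.prod ν ≤ ∫⁻ x, F x ∂riemVol (𝓑 k) X.g := fun F hF =>
    (lintegral_mono' hle le_rfl).trans (lintegral_collar_le hκ hF)
  have hR : AEMeasurable (fun y => ∫⁻ s, energyDensity u (κ (s, y)) ∂μ) ν :=
    (hQm.comp_aemeasurable hκm).prod_swap.lintegral_prod_right'
  have hstep : ∀ t ∈ Ioo 0 ℓ, ∀ y, ‖W 0 y - m‖ₑ ^ 2 ≤ 2 * (‖u (κ (t, y)) - m‖ₑ ^ 2 +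
      ofReal ℓ * ∫⁻ s, energyDensity u (κ (s, y)) ∂μ) := fun t ht y => by
    have h1 : ‖W 0 y - W t y‖ₑ ^ 2 ≤
        ofReal ℓ * ∫⁻ s, energyDensity u (κ (s, y)) ∂μ := by
      rw [← enorm_neg, neg_sub]
      refine (pow_le_pow_left' (enorm_sub_le_lintegral_deriv_of_contDiffOn_Icc
        ((hc y).mono (Icc_subset_Ico_right ht.2)) ht.1.le) 2).trans ?_
      rw [← restrict_Ioo_eq_restrict_Icc]
      refine (lintegral_sq_le _ (measurable_deriv _).enorm.aemeasurable).trans ?_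
      refine mul_le_mul' ?_ ?_
      · rw [Measure.restrict_apply_univ, Real.volume_Ioo, sub_zero]
        exact ofReal_le_ofReal ht.2.le
      · refine (lintegral_mono_set (Ioo_subset_Ioo_right ht.2.le)).trans ?_
        refine setLIntegral_mono' measurableSet_Ioo fun s hs => ?_
        obtain ⟨D, hD, hD1⟩ := hκ.hasDerivAt hu hs y
        rw [EventuallyEq.deriv_eq (f := fun s => u (κ (s, y)))
          (by filter_upwards [Ioo_mem_nhds hs.1 hs.2] with r hr using hW r hr y), hD.deriv]
        exact hD1
    rw [← sub_add_sub_cancel (W 0 y) (W t y) m, add_comm, hW t ht y]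
    rw [hW t ht y] at h1
    exact (enorm_sq_add_le _ _).trans (by gcongr)
  calc ofReal ℓ * ∫⁻ y, ‖W 0 y - m‖ₑ ^ 2 ∂ν
      = ∫⁻ _, ∫⁻ y, ‖W 0 y - m‖ₑ ^ 2 ∂ν ∂μ := by rw [lintegral_const, hμ1, mul_comm]
    _ ≤ ∫⁻ t, ∫⁻ y, 2 * (‖u (κ (t, y)) - m‖ₑ ^ 2 +
          ofReal ℓ * ∫⁻ s, energyDensity u (κ (s, y)) ∂μ) ∂ν ∂μ :=
        setLIntegral_mono' measurableSet_Ioo fun t ht => lintegral_mono fun y => hstep t ht y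
    _ = 2 * (∫⁻ q, ‖u (κ q) - m‖ₑ ^ 2 ∂μ.prod ν + ofReal ℓ * (ofReal ℓ *
          ∫⁻ q, energyDensity u (κ q) ∂μ.prod ν)) := by
        simp only [lintegral_const_mul' _ _ (ENNReal.ofNat_ne_top (n := 2)),
          lintegral_add_right' _ (hR.const_mul _), lintegral_const_mul'' _ hR]
        rw [lintegral_add_right _ measurable_const, lintegral_const, hμ1,
          lintegral_prod (fun q => ‖u (κ q) - m‖ₑ ^ 2) (hPm.comp_aemeasurable hκm),
          lintegral_prod_symm (fun q => energyDensity u (κ q)) (hQm.comp_aemeasurable hκm)]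
        ring
    _ ≤ _ := by
        rw [← mul_assoc, ← sq]
        gcongr
        exacts [hcol _ hPm, hcol _ hQm]

lemma le_two_mul_of_ofReal {x y : ℝ} (hy : 0 ≤ y)
    (h : ofReal x ≤ 2 * ofReal y) : x ≤ 2 * y := by
  rwa [← ENNReal.ofReal_ofNat 2, ← ofReal_mul (by norm_num),
    ENNReal.ofReal_le_ofReal_iff (by positivity)] at h

namespace BuildingBlocks

variable {n k : ℕ} {G : SimpleGraph (Fin n)} (B : BuildingBlocks.{u} G k) {d ε : ℝ}

lemma exists_extend_end (hd : 0 < d) (hε : 0 < ε) (a : EdgeEnd G) : ∃ σ : ℝ,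
    (∀ t ∈ Ico 0 B.ℓ, a.pos d + σ * t ∈ B.extInterval d ε a.edge) ∧
    ∀ (φ : B.Point → ℂ) (t : ℝ), 0 < t → ∀ y, B.extend d ε φ a.edge (a.pos d + σ * t, y) =
      φ (vertexPt a.vertex (B.collar a (t, y))) := by
  have hℓ := B.ℓ_pos
  rcases a with j | e | e
  · refine ⟨-ε, fun t ht => ?_, fun φ t ht y => (if_pos ?_).trans ?_⟩
    · change -(ε * B.ℓ) < 0 + -ε * t
      nlinarith [ht.2]
    · change 0 + -ε * t < 0
      nlinarith
    · have h : -(0 + -ε * t) / ε = t := by field_simp; ring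
      exact congrArg (fun t => φ (vertexPt j (B.collar (EdgeEnd.outer j) (t, y)))) h
  · refine ⟨-ε, fun t ht => ?_, fun φ t ht y => (if_pos ?_).trans ?_⟩
    · change -d - ε * B.ℓ < -d + -ε * t ∧ -d + -ε * t < d + ε * B.ℓ
      constructor <;> nlinarith [ht.1, ht.2]
    · change -d + -ε * t < -d
      nlinarith
    · have h : (-d - (-d + -ε * t)) / ε = t := by field_simp; ring
      exact congrArg (fun t => φ (vertexPt e.fst (B.collar (EdgeEnd.left e) (t, y)))) h
  · refine ⟨ε, fun t ht => ?_, fun φ t ht y => (if_neg ?_).trans ((if_pos ?_).trans ?_)⟩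
    · change -d - ε * B.ℓ < d + ε * t ∧ d + ε * t < d + ε * B.ℓ
      constructor <;> nlinarith [ht.1, ht.2]
    · change ¬ (d + ε * t < -d)
      nlinarith
    · change d < d + ε * t
      nlinarith
    · have h : (d + ε * t - d) / ε = t := by field_simp; ring
      exact congrArg (fun t => φ (vertexPt e.snd (B.collar (EdgeEnd.right e) (t, y)))) h

lemma pos_mem_edgeInterval (hd : 0 < d) (a : EdgeEnd G) : a.pos d ∈ edgeInterval d a.edge := by
  rcases a with j | e | e
  exacts [outer_zero_mem j, left_mem_Icc.mpr (by linarith), right_mem_Icc.mpr (by linarith)]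

/-- Poincaré and trace inequalities for test functions. -/
lemma exists_poincare_trace : ∃ P : ℝ, 0 < P ∧ ∀ {d ε : ℝ}, 0 < d → 0 < ε → ∀ φ : B.testSpace d ε,
    (∀ a : EdgeEnd G, ‖B.vertexAvg φ.1 a.vertex - ∫ y, B.extend d ε φ.1 a.edge (a.pos d, y)
      ∂dV (B.Y a.edge)‖ ^ 2 ≤ P * B.vertEnergy a.vertex φ.1) ∧
    (∀ v, B.vertMass v φ.1 ≤ P * (B.vertEnergy v φ.1 + ‖B.vertexAvg φ.1 v‖ ^ 2)) ∧
    ∀ e, ∫ q, ‖B.extend d ε φ.1 e q - ∫ y, B.extend d ε φ.1 e (q.1, y)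
      ∂dV (B.Y e)‖ ^ 2 ∂B.edgeMeas d e ≤ P * B.edgeTrans d ε e φ.1 := by
  choose CX hCX hX using fun v => exists_poincare (B.X v)
  choose CY hCY hY using fun e => exists_poincare (B.Y e)
  have hℓ := B.ℓ_pos
  have hX' : ∀ {d ε : ℝ} (φ : B.testSpace d ε) v, ∫⁻ x, ‖φ.1 (vertexPt v x) - B.vertexAvg φ.1 v‖ₑ ^ 2
      ∂B.vertMeas v ≤ ofReal (CX v * B.vertEnergy v φ.1) := fun φ v => by
    rw [ofReal_mul (hCX v).le, ← IsTestFunction.lintegral_vertEnergy φ.2 v]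
    exact hX v _ (IsTestFunction.smooth_vertex φ.2 v)
  obtain ⟨P, hP⟩ := (Set.finite_range fun e => CY e).bddAbove
  obtain ⟨P', hP'⟩ := (Set.finite_range fun v => 2 / B.ℓ * (CX v + B.ℓ ^ 2)).bddAbove
  obtain ⟨P'', hP''⟩ := (Set.finite_range fun v => 2 * (CX v + B.vertexVol v)).bddAbove
  refine ⟨|P| + |P'| + |P''| + 1, by positivity, fun {d ε} hd hε φ => ⟨fun a => ?_, fun v => ?_,
    fun e => ?_⟩⟩
  · have hE := vertEnergy_nonneg (B := B) a.vertex φ.1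
    refine le_trans ?_ (mul_le_mul_of_nonneg_right (((hP' ⟨a.vertex, rfl⟩).trans
      (le_abs_self _)).trans (by linarith [abs_nonneg P, abs_nonneg P''])) hE)
    obtain ⟨σ, h1, h2⟩ := B.exists_extend_end hd hε a
    have h3 := (B.isCollar a).trace_le (IsTestFunction.smooth_vertex φ.2 a.vertex)
      (W := fun t y => B.extend d ε φ.1 a.edge (a.pos d + σ * t, y))
      (fun t ht y => h2 φ.1 t ht.1 y) (fun y => by
        have h4 := (IsTestFunction.smooth_edge φ.2 a.edge).comp (s := Ico 0 B.ℓ)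
          (f := fun t : ℝ => (a.pos d + σ * t, y))
          (((contDiff_const.add (contDiff_const.mul contDiff_id)).contMDiff.prodMk
            contMDiff_const).contMDiffOn) (fun t ht => ⟨h1 t ht, mem_univ y⟩)
        exact (contMDiffOn_iff_contDiffOn.mp h4).of_le (by simp)) (B.vertexAvg φ.1 a.vertex)
    simp only [mul_zero, add_zero] at h3
    have h5 := (IsTestFunction.nice_extend hε φ.2 a.edge).integrable_slice (pos_mem_edgeInterval hd a)
    have h6 : ‖B.vertexAvg φ.1 a.vertex - ∫ y, B.extend d ε φ.1 a.edge (a.pos d, y)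
        ∂dV (B.Y a.edge)‖ₑ ^ 2 ≤ ∫⁻ y, ‖B.extend d ε φ.1 a.edge (a.pos d, y) -
          B.vertexAvg φ.1 a.vertex‖ₑ ^ 2 ∂dV (B.Y a.edge) := by
      rw [← enorm_neg, neg_sub]
      have h7 := integral_sub h5 (integrable_const (B.vertexAvg φ.1 a.vertex))
      rw [integral_const, probReal_univ, one_smul] at h7
      rw [← h7]
      refine (pow_le_pow_left' (enorm_integral_le_lintegral_enorm _) 2).trans ?_
      refine (lintegral_sq_le _ (h5.1.sub aestronglyMeasurable_const).enorm).trans ?_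
      rw [measure_univ, one_mul]
      rfl
    have h8 := (mul_le_mul_right h6 (ofReal B.ℓ)).trans h3
    have h9 := IsTestFunction.lintegral_vertEnergy φ.2 a.vertex
    rw [vertMeas] at h9
    rw [h9] at h8
    have h10 := h8.trans (mul_le_mul_right (add_le_add_left (hX' φ a.vertex) _) 2)
    rw [← ofReal_norm, ← ofReal_pow (norm_nonneg _), ← ofReal_mul hℓ.le,
      ← ofReal_pow hℓ.le, ← ofReal_mul (by positivity), ← ENNReal.ofReal_add
      (mul_nonneg (hCX _).le hE) (by positivity)] at h10
    have h11 := le_two_mul_of_ofReal (by have := (hCX a.vertex).le; positivity) h10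
    beta_reduce
    rw [div_mul_eq_mul_div, div_mul_eq_mul_div, le_div_iff₀ hℓ]
    linarith
  · have hE := vertEnergy_nonneg (B := B) v φ.1
    refine le_trans ?_ (mul_le_mul_of_nonneg_right (((hP'' ⟨v, rfl⟩).trans
      (le_abs_self _)).trans (by linarith [abs_nonneg P, abs_nonneg P'])) (by positivity))
    have h1 : ofReal (B.vertMass v φ.1) ≤ 2 * (ofReal (CX v * B.vertEnergy v φ.1) +
        ofReal (B.vertexVol v * ‖B.vertexAvg φ.1 v‖ ^ 2)) := by
      rw [← IsTestFunction.lintegral_vertMass φ.2 v]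
      refine (lintegral_mono fun x => (congrArg (fun z : ℂ => ‖z‖ₑ ^ 2)
        (sub_add_cancel (φ.1 (vertexPt v x)) (B.vertexAvg φ.1 v)).symm).trans_le
        (enorm_sq_add_le _ _)).trans ?_
      rw [lintegral_const_mul' _ _ ENNReal.ofNat_ne_top, lintegral_add_right _ measurable_const,
        lintegral_const]
      gcongr
      · exact hX' φ v
      · rw [ofReal_mul (vertexVol_pos v).le, mul_comm, vertexVol,
          ENNReal.ofReal_toReal (show dV (B.X v) univ ≠ ⊤ from
            measure_ne_top _ _), ← ofReal_norm,
          ← ofReal_pow (norm_nonneg _)]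
        rfl
    have hv := (vertexVol_pos (B := B) v).le
    have hc := (hCX v).le
    rw [← ENNReal.ofReal_add (by positivity) (by positivity)] at h1
    have h2 := le_two_mul_of_ofReal (by positivity) h1
    nlinarith [mul_nonneg hc (sq_nonneg ‖B.vertexAvg φ.1 v‖), mul_nonneg hv hE]
  · have hn := IsTestFunction.nice_extend hε φ.2 e
    refine le_trans ?_ (mul_le_mul_of_nonneg_right (((hP ⟨e, rfl⟩).trans
      (le_abs_self _)).trans (by linarith [abs_nonneg P', abs_nonneg P''])) (edgeTrans_nonneg e φ.1))
    have hm : MemLp (fun q : ℝ × B.Y e => B.extend d ε φ.1 e q -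
        ∫ y, B.extend d ε φ.1 e (q.1, y) ∂dV (B.Y e)) 2 (B.edgeMeas d e) :=
      (hn.memLp 2).sub ((lintegral_fiber_sq_le (hn.memLp 2)).comp_fst _)
    rw [← ENNReal.ofReal_le_ofReal_iff (mul_nonneg (hCY e).le (edgeTrans_nonneg e φ.1)),
      ofReal_integral_eq_lintegral_ofReal ((memLp_two_iff_integrable_sq_norm hm.1).mp hm)
        (.of_forall fun _ => by positivity), ofReal_mul (hCY e).le,
      ← IsTestFunction.lintegral_trans hε φ.2 e]
    simp only [ofReal_pow (norm_nonneg _), ofReal_norm]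
    have h1 := (hn.memLp 2).1
    refine (lintegral_prod _ (hm.1.enorm.pow_const 2)).trans_le ?_
    refine le_of_le_of_eq ?_ (congrArg _ (lintegral_prod _
      (Complex.measurable_re.comp_aemeasurable
        (IsTestFunction.nice_extGrad hε φ.2 φ.2 e).integrable.1.aemeasurable).ennreal_ofReal).symm)
    rw [← lintegral_const_mul' _ _ ofReal_ne_top]
    refine setLIntegral_mono' (measurableSet_edgeInterval e) fun s hs => ?_
    have h2 := hY e (fun y => B.extend d ε φ.1 e (s, y)) (by
      refine contMDiffOn_univ.mp ((IsTestFunction.smooth_edge φ.2 e).comp (s := univ)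
        (f := fun y => (s, y)) (contMDiff_const.prodMk contMDiff_id).contMDiffOn fun y _ =>
          ⟨B.edgeInterval_subset hε e hs, mem_univ y⟩))
    rw [B.vol_Y e] at h2
    simp only [ENNReal.toReal_one, inv_one, Complex.ofReal_one, one_mul] at h2
    exact h2

end BuildingBlocks
end Estimates

section Estimates

namespace BuildingBlocks

variable {n k : ℕ} {G : SimpleGraph (Fin n)} (B : BuildingBlocks.{u} G k) {d ε : ℝ}

lemma vertex_bound {P ε q S a b t g g' c E r V : ℝ} (hS : S = t ^ 2 + q) (h2 : a ≤ P * ε * q)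
    (h8 : P * ε * q ≤ P * S) (h3 : b ≤ 2 * g ^ 2 + 2 * g' ^ 2) (h4 : g ^ 2 ≤ t ^ 2) (h5 : g' ^ 2 ≤ q)
    (h6 : c ≤ 2 * a + 2 * b) (h7 : r * V = c) (hE : r * E ≤ ε * q) (hq : ε * q ≤ q) :
    r * (E + V) ≤ (2 * P + 5) * S := by
  have := sq_nonneg t
  linarith

lemma exists_test_estimates : ∃ P : ℝ, 0 < P ∧ ∀ {d ε : ℝ} (hε : 0 < ε), ε ≤ d → d ≤ 1 →
    ∀ φ : B.testSpace d ε,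
    (∀ a : EdgeEnd G, ‖B.scaledAvg d hε a.vertex (B.testToL2 hε φ) -
      fiberAvg ε (B.extend d ε φ.1) a.edge (a.pos d)‖ ^ 2 ≤
        P * ε * (B.testForm d ε 0 0 0 φ.1 φ.1).re) ∧
    ‖B.liftJ d hε (B.dropJ d hε (B.testToL2 hε φ)) - B.testToL2 hε φ‖ ^ 2 ≤
      P * ε * (‖B.testToL2 hε φ‖ ^ 2 + (B.testForm d ε 0 0 0 φ.1 φ.1).re) := by
  obtain ⟨P, hP0, hP⟩ := B.exists_poincare_trace
  set N : ℝ := Fintype.card (Edge G) + n + 1 with hN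
  set P' := P * (2 * P + 5) * N with hP'
  have hN1 : 1 ≤ N := by rw [hN]; exact le_add_of_nonneg_left (by positivity)
  have hPP : P ≤ P' := by
    rw [hP', mul_assoc]
    exact le_mul_of_one_le_right hP0.le (by nlinarith)
  refine ⟨P', by positivity, fun {d ε} hε hεd hd1 φ => ?_⟩
  have hd : 0 < d := hε.trans_le hεd
  obtain ⟨h1, h2, h3⟩ := hP hd hε φ
  set q := (B.testForm d ε 0 0 0 φ.1 φ.1).re with hq
  have hq0 : 0 ≤ q := IsTestFunction.testForm_zero_nonneg hε φ.2
  have hvE : ∀ v, ε ^ k * B.vertEnergy v φ.1 ≤ ε * q := fun v => by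
    have h := mul_le_mul_of_nonneg_left (IsTestFunction.vertEnergy_le_form hε φ.2 v) hε.le
    refine le_trans (le_of_eq ?_) h
    field_simp
    ring
  have hr := upScale_sq hε k
  have hend : ∀ a : EdgeEnd G, ‖B.scaledAvg d hε a.vertex (B.testToL2 hε φ) -
      fiberAvg ε (B.extend d ε φ.1) a.edge (a.pos d)‖ ^ 2 ≤ P * ε * q := fun a => by
    rw [scaledAvg_eq, vertexAvg_testToL2, fiberAvg, ← mul_sub, norm_mul, mul_pow, norm_real,
      norm_eq_abs, sq_abs, hr]
    refine (mul_le_mul_of_nonneg_left (h1 a) (by positivity)).trans ?_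
    nlinarith [hvE a.vertex]
  refine ⟨fun a => (hend a).trans (by gcongr), ?_⟩
  set S := ‖B.testToL2 hε φ‖ ^ 2 + q with hS
  have hS0 : 0 ≤ S := by positivity
  have hqS : q ≤ S := le_add_of_nonneg_left (by positivity)
  have hε1 : ε ≤ 1 := hεd.trans hd1
  have hεS : 0 ≤ ε * S := by positivity
  obtain ⟨a1, a2⟩ := (B.ae_mfd_iff hε).mp (isLift_liftJ (B := B) hε (B.dropJ d hε (B.testToL2 hε φ)))
  obtain ⟨b1, b2⟩ := testToL2_ae hε φ
  obtain ⟨c1, c2⟩ := (B.ae_mfd_iff hε).mp (Lp.coeFn_sub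
    (B.liftJ d hε (B.dropJ d hε (B.testToL2 hε φ))) (B.testToL2 hε φ))
  have hN' : P' * ε * S = ∑ _e : Edge G, P * (2 * P + 5) * (ε * S) +
      ∑ _v : Fin n, P * (2 * P + 5) * (ε * S) + P * (2 * P + 5) * (ε * S) := by
    rw [sum_const, sum_const, card_univ, card_univ, Fintype.card_fin,
      nsmul_eq_mul, nsmul_eq_mul, hP', hN]
    ring
  rw [B.mfd_norm_sq hε, hN']
  refine le_add_of_le_of_nonneg (add_le_add (sum_le_sum fun e _ => ?_)
    (sum_le_sum fun v _ => ?_)) (by positivity)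
  · have e1 : ∫ q, ‖(B.liftJ d hε (B.dropJ d hε (B.testToL2 hε φ)) - B.testToL2 hε φ)
        (edgePt e q)‖ ^ 2 ∂B.edgeMeas d e = ∫ q, ‖B.extend d ε φ.1 e q -
          ∫ y, B.extend d ε φ.1 e (q.1, y) ∂dV (B.Y e)‖ ^ 2 ∂B.edgeMeas d e := by
      refine integral_congr_ae ?_
      have hg := ofEdges_ae (fiberAvg ε (B.extend d ε φ.1)) (fun e => memLp_fiber
        ((IsTestFunction.nice_extend hε φ.2 e).memLp 2)) e
      rw [← dropJ_testToL2 hε] at hg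
      filter_upwards [a1 e, b1 e, c1 e, ae_fst hg] with q e1 e2 e3 e4
      rw [e3, Pi.sub_apply, e1, e2]
      change ‖(downScale k ε : ℂ) * _ - _‖ ^ 2 = _
      rw [e4, fiberAvg, ← mul_assoc, ← Complex.ofReal_mul, downScale_mul_upScale hε,
        Complex.ofReal_one, one_mul, norm_sub_rev]
    rw [e1]
    have e2 := mul_le_mul_of_nonneg_left (IsTestFunction.edgeTrans_le_form hε φ.2 e) (sq_nonneg ε)
    have e3 : ε ^ 2 * (ε ^ k * ((ε ^ 2)⁻¹ * B.edgeTrans d ε e φ.1)) =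
        ε ^ k * B.edgeTrans d ε e φ.1 := by field_simp
    rw [e3] at e2
    have e4 : ε ^ 2 * q ≤ ε * S := by nlinarith [mul_nonneg hε.le hq0]
    refine (mul_le_mul_of_nonneg_left (h3 e) (by positivity)).trans ?_
    nlinarith [mul_nonneg hP0.le hεS, mul_nonneg hP0.le (mul_nonneg hP0.le hεS)]
  · have e1 : ∫ z, ‖(B.liftJ d hε (B.dropJ d hε (B.testToL2 hε φ)) - B.testToL2 hε φ)
        (vertexPt v z)‖ ^ 2 ∂B.vertMeas v = B.vertMass v φ.1 := by
      refine integral_congr_ae ?_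
      filter_upwards [a2 v, b2 v, c2 v] with q e1 e2 e3
      rw [e3, Pi.sub_apply, e1, e2, zero_sub, norm_neg]
    rw [e1]
    have e2 := hend (EdgeEnd.outer v)
    have e3 := (isRep_dropJ hε φ).norm_outer_sq_le v
    have e4 := pow_le_pow_left₀ (norm_nonneg _) (norm_dropJ_le hε (B.testToL2 hε φ)) 2
    have e5 := norm_dropDeriv_sq_le hε φ
    have e6 := norm_sq_add_le (B.scaledAvg d hε v (B.testToL2 hε φ) -
      fiberAvg ε (B.extend d ε φ.1) (Sum.inl v) 0) (fiberAvg ε (B.extend d ε φ.1) (Sum.inl v) 0)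
    rw [sub_add_cancel] at e6
    have e7 : ε ^ k * ‖B.vertexAvg φ.1 v‖ ^ 2 = ‖B.scaledAvg d hε v (B.testToL2 hε φ)‖ ^ 2 := by
      rw [scaledAvg_eq, vertexAvg_testToL2, norm_mul, mul_pow, norm_real,
        norm_eq_abs, sq_abs, hr]
    change ‖B.scaledAvg d hε v (B.testToL2 hε φ) -
      fiberAvg ε (B.extend d ε φ.1) (Sum.inl v) 0‖ ^ 2 ≤ _ at e2
    have e8 : P * ε * q ≤ P * S := by
      rw [mul_assoc]; exact mul_le_mul_of_nonneg_left (by nlinarith) hP0.le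
    have e9 := vertex_bound hS e2 e8 e3 e4 e5 e6 e7 (hvE v) (mul_le_of_le_one_left hq0 hε1)
    refine (mul_le_mul_of_nonneg_left (h2 v) (by positivity)).trans ?_
    have e10 := mul_le_mul_of_nonneg_left e9 (mul_nonneg hP0.le hε.le)
    rw [pow_succ]
    linarith

lemma exists_estimates : ∃ P : ℝ, 0 < P ∧ ∀ {d ε : ℝ} (hε : 0 < ε), ε ≤ d → d ≤ 1 →
    ∀ x ∈ B.mfdH1 d ε, ∃ (ψ : ℕ → B.testSpace d ε) (g' : GraphL2 G d) (K : Edge G → ℝ → ℂ),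
      TestApprox hε x ψ ∧ Tendsto (fun i => dropDeriv hε (ψ i)) atTop (𝓝 g') ∧
      IsRep (B.dropJ d hε x) g' K ∧ ‖g'‖ ^ 2 ≤ (B.mfdSesqH1 d ε 0 0 0 x x).re ∧
      (∀ a : EdgeEnd G, ‖B.scaledAvg d hε a.vertex x - K a.edge (a.pos d)‖ ^ 2 ≤
        P * ε * (B.mfdSesqH1 d ε 0 0 0 x x).re) ∧
      ‖B.liftJ d hε (B.dropJ d hε x) - x‖ ^ 2 ≤
        P * ε * (‖x‖ ^ 2 + (B.mfdSesqH1 d ε 0 0 0 x x).re) := by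
  obtain ⟨P, hP0, hP⟩ := B.exists_test_estimates
  refine ⟨P, hP0, fun {d ε} hε hεd hd1 x hx => ?_⟩
  have hd : 0 < d := hε.trans_le hεd
  rw [mfdH1_eq hε hεd] at hx
  obtain ⟨ψ, hψ⟩ := hx
  obtain ⟨g', K, hK, hg'⟩ := exists_rep_dropJ hd hε hψ
  have hq := (isFormExtension_mfdSesqH1 hε hεd (B := B) 0 0 0).tendsto_re hψ
  have hg : Tendsto (fun i => B.dropJ d hε (B.testToL2 hε (ψ i))) atTop (𝓝 (B.dropJ d hε x)) :=
    ((B.dropJ d hε).continuous.tendsto x).comp hψ.tendsto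
  refine ⟨ψ, g', K, hψ, hg', hK, ?_, fun a => ?_, ?_⟩
  · exact le_of_tendsto_of_tendsto' (hg'.norm.pow 2) hq fun i => norm_dropDeriv_sq_le hε (ψ i)
  · exact le_of_tendsto_of_tendsto' (((((B.scaledAvg d hε a.vertex).continuous.tendsto x).comp
      hψ.tendsto).sub (IsEdgeRep.tendsto_rep hd (fun i => isRep_dropJ hε (ψ i)) hK hg hg'
        (pos_mem_edgeInterval hd a))).norm.pow 2) (hq.const_mul _)
      fun i => (hP hε hεd hd1 (ψ i)).1 a
  · exact le_of_tendsto_of_tendsto' (((((B.liftJ d hε).continuous.tendsto _).comp hg).sub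
      hψ.tendsto).norm.pow 2) (((hψ.tendsto.norm.pow 2).add hq).const_mul _)
      fun i => (hP hε hεd hd1 (ψ i)).2

end BuildingBlocks
end Estimates

section Corrections

variable {n : ℕ} {G : SimpleGraph (Fin n)} {d : ℝ} {χm χp χo φm φp φo : ℝ → ℝ}

open IsEdgeRep
/-- The combination of functions that live near the ends of the edges, with coefficients `c`. -/
def endComb (φm φp φo : ℝ → ℝ) (c : EdgeEnd G → ℂ) : Edge G → ℝ → ℂ
  | Sum.inl j, s => φo s * c (EdgeEnd.outer j)
  | Sum.inr e, s => φm s * c (EdgeEnd.left e) + φp s * c (EdgeEnd.right e)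

lemma memLp_endComb (hm : Continuous φm) (hp : Continuous φp) (ho : Continuous φo)
    (h0 : ∀ s, 1 < s → φo s = 0) (c : EdgeEnd G → ℂ) (e : Edge G) :
    MemLp (endComb φm φp φo c e) 2 (edgeVol d e) := by
  rcases e with j | e
  · exact memLp_Ici_of_continuous (h := fun s => φo s * c (EdgeEnd.outer j)) (by fun_prop) (R := 1)
      fun s hs => by simp_all
  · exact memLp_Icc_of_continuous (h := fun s => φm s * c (EdgeEnd.left e) +
      φp s * c (EdgeEnd.right e)) (by fun_prop) _ _

lemma norm_endComb_inner_le {M R s : ℝ} (hm : |φm s| ≤ M) (hp : |φp s| ≤ M)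
    {c : EdgeEnd G → ℂ} (hc : ∀ a, ‖c a‖ ^ 2 ≤ R) (e : InnerEdge G) :
    ‖endComb φm φp φo c (Sum.inr e) s‖ ^ 2 ≤ 4 * M ^ 2 * R := by
  have h : ∀ (a : ℝ) (z : ℂ), |a| ≤ M → ‖z‖ ^ 2 ≤ R → ‖a * z‖ ^ 2 ≤ M ^ 2 * R :=
    fun a z ha hz => by
      rw [norm_mul, mul_pow, norm_real, norm_eq_abs]
      gcongr
  have h1 := h _ _ hm (hc (EdgeEnd.left e))
  have h2 := h _ _ hp (hc (EdgeEnd.right e))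
  refine (norm_sq_add_le _ _).trans ?_
  linarith

lemma norm_ofEdges_endComb_le (hd : 0 < d) {Mo M R : ℝ}
    (hm : ∀ s ∈ Icc (-d) d, |φm s| ≤ M) (hp : ∀ s ∈ Icc (-d) d, |φp s| ≤ M)
    (ho : ∀ s, 0 ≤ s → |φo s| ≤ Mo) (h0 : ∀ s, 1 < s → φo s = 0) {c : EdgeEnd G → ℂ}
    (hc : ∀ a, ‖c a‖ ^ 2 ≤ R)
    (hL : ∀ e, MemLp (endComb φm φp φo c e) 2 (edgeVol d e)) :
    ‖ofEdges _ hL‖ ^ 2 ≤ Fintype.card (Edge G) * ((Mo ^ 2 + 8 * d * M ^ 2) * R) := by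
  rw [graph_norm_sq, ← nsmul_eq_mul, ← card_univ]
  refine Finset.sum_le_card_nsmul _ _ _ fun e _ => ?_
  rw [integral_congr_ae ((ofEdges_ae _ hL e).mono fun s hs => congrArg (fun z : ℂ => ‖z‖ ^ 2) hs)]
  rcases e with j | e
  · have hR : 0 ≤ R := (sq_nonneg _).trans (hc (EdgeEnd.outer j))
    have h1 : ∫ s in edgeInterval d (Sum.inl j : Edge G), ‖endComb φm φp φo c (Sum.inl j) s‖ ^ 2 =
        ∫ s in Icc (0 : ℝ) 1, ‖endComb φm φp φo c (Sum.inl j) s‖ ^ 2 :=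
      (setIntegral_eq_of_subset_of_forall_sdiff_eq_zero measurableSet_Ici Icc_subset_Ici_self
        fun s hs => by
          have : 1 < s := not_le.mp fun h => hs.2 ⟨hs.1, h⟩
          simp [endComb, h0 s this])
    rw [h1]
    have h2 := norm_setIntegral_le_of_norm_le_const (μ := volume) (s := Icc (0 : ℝ) 1)
      (f := fun s => ‖endComb φm φp φo c (Sum.inl j) s‖ ^ 2) (C := Mo ^ 2 * R) (by simp)
      fun s hs => by
        rw [norm_of_nonneg (by positivity)]
        change ‖(φo s : ℂ) * _‖ ^ 2 ≤ _
        rw [norm_mul, mul_pow, norm_real, norm_eq_abs]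
        have := ho s hs.1
        bound
    simp only [measureReal_def, Real.volume_Icc, sub_zero, ENNReal.ofReal_one, ENNReal.toReal_one,
      mul_one] at h2
    refine (le_abs_self _).trans (h2.trans ?_)
    bound
  · have hR := (sq_nonneg _).trans (hc (EdgeEnd.left e))
    have h2 := norm_setIntegral_le_of_norm_le_const (μ := volume) (s := Icc (-d) d)
      (f := fun s => ‖endComb φm φp φo c (Sum.inr e) s‖ ^ 2) (C := 4 * M ^ 2 * R) (by simp)
      fun s hs => by
        rw [norm_of_nonneg (by positivity)]
        exact norm_endComb_inner_le (hm s hs) (hp s hs) hc e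
    rw [measureReal_def, Real.volume_Icc, toReal_ofReal (by linarith)] at h2
    refine (le_abs_self _).trans (h2.trans ?_)
    nlinarith

namespace IsCutoff

lemma abs_le_of_deriv {φ : ℝ → ℝ} (hφ : ContDiff ℝ ∞ φ) {D : Set ℝ} (hD : Convex ℝ D) {M L x y : ℝ}
    (hM : 0 ≤ M) (h : ∀ s ∈ D, |deriv φ s| ≤ M) (hx : x ∈ D) (hy : y ∈ D) (h0 : φ x = 0)
    (hL : |y - x| ≤ L) : |φ y| ≤ M * L := by
  have := hD.norm_image_sub_le_of_norm_deriv_le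
    (fun s _ => hφ.differentiable (by simp) s) h hx hy
  rw [h0, sub_zero] at this
  exact this.trans (mul_le_mul_of_nonneg_left hL hM)

lemma abs_m_le (hχ : IsCutoff d χm χp χo) (hd : 0 < d) : ∀ s ∈ Icc (-d) d, |χm s| ≤ 2 :=
  fun s hs => (abs_le_of_deriv hχ.smooth_m (convex_Icc _ _) (by positivity) hχ.deriv_m
    (show (0 : ℝ) ∈ _ from ⟨by linarith, hd.le⟩) hs (hχ.zero_m 0 ⟨le_rfl, hd.le⟩) (L := d)
    (by grind)).trans_eq (by field_simp)

lemma abs_p_le (hχ : IsCutoff d χm χp χo) (hd : 0 < d) : ∀ s ∈ Icc (-d) d, |χp s| ≤ 2 :=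
  fun s hs => (abs_le_of_deriv hχ.smooth_p (convex_Icc _ _) (by positivity) hχ.deriv_p
    (show (0 : ℝ) ∈ _ from ⟨by linarith, hd.le⟩) hs (hχ.zero_p 0 ⟨by linarith, le_rfl⟩) (L := d)
    (by grind)).trans_eq (by field_simp)

lemma abs_o_le (hχ : IsCutoff d χm χp χo) : ∀ s, 0 ≤ s → |χo s| ≤ 2 := fun s hs => by
  rcases le_total s 1 with h | h
  · refine (abs_le_of_deriv hχ.smooth_o (convex_Ici 0) zero_le_two (fun s hs => hχ.deriv_o s hs)
      (mem_Ici.mpr zero_le_one) hs (hχ.zero_o 1 le_rfl) ?_).trans_eq (mul_one 2)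
    grind
  · rw [hχ.zero_o s h]; simp

lemma deriv_o_eq_zero (hχ : IsCutoff d χm χp χo) : ∀ s, 1 < s → deriv χo s = 0 := fun s hs => by
  rw [EventuallyEq.deriv_eq (f := fun _ => 0), deriv_const]
  filter_upwards [lt_mem_nhds hs] with t ht using hχ.zero_o t ht.le

lemma memLp (hχ : IsCutoff d χm χp χo) (c : EdgeEnd G → ℂ) (e : Edge G) :
    MemLp (endComb χm χp χo c e) 2 (edgeVol d e) :=
  memLp_endComb hχ.smooth_m.continuous hχ.smooth_p.continuous hχ.smooth_o.continuous
    (fun s hs => hχ.zero_o s hs.le) c e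

lemma memLp_deriv (hχ : IsCutoff d χm χp χo) (c : EdgeEnd G → ℂ) (e : Edge G) :
    MemLp (endComb (deriv χm) (deriv χp) (deriv χo) c e) 2 (edgeVol d e) :=
  memLp_endComb (hχ.smooth_m.continuous_deriv (by simp)) (hχ.smooth_p.continuous_deriv (by simp))
    (hχ.smooth_o.continuous_deriv (by simp)) hχ.deriv_o_eq_zero c e

/-- The corrections near the ends of the edges. -/
def corr (hχ : IsCutoff d χm χp χo) : (EdgeEnd G → ℂ) →ₗ[ℂ] GraphL2 G d where
  toFun c := ofEdges _ (hχ.memLp c)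
  map_add' c c' := graphL2_ext fun e => by
    filter_upwards [ofEdges_ae _ (hχ.memLp c) e, ofEdges_ae _ (hχ.memLp c') e,
      ofEdges_ae _ (hχ.memLp (c + c')) e,
      graphL2_add_ae (ofEdges _ (hχ.memLp c)) (ofEdges _ (hχ.memLp c')) e] with s h1 h2 h3 h4
    rw [h3, h4, h1, h2]
    rcases e with j | e <;> simp only [endComb, Pi.add_apply] <;> ring
  map_smul' a c := graphL2_ext fun e => by
    filter_upwards [ofEdges_ae _ (hχ.memLp c) e, ofEdges_ae _ (hχ.memLp (a • c)) e,
      graphL2_smul_ae a (ofEdges _ (hχ.memLp c)) e] with s h1 h2 h3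
    rw [h2, RingHom.id_apply, h3, h1]
    rcases e with j | e <;> simp only [endComb, Pi.smul_apply, smul_eq_mul] <;> ring

/-- The derivative of the corrections. -/
def corrDeriv (hχ : IsCutoff d χm χp χo) (c : EdgeEnd G → ℂ) : GraphL2 G d :=
  ofEdges _ (hχ.memLp_deriv c)

lemma isRep_corr (hχ : IsCutoff d χm χp χo) (c : EdgeEnd G → ℂ) :
    IsRep (hχ.corr c) (hχ.corrDeriv c) (endComb χm χp χo c) := by
  have hder : ∀ {φ : ℝ → ℝ}, ContDiff ℝ ∞ φ → ∀ (z : ℂ) s,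
      HasDerivAt (fun s => (φ s) * z) (deriv φ s * z) s := fun h z s =>
    ((h.differentiable (by simp) s).hasDerivAt.ofReal_comp).mul_const z
  refine IsEdgeRep.of_hasDerivAt (hχ.memLp c) (hχ.memLp_deriv c) fun e s _ => ?_
  rcases e with j | e
  · exact hder hχ.smooth_o _ s
  · exact (hder hχ.smooth_m _ s).add (hder hχ.smooth_p _ s)

lemma norm_corr_sq_le (hχ : IsCutoff d χm χp χo) (hd : 0 < d) (hd1 : d ≤ 1) {R : ℝ}
    {c : EdgeEnd G → ℂ} (hR : 0 ≤ R) (hc : ∀ a, ‖c a‖ ^ 2 ≤ R) :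
    ‖hχ.corr c‖ ^ 2 ≤ 36 * Fintype.card (Edge G) * R := by
  refine (norm_ofEdges_endComb_le hd (hχ.abs_m_le hd) (hχ.abs_p_le hd)
    hχ.abs_o_le (fun s hs => hχ.zero_o s hs.le) hc (hχ.memLp c)).trans ?_
  have : (2 ^ 2 + 8 * d * 2 ^ 2) * R ≤ 36 * R := by bound
  nlinarith

lemma norm_corrDeriv_sq_le (hχ : IsCutoff d χm χp χo) (hd : 0 < d) (hd1 : d ≤ 1) {R : ℝ}
    {c : EdgeEnd G → ℂ} (hR : 0 ≤ R) (hc : ∀ a, ‖c a‖ ^ 2 ≤ R) :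
    ‖hχ.corrDeriv c‖ ^ 2 ≤ 36 * Fintype.card (Edge G) * R / d := by
  refine (norm_ofEdges_endComb_le hd hχ.deriv_m hχ.deriv_p
    hχ.deriv_o hχ.deriv_o_eq_zero hc (hχ.memLp_deriv c)).trans ?_
  have : (2 ^ 2 + 8 * d * (2 / d) ^ 2) * R ≤ 36 / d * R := by
    refine mul_le_mul_of_nonneg_right ?_ hR
    rw [le_div_iff₀ hd]
    field_simp
    linarith
  refine (mul_le_mul_of_nonneg_left this (Nat.cast_nonneg _)).trans_eq (by ring)

end IsCutoff

section GraphEstimates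

variable {f f' g g' : GraphL2 G d} {F K : Edge G → ℝ → ℂ}

lemma endValue_add (hd : 0 < d) (hf : IsRep f f' F) (hg : IsRep g g' K) (a : EdgeEnd G) :
    endValue (f + g) a = endValue f a + endValue g a := by
  rw [endValue_eq hd (hf.add hg), endValue_eq hd hf, endValue_eq hd hg]; rfl

lemma endValue_smul (hd : 0 < d) (hf : IsRep f f' F) (c : ℂ) (a : EdgeEnd G) :
    endValue (c • f) a = c * endValue f a := by
  rw [endValue_eq hd (hf.smul c), endValue_eq hd hf]; rfl

/-- The norm of the multiplication by the magnetic potential on functions bounded on the inner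
edges. -/
lemma norm_potMul_sq_le_of_bounded (hd : 0 < d) {A : InnerEdge G → ℝ} {a₀ R : ℝ}
    (hA : ∀ e, |A e| ≤ a₀ / d) (hf : IsRep f f' F)
    (hF : ∀ (e : InnerEdge G), ∀ s ∈ Icc (-d) d, ‖F (Sum.inr e) s‖ ^ 2 ≤ R) (hR : 0 ≤ R) :
    ‖potMul A f‖ ^ 2 ≤ 2 * Fintype.card (Edge G) * a₀ ^ 2 * R / d := by
  have h : 2 * Fintype.card (Edge G) * a₀ ^ 2 * R / d =
      (Finset.univ : Finset (Edge G)).card • (2 * a₀ ^ 2 * R / d) := by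
    grind
  rw [graph_norm_sq, h]
  refine Finset.sum_le_card_nsmul _ _ _ fun e _ => ?_
  rw [integral_congr_ae (g := fun s => ‖(edgePotential A e : ℂ) * F e s‖ ^ 2)]
  · rcases e with j | e
    · simp only [edgePotential, Sum.elim_inl, Complex.ofReal_zero, zero_mul, norm_zero]
      simp only [ne_eq, OfNat.ofNat_ne_zero, not_false_eq_true, zero_pow, integral_zero]
      positivity
    · have h2 := norm_setIntegral_le_of_norm_le_const (μ := volume) (s := Icc (-d) d)
        (f := fun s => ‖(edgePotential A (Sum.inr e) : ℂ) * F (Sum.inr e) s‖ ^ 2)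
        (C := (a₀ / d) ^ 2 * R) (by simp) fun s hs => by
          rw [norm_of_nonneg (by positivity), norm_mul, mul_pow, norm_real,
            norm_eq_abs]
          bound
      rw [measureReal_def, Real.volume_Icc, toReal_ofReal (by linarith)] at h2
      refine (le_abs_self _).trans (h2.trans_eq ?_)
      grind
  · filter_upwards [potMul_ae A f e, hf.ae_eq e] with s h1 h2
    simp_all

/-- Functions in `H¹(Γ)` are bounded by their norm, uniformly in the length of the edges. -/
lemma norm_sq_le_of_continuous (hd : 0 < d) (hd1 : d ≤ 1) (hf : IsRep f f' F) {c : Fin n → ℂ}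
    (hc : ∀ a : EdgeEnd G, F a.edge (a.pos d) = c a.vertex) (e : InnerEdge G) :
    ∀ s ∈ Icc (-d) d, ‖F (Sum.inr e) s‖ ^ 2 ≤ 8 * (‖f‖ ^ 2 + ‖f'‖ ^ 2) := fun s hs => by
  have h1 := hf.norm_outer_sq_le e.fst
  have e1 : F (Sum.inl e.fst) 0 = F (Sum.inr e) (-d) :=
    (hc (EdgeEnd.outer e.fst)).trans (hc (EdgeEnd.left e)).symm
  rw [e1] at h1
  have h2 := hf.norm_sub_sq_le (e := Sum.inr e) (left_mem_Icc.mpr (by linarith)) hs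
  have h3 : |s - -d| ≤ 2 := abs_le.mpr ⟨by grind, by grind⟩
  have h4 := norm_sq_add_le (F (Sum.inr e) s - F (Sum.inr e) (-d)) (F (Sum.inr e) (-d))
  rw [sub_add_cancel] at h4
  nlinarith

/-- The mean over the middle of an edge compared with the value at the midpoint. -/
lemma norm_mid_sub_le (hd : 0 < d) (hd1 : d ≤ 1) {ε : ℝ} (hε : 0 < ε) (hεd : ε ≤ d)
    (hf : IsRep f f' F) (hg : IsRep g g' K) (e : InnerEdge G) :
    ‖K (Sum.inr e) 0 * conj (F (Sum.inr e) 0) - ((1 / (2 * ε) : ℝ) : ℂ) *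
      ∫ s in edgeInterval d (Sum.inr e : Edge G),
        conj ((Ioc (-ε) ε).indicator (fun s => f ⟨Sum.inr e, s⟩) s) * g ⟨Sum.inr e, s⟩‖ ≤
      3 * √(ε / d) * √(‖g‖ ^ 2 + ‖g'‖ ^ 2) * √(‖f‖ ^ 2 + ‖f'‖ ^ 2) := by
  set Φ := F (Sum.inr e)
  set κ := K (Sum.inr e)
  have hsub : Icc (-ε) ε ⊆ Icc (-d) d := Icc_subset_Icc (by linarith) hεd
  have hI : ∫ s in edgeInterval d (Sum.inr e),
      conj ((Ioc (-ε) ε).indicator (fun s => f ⟨Sum.inr e, s⟩) s) * g ⟨Sum.inr e, s⟩ =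
      ∫ s in (-ε)..ε, κ s * conj (Φ s) := by
    have hs := inter_eq_right.mpr
      (Ioc_subset_Icc_self.trans hsub : Ioc (-ε) ε ⊆ edgeInterval d (Sum.inr e))
    refine Eq.trans ?_ ((setIntegral_indicator measurableSet_Ioc).trans
      ((congrArg (fun t => ∫ s in t, κ s * conj (Φ s)) hs).trans
        (intervalIntegral.integral_of_le (by linarith)).symm))
    refine integral_congr_ae ?_
    filter_upwards [hf.ae_eq (Sum.inr e), hg.ae_eq (Sum.inr e)] with s h1 h2
    rw [h2]
    by_cases hs : s ∈ Ioc (-ε) ε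
    · rw [indicator_of_mem hs, indicator_of_mem hs, h1, mul_comm]
    simp_all
  have hcont : ContinuousOn (fun s => κ s * conj (Φ s)) (uIcc (-ε) ε) := by
    rw [uIcc_of_le (by linarith)]
    exact ((hg.continuousOn _).mul (Complex.continuous_conj.comp_continuousOn
      (hf.continuousOn _))).mono hsub
  have hD : κ 0 * conj (Φ 0) - ((1 / (2 * ε) : ℝ) : ℂ) * ∫ s in (-ε)..ε, κ s * conj (Φ s) =
      ((1 / (2 * ε) : ℝ) : ℂ) * ∫ s in (-ε)..ε, (κ 0 * conj (Φ 0) - κ s * conj (Φ s)) := by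
    rw [intervalIntegral.integral_sub intervalIntegrable_const hcont.intervalIntegrable,
      intervalIntegral.integral_const, mul_sub, real_smul, ← mul_assoc,
      ← Complex.ofReal_mul, show 1 / (2 * ε) * (ε - -ε) = 1 by field_simp; ring,
      Complex.ofReal_one, one_mul]
  set a := √(‖g‖ ^ 2 + ‖g'‖ ^ 2)
  set b := √(‖f‖ ^ 2 + ‖f'‖ ^ 2)
  have key : ∀ {h h' : GraphL2 G d} {H : Edge G → ℝ → ℂ}, IsRep h h' H → ∀ s ∈ Icc (-ε) ε,
      ‖H (Sum.inr e) s - H (Sum.inr e) 0‖ ≤ √ε * √(‖h‖ ^ 2 + ‖h'‖ ^ 2) ∧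
      ‖H (Sum.inr e) s‖ ≤ √(2 / d) * √(‖h‖ ^ 2 + ‖h'‖ ^ 2) := fun {h h' H} hH s hs => by
    rw [← Real.sqrt_mul hε.le, ← Real.sqrt_mul (by positivity)]
    refine ⟨le_sqrt_of_sq_le ?_, le_sqrt_of_sq_le ?_⟩
    · have h1 := hH.norm_sub_sq_le (inner_zero_mem hd e) (hsub hs)
      rw [sub_zero] at h1
      have h2 : |s| ≤ ε := abs_le.mpr hs
      nlinarith
    · refine (hH.norm_sq_le hd le_rfl (hsub hs)).trans ?_
      rw [mul_add]
      refine add_le_add_right (mul_le_mul_of_nonneg_right ?_ (by positivity)) _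
      rw [le_div_iff₀ hd]
      nlinarith
  have h0 : 0 ∈ Icc (-ε) ε := ⟨by linarith, hε.le⟩
  have hbd : ∀ s ∈ uIoc (-ε) ε, ‖κ 0 * conj (Φ 0) - κ s * conj (Φ s)‖ ≤
      2 * (√ε * √(2 / d)) * (a * b) := fun s hs => by
    rw [uIoc_of_le (by linarith)] at hs
    have hs' := Ioc_subset_Icc_self hs
    have e1 : κ 0 * conj (Φ 0) - κ s * conj (Φ s) =
      -((κ s - κ 0) * conj (Φ 0) + κ s * conj (Φ s - Φ 0)) := by grind
    rw [e1, norm_neg]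
    refine (norm_add_le _ _).trans ?_
    rw [norm_mul, norm_mul, RCLike.norm_conj, RCLike.norm_conj]
    refine (add_le_add (mul_le_mul (key hg s hs').1 (key hf 0 h0).2 (norm_nonneg _) (by positivity))
      (mul_le_mul (key hg s hs').2 (key hf s hs').1 (norm_nonneg _) (by positivity))).trans_eq ?_
    ring
  rw [hI, hD, norm_mul, norm_real, norm_of_nonneg (by positivity)]
  have h2 := mul_le_mul_of_nonneg_left
    (intervalIntegral.norm_integral_le_of_norm_le_const hbd) (by positivity : 0 ≤ 1 / (2 * ε))
  refine h2.trans ?_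
  rw [sub_neg_eq_add, abs_of_pos (by linarith), show 1 / (2 * ε) * (2 * (√ε * √(2 / d)) * (a * b) *
    (ε + ε)) = 2 * (√ε * √(2 / d)) * (a * b) by field_simp; ring, ← Real.sqrt_mul hε.le,
    show ε * (2 / d) = 2 * (ε / d) by ring, Real.sqrt_mul zero_le_two, mul_assoc _ a b]
  have h3 : √2 ≤ 3 / 2 := Real.sqrt_le_iff.mpr ⟨by norm_num, by norm_num⟩
  have h4 : 0 ≤ √(ε / d) * (a * b) := by positivity
  nlinarith

end GraphEstimates
end Corrections

section Identification

lemma abs_le_maxW {n : ℕ} {G : SimpleGraph (Fin n)} (wE : InnerEdge G → ℝ) (wV : Fin n → ℝ) :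
    0 ≤ maxW wE wV ∧ ∀ e, 3 * |wE e| ≤ maxW wE wV :=
  ⟨mul_nonneg zero_le_three (le_max_of_le_left (Real.iSup_nonneg fun _ => abs_nonneg _)),
    fun e => mul_le_mul_of_nonneg_left (le_max_of_le_left
      (le_ciSup (f := fun e => |wE e|) (finite_range _).bddAbove e)) zero_le_three⟩

namespace BuildingBlocks
open IsEdgeRep

variable {n k : ℕ} {G : SimpleGraph (Fin n)} {B : BuildingBlocks.{u} G k} {d ε : ℝ}
  {χm χp χo : ℝ → ℝ}

lemma exists_rep_of_mem (hd : 0 < d) (hε : 0 < ε) {x : B.MfdL2 d ε}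
    (hx : x ∈ closureDom (isClosable_testForm (B := B) (d := d) hε)) :
    ∃ g' K, IsRep (B.dropJ d hε x) g' K := by
  obtain ⟨ψ, hψ⟩ := hx
  obtain ⟨g', K, hK, -⟩ := exists_rep_dropJ hd hε hψ
  exact ⟨g', K, hK⟩

variable (B d) in
/-- The difference between the scaled average over the vertex manifold and the boundary value. -/
def defect (hε : 0 < ε) (x : B.MfdL2 d ε) (a : EdgeEnd G) : ℂ :=
  B.scaledAvg d hε a.vertex x - endValue (B.dropJ d hε x) a

variable (B) in
/-- The operator `J₁`. -/
def liftOne (hd : 0 < d) (hε : 0 < ε) : GraphL2 G d →ₗ.[ℂ] B.MfdL2 d ε where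
  domain := graphH1Sub G d
  toFun :=
    { toFun f := B.lift hε (f, vertexValue (f : GraphL2 G d))
      map_add' f g := by
        obtain ⟨f', F, hf, -⟩ := mem_graphH1.mp f.2
        obtain ⟨g', K, hg, -⟩ := mem_graphH1.mp g.2
        rw [← map_add]
        exact congrArg (fun c => B.lift hε (f.1 + g.1, c))
          (funext fun v => endValue_add hd hf hg _)
      map_smul' c f := by
        obtain ⟨f', F, hf, -⟩ := mem_graphH1.mp f.2
        rw [← map_smul]
        exact congrArg (fun z => B.lift hε (c • f.1, z))
          (funext fun v => endValue_smul hd hf c _) }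

variable (B) in
/-- The operator `J₁'`. -/
def dropOne (hχ : IsCutoff d χm χp χo) (hd : 0 < d) (hε : 0 < ε) :
    B.MfdL2 d ε →ₗ.[ℂ] GraphL2 G d where
  domain := closureDom (isClosable_testForm (B := B) (d := d) hε)
  toFun :=
    { toFun x := B.dropJ d hε x.1 + hχ.corr (B.defect d hε x.1)
      map_add' x y := by
        obtain ⟨f', F, hf⟩ := exists_rep_of_mem hd hε x.2
        obtain ⟨g', K, hg⟩ := exists_rep_of_mem hd hε y.2
        have : B.defect d hε (x.1 + y.1) = B.defect d hε x.1 + B.defect d hε y.1 :=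
          funext fun a => by
            simp only [defect, Pi.add_apply, map_add, endValue_add hd hf hg]; ring
        rw [Submodule.coe_add, this, map_add, map_add]
        abel
      map_smul' c x := by
        obtain ⟨f', F, hf⟩ := exists_rep_of_mem hd hε x.2
        have : B.defect d hε (c • x.1) = c • B.defect d hε x.1 :=
          funext fun a => by
            simp only [defect, Pi.smul_apply, map_smul, endValue_smul hd hf, smul_eq_mul]; ring
        rw [Submodule.coe_smul, this, map_smul, map_smul, RingHom.id_apply, smul_add] }

lemma isLift₁_liftOne (hd : 0 < d) (hε : 0 < ε) : B.IsLift₁ d ε (B.liftOne hd hε) :=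
  ⟨rfl, fun f => (lift_coeFn hε _).trans <| .of_forall fun z => by
    rcases z with ⟨e, s, y⟩ | ⟨v, x⟩ <;> rfl⟩

lemma isProj₁_dropOne (hχ : IsCutoff d χm χp χo) (hd : 0 < d) (hε : 0 < ε) (hεd : ε ≤ d) :
    B.IsProj₁ d ε χm χp χo (B.liftJ d hε) (B.dropOne hχ hd hε) := by
  refine ⟨(mfdH1_eq (B := B) hε hεd).symm, fun x => ?_⟩
  have hc : ∀ a, B.defect d hε x.1 a = ((ε ^ ((k : ℝ) / 2) : ℝ) : ℂ) *
      B.vertexAvg x.1 a.vertex - endValue (B.dropJ d hε x.1) a := fun a =>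
    congrArg (fun z => z - endValue (B.dropJ d hε x.1) a) (scaledAvg_eq hε _ _)
  refine ae_graph_iff.mpr fun e => ?_
  filter_upwards [graphL2_add_ae (B.dropJ d hε x.1) (hχ.corr (B.defect d hε x.1)) e,
    ofEdges_ae _ (hχ.memLp (B.defect d hε x.1)) e] with s h1 h2
  refine h1.trans ((congrArg (fun z => B.dropJ d hε x.1 ⟨e, s⟩ + z) h2).trans ?_)
  rcases e with j | e
  · exact congrArg (fun z => B.dropJ d hε x.1 ⟨Sum.inl j, s⟩ + χo s * z) (hc _)
  · refine Eq.trans ?_ (add_assoc _ _ _).symm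
    exact congrArg₂ (fun z w => B.dropJ d hε x.1 ⟨Sum.inr e, s⟩ + (χm s * z + χp s * w)) (hc _) (hc _)

/-- The defining properties of the operators on the form domains, on representatives. -/
lemma exists_rep_dropOne (hχ : IsCutoff d χm χp χo) (hd : 0 < d) (hε : 0 < ε) {x : B.MfdL2 d ε}
    {g' : GraphL2 G d} {K : Edge G → ℝ → ℂ} (hK : IsRep (B.dropJ d hε x) g' K) :
    (∀ a : EdgeEnd G, (K + endComb χm χp χo (B.defect d hε x)) a.edge (a.pos d) =
      B.scaledAvg d hε a.vertex x) ∧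
    ∀ e, (K + endComb χm χp χo (B.defect d hε x)) (Sum.inr e) 0 = K (Sum.inr e) 0 := by
  refine ⟨fun a => ?_, fun e => ?_⟩
  · have h := endValue_eq hd hK a
    change K a.edge (a.pos d) + endComb χm χp χo (B.defect d hε x) a.edge (a.pos d) = _
    suffices h' : endComb χm χp χo (B.defect d hε x) a.edge (a.pos d) = B.defect d hε x a by
      rw [h', defect, h]; ring
    rcases a with j | e | e
    · simp [endComb, EdgeEnd.edge, EdgeEnd.pos, hχ.one_o]
    · simp [endComb, EdgeEnd.edge, EdgeEnd.pos, hχ.one_m,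
        hχ.zero_p (-d) ⟨le_rfl, by linarith⟩]
    · simp [endComb, EdgeEnd.edge, EdgeEnd.pos, hχ.one_p, hχ.zero_m d ⟨hd.le, le_rfl⟩]
  · change K (Sum.inr e) 0 + endComb χm χp χo (B.defect d hε x) (Sum.inr e) 0 = _
    simp [endComb, hχ.zero_m 0 ⟨le_rfl, hd.le⟩, hχ.zero_p 0 ⟨by linarith, le_rfl⟩]

lemma norm_liftJ_sub_lift_sq (hε : 0 < ε) (f : GraphL2 G d) (c : Fin n → ℂ) :
    ‖B.liftJ d hε f - B.lift hε (f, c)‖ ^ 2 = ∑ v, ε * B.vertexVol v * ‖c v‖ ^ 2 := by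
  have h : B.liftJ d hε f - B.lift hε (f, c) = B.lift hε (0, -c) := by
    change B.lift hε (f, 0) - _ = _
    rw [← map_sub, Prod.mk_sub_mk, sub_self, zero_sub]
  rw [h, norm_lift_sq, norm_zero]
  simp

/-- The forms are close on the form domains. -/
lemma norm_form_sub_le (hχ : IsCutoff d χm χp χo) (hd : 0 < d) (hd1 : d ≤ 1) (hε : 0 < ε)
    (hεd : ε ≤ d) {x : B.MfdL2 d ε} {ψ : ℕ → B.testSpace d ε} (hx : TestApprox hε x ψ)
    {g' : GraphL2 G d} {K : Edge G → ℝ → ℂ}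
    (hg' : Tendsto (fun i => dropDeriv hε (ψ i)) atTop (𝓝 g')) (hK : IsRep (B.dropJ d hε x) g' K)
    {f f' : GraphL2 G d} {F : Edge G → ℝ → ℂ} (hf : IsRep f f' F) {c : Fin n → ℂ}
    (hc : ∀ a : EdgeEnd G, F a.edge (a.pos d) = c a.vertex)
    {A : InnerEdge G → ℝ} {a₀ : ℝ} (hA : ∀ e, |A e| ≤ a₀ / d) (wE : InnerEdge G → ℝ)
    (wV : Fin n → ℝ) {P Q : ℝ} (hP : 0 ≤ P) (hQ : 0 ≤ Q)
    (hgQ : ‖B.dropJ d hε x‖ ^ 2 + ‖g'‖ ^ 2 ≤ Q) (hdef : ∀ a, ‖B.defect d hε x a‖ ^ 2 ≤ P * ε * Q) :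
    ‖graphSesq G d A wE wV (B.dropJ d hε x + hχ.corr (B.defect d hε x)) f -
        B.mfdSesqH1 d ε A wE wV x (B.lift hε (f, c))‖ ≤
      (√(2 + 32 * Fintype.card (Edge G) * a₀ ^ 2) *
        √((72 + 64 * a₀ ^ 2) * Fintype.card (Edge G) * P) * (√ε / d) +
      Fintype.card (Edge G) * √(ε / d) * maxW wE wV) * √Q * √(‖f‖ ^ 2 + ‖f'‖ ^ 2) := by
  set N : ℝ := (Fintype.card (Edge G) : ℝ) with hN
  set D := ‖f‖ ^ 2 + ‖f'‖ ^ 2 with hD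
  have hD0 : 0 ≤ D := by positivity
  set e₀ := B.defect d hε x with he₀
  set g := B.dropJ d hε x with hg
  have hR : 0 ≤ P * ε * Q := by positivity
  obtain ⟨h1, h2⟩ := exists_rep_dropOne hχ hd hε hK
  rw [mfdSesqH1_lift hε hεd hx hg' hf hc, graphSesq_eq hd (hK.add (hχ.isRep_corr e₀)) hf]
  have hV : ∑ v, (wV v : ℂ) * ((K + endComb χm χp χo e₀) (Sum.inl v) 0 * conj (F (Sum.inl v) 0)) =
      ∑ v, wV v * (B.scaledAvg d hε v x * conj (c v)) :=
    sum_congr rfl fun v _ => by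
      have e1 := h1 (EdgeEnd.outer v)
      have e2 := hc (EdgeEnd.outer v)
      simp only [EdgeEnd.edge, EdgeEnd.pos, EdgeEnd.vertex] at e1 e2
      rw [e1, e2]
  have hEq : inner ℂ (f' + potMul A f) (g' + hχ.corrDeriv e₀ + potMul A (g + hχ.corr e₀)) +
      ∑ e, (wE e : ℂ) * ((K + endComb χm χp χo e₀) (Sum.inr e) 0 * conj (F (Sum.inr e) 0)) +
      ∑ v, (wV v : ℂ) * ((K + endComb χm χp χo e₀) (Sum.inl v) 0 * conj (F (Sum.inl v) 0)) -
      (inner ℂ (f' + potMul A f) (g' + potMul A g) + inner ℂ f (midMul ε wE g) +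
        ∑ v, wV v * (B.scaledAvg d hε v x * conj (c v))) =
      inner ℂ (f' + potMul A f) (hχ.corrDeriv e₀ + potMul A (hχ.corr e₀)) +
      ∑ e, (wE e : ℂ) * (K (Sum.inr e) 0 * conj (F (Sum.inr e) 0) - ((1 / (2 * ε) : ℝ) : ℂ) *
        ∫ s in edgeInterval d (Sum.inr e : Edge G),
          conj ((Ioc (-ε) ε).indicator (fun s => f ⟨Sum.inr e, s⟩) s) * g ⟨Sum.inr e, s⟩) := by
    rw [hV, inner_midMul, map_add, show g' + hχ.corrDeriv e₀ + (potMul A g + potMul A (hχ.corr e₀)) =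
      (g' + potMul A g) + (hχ.corrDeriv e₀ + potMul A (hχ.corr e₀)) by abel, inner_add_right]
    rw [sum_congr rfl fun e _ => congrArg (fun z : ℂ => (wE e : ℂ) * (z * _)) (h2 e)]
    simp only [mul_sub, Finset.sum_sub_distrib, ← mul_assoc, ← Complex.ofReal_mul, mul_one_div]
    ring
  rw [hEq]
  have hfF : ‖f' + potMul A f‖ ≤ √(2 + 32 * N * a₀ ^ 2) * √D / √d := by
    rw [← Real.sqrt_mul (by positivity), ← Real.sqrt_div (by positivity)]
    refine le_sqrt_of_sq_le ?_
    have e1 := norm_potMul_sq_le_of_bounded hd hA hf (norm_sq_le_of_continuous hd hd1 hf hc)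
      (by positivity)
    have e2 : ‖f'‖ ^ 2 ≤ D / d :=
      (le_add_of_nonneg_left (sq_nonneg _)).trans (le_div_self hD0 hd hd1)
    refine (norm_sq_add_le _ _).trans ((add_le_add (mul_le_mul_of_nonneg_left e2 zero_le_two)
      (mul_le_mul_of_nonneg_left e1 zero_le_two)).trans_eq ?_)
    ring
  have hcC : ‖hχ.corrDeriv e₀ + potMul A (hχ.corr e₀)‖ ≤
      √((72 + 64 * a₀ ^ 2) * N * P) * (√ε * √Q) / √d := by
    rw [← Real.sqrt_mul hε.le, ← Real.sqrt_mul (by positivity), ← Real.sqrt_div (by positivity)]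
    refine le_sqrt_of_sq_le ?_
    have e1 := norm_potMul_sq_le_of_bounded hd hA (hχ.isRep_corr e₀) (fun e s hs =>
      norm_endComb_inner_le (hχ.abs_m_le hd s hs) (hχ.abs_p_le hd s hs) hdef e) (by positivity)
    have e2 := hχ.norm_corrDeriv_sq_le hd hd1 hR hdef
    refine (norm_sq_add_le _ _).trans ((add_le_add (mul_le_mul_of_nonneg_left e2 zero_le_two)
      (mul_le_mul_of_nonneg_left e1 zero_le_two)).trans_eq ?_)
    ring
  refine (norm_add_le _ _).trans ?_
  rw [add_mul, add_mul]
  refine add_le_add ?_ ?_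
  · refine (norm_inner_le_norm _ _).trans ((mul_le_mul hfF hcC (norm_nonneg _)
      (by positivity)).trans_eq ?_)
    have : √d * √d = d := Real.mul_self_sqrt hd.le
    rw [div_mul_div_comm, this]
    ring
  · have hw := abs_le_maxW wE wV
    have hE : (Fintype.card (InnerEdge G) : ℝ) ≤ N := by
      rw [hN, Fintype.card_sum]; push_cast; exact le_add_of_nonneg_left (by positivity)
    have e1 := norm_sum_le_of_le (Finset.univ : Finset (InnerEdge G)) fun e _ => (norm_mul_le _ _).trans
      (mul_le_mul_of_nonneg_left (norm_mid_sub_le hd hd1 hε hεd hf hK e) (norm_nonneg (wE e : ℂ)))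
    refine e1.trans ?_
    have e2 : ∀ e : InnerEdge G, ‖(wE e : ℂ)‖ * (3 * √(ε / d) * √(‖g‖ ^ 2 + ‖g'‖ ^ 2) * √D) ≤
        √(ε / d) * maxW wE wV * √Q * √D := fun e => by
      rw [norm_real, norm_eq_abs]
      have h4 := Real.sqrt_le_sqrt hgQ
      have h5 : 0 ≤ √(ε / d) * √D := by positivity
      calc |wE e| * (3 * √(ε / d) * √(‖g‖ ^ 2 + ‖g'‖ ^ 2) * √D) =
          (3 * |wE e|) * √(‖g‖ ^ 2 + ‖g'‖ ^ 2) * (√(ε / d) * √D) := by ring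
        _ ≤ maxW wE wV * √Q * (√(ε / d) * √D) := mul_le_mul_of_nonneg_right
            (mul_le_mul (hw.2 e) h4 (sqrt_nonneg _) hw.1) h5
        _ = _ := by ring
    refine (Finset.sum_le_card_nsmul _ _ _ fun e _ => e2 e).trans ?_
    rw [nsmul_eq_mul, card_univ]
    have h6 : 0 ≤ √(ε / d) * maxW wE wV * √Q * √D := by
      have := hw.1
      positivity
    refine (mul_le_mul_of_nonneg_right hE h6).trans_eq (by ring)

end BuildingBlocks
end Identification

section Main

/-- There are cut-off functions. -/
lemma exists_isCutoff {d : ℝ} (hd : 0 < d) : ∃ χm χp χo, IsCutoff d χm χp χo := by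
  obtain ⟨χ, hχs, h0, h1, hbd⟩ := exists_smooth_cutoff
  have haff : ∀ r : ℝ, |r| = 1 → ∀ s, |deriv (fun s => χ (r / d * s + 1)) s| ≤ 2 / d :=
    fun r hr s => by
      have := (hχs.differentiable (by simp) (r / d * s + 1)).hasDerivAt.comp s
        (((hasDerivAt_id s).const_mul (r / d)).add_const 1)
      change HasDerivAt (fun s => χ (r / d * s + 1)) _ s at this
      rw [this.deriv, mul_one, abs_mul, abs_div, hr, abs_of_pos hd, mul_one_div]
      exact div_le_div_of_nonneg_right (hbd _) hd.le
  refine ⟨fun s => χ (1 / d * s + 1), fun s => χ (-1 / d * s + 1), χ, ?_, ?_, hχs, ?_, ?_, h0 0 le_rfl,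
    fun s _ => haff 1 (by simp) s, fun s _ => haff (-1) (by simp) s, fun s _ => hbd s,
    fun s hs => h1 _ ?_, fun s hs => h1 _ ?_, h1⟩
  · fun_prop
  · fun_prop
  · rw [← h0 0 le_rfl]; congr 1; field_simp; ring
  · rw [← h0 0 le_rfl]; congr 1; field_simp; ring
  · have : 0 ≤ 1 / d * s := mul_nonneg (by positivity) hs.1
    linarith
  · have : 0 ≤ 1 / d * -s := mul_nonneg (by positivity) (by linarith [hs.2])
    have e : -1 / d * s = 1 / d * -s := by ring
    linarith

namespace BuildingBlocks

variable {n k : ℕ} {G : SimpleGraph (Fin n)} (B : BuildingBlocks.{u} G k)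

set_option maxHeartbeats 1000000 in
lemma exists_isQuasiUnitary (a₀ : ℝ) : ∃ C : ℝ, 0 < C ∧ ∀ {d ε : ℝ} (hd : 0 < d) (_ : d ≤ 1)
    (hε : 0 < ε), ε ≤ d → ∀ (A wE : InnerEdge G → ℝ) (wV : Fin n → ℝ), (∀ e, |A e| ≤ a₀ / d) →
    ∀ {χm χp χo : ℝ → ℝ} (hχ : IsCutoff d χm χp χo),
      IsQuasiUnitary (graphForm G d A wE wV) (B.mfdForm d ε A wE wV)
        (C * ((ε / d) ^ (1 / 2 : ℝ) * (maxW wE wV + 1)) + C * (ε ^ (1 / 2 : ℝ) / d))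
        (B.liftJ d hε) (B.liftOne hd hε) (B.dropOne hχ hd hε) := by
  obtain ⟨P, hP0, hP⟩ := B.exists_estimates
  set N : ℝ := (Fintype.card (Edge G) : ℝ) with hN
  set C₁ := √(2 + 32 * N * a₀ ^ 2) * √((72 + 64 * a₀ ^ 2) * N * P) with hC₁
  set V := ∑ v, B.vertexVol v with hV
  have hN0 : 0 ≤ N := by positivity
  have hC₁0 : 0 ≤ C₁ := by positivity
  have hV0 : 0 ≤ V := sum_nonneg fun v _ => (B.vertexVol_pos v).le
  set C := 1 + 2 * V + 36 * N * P + P + C₁ + N with hC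
  have hNP : 0 ≤ 36 * N * P := by positivity
  have hC1 : 1 ≤ C := by linarith
  refine ⟨C, by linarith, fun {d ε} hd hd1 hε hεd A wE wV hA χm χp χo hχ => ?_⟩
  have hw := (abs_le_maxW wE wV).1
  rw [← Real.sqrt_eq_rpow, ← Real.sqrt_eq_rpow]
  set δ := C * (√(ε / d) * (maxW wE wV + 1)) + C * (√ε / d) with hδ
  have hδ1 : C * (√ε / d) ≤ δ := le_add_of_nonneg_left (by positivity)
  have hδ2 : C * ε ≤ δ ^ 2 := by
    have h1 := pow_le_pow_left₀ (by positivity) hδ1 2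
    rw [mul_pow, div_pow, Real.sq_sqrt hε.le] at h1
    refine le_trans (mul_le_mul (by nlinarith) ?_ hε.le (by positivity)) h1
    exact le_div_self hε.le (by positivity) (pow_le_one₀ hd.le hd1)
  have hgr : ∀ {f f' : GraphL2 G d} {F : Edge G → ℝ → ℂ}, IsRep f f' F →
      (graphForm G d A wE wV).normSq f = ‖f‖ ^ 2 + ‖f'‖ ^ 2 := fun h =>
    congrArg _ (graphSesq_free_re hd h)
  have hnn : ∀ x ∈ B.mfdH1 d ε, 0 ≤ (B.mfdSesqH1 d ε 0 0 0 x x).re :=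
    (isAdmissible_mfdForm hε hεd A wE wV).free_nonneg
  clear_value δ C V C₁ N
  have hdef : ∀ {x : B.MfdL2 d ε} {g' K}, IsRep (B.dropJ d hε x) g' K →
      (∀ a : EdgeEnd G, ‖B.scaledAvg d hε a.vertex x - K a.edge (a.pos d)‖ ^ 2 ≤
        P * ε * (B.mfdSesqH1 d ε 0 0 0 x x).re) → ∀ a, ‖B.defect d hε x a‖ ^ 2 ≤
          P * ε * (B.mfdSesqH1 d ε 0 0 0 x x).re := fun hK h a => by
    rw [defect, IsEdgeRep.endValue_eq hd hK]; exact h a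
  have hmem : ∀ x : (B.dropOne hχ hd hε).domain, x.1 ∈ B.mfdH1 d ε := fun x => by
    rw [mfdH1_eq hε hεd]; exact x.2
  have hvv : ∀ {f f' : GraphL2 G d} {F : Edge G → ℝ → ℂ} {c : Fin n → ℂ}, IsRep f f' F →
      (∀ a : EdgeEnd G, F a.edge (a.pos d) = c a.vertex) → vertexValue f = c := fun hf hc =>
    funext fun v => (IsEdgeRep.endValue_eq hd hf _).trans (hc (EdgeEnd.outer v))
  refine ⟨rfl, fun f => ?_, (mfdH1_eq (B := B) hε hεd).symm, fun x => ?_, fun f => ?_, fun x => ?_,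
    fun f hf => ?_, fun x hx => ?_, fun f x => ?_⟩
  · obtain ⟨f', F, hf, c, hc⟩ := mem_graphH1.mp f.2
    obtain ⟨H, hH, -, -, h⟩ := isTestApprox_lift (B := B) hd hε hf hc
    change B.lift hε (f.1, vertexValue f.1) ∈ B.mfdH1 d ε
    rw [mfdH1_eq hε hεd, hvv hf hc]
    exact ⟨_, h⟩
  · obtain ⟨g', K, hK⟩ := exists_rep_of_mem hd hε x.2
    exact mem_graphH1.mpr ⟨_, _, hK.add (hχ.isRep_corr _), fun v => B.scaledAvg d hε v x.1,
      (exists_rep_dropOne hχ hd hε hK).1⟩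
  · obtain ⟨f', F, hf, c, hc⟩ := mem_graphH1.mp f.2
    refine (norm_liftJ_sub_lift_sq hε f.1 _).trans_le ?_
    rw [hvv hf hc, hgr hf]
    set D := ‖f.1‖ ^ 2 + ‖f'‖ ^ 2 with hD
    have h2 : ∀ v, ε * B.vertexVol v * ‖c v‖ ^ 2 ≤ B.vertexVol v * (2 * (ε * D)) := fun v => by
      have h3 := hf.norm_outer_sq_le v
      rw [show F (Sum.inl v) 0 = c v from hc (EdgeEnd.outer v)] at h3
      have := mul_le_mul_of_nonneg_left h3 (mul_nonneg hε.le (B.vertexVol_pos v).le)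
      refine this.trans_eq ?_
      rw [hD]; ring
    refine (sum_le_sum fun v _ => h2 v).trans ?_
    rw [← sum_mul, ← hV]
    refine le_trans (le_of_eq ?_) (mul_le_mul_of_nonneg_right ((mul_le_mul_of_nonneg_right
      (show 2 * V ≤ C by linarith) hε.le).trans hδ2) (by positivity))
    ring
  · obtain ⟨ψ, g', K, -, -, hK, -, h1, -⟩ := hP hε hεd hd1 x.1 (hmem x)
    have hq := hnn _ (hmem x)
    change ‖B.dropJ d hε x.1 - (B.dropJ d hε x.1 + hχ.corr (B.defect d hε x.1))‖ ^ 2 ≤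
      δ ^ 2 * (‖x.1‖ ^ 2 + (B.mfdSesqH1 d ε 0 0 0 x.1 x.1).re)
    rw [sub_add_cancel_left, norm_neg]
    refine (hχ.norm_corr_sq_le hd hd1 (by positivity) (hdef hK h1)).trans ?_
    refine le_trans (le_of_eq ?_) (mul_le_mul ((mul_le_mul_of_nonneg_right
      (show 36 * N * P ≤ C by linarith) hε.le).trans hδ2) (le_add_of_nonneg_left (sq_nonneg ‖x.1‖))
      hq (sq_nonneg δ))
    rw [hN]
    ring
  · obtain ⟨f', F, h, -⟩ := mem_graphH1.mp hf
    rw [hgr h, dropJ_liftJ, sub_self, norm_zero, zero_pow two_ne_zero]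
    positivity
  · obtain ⟨ψ, g', K, -, -, hK, -, -, h2⟩ := hP hε hεd hd1 x hx
    have hq := hnn x hx
    exact h2.trans (mul_le_mul_of_nonneg_right ((mul_le_mul_of_nonneg_right
      (show P ≤ C by linarith) hε.le).trans hδ2) (by positivity))
  · obtain ⟨f', F, hf, c, hc⟩ := mem_graphH1.mp f.2
    obtain ⟨ψ, g', K, hψ, hg', hK, hgq, h1, -⟩ := hP hε hεd hd1 x.1 (hmem x)
    have hq := hnn _ (hmem x)
    rw [hgr hf]
    set Q := (B.mfdForm d ε A wE wV).normSq x.1 with hQ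
    have hQ' : Q = ‖x.1‖ ^ 2 + (B.mfdSesqH1 d ε 0 0 0 x.1 x.1).re := rfl
    have hQ0 : 0 ≤ Q := by rw [hQ']; positivity
    have hgQ : ‖B.dropJ d hε x.1‖ ^ 2 + ‖g'‖ ^ 2 ≤ Q :=
      add_le_add (pow_le_pow_left₀ (norm_nonneg _) (norm_dropJ_le hε x.1) 2) hgq
    have h2 := norm_form_sub_le hχ hd hd1 hε hεd hψ hg' hK hf hc hA wE wV hP0.le hQ0 hgQ
      fun a => (hdef hK h1 a).trans (mul_le_mul_of_nonneg_left
        (by rw [hQ']; exact le_add_of_nonneg_left (sq_nonneg _)) (by positivity))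
    rw [← hvv hf hc, ← hN, ← hC₁] at h2
    refine h2.trans ?_
    refine mul_le_mul_of_nonneg_right (mul_le_mul_of_nonneg_right ?_ (sqrt_nonneg _))
      (sqrt_nonneg _)
    rw [hδ, add_comm]
    refine add_le_add ?_ (mul_le_mul_of_nonneg_right (show C₁ ≤ C by linarith) (by positivity))
    rw [mul_assoc]
    exact mul_le_mul (show N ≤ C by linarith) (mul_le_mul_of_nonneg_left (by linarith)
      (sqrt_nonneg _)) (by positivity) (by linarith)

end BuildingBlocks
end Main

end MagneticGraph

end

theorem mainTheorem3 {m p k : ℕ} (hk : 0 < k) (G : SimpleGraph (Fin (m + p)))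
    (B : BuildingBlocks.{u} G k) (a₀ : ℝ) :
    ∃ C : ℝ, 0 < C ∧
      ∀ (S : Matrix (Fin m) (Fin m) ℂ) (T : Matrix (Fin m) (Fin p) ℂ),
        S.IsHermitian → stGraph S T = G →
      ∀ d ε : ℝ, 0 < d → d ≤ 1 → 0 < ε → ε ≤ d →
      ∀ (A wE : InnerEdge G → ℝ) (wV : Fin (m + p) → ℝ), (∀ e, |A e| ≤ a₀ / d) →
      ∀ δ : ℝ, δ = C * ((ε / d) ^ (1 / 2 : ℝ) * (maxW wE wV + 1)) + C * (ε ^ (1 / 2 : ℝ) / d) →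
        QuasiUnitarilyEquivalent (graphForm G d A wE wV) (B.mfdForm d ε A wE wV) δ ∧
        ∀ χm χp χo : ℝ → ℝ, IsCutoff d χm χp χo →
          ∃ (J : GraphL2 G d →L[ℂ] B.MfdL2 d ε) (J₁ : GraphL2 G d →ₗ.[ℂ] B.MfdL2 d ε)
            (J₁' : B.MfdL2 d ε →ₗ.[ℂ] GraphL2 G d),
            B.IsLift d ε J ∧ B.IsLift₁ d ε J₁ ∧ B.IsProj₁ d ε χm χp χo J J₁' ∧
              IsQuasiUnitary (graphForm G d A wE wV) (B.mfdForm d ε A wE wV) δ J J₁ J₁' := by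
  obtain ⟨C, hC, h⟩ := B.exists_isQuasiUnitary a₀
  refine ⟨C, hC, fun S T _ _ d ε hd hd1 hε hεd A wE wV hA δ hδ => ?_⟩
  subst hδ
  refine ⟨⟨isAdmissible_graphForm hd A wE wV, BuildingBlocks.isAdmissible_mfdForm hε hεd A wE wV, ?_⟩,
    fun χm χp χo hχ => ⟨_, _, _, BuildingBlocks.isLift_liftJ hε,
      BuildingBlocks.isLift₁_liftOne hd hε, BuildingBlocks.isProj₁_dropOne hχ hd hε hεd,
      h hd hd1 hε hεd A wE wV hA hχ⟩⟩
  obtain ⟨χm, χp, χo, hχ⟩ := exists_isCutoff hd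
  exact ⟨_, _, _, h hd hd1 hε hεd A wE wV hA hχ⟩
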